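/- **Setting.** Let $(M,g)$ be a time-oriented globally hyperbolic Lorentzian manifold of dimension $D\ge 2$, signature $(-,+,\dots,+)$, let $m^2,\xi\in\mathbb R$, $K=-g^{ab}\nabla_a\nabla_b+m^2+\xi R$, $\Delta=\Delta^{\rm adv}-\Delta^{\rm ret}$ the difference of the advanced and retarded Green's operators of $K$, and $d\mu_g$ the metric volume. Let $\Psi$ be a quasi-free Hadamard state of the Klein–Gordon field $\phi$ and let $\mathcal W(M,g)$ be the algebra of elements $\sum_n W_n(t_n)$ (finite sums), $W_n(t_n)=\int :\!\phi(x_1)\cdots\phi(x_n)\!:_\Psi t_n(x_1,\dots,x_n)$, where $t_n$ is a compactly supported symmetric distribution on $M^n$ whose wavefront set contains no point with all covectors in the closed future cone or all in the closed past cone; the product is given by Wick's theorem, $W_n(t)^*=W_n(\bar t)$, and two such sums are identified if their distributions agree on all products $\Delta f_1\otimes\cdots\otimes\Delta f_n$ of solutions of the Klein–Gordon equation ($f_i\in C_0^\infty(M)$). Greek letters $\alpha=a_1\cdots a_{|\alpha|}$ are spacetime multi-indices and $\nabla_\alpha=\nabla_{a_1}\cdots\nabla_{a_{|\alpha|}}$.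 A *Wick prescription* $\Phi$ on $(M,g)$ assigns to every string $\alpha_1\cdots\alpha_p$ ($p\ge0$) and every smooth compactly supported test tensor field $f=f^{\alpha_1\cdots\alpha_p}$ an element $(\nabla_{\alpha_1}\phi\cdots\nabla_{\alpha_p}\phi)(f)\in\mathcal W(M,g)$ such that: 1. for $p=0$ it is $(\int f\,d\mu_g)\,I$, and the monomial $\phi$ is the field $\phi(f)=W_1(f)$; 2. it depends linearly on, and only on, the classical expression: if $\sum_j c_j f_j^{\alpha_1\cdots\alpha_p}\nabla_{\alpha_1}u_1\cdots\nabla_{\alpha_p}u_p=0$ on $M$ for all smooth $u_1,\dots,u_p$ (a finite sum over terms with $p$ factors each, whose multi-indices may have lengths depending on $j$), then the same linear combination of smeared Wick monomials vanishes; 3. (smoothness) the expectation value of $\nabla_{\alpha_1}\phi\cdots\nabla_{\alpha_p}\phi$ in $\Psi$ is a smooth tensor field; 4. (commutator) $[(\nabla_{\alpha_1}\phi\cdots\nabla_{\alpha_p}\phi)(f),\phi(h)]=i\sum_{i}(\nabla_{\alpha_1}\phi\cdots\widehat{\nabla_{\alpha_i}\phi}\cdots\nabla_{\alpha_p}\phi)\big(f^{\alpha_1\cdots\alpha_p}\nabla_{\alpha_i}\Delta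 h\big)$; 5. (Leibniz) $(\nabla_{\alpha_1}\phi\cdots\nabla_{\alpha_p}\phi)(-\nabla_a f^{a\,\cdot})=\sum_i(\nabla_{\alpha_1}\phi\cdots\nabla_{a}\nabla_{\alpha_i}\phi\cdots\nabla_{\alpha_p}\phi)(f)$; 6. (Hermiticity) $(\nabla_{\alpha_1}\phi\cdots\nabla_{\alpha_p}\phi)(f)^*=(\nabla_{\alpha_1}\phi\cdots\nabla_{\alpha_p}\phi)(\bar f)$; 7. (symmetry) it is symmetric under permutations of the factors $\nabla_{\alpha_i}\phi$. (A prescription that in addition is locally covariant, jointly smooth in $g,m^2,\xi$, scales homogeneously up to logarithms and has conserved stress-energy is in particular of this kind.) **Proposition.** Let $\Phi$ and $\Phi'$ be two Wick prescriptions on $(M,g)$. There is a unique family of real-valued smooth covariant tensor fields $\mathcal Z^I_{\alpha_1\cdots\alpha_n}$ ($n\ge0$), symmetric under permutations of the multi-indices, such that for all $\alpha_1,\dots,\alpha_p$ $$(\nabla_{\alpha_1}\phi\cdots\nabla_{\alpha_p}\phi)'=\sum_{T\subseteq\{1,\dots,p\}}\Big(\prod_{i\in T}\nabla_{\alpha_i}\phi\Big)\,\mathcal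 Z^I_{(\alpha_i)_{i\notin T}},$$ that is, $\Phi'_A=\sum_B\mathcal Z_A^B\Phi_B$ with $\mathcal Z_{\alpha_1\cdots\alpha_p}^{\beta_1\cdots\beta_q}=\binom pq\delta_{(\alpha_1}^{\beta_1}\cdots\delta_{\alpha_q}^{\beta_q}\mathcal Z^I_{\alpha_{q+1}\cdots\alpha_p)}$. One has $\mathcal Z^I_I=1$ (for $n=0$) and $\mathcal Z^I_{\alpha_1}=0$. For each $n\ge2$ there exists a real-valued function $F_n(x_1,\dots,x_n;z)$, smooth on an open neighbourhood in $M^{n}\times M$ of the total diagonal $\{(z,\dots,z;z)\}$ and symmetric in $(x_1,\dots,x_n)$ there, such that for all multi-indices and all $z\in M$ $$\mathcal Z^I_{\alpha_1\cdots\alpha_n}(z)=\nabla^{(x_1)}_{\alpha_1}\cdots\nabla^{(x_n)}_{\alpha_n}F_n(x_1,\dots,x_n;z)\big|_{x_1,\dots,x_n=z},$$ and, for all $\alpha_1,\dots,\alpha_n$ and all $\beta$ with $|\beta|\ge1$, $$\big[\nabla^{(x_1)}_{\alpha_1}\cdots\nabla^{(x_n)}_{\alpha_n}\nabla^{(z)}_\beta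 F_n(x_1,\dots,x_n;z)\big]_{x_1,\dots,x_n=z}=0 .$$ In this sense the difference between any two Wick prescriptions is completely characterized by the sequence $(F_n)_{n\ge2}$. -/

import Mathlib

open scoped Manifold ContDiff Topology
open MeasureTheory

noncomputable section

namespace WickField

/-! ### Coordinates, tensors and iterated covariant derivatives -/

/-- The model space `ℝ^D`. -/
abbrev Coord (D : ℕ) := EuclideanSpace ℝ (Fin D)

/-- The standard basis vectors of `ℝ^D`. -/
def stdVec (D : ℕ) (a : Fin D) : Coord D := EuclideanSpace.single a 1

/-- Iterated covariant derivatives, in coordinates on `ℝ^D` with connection coefficients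
`Γ y c a b = Γ^c_{ab}(y)`, of a scalar function `f`. The value at `c : Fin k → Fin D` is
the component `∇_{c 0} ∇_{c 1} ⋯ ∇_{c (k-1)} f` (the outermost derivative is the first index):
`∇_b T_{a_1 ⋯ a_k} = ∂_b T_{a_1 ⋯ a_k} - ∑_j Γ^d_{b a_j} T_{a_1 ⋯ d ⋯ a_k}`. -/
def covD {D : ℕ} {V : Type*} [NormedAddCommGroup V] [NormedSpace ℝ V]
    (Γ : Coord D → Fin D → Fin D → Fin D → ℝ) :
    (k : ℕ) → (Coord D → V) → (Fin k → Fin D) → Coord D → V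
  | 0, f, _, y => f y
  | k + 1, f, c, y =>
      fderiv ℝ (covD Γ k f (Fin.tail c)) y (stdVec D (c 0))
        - ∑ j : Fin k, ∑ d : Fin D,
            Γ y d (c 0) (Fin.tail c j) • covD Γ k f (Function.update (Fin.tail c) j d) y

section Manifold

variable {D : ℕ} {M : Type*} [TopologicalSpace M] [ChartedSpace (Coord D) M]

/-- Coordinate vector field `∂_a` of the chart `e`, at the point with coordinates `y`. -/
def coordVec (e : OpenPartialHomeomorph M (Coord D)) (y : Coord D) (a : Fin D) :
    TangentSpace 𝓘(ℝ, Coord D) (e.symm y) :=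
  mfderiv 𝓘(ℝ, Coord D) 𝓘(ℝ, Coord D) e.symm y (stdVec D a)

/-- Components of `∂_a` (for the chart `e`) with respect to the standard basis of the tangent
space, which is the coordinate basis of the preferred chart at the point. -/
def jacInv (e : OpenPartialHomeomorph M (Coord D)) (y : Coord D) (a a' : Fin D) : ℝ :=
  (show Coord D from coordVec e y a) a'

/-- The `a`-th component in the chart `e` of the `a'`-th standard basis vector of `T_x M`. -/
def jac (e : OpenPartialHomeomorph M (Coord D)) (x : M) (a a' : Fin D) : ℝ :=
  (show Coord D from mfderiv 𝓘(ℝ, Coord D) 𝓘(ℝ, Coord D) e x (stdVec D a')) a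

/-- A tensor field with slots indexed by `ι`, given at each `x` by its components in the standard
basis of `T_x M` (the coordinate basis of the preferred chart `chartAt _ x`). Whether it is
contravariant or covariant is decided by the transformation law used below. -/
abbrev TensorField (D : ℕ) (M : Type*) (ι : Type*) (V : Type*) := M → (ι → Fin D) → V

/-- Components of a contravariant tensor field in the chart `e`. -/
def contraComp {ι : Type*} [Fintype ι] [DecidableEq ι] (e : OpenPartialHomeomorph M (Coord D))
    (f : TensorField D M ι ℂ) (y : Coord D) (c : ι → Fin D) : ℂ :=
  ∑ c' : ι → Fin D, (∏ s, jac e (e.symm y) (c s) (c' s)) • f (e.symm y) c'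

/-- Components of a covariant tensor field in the chart `e`. -/
def covComp {ι : Type*} [Fintype ι] [DecidableEq ι] {V : Type*} [NormedAddCommGroup V]
    [NormedSpace ℝ V] (e : OpenPartialHomeomorph M (Coord D))
    (w : TensorField D M ι V) (y : Coord D) (c : ι → Fin D) : V :=
  ∑ c' : ι → Fin D, (∏ s, jacInv e y (c s) (c' s)) • w (e.symm y) c'

/-- Smooth covariant tensor fields. -/
def SmoothCov {ι : Type*} [Fintype ι] [DecidableEq ι] {V : Type*} [NormedAddCommGroup V]
    [NormedSpace ℝ V] (w : TensorField D M ι V) : Prop :=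
  ∀ e ∈ atlas (Coord D) M, ∀ c, ContDiffOn ℝ ∞ (fun y => covComp e w y c) e.target

/-- Test tensor fields: smooth contravariant tensor fields of compact support. -/
structure IsTestTensor {ι : Type*} [Fintype ι] [DecidableEq ι] (f : TensorField D M ι ℂ) :
    Prop where
  smooth : ∀ e ∈ atlas (Coord D) M, ∀ c, ContDiffOn ℝ ∞ (fun y => contraComp e f y c) e.target
  compact : HasCompactSupport f

/-- Smooth complex functions on `M`. -/
def IsSmoothFn (D : ℕ) {M : Type*} [TopologicalSpace M] [ChartedSpace (Coord D) M]
    (u : M → ℂ) : Prop :=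
  ContMDiff 𝓘(ℝ, Coord D) 𝓘(ℝ, ℂ) ∞ u

/-- Complex test functions on `M`. -/
def IsTestFn (D : ℕ) {M : Type*} [TopologicalSpace M] [ChartedSpace (Coord D) M]
    (u : M → ℂ) : Prop :=
  IsSmoothFn D u ∧ HasCompactSupport u

/-- Tangent vector of a curve. -/
def velocity (D : ℕ) {M : Type*} [TopologicalSpace M] [ChartedSpace (Coord D) M]
    (γ : ℝ → M) (t : ℝ) : TangentSpace 𝓘(ℝ, Coord D) (γ t) :=
  mfderiv 𝓘(ℝ, ℝ) 𝓘(ℝ, Coord D) γ t (1 : ℝ)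

/-! ### Functions and distributions on `M^n` -/

/-- Product of charts on `M^n` (inverse map). -/
def powSymm {n : ℕ} (e : Fin n → OpenPartialHomeomorph M (Coord D)) (y : Fin n → Coord D) :
    Fin n → M :=
  fun i => (e i).symm (y i)

/-- Target of a product of charts on `M^n`. -/
def powTarget {n : ℕ} (e : Fin n → OpenPartialHomeomorph M (Coord D)) : Set (Fin n → Coord D) :=
  Set.univ.pi fun i => (e i).target

/-- Smooth functions on `M^n`. -/
def IsSmoothPow (D : ℕ) {M : Type*} [TopologicalSpace M] [ChartedSpace (Coord D) M] {n : ℕ}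
    (h : (Fin n → M) → ℂ) : Prop :=
  ∀ e : Fin n → OpenPartialHomeomorph M (Coord D), (∀ i, e i ∈ atlas (Coord D) M) →
    ContDiffOn ℝ ∞ (h ∘ powSymm e) (powTarget e)

/-- Test functions on `M^n`. -/
def IsTestPow (D : ℕ) {M : Type*} [TopologicalSpace M] [ChartedSpace (Coord D) M] {n : ℕ}
    (h : (Fin n → M) → ℂ) : Prop :=
  IsSmoothPow D h ∧ HasCompactSupport h

/-- Raw functionals on functions on `M^n`; only the values on smooth functions (or on test
functions) matter. -/
abbrev Functional (M : Type*) (n : ℕ) := ((Fin n → M) → ℂ) → ℂ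

/-- All derivatives of `h` up to order `N` are bounded by `B` on `K`, in the charts `e`. -/
def DerivBound {n : ℕ} (e : Fin n → OpenPartialHomeomorph M (Coord D)) (K : Set (Fin n → Coord D))
    (N : ℕ) (B : ℝ) (h : (Fin n → M) → ℂ) : Prop :=
  ∀ y ∈ K, ∀ l ≤ N, ‖iteratedFDeriv ℝ l (h ∘ powSymm e) y‖ ≤ B

/-- Distributions on `M^n`: continuous linear functionals on the test functions. -/
structure IsDistribution (D : ℕ) {M : Type*} [TopologicalSpace M] [ChartedSpace (Coord D) M]
    {n : ℕ} (u : Functional M n) : Prop where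
  add : ∀ h h', IsTestPow D h → IsTestPow D h' → u (h + h') = u h + u h'
  smul : ∀ (c : ℂ) (h), IsTestPow D h → u (c • h) = c * u h
  cont : ∀ e : Fin n → OpenPartialHomeomorph M (Coord D), (∀ i, e i ∈ atlas (Coord D) M) →
    ∀ K : Set (Fin n → Coord D), IsCompact K → K ⊆ powTarget e →
      ∃ (N : ℕ) (C : ℝ), ∀ h, IsTestPow D h → (∀ x, h x ≠ 0 → x ∈ powSymm e '' K) →
        ∀ B, 0 ≤ B → DerivBound e K N B h → ‖u h‖ ≤ C * B

/-- Compactly supported distributions on `M^n`: continuous linear functionals on the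
space of all smooth functions. -/
structure IsCompactDistribution (D : ℕ) {M : Type*} [TopologicalSpace M]
    [ChartedSpace (Coord D) M] {n : ℕ} (u : Functional M n) : Prop where
  add : ∀ h h', IsSmoothPow D h → IsSmoothPow D h' → u (h + h') = u h + u h'
  smul : ∀ (c : ℂ) (h), IsSmoothPow D h → u (c • h) = c * u h
  cont : ∃ (r : ℕ) (e : Fin r → Fin n → OpenPartialHomeomorph M (Coord D))
      (K : Fin r → Set (Fin n → Coord D)) (N : ℕ) (C : ℝ),
    (∀ j i, e j i ∈ atlas (Coord D) M) ∧ (∀ j, IsCompact (K j) ∧ K j ⊆ powTarget (e j)) ∧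
      ∀ h, IsSmoothPow D h → ∀ B, 0 ≤ B → (∀ j, DerivBound (e j) (K j) N B h) → ‖u h‖ ≤ C * B

/-- An `n`-tuple of covectors at the points `x 0, …, x (n-1)`. (The tangent space `T_x M` is
the model space, identified with it through the preferred chart at `x`.) -/
abbrev Covectors (D n : ℕ) := Fin n → (Coord D →L[ℝ] ℝ)

/-- `(x, k)` is a regular directed point of `u`: the Fourier transform of a localization of `u`
near `x` decays rapidly in a conic neighbourhood of `k`. -/
def IsRegularDirected {n : ℕ} (u : Functional M n) (x : Fin n → M) (k : Covectors D n) : Prop :=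
  ∃ χ : (Fin n → M) → ℂ, IsTestPow D χ ∧ χ x ≠ 0 ∧
    tsupport χ ⊆ (Set.univ.pi fun i => (chartAt (Coord D) (x i)).source) ∧
    ∃ V : Set (Covectors D n), IsOpen V ∧ k ∈ V ∧ (∀ ζ ∈ V, ∀ s : ℝ, 0 < s → s • ζ ∈ V) ∧
      ∀ N : ℕ, ∃ C : ℝ, ∀ ζ ∈ V,
        ‖u (fun y => χ y * Complex.exp
            (-(Complex.I * ((∑ i, ζ i (chartAt (Coord D) (x i) (y i)) : ℝ) : ℂ))))‖
          * (1 + ‖ζ‖) ^ N ≤ C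

/-- The wavefront set of `u`. -/
def InWF {n : ℕ} (u : Functional M n) (x : Fin n → M) (k : Covectors D n) : Prop :=
  k ≠ 0 ∧ ¬ IsRegularDirected u x k

end Manifold

/-! ### Lorentzian geometry -/

/-- A time-oriented Lorentzian manifold of dimension `D`, signature `(-,+,…,+)`. -/
structure Spacetime (D : ℕ) (M : Type*) [TopologicalSpace M] [ChartedSpace (Coord D) M] where
  /-- the metric -/
  metric : (x : M) → TangentSpace 𝓘(ℝ, Coord D) x →L[ℝ] TangentSpace 𝓘(ℝ, Coord D) x →L[ℝ] ℝ
  symm : ∀ x v w, metric x v w = metric x w v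
  smooth : ∀ e ∈ atlas (Coord D) M, ∀ a b,
    ContDiffOn ℝ ∞ (fun y => metric (e.symm y) (coordVec e y a) (coordVec e y b)) e.target
  /-- the vector field defining the time orientation -/
  time : (x : M) → TangentSpace 𝓘(ℝ, Coord D) x
  time_smooth : ∀ e ∈ atlas (Coord D) M, ∀ a, ContDiffOn ℝ ∞
    (fun y => (show Coord D from
      mfderiv 𝓘(ℝ, Coord D) 𝓘(ℝ, Coord D) e (e.symm y) (time (e.symm y))) a) e.target
  time_neg : ∀ x, metric x (time x) (time x) < 0
  pos_of_orthogonal : ∀ x v, v ≠ 0 → metric x (time x) v = 0 → 0 < metric x v v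

namespace Spacetime

variable {D : ℕ} {M : Type*} [TopologicalSpace M] [ChartedSpace (Coord D) M] (S : Spacetime D M)

/-- The matrix `g_{ab}` in the chart `e`. -/
def gMat (e : OpenPartialHomeomorph M (Coord D)) (y : Coord D) : Matrix (Fin D) (Fin D) ℝ :=
  Matrix.of fun a b => S.metric (e.symm y) (coordVec e y a) (coordVec e y b)

/-- The Christoffel symbols `Γ^c_{ab}` in the chart `e`. -/
def christoffel (e : OpenPartialHomeomorph M (Coord D)) (y : Coord D) (c a b : Fin D) : ℝ :=
  (1 / 2) * ∑ d, (S.gMat e y)⁻¹ c d *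
    (fderiv ℝ (fun y' => S.gMat e y' d b) y (stdVec D a)
      + fderiv ℝ (fun y' => S.gMat e y' d a) y (stdVec D b)
      - fderiv ℝ (fun y' => S.gMat e y' a b) y (stdVec D d))

/-- The Ricci tensor `R_{ab}` in the chart `e`. -/
def ricci (e : OpenPartialHomeomorph M (Coord D)) (y : Coord D) (a b : Fin D) : ℝ :=
  ∑ d, fderiv ℝ (fun y' => S.christoffel e y' d a b) y (stdVec D d)
    - ∑ d, fderiv ℝ (fun y' => S.christoffel e y' d d b) y (stdVec D a)
    + ∑ d, ∑ c, S.christoffel e y c a b * S.christoffel e y d c d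
    - ∑ d, ∑ c, S.christoffel e y c d b * S.christoffel e y d c a

/-- The scalar curvature. -/
def scalarCurvature (x : M) : ℝ :=
  ∑ a, ∑ b, (S.gMat (chartAt (Coord D) x) (chartAt (Coord D) x x))⁻¹ a b *
    S.ricci (chartAt (Coord D) x) (chartAt (Coord D) x x) a b

/-- The iterated covariant derivative `∇_{c 0} ⋯ ∇_{c (k-1)} u` of a scalar function on `M`. -/
def nabla {V : Type*} [NormedAddCommGroup V] [NormedSpace ℝ V] (k : ℕ) (u : M → V) :
    TensorField D M (Fin k) V :=
  fun x c => covD (S.christoffel (chartAt (Coord D) x)) k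
    (u ∘ (chartAt (Coord D) x).symm) c (chartAt (Coord D) x x)

/-- The divergence `∇_a f^{a α}` of a contravariant tensor field; the slot `none` is `a`. -/
def divergence {ι : Type*} [Fintype ι] [DecidableEq ι] (f : TensorField D M (Option ι) ℂ) :
    TensorField D M ι ℂ := fun x c =>
  let e := chartAt (Coord D) x
  let y := e x
  let comp : Coord D → Fin D → (ι → Fin D) → ℂ :=
    fun y' a c' => contraComp e f y' (fun o => o.elim a c')
  ∑ a, fderiv ℝ (fun y' => comp y' a c) y (stdVec D a)
    + ∑ a, ∑ b, S.christoffel e y a a b • comp y b c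
    + ∑ a, ∑ s, ∑ b, S.christoffel e y (c s) a b • comp y a (Function.update c s b)

/-- The Klein-Gordon operator `K = -g^{ab} ∇_a ∇_b + m² + ξ R`. -/
def kleinGordon (m2 ξ : ℝ) (u : M → ℂ) : M → ℂ := fun x =>
  -(∑ a, ∑ b, (S.gMat (chartAt (Coord D) x) (chartAt (Coord D) x x))⁻¹ a b •
      S.nabla 2 u x ![a, b])
    + (m2 + ξ * S.scalarCurvature x) • u x

/-- The metric volume measure `√|det g| d^D x`. The measures given by this density in the
single charts agree on overlaps, so that their supremum is the measure glued from them. -/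
def vol [MeasurableSpace M] : Measure M :=
  ⨆ e ∈ atlas (Coord D) M, Measure.map e.symm
    ((volume.restrict e.target).withDensity fun y => ENNReal.ofReal √|(S.gMat e y).det|)

/-- Future-directed causal tangent vectors. -/
def IsFutureCausal (x : M) (v : TangentSpace 𝓘(ℝ, Coord D) x) : Prop :=
  v ≠ 0 ∧ S.metric x v v ≤ 0 ∧ S.metric x v (S.time x) < 0

/-- `y ∈ J⁺(x)`, equivalently `x ∈ J⁻(y)`. -/
def CausalLE (x y : M) : Prop :=
  x = y ∨ ∃ γ : ℝ → M, ContMDiff 𝓘(ℝ, ℝ) 𝓘(ℝ, Coord D) 1 γ ∧ γ 0 = x ∧ γ 1 = y ∧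
    ∀ t ∈ Set.Icc (0 : ℝ) 1, S.IsFutureCausal (γ t) (velocity D γ t)

/-- Global hyperbolicity: there is a Cauchy surface, i.e. a set that is met exactly once by every
inextendible timelike curve. -/
def GloballyHyperbolic : Prop :=
  ∃ A : Set M, ∀ γ : ℝ → M, ContMDiff 𝓘(ℝ, ℝ) 𝓘(ℝ, Coord D) 1 γ →
    (∀ t, S.metric (γ t) (velocity D γ t) (velocity D γ t) < 0 ∧
      S.metric (γ t) (velocity D γ t) (S.time (γ t)) < 0) →
    (∀ p, ¬ Filter.Tendsto γ Filter.atTop (𝓝 p)) →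
    (∀ p, ¬ Filter.Tendsto γ Filter.atBot (𝓝 p)) →
    ∃! t, γ t ∈ A

/-- The covector `k` at `x` lies in the closed future light cone `V_x^+`. -/
def InFutureCone (x : M) (k : Coord D →L[ℝ] ℝ) : Prop :=
  ∃ v : TangentSpace 𝓘(ℝ, Coord D) x, (∀ w, k w = S.metric x v w) ∧
    S.metric x v v ≤ 0 ∧ S.metric x v (S.time x) ≤ 0

/-- `γ` is an affinely parametrized geodesic on `J`. -/
def IsGeodesicOn (γ : ℝ → M) (J : Set ℝ) : Prop :=
  ContMDiffOn 𝓘(ℝ, ℝ) 𝓘(ℝ, Coord D) ∞ γ J ∧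
  ∀ t ∈ J, ∀ e ∈ atlas (Coord D) M, γ t ∈ e.source → ∀ a,
    iteratedDeriv 2 (fun s => e (γ s) a) t =
      -∑ b, ∑ c, S.christoffel e (e (γ t)) a b c *
        deriv (fun s => e (γ s) b) t * deriv (fun s => e (γ s) c) t

/-- `(x₁,k₁) ∼ (x₂,k₂)`: the points are joined by a null geodesic to which `k₁` and `k₂` are
cotangent and coparallel (for `x₁ = x₂` this includes the case `k₁ = k₂` null). -/
def NullRelated (x₁ : M) (k₁ : Coord D →L[ℝ] ℝ) (x₂ : M) (k₂ : Coord D →L[ℝ] ℝ) : Prop :=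
  ∃ (γ : ℝ → M) (s : ℝ) (J : Set ℝ), IsOpen J ∧ J.OrdConnected ∧ 0 ∈ J ∧ s ∈ J ∧
    S.IsGeodesicOn γ J ∧ γ 0 = x₁ ∧ γ s = x₂ ∧
    S.metric (γ 0) (velocity D γ 0) (velocity D γ 0) = 0 ∧
    (∀ w, k₁ w = S.metric (γ 0) (velocity D γ 0) w) ∧
    (∀ w, k₂ w = S.metric (γ s) (velocity D γ s) w)

/-- The wavefront set of the two-point function of a Hadamard state. -/
def InHadamardSet (x : Fin 2 → M) (k : Covectors D 2) : Prop :=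
  k 0 ≠ 0 ∧ k 1 ≠ 0 ∧ S.NullRelated (x 0) (k 0) (x 1) (-k 1) ∧
    ∃ v : TangentSpace 𝓘(ℝ, Coord D) (x 0), (∀ w, k 0 w = S.metric (x 0) v w) ∧
      S.metric (x 0) v v = 0 ∧ S.metric (x 0) v (S.time (x 0)) < 0

end Spacetime

/-! ### The Klein-Gordon field: Green's operators, Hadamard states, the algebra `𝒲(M,g)` -/

section Field

variable {D : ℕ} {M : Type*} [TopologicalSpace M] [ChartedSpace (Coord D) M]

/-- The advanced and retarded Green's operators of the Klein-Gordon operator. -/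
structure GreenOperators (S : Spacetime D M) (m2 ξ : ℝ) where
  adv : (M → ℂ) → (M → ℂ)
  ret : (M → ℂ) → (M → ℂ)
  adv_smooth : ∀ f, IsTestFn D f → IsSmoothFn D (adv f)
  ret_smooth : ∀ f, IsTestFn D f → IsSmoothFn D (ret f)
  kg_adv : ∀ f, IsTestFn D f → S.kleinGordon m2 ξ (adv f) = f
  kg_ret : ∀ f, IsTestFn D f → S.kleinGordon m2 ξ (ret f) = f
  adv_kg : ∀ f, IsTestFn D f → adv (S.kleinGordon m2 ξ f) = f
  ret_kg : ∀ f, IsTestFn D f → ret (S.kleinGordon m2 ξ f) = f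
  adv_supp : ∀ f, IsTestFn D f → ∀ x, adv f x ≠ 0 → ∃ y ∈ tsupport f, S.CausalLE x y
  ret_supp : ∀ f, IsTestFn D f → ∀ x, ret f x ≠ 0 → ∃ y ∈ tsupport f, S.CausalLE y x

/-- The causal propagator `Δ = Δ^adv - Δ^ret`. -/
def GreenOperators.causal {S : Spacetime D M} {m2 ξ : ℝ} (G : GreenOperators S m2 ξ) (f : M → ℂ) :
    M → ℂ :=
  fun x => G.adv f x - G.ret f x

/-- The (quasi-free) Hadamard state with two-point distribution `Ψ₂`. The functions
`kerR h = Ψ₂(·, h)` and `kerL h = Ψ₂(h, ·)` are the smooth functions obtained by smearing one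
argument only. -/
structure HadamardState [MeasurableSpace M] (S : Spacetime D M) {m2 ξ : ℝ}
    (G : GreenOperators S m2 ξ) where
  twoPoint : Functional M 2
  distr : IsDistribution D twoPoint
  kerR : (M → ℂ) → (M → ℂ)
  kerL : (M → ℂ) → (M → ℂ)
  kerR_smooth : ∀ h, IsTestFn D h → IsSmoothFn D (kerR h)
  kerL_smooth : ∀ h, IsTestFn D h → IsSmoothFn D (kerL h)
  kerR_spec : ∀ f h, IsTestFn D f → IsTestFn D h →
    twoPoint (fun x => f (x 0) * h (x 1)) = ∫ x, f x * kerR h x ∂S.vol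
  kerL_spec : ∀ f h, IsTestFn D f → IsTestFn D h →
    twoPoint (fun x => h (x 0) * f (x 1)) = ∫ x, f x * kerL h x ∂S.vol
  fieldEq_left : ∀ f h, IsTestFn D f → IsTestFn D h →
    twoPoint (fun x => S.kleinGordon m2 ξ f (x 0) * h (x 1)) = 0
  fieldEq_right : ∀ f h, IsTestFn D f → IsTestFn D h →
    twoPoint (fun x => f (x 0) * S.kleinGordon m2 ξ h (x 1)) = 0
  ccr : ∀ f h, IsTestFn D f → IsTestFn D h →
    twoPoint (fun x => f (x 0) * h (x 1)) - twoPoint (fun x => h (x 0) * f (x 1)) =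
      Complex.I * ∫ x, f x * G.causal h x ∂S.vol
  positive : ∀ f, IsTestFn D f →
    0 ≤ (twoPoint (fun x => star (f (x 0)) * f (x 1))).re ∧
      (twoPoint (fun x => star (f (x 0)) * f (x 1))).im = 0
  hadamard : ∀ x k, InWF twoPoint x k ↔ S.InHadamardSet x k

/-- `t ∈ ℰ'(M^n)`: a symmetric compactly supported distribution whose wavefront set contains no
point at which all covectors are in the future cone, or all are in the past cone. -/
structure IsMicrocausal (S : Spacetime D M) {n : ℕ} (t : Functional M n) : Prop where
  distr : IsCompactDistribution D t
  symm : ∀ (π : Equiv.Perm (Fin n)) (h), IsSmoothPow D h → t (fun x => h (x ∘ π)) = t h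
  wf : ∀ x k, InWF (D := D) t x k →
    ¬ (∀ i, S.InFutureCone (x i) (k i)) ∧ ¬ (∀ i, S.InFutureCone (x i) (-k i))

/-- Representatives `(t_0, t_1, …)` of elements `∑_n W_n(t_n)` of `𝒲(M,g)`, where
`W_n(t_n) = ∫ :φ(x_1) ⋯ φ(x_n):_Ψ t_n(x_1,…,x_n)`. -/
abbrev WickElem (M : Type*) := (n : ℕ) → Functional M n

/-- The sequences of distributions that represent elements of `𝒲(M,g)`. -/
def IsWickElem (S : Spacetime D M) (a : WickElem M) : Prop :=
  (∃ N, ∀ n, N < n → a n = 0) ∧ ∀ n, IsMicrocausal S (a n)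

/-- Two representatives define the same element of `𝒲(M,g)`: because of the field equation, this
means that the distributions agree on products of solutions `Δ f` of the Klein-Gordon equation. -/
def SameElem {S : Spacetime D M} {m2 ξ : ℝ} (G : GreenOperators S m2 ξ) (a b : WickElem M) : Prop :=
  ∀ (n : ℕ) (f : Fin n → M → ℂ), (∀ i, IsTestFn D (f i)) →
    a n (fun x => ∏ i, G.causal (f i) (x i)) = b n (fun x => ∏ i, G.causal (f i) (x i))

/-- The `*`-operation, `W_n(t)^* = W_n(t̄)`. -/
def WickElem.adjoint (a : WickElem M) : WickElem M :=
  fun n u => star (a n (fun x => star (u x)))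

/-- The unit of the algebra. -/
def unitElem (M : Type*) : WickElem M
  | 0 => fun u => u Fin.elim0
  | _ + 1 => 0

/-- The expectation value in the (quasi-free) state with respect to which one normal-orders. -/
def expectation (a : WickElem M) : ℂ := a 0 (fun _ => 1)

/-- The part of the product with `φ(h) = W_1(h)` without contraction: `t ↦ Sym (h ⊗ t)`. -/
def tensorPart [MeasurableSpace M] (S : Spacetime D M) (h : M → ℂ) (a : WickElem M) : WickElem M
  | 0 => 0
  | n + 1 => fun u => (1 / (n + 1 : ℂ)) * ∑ i : Fin (n + 1),
      ∫ y, h y * a n (fun x => u (i.insertNth y x)) ∂S.vol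

/-- Contraction of one argument of `t` with the function `r`. -/
def contractPart (r : M → ℂ) (a : WickElem M) : WickElem M :=
  fun n u => (n + 1 : ℂ) * a (n + 1) (fun x => r (x 0) * u (Fin.tail x))

/-- The product `a · φ(h)` in `𝒲(M,g)`, by the product rule (Wick's theorem). -/
def mulField [MeasurableSpace M] {S : Spacetime D M} {m2 ξ : ℝ} {G : GreenOperators S m2 ξ}
    (Ψ : HadamardState S G) (a : WickElem M) (h : M → ℂ) : WickElem M :=
  tensorPart S h a + contractPart (Ψ.kerR h) a

/-- The product `φ(h) · a` in `𝒲(M,g)`, by the product rule (Wick's theorem). -/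
def fieldMul [MeasurableSpace M] {S : Spacetime D M} {m2 ξ : ℝ} {G : GreenOperators S m2 ξ}
    (Ψ : HadamardState S G) (h : M → ℂ) (a : WickElem M) : WickElem M :=
  tensorPart S h a + contractPart (Ψ.kerL h) a

/-- The smeared field `φ(h) = W_1(h)`. -/
def linearField [MeasurableSpace M] (S : Spacetime D M) (h : M → ℂ) : WickElem M
  | 1 => fun u => ∫ y, h y * u (fun _ => y) ∂S.vol
  | _ => 0

/-! ### Wick monomials -/

/-- The spacetime indices of a string `α_1 ⋯ α_p` of multi-indices of lengths `k 0, …, k (p-1)`;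
`⟨i, s⟩` is the `s`-th index of the `i`-th multi-index. -/
abbrev Slots {p : ℕ} (k : Fin p → ℕ) := Σ i : Fin p, Fin (k i)

/-- Relabelling of the slots of a tensor field. -/
def relabel {ι ι' : Type*} (σ : ι → ι') (f : TensorField D M ι ℂ) : TensorField D M ι' ℂ :=
  fun x c => f x (c ∘ σ)

/-- Partial contraction: the slots in the image of `σ` stay free, all other indices are
summed after multiplication with `w`. -/
def contract {ι ι' : Type*} [Fintype ι] [DecidableEq ι] [Fintype ι'] (σ : ι' → ι)
    (f w : TensorField D M ι ℂ) : TensorField D M ι' ℂ :=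
  fun x c => ∑ C : ι → Fin D, if C ∘ σ = c then f x C * w x C else 0

/-- Lengths of the multi-indices after one more derivative acts on the `i`-th factor. -/
def addDeriv {p : ℕ} (k : Fin p → ℕ) (i : Fin p) : Fin p → ℕ := fun j => if j = i then k j + 1 else k j

/-- The slots of `α_1, …, {b α_i}, …, α_p` seen as the index `b` and the slots of
`α_1, …, α_p`. -/
def addDerivSlot {p : ℕ} (k : Fin p → ℕ) (i : Fin p) : Option (Slots k) → Slots (addDeriv k i)
  | none => ⟨i, ⟨0, by simp [addDeriv]⟩⟩
  | some ⟨j, s⟩ => ⟨j, ⟨if j = i then (s : ℕ) + 1 else (s : ℕ), by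
      have := s.2
      unfold addDeriv
      split_ifs <;> omega⟩⟩

/-- The multi-indices with positions in `T`, in increasing order of the position. -/
def subIndex {p : ℕ} (k : Fin p → ℕ) (T : Finset (Fin p)) : Fin T.card → ℕ :=
  fun j => k (T.orderEmbOfFin rfl j)

/-- The slots of the multi-indices with positions in `T`. -/
def subSlot {p : ℕ} (k : Fin p → ℕ) (T : Finset (Fin p)) : Slots (subIndex k T) → Slots k :=
  fun s => ⟨T.orderEmbOfFin rfl s.1, s.2⟩

/-- A prescription for Wick monomials on `(M,g)`: it assigns to each string of
multi-indices `α_1 ⋯ α_p` and each test tensor field `f` the element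
`(∇_{α_1}φ ⋯ ∇_{α_p}φ)(f)` of `𝒲(M,g)`. -/
structure WickPrescription [MeasurableSpace M] {S : Spacetime D M} {m2 ξ : ℝ}
    {G : GreenOperators S m2 ξ} (Ψ : HadamardState S G) where
  /-- `mono k f` is the smeared Wick monomial with multi-indices of lengths `k 0, …, k (p-1)`. -/
  mono : {p : ℕ} → (k : Fin p → ℕ) → TensorField D M (Slots k) ℂ → WickElem M
  mem : ∀ {p : ℕ} (k : Fin p → ℕ) (f), IsTestTensor f → IsWickElem S (mono k f)
  /-- the monomial without factors is the unit -/
  unit : ∀ (k : Fin 0 → ℕ) (f), IsTestTensor f →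
    SameElem G (mono k f) ((∫ x, f x (fun s => s.1.elim0) ∂S.vol) • unitElem M)
  /-- the monomial `φ` is the linear field -/
  field : ∀ h : M → ℂ, IsTestFn D h →
    SameElem G (mono (fun _ : Fin 1 => 0) (fun x _ => h x)) (linearField S h)
  /-- A Wick monomial depends only on the classical expression `f^{α_1⋯α_p} ∇_{α_1}φ⋯∇_{α_p}φ`
  (and linearly): a linear relation that holds between such expressions for all smooth functions,
  e.g. on account of `∇_a ∇_b φ = ∇_b ∇_a φ`, holds between the Wick monomials. -/
  classical : ∀ {p r : ℕ} (coef : Fin r → ℂ) (k : Fin r → Fin p → ℕ)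
    (f : (j : Fin r) → TensorField D M (Slots (k j)) ℂ), (∀ j, IsTestTensor (f j)) →
    (∀ u : Fin p → M → ℂ, (∀ i, IsSmoothFn D (u i)) → ∀ x,
      ∑ j, coef j * ∑ c : Slots (k j) → Fin D,
        f j x c * ∏ i, S.nabla (k j i) (u i) x (fun s => c ⟨i, s⟩) = 0) →
    SameElem G (∑ j, coef j • mono (k j) (f j)) 0
  /-- smoothness of expectation values -/
  smooth : ∀ {p : ℕ} (k : Fin p → ℕ), ∃ w : TensorField D M (Slots k) ℂ, SmoothCov w ∧
    ∀ f, IsTestTensor f → expectation (mono k f) = ∫ x, ∑ c, f x c * w x c ∂S.vol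
  /-- commutator with the linear field -/
  commutator : ∀ {p : ℕ} (k : Fin (p + 1) → ℕ) (f) (h : M → ℂ), IsTestTensor f → IsTestFn D h →
    SameElem G (mulField Ψ (mono k f) h - fieldMul Ψ h (mono k f))
      (Complex.I • ∑ i : Fin (p + 1), mono (fun j => k (i.succAbove j))
        (contract (fun s => ⟨i.succAbove s.1, s.2⟩) f
          (fun x C => S.nabla (k i) (G.causal h) x (fun s => C ⟨i, s⟩))))
  /-- Leibniz rule -/
  leibniz : ∀ {p : ℕ} (k : Fin p → ℕ) (f : TensorField D M (Option (Slots k)) ℂ), IsTestTensor f →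
    SameElem G (mono k (-S.divergence f))
      (∑ i, mono (addDeriv k i) (relabel (addDerivSlot k i) f))
  /-- Hermiticity -/
  hermitian : ∀ {p : ℕ} (k : Fin p → ℕ) (f), IsTestTensor f →
    SameElem G (mono k f).adjoint (mono k (fun x c => star (f x c)))
  /-- symmetry -/
  symm : ∀ {p : ℕ} (k : Fin p → ℕ) (π : Equiv.Perm (Fin p))
    (f : TensorField D M (Slots (k ∘ π)) ℂ), IsTestTensor f →
    SameElem G (mono (k ∘ π) f) (mono k (relabel (fun s => ⟨π s.1, s.2⟩) f))

/-- Families of tensor fields `𝒵^I_{α_1 ⋯ α_n}`, for all strings of multi-indices. -/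
abbrev MixingCoeffs (D : ℕ) (M : Type*) :=
  (n : ℕ) → (k : Fin n → ℕ) → TensorField D M (Slots k) ℝ

/-- `Z` is the family of the coefficients `𝒵^I` of the mixing matrix from `Φ` to `Φ'`: smooth
covariant tensor fields such that, for every `α_1 ⋯ α_p`,
`(∇_{α_1}φ ⋯ ∇_{α_p}φ)' = ∑_T (∏_{i ∈ T} ∇_{α_i}φ) 𝒵^I_{(α_i)_{i ∉ T}}`,
the sum being over all subsets `T` of `{1,…,p}`. This is `Φ'_A = ∑_B 𝒵_A^B Φ_B` with
`𝒵_{α_1⋯α_p}^{β_1⋯β_q} = (p choose q) δ_{(α_1}^{β_1} ⋯ δ_{α_q}^{β_q} 𝒵^I_{α_{q+1}⋯α_p)}`. -/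
structure IsMixing [MeasurableSpace M] {S : Spacetime D M} {m2 ξ : ℝ} {G : GreenOperators S m2 ξ}
    {Ψ : HadamardState S G} (Φ Φ' : WickPrescription Ψ) (Z : MixingCoeffs D M) : Prop where
  smooth : ∀ (n : ℕ) (k : Fin n → ℕ), SmoothCov (Z n k)
  symm : ∀ (n : ℕ) (k : Fin n → ℕ) (π : Equiv.Perm (Fin n)) (x : M) (c : Slots k → Fin D),
    Z n (k ∘ π) x (fun s => c ⟨π s.1, s.2⟩) = Z n k x c
  mixing : ∀ {p : ℕ} (k : Fin p → ℕ) (f), IsTestTensor f →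
    SameElem G (Φ'.mono k f) (∑ T : Finset (Fin p), Φ.mono (subIndex k T)
      (contract (subSlot k T) f
        (fun x C => (Z _ (subIndex k Tᶜ) x (C ∘ subSlot k Tᶜ) : ℂ))))

/-! ### The functions `F_n` -/

/-- Smoothness on `U ⊆ M^n × M` of a real function of `(x_1,…,x_n; z)`. -/
def SmoothOnPow (D : ℕ) {M : Type*} [TopologicalSpace M] [ChartedSpace (Coord D) M] {n : ℕ}
    (F : (Fin n → M) → M → ℝ) (U : Set ((Fin n → M) × M)) : Prop :=
  ∀ (e : Fin n → OpenPartialHomeomorph M (Coord D)) (e₀ : OpenPartialHomeomorph M (Coord D)),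
    (∀ i, e i ∈ atlas (Coord D) M) → e₀ ∈ atlas (Coord D) M →
    ContDiffOn ℝ ∞ (fun q : (Fin n → Coord D) × Coord D => F (powSymm e q.1) (e₀.symm q.2))
      {q | q.1 ∈ powTarget e ∧ q.2 ∈ e₀.target ∧ (powSymm e q.1, e₀.symm q.2) ∈ U}

/-- `∇^{(x_1)}_{α_1} ⋯ ∇^{(x_n)}_{α_n} G` in coordinates, for a function `G` of
`(x_1,…,x_n) ∈ (ℝ^D)^n`; the `i`-th multi-index has the components `c ⟨i, ·⟩`. -/
def multiCovD {n : ℕ} (Γ : Coord D → Fin D → Fin D → Fin D → ℝ) (k : Fin n → ℕ)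
    (c : Slots k → Fin D) (G : (Fin n → Coord D) → ℝ) : (Fin n → Coord D) → ℝ :=
  (List.finRange n).foldr
    (fun i H y => covD Γ (k i) (fun v => H (Function.update y i v)) (fun s => c ⟨i, s⟩) (y i)) G

/-- `[∇^{(x_1)}_{α_1} ⋯ ∇^{(x_n)}_{α_n} ∇^{(z)}_β F(x_1,…,x_n;z)]_{x_1,…,x_n = z}`, with `β` of
length `l` and components `b`. -/
def diagDeriv (S : Spacetime D M) {n : ℕ} (F : (Fin n → M) → M → ℝ) (k : Fin n → ℕ) (l : ℕ)
    (z : M) (c : Slots k → Fin D) (b : Fin l → Fin D) : ℝ :=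
  let e := chartAt (Coord D) z
  multiCovD (S.christoffel e) k c
    (fun y => covD (S.christoffel e) l (fun w => F (powSymm (fun _ => e) y) (e.symm w)) b (e z))
    (fun _ => e z)

end Field

end WickField

end

/-!
The two prescriptions are compared through the expectation values of their monomials. The
commutator condition says that the part of degree `n + 1` of a monomial, evaluated on a product of
solutions, arises from the part of degree `n` of the monomials with one factor `∇_α φ` replaced by
`∇_α Δh`. By induction the whole monomial is determined by the expectation values of all
monomials (`WickPrescription.mono_eq_pairing`). Those form a symmetric family `w` of smooth tensor
fields, real by Hermiticity, with value `1` on the empty string; it is regarded as a function of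
finite multisets of multi-indices. Such functions form a commutative algebra under convolution, the
sum over all ways to split a multiset in two. The mixing formula says `w' = w * Z` in this algebra.
As `w` has value `1` at the empty multiset, it is invertible, which gives the existence and the
uniqueness of the coefficients (`isMixing_mixCoeff`, `IsMixing.unique`).

Two properties of `w` and `w'` are inherited by the quotient `Z`. A linear relation with smooth
coefficients between the covariant derivatives of arbitrary functions holds for any single
multi-index of `w`, since a monomial depends on the classical expression only; hence it holds for
`Z` (`sum_mul_chartFam_mixCoeff_cons`). The Leibniz condition says that the covariant derivative of
`w` is the sum over the ways to put one more derivative on a factor. This operation is a derivation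
of the convolution algebra, hence `Z` obeys the same rule (`pd_chartFam_mixCoeff`). With the
normalization of the linear field it follows that the coefficients with one multi-index vanish
(`mixCoeff_one`).

Because of the relations, the coefficients with `n` multi-indices at `z` are the covariant
derivatives of a formal power series in `x_1 - z, …, x_n - z` in a chart: its Taylor coefficients
are obtained by writing partial derivatives as combinations of covariant ones, and the relations
make the converse conversion consistent (`JetTransform.sum_taylor_monom`). Borel's theorem with `z`
as a parameter (`exists_borel`) turns the series into a smooth function, which is symmetric since
the terms and the cut-off are; a partition of unity in `z` glues these functions to one that is
defined on all of `M^n × M` (`exists_local_function`, `exists_global_function`), as derivatives with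
respect to the `x_i` are linear in the function for fixed `z`.

Finally, differentiate along the diagonal the identity that expresses `Z(z)` by the derivatives of
`F_n` with respect to the `x_i`. The left-hand side is given by the Leibniz rule for `Z`, and the
right-hand side is the sum of the same terms and of the one in which `z` is differentiated. The
latter therefore vanishes, and so do all derivatives that involve `z`, by induction on their number
(`mop_op_none_eq_zero`). The function is smooth everywhere, so that the neighbourhood of the total
diagonal can be taken to be all of `M^n × M`.
-/

open scoped Manifold ContDiff Topology
open MeasureTheory
noncomputable section
namespace WickField
set_option linter.unusedSectionVars false

/-! ### Changes of charts -/

section Charts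

variable {D : ℕ} {M : Type*} [TopologicalSpace M] [ChartedSpace (Coord D) M]

/-- The change of coordinates from the chart `e` to the chart `e'`. -/
def trans (e e' : OpenPartialHomeomorph M (Coord D)) : Coord D → Coord D := e' ∘ e.symm

/-- The set of coordinates, in the chart `e`, of the overlap of the charts `e` and `e'`. -/
def overlap (e e' : OpenPartialHomeomorph M (Coord D)) : Set (Coord D) :=
  e.target ∩ e.symm ⁻¹' e'.source

/-- The Jacobian matrix `∂_a y'^b` of the change of coordinates from `e` to `e'`. -/
def jacobi (e e' : OpenPartialHomeomorph M (Coord D)) (y : Coord D) (a b : Fin D) : ℝ :=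
  (fderiv ℝ (trans e e') y (stdVec D a)) b

theorem isOpen_overlap (e e' : OpenPartialHomeomorph M (Coord D)) : IsOpen (overlap e e') :=
  e.symm.isOpen_inter_preimage e'.open_source

theorem mem_overlap_self {e : OpenPartialHomeomorph M (Coord D)} {y : Coord D}
    (hy : y ∈ e.target) : y ∈ overlap e e :=
  ⟨hy, e.map_target hy⟩

theorem mem_overlap_chartAt {e : OpenPartialHomeomorph M (Coord D)} {y : Coord D}
    (hy : y ∈ e.target) : y ∈ overlap e (chartAt (Coord D) (e.symm y)) :=
  ⟨hy, mem_chart_source _ _⟩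

theorem trans_mem_overlap {e e' : OpenPartialHomeomorph M (Coord D)} {y : Coord D}
    (hy : y ∈ overlap e e') : trans e e' y ∈ overlap e' e := by
  refine ⟨e'.map_source hy.2, ?_⟩
  simp [trans, e'.left_inv hy.2, e.map_target hy.1]

theorem symm_trans {e e' : OpenPartialHomeomorph M (Coord D)} {y : Coord D}
    (hy : y ∈ overlap e e') : e'.symm (trans e e' y) = e.symm y :=
  e'.left_inv hy.2

theorem trans_trans {e e' e'' : OpenPartialHomeomorph M (Coord D)} {y : Coord D}
    (hy : y ∈ overlap e e') : trans e' e'' (trans e e' y) = trans e e'' y := by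
  simp only [trans, Function.comp_apply, e'.left_inv hy.2]

theorem trans_self {e : OpenPartialHomeomorph M (Coord D)} {y : Coord D}
    (hy : y ∈ e.target) : trans e e y = y :=
  e.right_inv hy

theorem trans_mem_overlap' {e e' e'' : OpenPartialHomeomorph M (Coord D)} {y : Coord D}
    (hy : y ∈ overlap e e') (hy' : y ∈ overlap e e'') : trans e e' y ∈ overlap e' e'' :=
  ⟨(trans_mem_overlap hy).1, by simpa [symm_trans hy] using hy'.2⟩

theorem contDiffOn_trans [IsManifold 𝓘(ℝ, Coord D) ∞ M]
    {e e' : OpenPartialHomeomorph M (Coord D)} (he : e ∈ atlas (Coord D) M)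
    (he' : e' ∈ atlas (Coord D) M) : ContDiffOn ℝ ∞ (trans e e') (overlap e e') := by
  have h := (contDiffGroupoid ∞ 𝓘(ℝ, Coord D)).compatible he he'
  rw [contDiffGroupoid, mem_groupoid_of_pregroupoid] at h
  simpa [contDiffPregroupoid, mfld_simps, trans, overlap] using h.1

/-- The tangent space at a point is the model space, identified with it through the preferred chart;
the derivative of the inverse of a chart is therefore that of the change to the preferred chart. -/
theorem mfderiv_symm_eq [IsManifold 𝓘(ℝ, Coord D) ∞ M]
    {e : OpenPartialHomeomorph M (Coord D)} (he : e ∈ atlas (Coord D) M) {y : Coord D}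
    (hy : y ∈ e.target) : mfderiv 𝓘(ℝ, Coord D) 𝓘(ℝ, Coord D) e.symm y =
      fderiv ℝ (trans e (chartAt (Coord D) (e.symm y))) y := by
  have : IsManifold 𝓘(ℝ, Coord D) 1 M := IsManifold.of_le (n := ∞) (by simp)
  have : MDifferentiableAt 𝓘(ℝ, Coord D) 𝓘(ℝ, Coord D) e.symm y :=
    mdifferentiableAt_atlas_symm (I := 𝓘(ℝ, Coord D)) he hy
  refine this.mfderiv.trans ?_
  simp [mfld_simps, trans]
  rfl

theorem mfderiv_chart_eq [IsManifold 𝓘(ℝ, Coord D) ∞ M]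
    {e : OpenPartialHomeomorph M (Coord D)} (he : e ∈ atlas (Coord D) M) {x : M}
    (hx : x ∈ e.source) : mfderiv 𝓘(ℝ, Coord D) 𝓘(ℝ, Coord D) e x =
      fderiv ℝ (trans (chartAt (Coord D) x) e) (chartAt (Coord D) x x) := by
  have : IsManifold 𝓘(ℝ, Coord D) 1 M := IsManifold.of_le (n := ∞) (by simp)
  have : MDifferentiableAt 𝓘(ℝ, Coord D) 𝓘(ℝ, Coord D) e x :=
    mdifferentiableAt_atlas (I := 𝓘(ℝ, Coord D)) he hx
  refine this.mfderiv.trans ?_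
  simp [mfld_simps, trans]
  rfl

theorem jacInv_eq [IsManifold 𝓘(ℝ, Coord D) ∞ M]
    {e : OpenPartialHomeomorph M (Coord D)} (he : e ∈ atlas (Coord D) M) {y : Coord D}
    (hy : y ∈ e.target) (a b : Fin D) :
    jacInv e y a b = jacobi e (chartAt (Coord D) (e.symm y)) y a b :=
  congrArg (fun L : Coord D →L[ℝ] Coord D => L (stdVec D a) b) (mfderiv_symm_eq he hy)

theorem jac_eq [IsManifold 𝓘(ℝ, Coord D) ∞ M]
    {e : OpenPartialHomeomorph M (Coord D)} (he : e ∈ atlas (Coord D) M) {x : M}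
    (hx : x ∈ e.source) (a b : Fin D) :
    jac e x a b = jacobi (chartAt (Coord D) x) e (chartAt (Coord D) x x) b a :=
  congrArg (fun L : Coord D →L[ℝ] Coord D => L (stdVec D b) a) (mfderiv_chart_eq he hx)

theorem differentiableAt_trans [IsManifold 𝓘(ℝ, Coord D) ∞ M]
    {e e' : OpenPartialHomeomorph M (Coord D)} (he : e ∈ atlas (Coord D) M)
    (he' : e' ∈ atlas (Coord D) M) {y : Coord D} (hy : y ∈ overlap e e') :
    DifferentiableAt ℝ (trans e e') y :=
  ((contDiffOn_trans he he').contDiffAt ((isOpen_overlap e e').mem_nhds hy)).differentiableAt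
    (by simp)

theorem sum_stdVec (v : Coord D) : v = ∑ a, v a • stdVec D a := by
  ext b
  simp [stdVec, Finset.sum_apply, Pi.single_apply]

theorem jacobi_chain [IsManifold 𝓘(ℝ, Coord D) ∞ M]
    {e e' e'' : OpenPartialHomeomorph M (Coord D)} (he : e ∈ atlas (Coord D) M)
    (he' : e' ∈ atlas (Coord D) M) (he'' : e'' ∈ atlas (Coord D) M) {y : Coord D}
    (hy : y ∈ overlap e e') (hy' : y ∈ overlap e e'') (a c : Fin D) :
    jacobi e e'' y a c = ∑ b, jacobi e e' y a b * jacobi e' e'' (trans e e' y) b c := by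
  have h1 : trans e e'' =ᶠ[𝓝 y] trans e' e'' ∘ trans e e' := by
    filter_upwards [(isOpen_overlap e e').mem_nhds hy] with y hy
    exact (trans_trans hy).symm
  have h2 : fderiv ℝ (trans e e'') y =
      (fderiv ℝ (trans e' e'') (trans e e' y)).comp (fderiv ℝ (trans e e') y) := by
    rw [h1.fderiv_eq, fderiv_comp y
      (differentiableAt_trans he' he'' (trans_mem_overlap' hy hy')) (differentiableAt_trans he he' hy)]
  unfold jacobi
  rw [h2, ContinuousLinearMap.comp_apply]
  conv_lhs => rw [sum_stdVec (fderiv ℝ (trans e e') y (stdVec D a)), map_sum]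
  simp [Finset.sum_apply]

theorem jacobi_self {e : OpenPartialHomeomorph M (Coord D)} {y : Coord D}
    (hy : y ∈ e.target) (a b : Fin D) : jacobi e e y a b = if a = b then 1 else 0 := by
  have h1 : trans e e =ᶠ[𝓝 y] id := by
    filter_upwards [e.open_target.mem_nhds hy] with y hy
    exact trans_self hy
  unfold jacobi
  rw [h1.fderiv_eq, fderiv_id]
  simp [stdVec, eq_comm]

theorem contDiffOn_jacobi [IsManifold 𝓘(ℝ, Coord D) ∞ M]
    {e e' : OpenPartialHomeomorph M (Coord D)} (he : e ∈ atlas (Coord D) M)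
    (he' : e' ∈ atlas (Coord D) M) (a b : Fin D) :
    ContDiffOn ℝ ∞ (fun y => jacobi e e' y a b) (overlap e e') := by
  have h := ((contDiffOn_trans he he').fderiv_of_isOpen (isOpen_overlap e e')
    (m := ∞) (by simp)).clm_apply (contDiffOn_const (c := stdVec D a))
  exact (EuclideanSpace.proj (𝕜 := ℝ) b).contDiff.comp_contDiffOn h

theorem jacobi_inv [IsManifold 𝓘(ℝ, Coord D) ∞ M]
    {e e' : OpenPartialHomeomorph M (Coord D)} (he : e ∈ atlas (Coord D) M)
    (he' : e' ∈ atlas (Coord D) M) {y : Coord D} (hy : y ∈ overlap e e') (a c : Fin D) :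
    ∑ b, jacobi e e' y a b * jacobi e' e (trans e e' y) b c = if a = c then 1 else 0 := by
  rw [← jacobi_chain he he' he hy (mem_overlap_self hy.1), jacobi_self hy.1]

end Charts

/-! ### Partial derivatives and derivatives of tensor components -/

section TensorCalculus

variable {D : ℕ} {V : Type*} [NormedAddCommGroup V] [NormedSpace ℝ V]

/-- The partial derivative `∂_a f`. -/
def pd (a : Fin D) (f : Coord D → V) (y : Coord D) : V := fderiv ℝ f y (stdVec D a)

theorem pd_congr {a : Fin D} {f g : Coord D → V} {y : Coord D} (h : f =ᶠ[𝓝 y] g) :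
    pd a f y = pd a g y := by
  unfold pd; rw [h.fderiv_eq]

theorem pd_const (a : Fin D) (v : V) (y : Coord D) : pd a (fun _ => v) y = 0 := by
  simp [pd]

theorem pd_sum {κ : Type*} {a : Fin D} {f : κ → Coord D → V} {y : Coord D} (s : Finset κ)
    (hf : ∀ i ∈ s, DifferentiableAt ℝ (f i) y) :
    pd a (fun y => ∑ i ∈ s, f i y) y = ∑ i ∈ s, pd a (f i) y := by
  unfold pd; rw [fderiv_fun_sum hf]; simp

theorem pd_smul {a : Fin D} {r : Coord D → ℝ} {f : Coord D → V} {y : Coord D}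
    (hr : DifferentiableAt ℝ r y) (hf : DifferentiableAt ℝ f y) :
    pd a (fun y => r y • f y) y = pd a r y • f y + r y • pd a f y := by
  unfold pd; rw [fderiv_fun_smul hr hf]; simp [add_comm]

theorem pd_mul {𝔸 : Type*} [NormedCommRing 𝔸] [NormedAlgebra ℝ 𝔸] {a : Fin D} {r f : Coord D → 𝔸}
    {y : Coord D} (hr : DifferentiableAt ℝ r y) (hf : DifferentiableAt ℝ f y) :
    pd a (fun y => r y * f y) y = pd a r y * f y + r y * pd a f y := by
  unfold pd; rw [fderiv_fun_mul hr hf]; simp [mul_comm, add_comm]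

theorem pd_prod {κ : Type*} [DecidableEq κ] {a : Fin D} {f : κ → Coord D → ℝ} {y : Coord D}
    (s : Finset κ) (hf : ∀ i ∈ s, DifferentiableAt ℝ (f i) y) :
    pd a (fun y => ∏ i ∈ s, f i y) y = ∑ i ∈ s, pd a (f i) y * ∏ j ∈ s.erase i, f j y := by
  unfold pd
  rw [(HasFDerivAt.finsetProd fun i hi => (hf i hi).hasFDerivAt).fderiv]
  simp [mul_comm]

theorem pd_comp {τ : Coord D → Coord D} {f : Coord D → V} {a : Fin D} {y : Coord D}
    (hf : DifferentiableAt ℝ f (τ y)) (hτ : DifferentiableAt ℝ τ y) :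
    pd a (fun y => f (τ y)) y = ∑ b, (fderiv ℝ τ y (stdVec D a)) b • pd b f (τ y) := by
  unfold pd
  have h := fderiv_comp y hf hτ
  change fderiv ℝ (f ∘ τ) y (stdVec D a) = _
  rw [h, ContinuousLinearMap.comp_apply]
  conv_lhs => rw [sum_stdVec (fderiv ℝ τ y (stdVec D a)), map_sum]
  simp

theorem contDiffOn_pd {a : Fin D} {f : Coord D → V} {U : Set (Coord D)} (hU : IsOpen U)
    (hf : ContDiffOn ℝ ∞ f U) : ContDiffOn ℝ ∞ (pd a f) U :=
  (hf.fderiv_of_isOpen hU (m := ∞) (by simp)).clm_apply contDiffOn_const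

theorem pd_comm {a b : Fin D} {f : Coord D → V} {U : Set (Coord D)} (hU : IsOpen U)
    (hf : ContDiffOn ℝ ∞ f U) {y : Coord D} (hy : y ∈ U) :
    pd a (pd b f) y = pd b (pd a f) y := by
  have hfy : ContDiffAt ℝ ∞ f y := hf.contDiffAt (hU.mem_nhds hy)
  have hs := hfy.isSymmSndFDerivAt (by simp; norm_cast)
  have hd : DifferentiableAt ℝ (fderiv ℝ f) y :=
    (hfy.fderiv_right (m := 1) (by norm_cast)).differentiableAt (by simp)
  have key : ∀ c d : Fin D, pd c (pd d f) y = fderiv ℝ (fderiv ℝ f) y (stdVec D c) (stdVec D d) := by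
    intro c d
    unfold pd
    rw [fderiv_clm_apply hd (by fun_prop)]
    simp
  rw [key, key, hs.eq]

variable {ι : Type*} [Fintype ι] [DecidableEq ι]

/-- The change of tensor components `t` induced by the matrix `m` acting in every slot. -/
def pull (m : Fin D → Fin D → ℝ) (t : (ι → Fin D) → V) (c : ι → Fin D) : V :=
  ∑ c', (∏ s, m (c s) (c' s)) • t c'

/-- The derivative `∂_a T_c - ∑_s ∑_d A(a, c_s, d) T_{c[s := d]}` of a field of tensor components.
With `A(a, b, d) = Γ^d_{ab}` this is the covariant derivative of covariant components, with
`A(a, c, d) = -Γ^c_{ad}` that of contravariant ones. -/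
def covDeriv (A : Coord D → Fin D → Fin D → Fin D → ℝ) (T : Coord D → (ι → Fin D) → V)
    (a : Fin D) (c : ι → Fin D) (y : Coord D) : V :=
  pd a (fun y => T y c) y - ∑ s, ∑ d, A y a (c s) d • T y (Function.update c s d)

/-- In a sum over all tensor components `c` and one further index `d`, the index `d` may be
exchanged with the index in the slot `s`. -/
theorem sum_update_swap {W : Type*} [AddCommMonoid W] (s : ι)
    (G : (ι → Fin D) → Fin D → W) :
    ∑ c : ι → Fin D, ∑ d, G c d = ∑ c, ∑ d, G (Function.update c s d) (c s) := by
  rw [← Fintype.sum_prod_type', ← Fintype.sum_prod_type']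
  let σ : (ι → Fin D) × Fin D → (ι → Fin D) × Fin D := fun p => (Function.update p.1 s p.2, p.1 s)
  have hσ : Function.Involutive σ := by
    rintro ⟨c, d⟩
    simp [σ]
  exact ((Equiv.sum_comp hσ.toPerm (fun p : (ι → Fin D) × Fin D => G p.1 p.2)).symm).trans rfl

theorem prod_update_left (m : Fin D → Fin D → ℝ) (c c' : ι → Fin D) (s : ι) (d : Fin D) :
    ∏ t, m (Function.update c s d t) (c' t) =
      m d (c' s) * ∏ t ∈ Finset.univ.erase s, m (c t) (c' t) := by
  rw [← Finset.mul_prod_erase _ _ (Finset.mem_univ s)]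
  congr 1
  · simp
  · refine Finset.prod_congr rfl fun t ht => ?_
    rw [Function.update_of_ne (Finset.ne_of_mem_erase ht)]

theorem prod_update_right (m : Fin D → Fin D → ℝ) (c c' : ι → Fin D) (s : ι) (d : Fin D) :
    ∏ t, m (c t) (Function.update c' s d t) =
      m (c s) d * ∏ t ∈ Finset.univ.erase s, m (c t) (c' t) := by
  rw [← Finset.mul_prod_erase _ _ (Finset.mem_univ s)]
  congr 1
  · simp
  · refine Finset.prod_congr rfl fun t ht => ?_
    rw [Function.update_of_ne (Finset.ne_of_mem_erase ht)]

/-- The tensoriality of covariant derivatives: if the connection coefficients `A`, `A'`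
are related by the inhomogeneous transformation law for the slot matrix `m`, then the derivative
of the transformed tensor is the transformed derivative. -/
theorem covDeriv_pull {A A' : Coord D → Fin D → Fin D → Fin D → ℝ}
    {m : Coord D → Fin D → Fin D → ℝ} {τ : Coord D → Coord D} {T' : Coord D → (ι → Fin D) → V}
    {y : Coord D} (hτ : DifferentiableAt ℝ τ y)
    (hm : ∀ b b', DifferentiableAt ℝ (fun y => m y b b') y)
    (hT : ∀ c, DifferentiableAt ℝ (fun y => T' y c) (τ y)) (a : Fin D)
    (hA : ∀ b b', pd a (fun y => m y b b') y - ∑ d, A y a b d * m y d b' =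
      -∑ a', ∑ b'', (fderiv ℝ τ y (stdVec D a)) a' * m y b b'' * A' (τ y) a' b'' b')
    (c : ι → Fin D) :
    covDeriv A (fun y => pull (m y) (T' (τ y))) a c y =
      ∑ a', (fderiv ℝ τ y (stdVec D a)) a' •
        pull (m y) (fun c' => covDeriv A' T' a' c' (τ y)) c := by
  have hTτ : ∀ c, DifferentiableAt ℝ (fun y => T' (τ y) c) y := fun c => (hT c).comp y hτ
  have hprod : ∀ c' : ι → Fin D, DifferentiableAt ℝ (fun y => ∏ s, m y (c s) (c' s)) y := by
    intro c'
    exact (HasFDerivAt.finsetProd fun i _ => (hm (c i) (c' i)).hasFDerivAt).differentiableAt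
  have h1 : pd a (fun y => pull (m y) (T' (τ y)) c) y =
      ∑ c', ∑ s, (pd a (fun y => m y (c s) (c' s)) y *
        ∏ t ∈ Finset.univ.erase s, m y (c t) (c' t)) • T' (τ y) c' +
      ∑ a', (fderiv ℝ τ y (stdVec D a)) a' • ∑ c', (∏ s, m y (c s) (c' s)) • pd a' (fun y => T' y c') (τ y) := by
    unfold pull
    rw [pd_sum _ fun c' _ => (hprod c').fun_smul (hTτ c')]
    simp_rw [Finset.smul_sum]
    rw [Finset.sum_comm (s := (Finset.univ : Finset (Fin D))), ← Finset.sum_add_distrib]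
    refine Finset.sum_congr rfl fun c' _ => ?_
    rw [pd_smul (hprod c') (hTτ c'), pd_prod _ fun i _ => hm _ _, Finset.sum_smul,
      pd_comp (f := fun y => T' y c') (hT c') hτ, Finset.smul_sum]
    congr 1
    refine Finset.sum_congr rfl fun a' _ => ?_
    rw [smul_comm]
  have h2 : ∑ s, ∑ d, A y a (c s) d • pull (m y) (T' (τ y)) (Function.update c s d) =
      ∑ c', ∑ s, ((∑ d, A y a (c s) d * m y d (c' s)) *
        ∏ t ∈ Finset.univ.erase s, m y (c t) (c' t)) • T' (τ y) c' := by
    rw [Finset.sum_comm (t := (Finset.univ : Finset ι))]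
    refine Finset.sum_congr rfl fun s _ => ?_
    simp only [pull, Finset.smul_sum, prod_update_left, Finset.sum_mul, Finset.sum_smul]
    rw [Finset.sum_comm]
    refine Finset.sum_congr rfl fun c' _ => Finset.sum_congr rfl fun d _ => ?_
    rw [smul_smul, mul_assoc]
  have h3 : ∀ a', pull (m y) (fun c' => covDeriv A' T' a' c' (τ y)) c =
      ∑ c', (∏ s, m y (c s) (c' s)) • pd a' (fun y => T' y c') (τ y) -
      ∑ c', ∑ s, ((∑ b'', m y (c s) b'' * A' (τ y) a' b'' (c' s)) *
        ∏ t ∈ Finset.univ.erase s, m y (c t) (c' t)) • T' (τ y) c' := by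
    intro a'
    simp only [pull, covDeriv, smul_sub, Finset.sum_sub_distrib]
    congr 1
    simp only [Finset.smul_sum]
    rw [Finset.sum_comm, Finset.sum_comm (t := (Finset.univ : Finset ι))]
    refine Finset.sum_congr rfl fun s _ => ?_
    rw [sum_update_swap s]
    refine Finset.sum_congr rfl fun c' _ => ?_
    rw [Finset.sum_mul, Finset.sum_smul]
    refine Finset.sum_congr rfl fun d _ => ?_
    rw [prod_update_right]
    simp only [Function.update_self, Function.update_idem, Function.update_eq_self]
    rw [smul_smul]
    congr 1
    ring
  rw [covDeriv]
  rw [h1, h2]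
  simp_rw [h3, smul_sub, Finset.sum_sub_distrib]
  rw [add_sub_right_comm, ← Finset.sum_sub_distrib, sub_eq_add_neg, add_comm, ]
  congr 1
  simp_rw [Finset.smul_sum]
  rw [Finset.sum_comm, ← Finset.sum_neg_distrib]
  refine Finset.sum_congr rfl fun c' _ => ?_
  rw [← Finset.sum_sub_distrib, Finset.sum_comm, ← Finset.sum_neg_distrib]
  refine Finset.sum_congr rfl fun s _ => ?_
  rw [← sub_smul, ← sub_mul, hA]
  simp_rw [smul_smul]
  rw [← Finset.sum_smul, ← neg_smul]
  congr 1
  rw [← Finset.sum_neg_distrib, Finset.sum_mul, ← Finset.sum_neg_distrib]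
  refine Finset.sum_congr rfl fun a' _ => ?_
  rw [neg_mul, ← mul_assoc, Finset.mul_sum]
  simp only [mul_assoc]

end TensorCalculus

/-! ### The metric and the Christoffel symbols under changes of charts -/

variable {D : ℕ} {M : Type*} [TopologicalSpace M] [ChartedSpace (Coord D) M]

/-- The Jacobian matrix of a change of charts. -/
def jacMat (e e' : OpenPartialHomeomorph M (Coord D)) (y : Coord D) : Matrix (Fin D) (Fin D) ℝ :=
  Matrix.of (jacobi e e' y)

theorem bilin_expand (B : Coord D →L[ℝ] Coord D →L[ℝ] ℝ) (v w : Coord D) :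
    B v w = ∑ a, ∑ b, v a * B (stdVec D a) (stdVec D b) * w b := by
  conv_lhs => rw [sum_stdVec v, sum_stdVec w]
  simp only [map_sum, map_smul, sum_apply, smul_apply, smul_eq_mul, Finset.mul_sum]
  rw [Finset.sum_comm]
  refine Finset.sum_congr rfl fun a _ => Finset.sum_congr rfl fun b _ => ?_
  ring

section

variable [IsManifold 𝓘(ℝ, Coord D) ∞ M]

theorem jacMat_chain {e e' e'' : OpenPartialHomeomorph M (Coord D)} (he : e ∈ atlas (Coord D) M)
    (he' : e' ∈ atlas (Coord D) M) (he'' : e'' ∈ atlas (Coord D) M) {y : Coord D}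
    (hy : y ∈ overlap e e') (hy' : y ∈ overlap e e'') :
    jacMat e e'' y = jacMat e e' y * jacMat e' e'' (trans e e' y) := by
  ext a c
  simp [jacMat, Matrix.mul_apply, jacobi_chain he he' he'' hy hy']

theorem jacMat_self {e : OpenPartialHomeomorph M (Coord D)} {y : Coord D}
    (hy : y ∈ e.target) : jacMat e e y = 1 := by
  ext a c
  simp [jacMat, jacobi_self hy, Matrix.one_apply]

theorem jacMat_mul_inv {e e' : OpenPartialHomeomorph M (Coord D)} (he : e ∈ atlas (Coord D) M)
    (he' : e' ∈ atlas (Coord D) M) {y : Coord D} (hy : y ∈ overlap e e') :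
    jacMat e e' y * jacMat e' e (trans e e' y) = 1 := by
  rw [← jacMat_chain he he' he hy (mem_overlap_self hy.1), jacMat_self hy.1]

namespace Spacetime

variable (S : Spacetime D M)

/-- The components of the metric in the standard basis of the tangent space. -/
def stdMetric (x : M) : Matrix (Fin D) (Fin D) ℝ :=
  Matrix.of fun a b =>
    (show Coord D →L[ℝ] Coord D →L[ℝ] ℝ from S.metric x) (stdVec D a) (stdVec D b)

theorem gMat_eq_stdMetric {e : OpenPartialHomeomorph M (Coord D)} (he : e ∈ atlas (Coord D) M)
    {y : Coord D} (hy : y ∈ e.target) :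
    S.gMat e y = jacMat e (chartAt (Coord D) (e.symm y)) y * S.stdMetric (e.symm y) *
      (jacMat e (chartAt (Coord D) (e.symm y)) y).transpose := by
  ext a b
  have h : S.gMat e y a b = (show Coord D →L[ℝ] Coord D →L[ℝ] ℝ from S.metric (e.symm y))
      (fderiv ℝ (trans e (chartAt (Coord D) (e.symm y))) y (stdVec D a))
      (fderiv ℝ (trans e (chartAt (Coord D) (e.symm y))) y (stdVec D b)) := by
    have := mfderiv_symm_eq he hy
    unfold gMat coordVec
    rw [Matrix.of_apply, this]
    rfl
  rw [h, bilin_expand]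
  simp only [Matrix.mul_apply, Finset.sum_mul, Matrix.transpose_apply]
  rw [Finset.sum_comm]
  rfl

/-- The transformation law of the metric. -/
theorem gMat_trans {e e' : OpenPartialHomeomorph M (Coord D)} (he : e ∈ atlas (Coord D) M)
    (he' : e' ∈ atlas (Coord D) M) {y : Coord D} (hy : y ∈ overlap e e') :
    S.gMat e y = jacMat e e' y * S.gMat e' (trans e e' y) * (jacMat e e' y).transpose := by
  have hc := mem_overlap_chartAt hy.1
  rw [S.gMat_eq_stdMetric he hy.1, S.gMat_eq_stdMetric he' (trans_mem_overlap hy).1,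
    symm_trans hy, jacMat_chain he he' (chart_mem_atlas _ _) hy hc]
  simp only [Matrix.transpose_mul, Matrix.mul_assoc]

/-- The metric is nondegenerate: a vector in its kernel would be orthogonal to the time direction,
and spacelike. -/
theorem stdMetric_det_ne_zero (x : M) : (S.stdMetric x).det ≠ 0 := by
  intro h0
  obtain ⟨v, hv, h⟩ := Matrix.exists_mulVec_eq_zero_iff.2 h0
  set B : Coord D →L[ℝ] Coord D →L[ℝ] ℝ := S.metric x with hB
  set V : Coord D := WithLp.toLp 2 v
  have hz : ∀ w : Coord D, B w V = 0 := by
    intro w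
    rw [bilin_expand]
    refine Finset.sum_eq_zero fun a _ => ?_
    have := congrFun h a
    simp only [Matrix.mulVec, dotProduct, Pi.zero_apply] at this
    simp_rw [mul_assoc]
    rw [← Finset.mul_sum]
    exact mul_eq_zero_of_right _ this
  have hV : V ≠ 0 := fun h => hv (by
    ext i
    exact congrArg (fun u : Coord D => u i) h)
  have h1 := S.pos_of_orthogonal x V hV (hz (S.time x))
  exact absurd (hz V) h1.ne'

theorem gMat_det_ne_zero {e : OpenPartialHomeomorph M (Coord D)} (he : e ∈ atlas (Coord D) M)
    {y : Coord D} (hy : y ∈ e.target) : (S.gMat e y).det ≠ 0 := by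
  have h1 : (jacMat e (chartAt (Coord D) (e.symm y)) y).det ≠ 0 := fun h => by
    have := congrArg Matrix.det (jacMat_mul_inv he (chart_mem_atlas _ _) (mem_overlap_chartAt hy))
    simp [h] at this
  rw [S.gMat_eq_stdMetric he hy]
  simp [h1, S.stdMetric_det_ne_zero]

theorem gMat_isSymm (e : OpenPartialHomeomorph M (Coord D)) (y : Coord D) (a b : Fin D) :
    S.gMat e y a b = S.gMat e y b a :=
  S.symm _ _ _

theorem contDiffOn_gMat {e : OpenPartialHomeomorph M (Coord D)} (he : e ∈ atlas (Coord D) M)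
    (a b : Fin D) : ContDiffOn ℝ ∞ (fun y => S.gMat e y a b) e.target :=
  S.smooth e he a b

theorem contDiffOn_det {U : Set (Coord D)} {m : Coord D → Matrix (Fin D) (Fin D) ℝ}
    (hm : ∀ a b, ContDiffOn ℝ ∞ (fun y => m y a b) U) : ContDiffOn ℝ ∞ (fun y => (m y).det) U := by
  simp only [Matrix.det_apply]
  refine ContDiffOn.sum fun σ _ => ContDiffOn.const_smul _ (contDiffOn_prod fun i _ => hm _ _)

theorem contDiffOn_gMat_inv {e : OpenPartialHomeomorph M (Coord D)} (he : e ∈ atlas (Coord D) M)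
    (a b : Fin D) : ContDiffOn ℝ ∞ (fun y => (S.gMat e y)⁻¹ a b) e.target := by
  have h : ∀ y, (S.gMat e y)⁻¹ a b =
      (S.gMat e y).det⁻¹ * ((S.gMat e y).updateRow b (Pi.single a 1)).det := by
    intro y
    rw [Matrix.inv_def, Ring.inverse_eq_inv', Matrix.smul_apply, Matrix.adjugate_apply, smul_eq_mul]
  simp_rw [h]
  refine ContDiffOn.mul (ContDiffOn.inv (contDiffOn_det (S.contDiffOn_gMat he))
    fun y hy => S.gMat_det_ne_zero he hy) (contDiffOn_det fun c d => ?_)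
  by_cases hc : c = b
  · subst hc
    simp only [Matrix.updateRow_self]
    exact contDiffOn_const
  · simp only [Matrix.updateRow_ne hc]
    exact S.contDiffOn_gMat he c d

theorem contDiffOn_christoffel {e : OpenPartialHomeomorph M (Coord D)}
    (he : e ∈ atlas (Coord D) M) (c a b : Fin D) :
    ContDiffOn ℝ ∞ (fun y => S.christoffel e y c a b) e.target := by
  unfold christoffel
  have hp : ∀ p q r, ContDiffOn ℝ ∞ (pd r fun y => S.gMat e y p q) e.target :=
    fun p q r => contDiffOn_pd e.open_target (S.contDiffOn_gMat he p q)
  exact contDiffOn_const.mul (ContDiffOn.sum fun d _ => (S.contDiffOn_gMat_inv he c d).mul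
    (((hp _ _ _).add (hp _ _ _)).sub (hp _ _ _)))

/-- The Christoffel symbols of the first kind, `½ (∂_a g_{db} + ∂_b g_{da} - ∂_d g_{ab})`. -/
def christoffelLow (e : OpenPartialHomeomorph M (Coord D)) (y : Coord D) (d a b : Fin D) : ℝ :=
  (1 / 2) * (pd a (fun y' => S.gMat e y' d b) y + pd b (fun y' => S.gMat e y' d a) y
    - pd d (fun y' => S.gMat e y' a b) y)

theorem christoffel_eq (e : OpenPartialHomeomorph M (Coord D)) (y : Coord D) (c a b : Fin D) :
    S.christoffel e y c a b = ∑ d, (S.gMat e y)⁻¹ c d * S.christoffelLow e y d a b := by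
  unfold christoffel christoffelLow
  rw [Finset.mul_sum]
  refine Finset.sum_congr rfl fun d _ => ?_
  change _ = _ * (_ * (fderiv ℝ _ y _ + fderiv ℝ _ y _ - fderiv ℝ _ y _))
  ring

theorem pd_jacobi_symm {e e' : OpenPartialHomeomorph M (Coord D)} (he : e ∈ atlas (Coord D) M)
    (he' : e' ∈ atlas (Coord D) M) {y : Coord D} (hy : y ∈ overlap e e') (a b c : Fin D) :
    pd a (fun y => jacobi e e' y b c) y = pd b (fun y => jacobi e e' y a c) y := by
  have h : ContDiffOn ℝ ∞ (fun y => trans e e' y c) (overlap e e') :=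
    (EuclideanSpace.proj (𝕜 := ℝ) c).contDiff.comp_contDiffOn (contDiffOn_trans he he')
  have h2 : ∀ d, ∀ᶠ y' in 𝓝 y, jacobi e e' y' d c = pd d (fun y => trans e e' y c) y' := by
    intro d
    filter_upwards [(isOpen_overlap e e').mem_nhds hy] with y' hy'
    unfold pd jacobi
    have := ((EuclideanSpace.proj (𝕜 := ℝ) c).hasFDerivAt.comp y'
      (differentiableAt_trans he he' hy').hasFDerivAt).fderiv
    change _ = fderiv ℝ ((EuclideanSpace.proj (𝕜 := ℝ) c) ∘ trans e e') y' _
    rw [this]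
    simp
  rw [pd_congr (h2 b), pd_congr (h2 a), pd_comm (isOpen_overlap e e') h hy]

/-- The transformation law of the Christoffel symbols of the first kind. -/
theorem christoffelLow_trans {e e' : OpenPartialHomeomorph M (Coord D)}
    (he : e ∈ atlas (Coord D) M) (he' : e' ∈ atlas (Coord D) M) {y : Coord D}
    (hy : y ∈ overlap e e') (d a b : Fin D) :
    S.christoffelLow e y d a b =
      ∑ p, jacobi e e' y d p * (∑ q, S.gMat e' (trans e e' y) p q *
          pd a (fun y => jacobi e e' y b q) y +
        ∑ r, ∑ q, jacobi e e' y a r * jacobi e e' y b q *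
          S.christoffelLow e' (trans e e' y) p r q) := by
  set X : Fin D → Fin D → Fin D → ℝ := fun a b d => ∑ p, ∑ q, jacobi e e' y d p *
    (S.gMat e' (trans e e' y) p q * pd a (fun y => jacobi e e' y b q) y) with hX
  set Y : Fin D → Fin D → Fin D → ℝ := fun r p q =>
    pd r (fun y => S.gMat e' y p q) (trans e e' y) with hY
  have hJ : ∀ a b, DifferentiableAt ℝ (fun y => jacobi e e' y a b) y := fun a b =>
    ((contDiffOn_jacobi he he' a b).contDiffAt
      ((isOpen_overlap e e').mem_nhds hy)).differentiableAt (by simp)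
  have hg : ∀ p q, DifferentiableAt ℝ (fun y => S.gMat e' y p q) (trans e e' y) := fun p q =>
    ((S.contDiffOn_gMat he' p q).contDiffAt
      (e'.open_target.mem_nhds (trans_mem_overlap hy).1)).differentiableAt (by simp)
  have hτ := differentiableAt_trans he he' hy
  have hgτ : ∀ p q, DifferentiableAt ℝ (fun y => S.gMat e' (trans e e' y) p q) y := fun p q =>
    (hg p q).comp y hτ
  have hXs : ∀ a b d, X a b d = X b a d := by
    intro a b d
    simp only [hX, pd_jacobi_symm he he' hy a b]
  have key : ∀ a d b, pd a (fun y => S.gMat e y d b) y = X a d b + X a b d +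
      ∑ p, ∑ q, ∑ r, jacobi e e' y d p * jacobi e e' y b q * jacobi e e' y a r * Y r p q := by
    intro a d b
    have h1 : (fun y => S.gMat e y d b) =ᶠ[𝓝 y] fun y => ∑ p, ∑ q,
        (jacobi e e' y d p * S.gMat e' (trans e e' y) p q) * jacobi e e' y b q := by
      filter_upwards [(isOpen_overlap e e').mem_nhds hy] with y hy
      rw [S.gMat_trans he he' hy, Finset.sum_comm]
      simp [Matrix.mul_apply, jacMat, Finset.sum_mul]
    have h2 : pd a (fun y => S.gMat e y d b) y = ∑ p, ∑ q,
        (jacobi e e' y b q * (S.gMat e' (trans e e' y) q p *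
            pd a (fun y => jacobi e e' y d p) y) +
          jacobi e e' y d p * (S.gMat e' (trans e e' y) p q *
            pd a (fun y => jacobi e e' y b q) y) +
          ∑ r, jacobi e e' y d p * jacobi e e' y b q * jacobi e e' y a r * Y r p q) := by
      rw [pd_congr h1, pd_sum _ fun q _ => by fun_prop]
      refine Finset.sum_congr rfl fun p _ => ?_
      rw [pd_sum _ fun q _ => by fun_prop]
      refine Finset.sum_congr rfl fun q _ => ?_
      rw [pd_mul ((hJ _ _).fun_mul (hgτ _ _)) (hJ _ _), pd_mul (hJ _ _) (hgτ _ _),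
        pd_comp (f := fun y => S.gMat e' y p q) (hg p q) hτ, S.gMat_isSymm e' _ q p,
        Finset.mul_sum, add_mul, Finset.sum_mul]
      simp only [smul_eq_mul]
      have : ∀ r, jacobi e e' y d p * ((fderiv ℝ (trans e e') y (stdVec D a)) r * Y r p q) *
          jacobi e e' y b q = jacobi e e' y d p * jacobi e e' y b q * jacobi e e' y a r * Y r p q :=
        fun r => by unfold jacobi; ring
      simp only [hY] at this
      simp only [this, hY]
      ring
    rw [h2]
    simp only [Finset.sum_add_distrib, hX]
    congr 2
    exact Finset.sum_comm
  have e1 : ∑ p, jacobi e e' y d p * (∑ q, S.gMat e' (trans e e' y) p q *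
          pd a (fun y => jacobi e e' y b q) y +
        ∑ r, ∑ q, jacobi e e' y a r * jacobi e e' y b q *
          S.christoffelLow e' (trans e e' y) p r q) = X a b d +
        (1 / 2) * (∑ p, ∑ q, ∑ r, jacobi e e' y d p * jacobi e e' y b q * jacobi e e' y a r * Y r p q
        + ∑ p, ∑ q, ∑ r, jacobi e e' y d p * jacobi e e' y a q * jacobi e e' y b r * Y r p q
        - ∑ p, ∑ q, ∑ r, jacobi e e' y a p * jacobi e e' y b q * jacobi e e' y d r * Y r p q) := by
    have h2 : ∑ p, ∑ q, ∑ r, jacobi e e' y d p * jacobi e e' y a q * jacobi e e' y b r * Y r p q =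
        ∑ p, ∑ q, ∑ r, jacobi e e' y d p * jacobi e e' y a r * jacobi e e' y b q * Y q p r :=
      Finset.sum_congr rfl fun p _ => Finset.sum_comm
    have h3 : ∑ p, ∑ q, ∑ r, jacobi e e' y a p * jacobi e e' y b q * jacobi e e' y d r * Y r p q =
        ∑ p, ∑ q, ∑ r, jacobi e e' y a r * jacobi e e' y b q * jacobi e e' y d p * Y p r q := by
      rw [Finset.sum_comm]
      simp_rw [Finset.sum_comm (s := (Finset.univ : Finset (Fin D)))
        (f := fun p r => jacobi e e' y a p * _ * jacobi e e' y d r * Y r p _)]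
      rw [Finset.sum_comm]
    rw [h2, h3, hX]
    simp only [mul_add, Finset.sum_add_distrib, Finset.mul_sum]
    congr 1
    rw [← Finset.sum_add_distrib, ← Finset.sum_sub_distrib, Finset.mul_sum]
    refine Finset.sum_congr rfl fun p _ => ?_
    rw [Finset.sum_comm, ← Finset.sum_add_distrib, ← Finset.sum_sub_distrib, Finset.mul_sum]
    refine Finset.sum_congr rfl fun q _ => ?_
    rw [← Finset.sum_add_distrib, ← Finset.sum_sub_distrib, Finset.mul_sum]
    refine Finset.sum_congr rfl fun r _ => ?_
    unfold christoffelLow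
    simp only [hY]
    ring
  rw [e1, christoffelLow, key a d b, key b d a, key d a b, hXs b a d, hXs d a b, hXs d b a]
  ring

theorem sum_mul_mulVec (J g : Matrix (Fin D) (Fin D) ℝ) (K : Fin D → ℝ) (c : Fin D) :
    ∑ d, (∑ f, g d f * ∑ p, J f p * K p) * J d c = ∑ p, (J.transpose * g * J) c p * K p := by
  have h : (J.transpose * g * J).mulVec K = J.transpose.mulVec (g.mulVec (J.mulVec K)) := by
    simp only [Matrix.mulVec_mulVec, Matrix.mul_assoc]
  refine Eq.trans ?_ (congrFun h c).symm
  simp only [Matrix.mulVec, dotProduct, Matrix.transpose_apply]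
  exact Finset.sum_congr rfl fun d _ => mul_comm _ _

/-- The transformation law of the Christoffel symbols. -/
theorem christoffel_trans {e e' : OpenPartialHomeomorph M (Coord D)}
    (he : e ∈ atlas (Coord D) M) (he' : e' ∈ atlas (Coord D) M) {y : Coord D}
    (hy : y ∈ overlap e e') (a b c : Fin D) :
    pd a (fun y => jacobi e e' y b c) y - ∑ d, S.christoffel e y d a b * jacobi e e' y d c =
      -∑ a', ∑ b', jacobi e e' y a a' * jacobi e e' y b b' *
        S.christoffel e' (trans e e' y) c a' b' := by
  have hU : IsUnit (jacMat e e' y).det := by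
    refine isUnit_iff_ne_zero.2 fun h => ?_
    have := congrArg Matrix.det (jacMat_mul_inv he he' hy)
    simp [h] at this
  have hQ : (jacMat e e' y).transpose * (S.gMat e y)⁻¹ * jacMat e e' y =
      (S.gMat e' (trans e e' y))⁻¹ := by
    have hUt : IsUnit (jacMat e e' y).transpose.det := by rwa [Matrix.det_transpose]
    rw [S.gMat_trans he he' hy, Matrix.mul_inv_rev, Matrix.mul_inv_rev,
      ← Matrix.mul_assoc, Matrix.mul_nonsing_inv _ hUt, Matrix.one_mul, Matrix.mul_assoc,
      Matrix.nonsing_inv_mul _ hU, Matrix.mul_one]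
  have hg' : (S.gMat e' (trans e e' y))⁻¹ * S.gMat e' (trans e e' y) = 1 :=
    Matrix.nonsing_inv_mul _ (isUnit_iff_ne_zero.2 (S.gMat_det_ne_zero he' (trans_mem_overlap hy).1))
  have h1 : ∑ d, S.christoffel e y d a b * jacobi e e' y d c =
      ∑ p, (S.gMat e' (trans e e' y))⁻¹ c p * (∑ q, S.gMat e' (trans e e' y) p q *
          pd a (fun y => jacobi e e' y b q) y +
        ∑ r, ∑ q, jacobi e e' y a r * jacobi e e' y b q *
          S.christoffelLow e' (trans e e' y) p r q) := by
    rw [← hQ]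
    simp_rw [S.christoffel_eq, S.christoffelLow_trans he he' hy]
    exact sum_mul_mulVec _ _ _ c
  have h2 : ∀ f : Fin D → ℝ, ∑ p, (S.gMat e' (trans e e' y))⁻¹ c p *
      ∑ q, S.gMat e' (trans e e' y) p q * f q = f c := by
    intro f
    have h : (S.gMat e' (trans e e' y))⁻¹.mulVec ((S.gMat e' (trans e e' y)).mulVec f) = f := by
      rw [Matrix.mulVec_mulVec, hg', Matrix.one_mulVec]
    exact congrFun h c
  rw [h1]
  simp_rw [mul_add, Finset.sum_add_distrib]
  rw [h2 fun q => pd a (fun y => jacobi e e' y b q) y, sub_add_cancel_left]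
  congr 1
  simp_rw [S.christoffel_eq, Finset.mul_sum]
  rw [Finset.sum_comm]
  refine Finset.sum_congr rfl fun r _ => ?_
  rw [Finset.sum_comm]
  refine Finset.sum_congr rfl fun r _ => Finset.sum_congr rfl fun q _ => ?_
  ring

end Spacetime
end

/-! ### Algebra of the slotwise action of a matrix on tensor components -/

section Pull

variable {D : ℕ} {V : Type*} [NormedAddCommGroup V] [NormedSpace ℝ V]
variable {ι : Type*} [Fintype ι] [DecidableEq ι]

theorem sum_prod_pi (m m' : Fin D → Fin D → ℝ) (c c'' : ι → Fin D) :
    ∑ c' : ι → Fin D, (∏ s, m (c s) (c' s)) * ∏ s, m' (c' s) (c'' s) =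
      ∏ s, ∑ b, m (c s) b * m' b (c'' s) := by
  rw [Finset.prod_univ_sum]
  simp [Finset.prod_mul_distrib]

theorem pull_pull (m m' : Fin D → Fin D → ℝ) (t : (ι → Fin D) → V) (c : ι → Fin D) :
    pull m (pull m' t) c = pull (fun a c => ∑ b, m a b * m' b c) t c := by
  unfold pull
  simp_rw [← sum_prod_pi, Finset.smul_sum, Finset.sum_smul, smul_smul]
  exact Finset.sum_comm

theorem pull_one (t : (ι → Fin D) → V) (c : ι → Fin D) :
    pull (fun a b => if a = b then 1 else 0) t c = t c := by
  unfold pull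
  rw [Finset.sum_eq_single c]
  · simp
  · intro c' _ h
    obtain ⟨s, hs⟩ := Function.ne_iff.1 h
    rw [Finset.prod_eq_zero (Finset.mem_univ s) (by simp [Ne.symm hs]), zero_smul]
  · simp

theorem pull_sum {κ : Type*} (u : Finset κ) (m : Fin D → Fin D → ℝ)
    (t : κ → (ι → Fin D) → V) (c : ι → Fin D) :
    pull m (fun c => ∑ i ∈ u, t i c) c = ∑ i ∈ u, pull m (t i) c := by
  simp only [pull, Finset.smul_sum]
  exact Finset.sum_comm

/-- The pairing of covariant and contravariant components does not depend on the basis. -/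
theorem sum_pull_mul_pull {𝔸 : Type*} [NormedCommRing 𝔸] [NormedAlgebra ℝ 𝔸]
    {m n : Fin D → Fin D → ℝ}
    (h : ∀ a c, ∑ b, n b a * m b c = if a = c then 1 else 0) (f w : (ι → Fin D) → 𝔸) :
    ∑ c, pull n f c * pull m w c = ∑ c, f c * w c := by
  have h1 : ∀ c, f c * w c = f c * pull (fun a c => ∑ b, n b a * m b c) w c := by
    intro c
    simp_rw [h, pull_one]
  simp_rw [h1, ← pull_pull]
  unfold pull
  simp_rw [Finset.sum_mul, Finset.mul_sum]
  rw [Finset.sum_comm]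
  refine Finset.sum_congr rfl fun c _ => ?_
  refine Finset.sum_congr rfl fun c' _ => ?_
  rw [Finset.smul_sum, Finset.mul_sum]
  refine Finset.sum_congr rfl fun c'' _ => ?_
  simp only [smul_mul_assoc, mul_smul_comm]
  rw [smul_comm]

theorem pull_equiv {ι' : Type*} [Fintype ι'] [DecidableEq ι'] (σ : ι' ≃ ι)
    (m : Fin D → Fin D → ℝ) (t : (ι' → Fin D) → V) (c : ι → Fin D) :
    pull m (fun c => t (c ∘ σ)) c = pull m t (c ∘ σ) := by
  unfold pull
  refine Fintype.sum_equiv (Equiv.arrowCongr σ.symm (Equiv.refl _)) _ _ fun c' => ?_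
  have h : ∏ s, m (c s) (c' s) = ∏ s, m ((c ∘ σ) s) ((c' ∘ σ) s) :=
    (Equiv.prod_comp σ fun s => m (c s) (c' s)).symm
  rw [h]
  rfl

variable {ι₁ ι₂ : Type*} [Fintype ι₁] [DecidableEq ι₁] [Fintype ι₂] [DecidableEq ι₂]

/-- The family with index set `ι` that is composed of `c₁` and `c₂`, for a decomposition of `ι`
into the images of two maps. -/
def glue {σ₁ : ι₁ → ι} {σ₂ : ι₂ → ι} (h : Function.Bijective (Sum.elim σ₁ σ₂))
    (c₁ : ι₁ → Fin D) (c₂ : ι₂ → Fin D) : ι → Fin D :=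
  Sum.elim c₁ c₂ ∘ (Equiv.ofBijective _ h).symm

theorem glue_comp_left {σ₁ : ι₁ → ι} {σ₂ : ι₂ → ι} (h : Function.Bijective (Sum.elim σ₁ σ₂))
    (c₁ : ι₁ → Fin D) (c₂ : ι₂ → Fin D) : glue h c₁ c₂ ∘ σ₁ = c₁ := by
  ext s : 1
  have : (Equiv.ofBijective _ h).symm (σ₁ s) = Sum.inl s := by
    rw [Equiv.symm_apply_eq]; rfl
  simp [glue, this]

theorem glue_comp_right {σ₁ : ι₁ → ι} {σ₂ : ι₂ → ι} (h : Function.Bijective (Sum.elim σ₁ σ₂))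
    (c₁ : ι₁ → Fin D) (c₂ : ι₂ → Fin D) : glue h c₁ c₂ ∘ σ₂ = c₂ := by
  ext s : 1
  have : (Equiv.ofBijective _ h).symm (σ₂ s) = Sum.inr s := by
    rw [Equiv.symm_apply_eq]; rfl
  simp [glue, this]

theorem glue_eta {σ₁ : ι₁ → ι} {σ₂ : ι₂ → ι} (h : Function.Bijective (Sum.elim σ₁ σ₂))
    (c : ι → Fin D) : glue h (c ∘ σ₁) (c ∘ σ₂) = c := by
  ext s : 1
  obtain ⟨q, rfl⟩ := h.2 s
  rcases q with q | q
  · exact congrFun (glue_comp_left h (c ∘ σ₁) (c ∘ σ₂)) q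
  · exact congrFun (glue_comp_right h (c ∘ σ₁) (c ∘ σ₂)) q

theorem prod_glue {R : Type*} [CommMonoid R] {σ₁ : ι₁ → ι} {σ₂ : ι₂ → ι}
    (h : Function.Bijective (Sum.elim σ₁ σ₂)) (g : ι → R) :
    ∏ s, g s = (∏ s, g (σ₁ s)) * ∏ s, g (σ₂ s) := by
  rw [← (Equiv.ofBijective _ h).prod_comp, Fintype.prod_sum_type]
  rfl

theorem sum_glue {W : Type*} [AddCommMonoid W] {σ₁ : ι₁ → ι} {σ₂ : ι₂ → ι}
    (h : Function.Bijective (Sum.elim σ₁ σ₂)) (g : (ι → Fin D) → W) :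
    ∑ c, g c = ∑ c₁, ∑ c₂, g (glue h c₁ c₂) := by
  rw [← Fintype.sum_prod_type']
  refine Fintype.sum_equiv ⟨fun c => (c ∘ σ₁, c ∘ σ₂), fun q => glue h q.1 q.2,
    fun c => glue_eta h c, fun q => Prod.ext (glue_comp_left h _ _) (glue_comp_right h _ _)⟩ _ _
    fun c => ?_
  simp [glue_eta]

theorem pull_mul {𝔸 : Type*} [NormedCommRing 𝔸] [NormedAlgebra ℝ 𝔸] {σ₁ : ι₁ → ι} {σ₂ : ι₂ → ι}
    (h : Function.Bijective (Sum.elim σ₁ σ₂)) (m : Fin D → Fin D → ℝ) (u : (ι₁ → Fin D) → 𝔸)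
    (v : (ι₂ → Fin D) → 𝔸) (c : ι → Fin D) :
    pull m (fun c => u (c ∘ σ₁) * v (c ∘ σ₂)) c = pull m u (c ∘ σ₁) * pull m v (c ∘ σ₂) := by
  unfold pull
  rw [sum_glue h, Finset.sum_mul_sum]
  refine Finset.sum_congr rfl fun c₁ _ => Finset.sum_congr rfl fun c₂ _ => ?_
  rw [prod_glue h]
  simp only [glue_comp_left, glue_comp_right, smul_mul_smul_comm]
  have h1 : ∀ s, glue h c₁ c₂ (σ₁ s) = c₁ s := fun s => congrFun (glue_comp_left h c₁ c₂) s
  have h2 : ∀ s, glue h c₁ c₂ (σ₂ s) = c₂ s := fun s => congrFun (glue_comp_right h c₁ c₂) s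
  simp only [h1, h2, Function.comp_apply]

theorem pull_prod {p : ℕ} {k : Fin p → ℕ} {𝔸 : Type*} [NormedCommRing 𝔸] [NormedAlgebra ℝ 𝔸]
    (m : Fin D → Fin D → ℝ) (t : (i : Fin p) → (Fin (k i) → Fin D) → 𝔸) (c : Slots k → Fin D) :
    pull m (fun c => ∏ i, t i (fun s => c ⟨i, s⟩)) c =
      ∏ i, pull m (t i) (fun s => c ⟨i, s⟩) := by
  unfold pull
  rw [Finset.prod_univ_sum, Fintype.piFinset_univ]
  refine Fintype.sum_equiv (Equiv.piCurry fun (i : Fin p) (_ : Fin (k i)) => Fin D) _ _ fun c' => ?_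
  have h1 : ∀ i, (∏ s, m (c ⟨i, s⟩) (c' ⟨i, s⟩)) • t i (fun s => c' ⟨i, s⟩) =
      algebraMap ℝ 𝔸 (∏ s, m (c ⟨i, s⟩) (c' ⟨i, s⟩)) * t i (fun s => c' ⟨i, s⟩) :=
    fun i => Algebra.smul_def _ _
  change _ = ∏ i, (∏ s, m (c ⟨i, s⟩) (c' ⟨i, s⟩)) • t i (fun s => c' ⟨i, s⟩)
  simp_rw [h1, Finset.prod_mul_distrib, ← map_prod, ← Algebra.smul_def]
  congr 1
  exact Fintype.prod_sigma _

theorem contract_eq_sum {M : Type*} {σ₁ : ι₁ → ι} {σ₂ : ι₂ → ι}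
    (h : Function.Bijective (Sum.elim σ₁ σ₂)) (f w : TensorField D M ι ℂ) (x : M)
    (c : ι₁ → Fin D) :
    contract σ₁ f w x c = ∑ q, f x (glue h c q) * w x (glue h c q) := by
  unfold contract
  rw [sum_glue h, Finset.sum_eq_single c]
  · simp [glue_comp_left]
  · intro c' _ hc
    simp [glue_comp_left, hc]
  · simp

theorem sum_contract {M : Type*} (σ₁ : ι₁ → ι) (f w : TensorField D M ι ℂ) (x : M)
    (g : (ι₁ → Fin D) → ℂ) :
    ∑ c, contract σ₁ f w x c * g c = ∑ C, f x C * w x C * g (C ∘ σ₁) := by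
  unfold contract
  simp_rw [Finset.sum_mul]
  rw [Finset.sum_comm]
  refine Finset.sum_congr rfl fun C _ => ?_
  rw [Finset.sum_eq_single (C ∘ σ₁)]
  · simp
  · intro c _ hc
    simp [Ne.symm hc]
  · simp

theorem pull_contract {σ₁ : ι₁ → ι} {σ₂ : ι₂ → ι}
    (h : Function.Bijective (Sum.elim σ₁ σ₂)) {m n : Fin D → Fin D → ℝ}
    (hmn : ∀ a c, ∑ b, n b a * m b c = if a = c then 1 else 0) (f : (ι → Fin D) → ℂ)
    (z : (ι₂ → Fin D) → ℂ) (c : ι₁ → Fin D) :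
    pull n (fun c => ∑ q, f (glue h c q) * z q) c = ∑ q, pull n f (glue h c q) * pull m z q := by
  have h1 : ∀ q, pull n f (glue h c q) =
      pull n (fun q' => ∑ c', (∏ s, n (c s) (c' s)) • f (glue h c' q')) q := by
    intro q
    unfold pull
    rw [sum_glue h, Finset.sum_comm]
    refine Finset.sum_congr rfl fun q' _ => ?_
    rw [Finset.smul_sum]
    refine Finset.sum_congr rfl fun c' _ => ?_
    rw [prod_glue h, smul_smul]
    have e1 : ∀ c q s, glue (D := D) h c q (σ₁ s) = c s := fun c q s =>
      congrFun (glue_comp_left h c q) s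
    have e2 : ∀ c q s, glue (D := D) h c q (σ₂ s) = q s := fun c q s =>
      congrFun (glue_comp_right h c q) s
    simp only [e1, e2]
    rw [mul_comm]
  simp_rw [h1]
  rw [sum_pull_mul_pull hmn]
  unfold pull
  simp_rw [Finset.smul_sum, Finset.sum_mul]
  rw [Finset.sum_comm]
  simp only [smul_mul_assoc]

end Pull

/-! ### Components of tensor fields in charts -/

section Components

variable {D : ℕ} {M : Type*} [TopologicalSpace M] [ChartedSpace (Coord D) M]
  [IsManifold 𝓘(ℝ, Coord D) ∞ M]
variable {V : Type*} [NormedAddCommGroup V] [NormedSpace ℝ V]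
variable {ι : Type*} [Fintype ι] [DecidableEq ι]
variable {e e' : OpenPartialHomeomorph M (Coord D)}

theorem covComp_eq (he : e ∈ atlas (Coord D) M) (w : TensorField D M ι V) {y : Coord D}
    (hy : y ∈ e.target) (c : ι → Fin D) : covComp e w y c =
      pull (jacobi e (chartAt (Coord D) (e.symm y)) y) (w (e.symm y)) c := by
  simp only [covComp, pull, jacInv_eq he hy]

theorem contraComp_eq (he : e ∈ atlas (Coord D) M) (f : TensorField D M ι ℂ) {y : Coord D}
    (hy : y ∈ e.target) (c : ι → Fin D) : contraComp e f y c =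
      pull (fun b b' => jacobi (chartAt (Coord D) (e.symm y)) e
        (trans e (chartAt (Coord D) (e.symm y)) y) b' b) (f (e.symm y)) c := by
  simp only [contraComp, pull, jac_eq he (e.map_target hy)]
  rfl

theorem pull_congr_matrix {m m' : Fin D → Fin D → ℝ} (h : ∀ a b, m a b = m' a b)
    (t : (ι → Fin D) → V) (c : ι → Fin D) : pull m t c = pull m' t c := by
  have : m = m' := funext fun a => funext fun b => h a b
  rw [this]

/-- The transformation law of covariant components. -/
theorem covComp_trans (he : e ∈ atlas (Coord D) M) (he' : e' ∈ atlas (Coord D) M)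
    (w : TensorField D M ι V) {y : Coord D} (hy : y ∈ overlap e e') (c : ι → Fin D) :
    covComp e w y c = pull (jacobi e e' y) (covComp e' w (trans e e' y)) c := by
  have h : covComp e' w (trans e e' y) = pull (jacobi e' (chartAt (Coord D) (e.symm y))
      (trans e e' y)) (w (e.symm y)) := by
    ext c
    rw [covComp_eq he' w (trans_mem_overlap hy).1, symm_trans hy]
  rw [h, pull_pull, covComp_eq he w hy.1]
  exact pull_congr_matrix
    (fun a b => jacobi_chain he he' (chart_mem_atlas _ _) hy (mem_overlap_chartAt hy.1) a b) _ _

/-- The transformation law of contravariant components. -/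
theorem contraComp_trans (he : e ∈ atlas (Coord D) M) (he' : e' ∈ atlas (Coord D) M)
    (f : TensorField D M ι ℂ) {y : Coord D} (hy : y ∈ overlap e e') (c : ι → Fin D) :
    contraComp e f y c =
      pull (fun b b' => jacobi e' e (trans e e' y) b' b) (contraComp e' f (trans e e' y)) c := by
  set e₀ := chartAt (Coord D) (e.symm y) with he₀
  have hc : y ∈ overlap e e₀ := mem_overlap_chartAt hy.1
  have h : contraComp e' f (trans e e' y) = pull (fun b b' => jacobi e₀ e' (trans e e₀ y) b' b)
      (f (e.symm y)) := by
    ext c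
    rw [contraComp_eq he' f (trans_mem_overlap hy).1, symm_trans hy, ← he₀, trans_trans hy]
  rw [h, pull_pull, contraComp_eq he f hy.1, ← he₀]
  refine pull_congr_matrix (fun a b => ?_) _ _
  have := jacobi_chain (chart_mem_atlas _ _) he' he
    (trans_mem_overlap' hc hy) (trans_mem_overlap hc) b a
  rw [this, trans_trans hc]
  exact Finset.sum_congr rfl fun b _ => mul_comm _ _

theorem covComp_chartAt (w : TensorField D M ι V) (x : M) (c : ι → Fin D) :
    covComp (chartAt (Coord D) x) w (chartAt (Coord D) x x) c = w x c := by
  have hx : x ∈ (chartAt (Coord D) x).source := mem_chart_source _ _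
  have hl : (chartAt (Coord D) x).symm (chartAt (Coord D) x x) = x :=
    (chartAt (Coord D) x).left_inv hx
  rw [covComp_eq (chart_mem_atlas _ _) w ((chartAt (Coord D) x).map_source hx), hl,
    pull_congr_matrix (jacobi_self ((chartAt (Coord D) x).map_source hx)), pull_one]

/-- The pairing of a contravariant and a covariant tensor field, computed in a chart. -/
theorem sum_contraComp_mul_covComp (he : e ∈ atlas (Coord D) M) (f w : TensorField D M ι ℂ)
    {y : Coord D} (hy : y ∈ e.target) :
    ∑ c, contraComp e f y c * covComp e w y c = ∑ c, f (e.symm y) c * w (e.symm y) c := by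
  simp_rw [contraComp_eq he f hy, covComp_eq he w hy]
  have hc := mem_overlap_chartAt hy
  refine sum_pull_mul_pull (fun a c => ?_) _ _
  have := jacobi_inv (chart_mem_atlas _ _) he (trans_mem_overlap hc) a c
  rwa [trans_trans hc, trans_self hy] at this

theorem contraComp_contract {ι₁ ι₂ : Type*} [Fintype ι₁] [DecidableEq ι₁] [Fintype ι₂]
    [DecidableEq ι₂] {σ₁ : ι₁ → ι} {σ₂ : ι₂ → ι} (h : Function.Bijective (Sum.elim σ₁ σ₂))
    (he : e ∈ atlas (Coord D) M) (f : TensorField D M ι ℂ) (z : TensorField D M ι₂ ℂ)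
    {y : Coord D} (hy : y ∈ e.target) (c : ι₁ → Fin D) :
    contraComp e (contract σ₁ f fun x C => z x (C ∘ σ₂)) y c =
      ∑ q, contraComp e f y (glue h c q) * covComp e z y q := by
  simp_rw [contraComp_eq he _ hy, covComp_eq he z hy]
  have hc := mem_overlap_chartAt hy
  rw [← pull_contract h (fun a c => ?_)]
  · congr 1
    ext c
    rw [contract_eq_sum h]
    simp only [glue_comp_right]
  · have := jacobi_inv (chart_mem_atlas _ _) he (trans_mem_overlap hc) a c
    rwa [trans_trans hc, trans_self hy] at this

theorem IsTestTensor.contract {ι₁ ι₂ : Type*} [Fintype ι₁] [DecidableEq ι₁] [Fintype ι₂]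
    [DecidableEq ι₂] {σ₁ : ι₁ → ι} {σ₂ : ι₂ → ι} (h : Function.Bijective (Sum.elim σ₁ σ₂))
    {f : TensorField D M ι ℂ} (hf : IsTestTensor f) {z : TensorField D M ι₂ ℂ}
    (hz : SmoothCov z) : IsTestTensor (contract σ₁ f fun x C => z x (C ∘ σ₂)) where
  smooth e he c := by
    refine ContDiffOn.congr ?_ fun y hy => contraComp_contract h he f z hy c
    exact ContDiffOn.sum fun q _ => (hf.smooth e he _).mul (hz e he _)
  compact := by
    refine hf.compact.mono fun x hx => ?_
    contrapose! hx
    have : f x = 0 := by simpa using hx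
    simp only [Function.mem_support, not_not]
    ext c
    simp [WickField.contract, this]

theorem SmoothCov.sum {κ : Type*} {u : Finset κ} {w : κ → TensorField D M ι V}
    (h : ∀ i ∈ u, SmoothCov (w i)) : SmoothCov (fun x c => ∑ i ∈ u, w i x c) := by
  intro e he c
  refine ContDiffOn.congr (ContDiffOn.sum fun i hi => h i hi e he c) fun y hy => ?_
  simp only [covComp_eq he _ hy, ← pull_sum]

theorem covComp_sum {κ : Type*} (u : Finset κ) (w : κ → TensorField D M ι V)
    (he : e ∈ atlas (Coord D) M) {y : Coord D} (hy : y ∈ e.target) (c : ι → Fin D) :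
    covComp e (fun x c => ∑ i ∈ u, w i x c) y c = ∑ i ∈ u, covComp e (w i) y c := by
  simp only [covComp_eq he _ hy, ← pull_sum]

theorem covComp_mul {𝔸 : Type*} [NormedCommRing 𝔸] [NormedAlgebra ℝ 𝔸] {ι₁ ι₂ : Type*}
    [Fintype ι₁] [DecidableEq ι₁] [Fintype ι₂] [DecidableEq ι₂] {σ₁ : ι₁ → ι} {σ₂ : ι₂ → ι}
    (h : Function.Bijective (Sum.elim σ₁ σ₂)) (he : e ∈ atlas (Coord D) M)
    (u : TensorField D M ι₁ 𝔸) (v : TensorField D M ι₂ 𝔸) {y : Coord D} (hy : y ∈ e.target)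
    (c : ι → Fin D) :
    covComp e (fun x c => u x (c ∘ σ₁) * v x (c ∘ σ₂)) y c =
      covComp e u y (c ∘ σ₁) * covComp e v y (c ∘ σ₂) := by
  simp only [covComp_eq he _ hy]
  exact pull_mul h _ _ _ _

theorem SmoothCov.mul {𝔸 : Type*} [NormedCommRing 𝔸] [NormedAlgebra ℝ 𝔸] {ι₁ ι₂ : Type*}
    [Fintype ι₁] [DecidableEq ι₁] [Fintype ι₂] [DecidableEq ι₂] {σ₁ : ι₁ → ι} {σ₂ : ι₂ → ι}
    (h : Function.Bijective (Sum.elim σ₁ σ₂)) {u : TensorField D M ι₁ 𝔸}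
    {v : TensorField D M ι₂ 𝔸} (hu : SmoothCov u) (hv : SmoothCov v) :
    SmoothCov (fun x (c : ι → Fin D) => u x (c ∘ σ₁) * v x (c ∘ σ₂)) := fun e he c =>
  ((hu e he _).mul (hv e he _)).congr fun _ hy => covComp_mul h he u v hy c

theorem covComp_equiv {ι' : Type*} [Fintype ι'] [DecidableEq ι'] (σ : ι' ≃ ι)
    (he : e ∈ atlas (Coord D) M) (w : TensorField D M ι' V) {y : Coord D} (hy : y ∈ e.target)
    (c : ι → Fin D) : covComp e (fun x c => w x (c ∘ σ)) y c = covComp e w y (c ∘ σ) := by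
  simp only [covComp_eq he _ hy]
  exact pull_equiv _ _ _ _

theorem covComp_prod {p : ℕ} {k : Fin p → ℕ} {𝔸 : Type*} [NormedCommRing 𝔸] [NormedAlgebra ℝ 𝔸]
    (he : e ∈ atlas (Coord D) M) (w : (i : Fin p) → TensorField D M (Fin (k i)) 𝔸) {y : Coord D}
    (hy : y ∈ e.target) (c : Slots k → Fin D) :
    covComp e (fun x c => ∏ i, w i x (fun s => c ⟨i, s⟩)) y c =
      ∏ i, covComp e (w i) y (fun s => c ⟨i, s⟩) := by
  simp only [covComp_eq he _ hy]
  exact pull_prod _ _ _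

/-- The smooth functions on a manifold, expressed in charts. -/
theorem contDiffOn_comp_symm {u : M → V} (hu : ContMDiff 𝓘(ℝ, Coord D) 𝓘(ℝ, V) ∞ u)
    (he : e ∈ atlas (Coord D) M) : ContDiffOn ℝ ∞ (u ∘ e.symm) e.target := by
  have h1 : ContMDiffOn 𝓘(ℝ, Coord D) 𝓘(ℝ, Coord D) ∞ e.symm e.target :=
    contMDiffOn_symm_of_mem_maximalAtlas (IsManifold.subset_maximalAtlas he)
  exact contMDiffOn_iff_contDiffOn.1 (hu.comp_contMDiffOn h1)

theorem contMDiff_of_contDiffOn {u : M → V}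
    (hu : ∀ e ∈ atlas (Coord D) M, ContDiffOn ℝ ∞ (u ∘ e.symm) e.target) :
    ContMDiff 𝓘(ℝ, Coord D) 𝓘(ℝ, V) ∞ u := by
  intro x
  have hx : x ∈ (chartAt (Coord D) x).source := mem_chart_source _ _
  have h1 : ContMDiffOn 𝓘(ℝ, Coord D) 𝓘(ℝ, Coord D) ∞ (chartAt (Coord D) x)
      (chartAt (Coord D) x).source := contMDiffOn_chart
  have h2 := (contMDiffOn_iff_contDiffOn.2 (hu _ (chart_mem_atlas _ x))).comp h1
    (fun y hy => (chartAt (Coord D) x).map_source hy)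
  refine ((h2.congr (f₁ := u) fun y hy => ?_).contMDiffAt
    ((chartAt (Coord D) x).open_source.mem_nhds hx))
  simp [(chartAt (Coord D) x).left_inv hy]

end Components

/-! ### Tensoriality of iterated covariant derivatives and of the divergence -/

section CovariantDerivatives

variable {D : ℕ} {V : Type*} [NormedAddCommGroup V] [NormedSpace ℝ V]

/-- The connection coefficients that act on covariant slots. -/
def lowerConn (Γ : Coord D → Fin D → Fin D → Fin D → ℝ) (y : Coord D) (a b d : Fin D) : ℝ :=
  Γ y d a b

/-- The connection coefficients that act on contravariant slots. -/
def upperConn (Γ : Coord D → Fin D → Fin D → Fin D → ℝ) (y : Coord D) (a c d : Fin D) : ℝ :=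
  -Γ y c a d

theorem covD_succ (Γ : Coord D → Fin D → Fin D → Fin D → ℝ) (k : ℕ) (f : Coord D → V)
    (c : Fin (k + 1) → Fin D) (y : Coord D) :
    covD Γ (k + 1) f c y =
      covDeriv (lowerConn Γ) (fun y c => covD Γ k f c y) (c 0) (Fin.tail c) y :=
  rfl

theorem contDiffOn_covDeriv {ι : Type*} [Fintype ι] [DecidableEq ι]
    {A : Coord D → Fin D → Fin D → Fin D → ℝ} {T : Coord D → (ι → Fin D) → V} {U : Set (Coord D)}
    (hU : IsOpen U) (hA : ∀ a b d, ContDiffOn ℝ ∞ (fun y => A y a b d) U)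
    (hT : ∀ c, ContDiffOn ℝ ∞ (fun y => T y c) U) (a : Fin D) (c : ι → Fin D) :
    ContDiffOn ℝ ∞ (covDeriv A T a c) U := by
  unfold covDeriv
  exact (contDiffOn_pd hU (hT c)).sub (ContDiffOn.sum fun s _ => ContDiffOn.sum fun d _ =>
    (hA _ _ _).smul (hT _))

theorem contDiffOn_covD {Γ : Coord D → Fin D → Fin D → Fin D → ℝ} {U : Set (Coord D)}
    (hU : IsOpen U) (hΓ : ∀ c a b, ContDiffOn ℝ ∞ (fun y => Γ y c a b) U) {f : Coord D → V}
    (hf : ContDiffOn ℝ ∞ f U) : ∀ (k : ℕ) (c : Fin k → Fin D), ContDiffOn ℝ ∞ (covD Γ k f c) U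
  | 0, _ => hf
  | k + 1, c => contDiffOn_covDeriv (A := lowerConn Γ) hU (fun a b d => hΓ d a b)
      (contDiffOn_covD hU hΓ hf k) (c 0) (Fin.tail c)

theorem pull_cons {k : ℕ} (m : Fin D → Fin D → ℝ) (t : (Fin (k + 1) → Fin D) → V)
    (c : Fin (k + 1) → Fin D) :
    pull m t c = ∑ a, m (c 0) a • pull m (fun c' => t (Fin.cons a c')) (Fin.tail c) := by
  unfold pull
  rw [← (Fin.consEquiv fun _ => Fin D).sum_comp, Fintype.sum_prod_type]
  refine Finset.sum_congr rfl fun a _ => ?_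
  rw [Finset.smul_sum]
  refine Finset.sum_congr rfl fun c' _ => ?_
  rw [Fin.prod_univ_succ, smul_smul]
  simp [Fin.consEquiv, Fin.tail]

theorem pull_option {ι : Type*} [Fintype ι] [DecidableEq ι] (m : Fin D → Fin D → ℝ)
    (t : (Option ι → Fin D) → V) (a : Fin D) (c : ι → Fin D) :
    pull m t (fun o => o.elim a c) =
      ∑ a', m a a' • pull m (fun c' => t (fun o => o.elim a' c')) c := by
  unfold pull
  rw [← (Equiv.piOptionEquivProd (β := fun _ : Option ι => Fin D)).symm.sum_comp,
    Fintype.sum_prod_type]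
  refine Finset.sum_congr rfl fun a' _ => ?_
  rw [Finset.smul_sum]
  refine Finset.sum_congr rfl fun c' _ => ?_
  rw [Fintype.prod_option, smul_smul]
  congr 2
  ext o
  cases o <;> rfl

variable {M : Type*} [TopologicalSpace M] [ChartedSpace (Coord D) M]
  [IsManifold 𝓘(ℝ, Coord D) ∞ M] (S : Spacetime D M)
variable {e e' : OpenPartialHomeomorph M (Coord D)}

namespace Spacetime

/-- Iterated covariant derivatives of a function transform as covariant tensor components. -/
theorem covD_trans (he : e ∈ atlas (Coord D) M) (he' : e' ∈ atlas (Coord D) M) {u : M → V}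
    (hu : ContDiffOn ℝ ∞ (u ∘ e'.symm) e'.target) (k : ℕ) :
    ∀ (c : Fin k → Fin D) {y : Coord D}, y ∈ overlap e e' →
    covD (S.christoffel e) k (u ∘ e.symm) c y = pull (jacobi e e' y)
      (fun c' => covD (S.christoffel e') k (u ∘ e'.symm) c' (trans e e' y)) c := by
  induction k with
  | zero =>
    intro c y hy
    simp only [covD, pull, Finset.univ_unique, Finset.univ_eq_empty, Finset.prod_empty, one_smul,
      Finset.sum_const, Finset.card_singleton, Function.comp_apply, symm_trans hy]
  | succ k ih =>
    intro c y hy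
    have hsm := contDiffOn_covD e'.open_target (S.contDiffOn_christoffel he') hu k
    rw [covD_succ]
    have h1 : covDeriv (lowerConn (S.christoffel e))
        (fun y c => covD (S.christoffel e) k (u ∘ e.symm) c y) (c 0) (Fin.tail c) y =
        covDeriv (lowerConn (S.christoffel e)) (fun y => pull (jacobi e e' y)
          ((fun y c => covD (S.christoffel e') k (u ∘ e'.symm) c y) (trans e e' y)))
          (c 0) (Fin.tail c) y := by
      unfold covDeriv
      congr 1
      · refine pd_congr ?_
        filter_upwards [(isOpen_overlap e e').mem_nhds hy] with y hy
        exact ih _ hy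
      · simp_rw [ih _ hy]
    rw [h1, covDeriv_pull (A' := lowerConn (S.christoffel e')) (differentiableAt_trans he he' hy)
      (fun b b' => ((contDiffOn_jacobi he he' b b').contDiffAt
        ((isOpen_overlap e e').mem_nhds hy)).differentiableAt (by simp))
      (fun c' => ((hsm c').contDiffAt
        (e'.open_target.mem_nhds (trans_mem_overlap hy).1)).differentiableAt (by simp))
      _ (fun b b' => S.christoffel_trans he he' hy (c 0) b b'), pull_cons]
    rfl

/-- Iterated covariant derivatives of a function, in a chart. -/
theorem covComp_nabla (he : e ∈ atlas (Coord D) M) {u : M → V}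
    (hu : ∀ e ∈ atlas (Coord D) M, ContDiffOn ℝ ∞ (u ∘ e.symm) e.target) (k : ℕ)
    (c : Fin k → Fin D) {y : Coord D} (hy : y ∈ e.target) :
    covComp e (S.nabla k u) y c = covD (S.christoffel e) k (u ∘ e.symm) c y := by
  rw [covComp_eq he _ hy, S.covD_trans he (chart_mem_atlas (Coord D) (e.symm y))
    (hu _ (chart_mem_atlas _ _)) k c (mem_overlap_chartAt hy)]
  rfl

theorem smoothCov_nabla {u : M → V}
    (hu : ∀ e ∈ atlas (Coord D) M, ContDiffOn ℝ ∞ (u ∘ e.symm) e.target) (k : ℕ) :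
    SmoothCov (S.nabla k u) := fun e he c =>
  (contDiffOn_covD e.open_target (S.contDiffOn_christoffel he) (hu e he) k c).congr
    fun _ hy => S.covComp_nabla he hu k c hy

/-- The divergence of a contravariant tensor field in a chart. -/
def chartDiv {ι : Type*} [Fintype ι] [DecidableEq ι] (e : OpenPartialHomeomorph M (Coord D))
    (f : TensorField D M (Option ι) ℂ) (y : Coord D) (c : ι → Fin D) : ℂ :=
  ∑ a, covDeriv (upperConn (S.christoffel e)) (contraComp e f) a (fun o => o.elim a c) y

theorem divergence_eq_chartDiv {ι : Type*} [Fintype ι] [DecidableEq ι]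
    (f : TensorField D M (Option ι) ℂ) (x : M) (c : ι → Fin D) :
    S.divergence f x c = S.chartDiv (chartAt (Coord D) x) f (chartAt (Coord D) x x) c := by
  simp only [divergence, chartDiv, covDeriv, upperConn, Fintype.sum_option]
  rw [Finset.sum_sub_distrib, sub_eq_add_neg, ← Finset.sum_neg_distrib, add_assoc,
    ← Finset.sum_add_distrib]
  congr 1
  refine Finset.sum_congr rfl fun a _ => ?_
  rw [neg_add, ← Finset.sum_neg_distrib, ← Finset.sum_neg_distrib]
  congr 1
  · refine Finset.sum_congr rfl fun b _ => ?_
    rw [neg_smul, neg_neg]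
    congr 2
    ext o
    cases o <;> simp
  · refine Finset.sum_congr rfl fun s _ => ?_
    rw [← Finset.sum_neg_distrib]
    refine Finset.sum_congr rfl fun b _ => ?_
    rw [neg_smul, neg_neg]
    congr 2
    ext o
    cases o with
    | none => simp
    | some t => by_cases h : t = s <;> simp [h]

/-- The divergence transforms as contravariant tensor components. -/
theorem chartDiv_trans {ι : Type*} [Fintype ι] [DecidableEq ι] (he : e ∈ atlas (Coord D) M)
    (he' : e' ∈ atlas (Coord D) M) {f : TensorField D M (Option ι) ℂ}
    (hf : ∀ c, ContDiffOn ℝ ∞ (fun y => contraComp e' f y c) e'.target) {y : Coord D}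
    (hy : y ∈ overlap e e') (c : ι → Fin D) :
    S.chartDiv e f y c = pull (fun b b' => jacobi e' e (trans e e' y) b' b)
      (S.chartDiv e' f (trans e e' y)) c := by
  have hτ := differentiableAt_trans he he' hy
  have hm : ∀ b b', DifferentiableAt ℝ (fun y => jacobi e' e y b' b) (trans e e' y) :=
    fun b b' => ((contDiffOn_jacobi he' he b' b).contDiffAt
      ((isOpen_overlap e' e).mem_nhds (trans_mem_overlap hy))).differentiableAt (by simp)
  have hA : ∀ a b b', pd a (fun y => jacobi e' e (trans e e' y) b' b) y -
      ∑ d, upperConn (S.christoffel e) y a b d * jacobi e' e (trans e e' y) b' d =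
      -∑ a', ∑ b'', jacobi e e' y a a' * jacobi e' e (trans e e' y) b'' b *
        upperConn (S.christoffel e') (trans e e' y) a' b'' b' := by
    intro a b b'
    have h1 := fun a' => S.christoffel_trans he' he (trans_mem_overlap hy) a' b' b
    have hs : trans e' e (trans e e' y) = y := by
      rw [trans_trans hy, trans_self hy.1]
    simp only [hs] at h1
    have h2 : ∀ a', pd a' (fun y => jacobi e' e y b' b) (trans e e' y) =
        ∑ d, S.christoffel e' (trans e e' y) d a' b' * jacobi e' e (trans e e' y) d b -
        ∑ p, ∑ q, jacobi e' e (trans e e' y) a' p * jacobi e' e (trans e e' y) b' q *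
          S.christoffel e y b p q := fun a' => by linear_combination h1 a'
    rw [pd_comp (f := fun y => jacobi e' e y b' b) (hm b b') hτ]
    change ∑ a', jacobi e e' y a a' • _ - _ = _
    have h3 : ∑ a', jacobi e e' y a a' * ∑ p, ∑ q, jacobi e' e (trans e e' y) a' p *
        jacobi e' e (trans e e' y) b' q * S.christoffel e y b p q =
        ∑ q, jacobi e' e (trans e e' y) b' q * S.christoffel e y b a q := by
      have : ∀ p, (∑ a', jacobi e e' y a a' * jacobi e' e (trans e e' y) a' p) =
        if a = p then 1 else 0 := fun p => jacobi_inv he he' hy a p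
      calc _ = ∑ p, (∑ a', jacobi e e' y a a' * jacobi e' e (trans e e' y) a' p) *
            ∑ q, jacobi e' e (trans e e' y) b' q * S.christoffel e y b p q := by
            simp_rw [Finset.sum_mul, Finset.mul_sum]
            rw [Finset.sum_comm]
            refine Finset.sum_congr rfl fun p _ => Finset.sum_congr rfl fun a' _ =>
              Finset.sum_congr rfl fun q _ => ?_
            ring
        _ = _ := by simp [this]
    simp_rw [h2, smul_eq_mul, mul_sub, Finset.sum_sub_distrib]
    rw [h3]
    simp only [upperConn, neg_mul, mul_neg, Finset.sum_neg_distrib, neg_neg, sub_neg_eq_add]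
    have h4 : ∑ q, jacobi e' e (trans e e' y) b' q * S.christoffel e y b a q =
        ∑ d, S.christoffel e y b a d * jacobi e' e (trans e e' y) b' d :=
      Finset.sum_congr rfl fun _ _ => mul_comm _ _
    rw [h4, sub_add_cancel]
    refine Finset.sum_congr rfl fun a' _ => ?_
    rw [Finset.mul_sum]
    exact Finset.sum_congr rfl fun _ _ => by ring
  have key : ∀ a C, covDeriv (upperConn (S.christoffel e)) (contraComp e f) a C y =
      ∑ a', jacobi e e' y a a' • pull (fun b b' => jacobi e' e (trans e e' y) b' b)
        (fun C' => covDeriv (upperConn (S.christoffel e')) (contraComp e' f) a' C'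
          (trans e e' y)) C := by
    intro a C
    refine Eq.trans ?_ (covDeriv_pull (m := fun y b b' => jacobi e' e (trans e e' y) b' b)
      (τ := trans e e') (A := upperConn (S.christoffel e)) hτ (fun b b' => (hm b b').comp y hτ)
      (fun C' => ((hf C').contDiffAt
        (e'.open_target.mem_nhds (trans_mem_overlap hy).1)).differentiableAt (by simp)) a (hA a) C)
    unfold covDeriv
    congr 1
    · refine pd_congr ?_
      filter_upwards [(isOpen_overlap e e').mem_nhds hy] with y hy
      exact contraComp_trans he he' f hy C
    · simp_rw [contraComp_trans he he' f hy]
  unfold chartDiv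
  simp_rw [key, pull_option]
  rw [Finset.sum_comm, pull_sum]
  refine Finset.sum_congr rfl fun a' _ => ?_
  simp_rw [Finset.smul_sum, smul_smul]
  rw [Finset.sum_comm, Finset.sum_eq_single a']
  · rw [← Finset.sum_smul]
    have := jacobi_inv he' he (trans_mem_overlap hy) a' a'
    rw [trans_trans hy, trans_self hy.1, if_pos rfl] at this
    simp_rw [mul_comm (jacobi e e' y _ _)]
    rw [this, one_smul]
  · intro b _ hb
    rw [← Finset.sum_smul]
    have := jacobi_inv he' he (trans_mem_overlap hy) b a'
    rw [trans_trans hy, trans_self hy.1, if_neg hb] at this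
    simp_rw [mul_comm (jacobi e e' y _ _)]
    rw [this, zero_smul]
  · simp

theorem contraComp_divergence {ι : Type*} [Fintype ι] [DecidableEq ι] (he : e ∈ atlas (Coord D) M)
    {f : TensorField D M (Option ι) ℂ} (hf : IsTestTensor f) {y : Coord D} (hy : y ∈ e.target)
    (c : ι → Fin D) : contraComp e (S.divergence f) y c = S.chartDiv e f y c := by
  have hc := mem_overlap_chartAt hy
  rw [contraComp_eq he _ hy, S.chartDiv_trans he (chart_mem_atlas _ _)
    (hf.smooth _ (chart_mem_atlas _ _)) hc]
  congr 1
  ext c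
  rw [divergence_eq_chartDiv]
  rfl

theorem isTestTensor_divergence {ι : Type*} [Fintype ι] [DecidableEq ι]
    {f : TensorField D M (Option ι) ℂ} (hf : IsTestTensor f) :
    IsTestTensor (S.divergence f) where
  smooth e he c := by
    refine ContDiffOn.congr ?_ fun y hy => S.contraComp_divergence he hf hy c
    exact ContDiffOn.sum fun a _ => contDiffOn_covDeriv e.open_target
      (fun a b d => (S.contDiffOn_christoffel he b a d).neg) (hf.smooth e he) _ _
  compact := by
    refine hf.compact.mono' fun x hx => ?_
    by_contra hn
    refine hx ?_
    have hz : f =ᶠ[𝓝 x] 0 := notMem_tsupport_iff_eventuallyEq.1 hn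
    have hx' : x ∈ (chartAt (Coord D) x).source := mem_chart_source _ _
    have hcont : Filter.Tendsto (chartAt (Coord D) x).symm (𝓝 (chartAt (Coord D) x x)) (𝓝 x) := by
      have := (chartAt (Coord D) x).continuousAt_symm ((chartAt (Coord D) x).map_source hx')
      rwa [ContinuousAt, (chartAt (Coord D) x).left_inv hx'] at this
    have hz' : ∀ C, (fun y => contraComp (chartAt (Coord D) x) f y C)
        =ᶠ[𝓝 (chartAt (Coord D) x x)] fun _ => 0 := by
      intro C
      filter_upwards [hcont hz] with y hy
      have : f ((chartAt (Coord D) x).symm y) = 0 := hy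
      simp [contraComp, this]
    ext c
    rw [divergence_eq_chartDiv]
    simp only [chartDiv, covDeriv, Pi.zero_apply]
    refine Finset.sum_eq_zero fun a _ => ?_
    rw [pd_congr (hz' _), pd_const]
    simp [fun C => (hz' C).eq_of_nhds]

end Spacetime

end CovariantDerivatives

/-! ### The metric volume -/

section Volume

variable {D : ℕ} {M : Type*} [TopologicalSpace M] [ChartedSpace (Coord D) M]
  [IsManifold 𝓘(ℝ, Coord D) ∞ M] [MeasurableSpace M] [BorelSpace M] (S : Spacetime D M)
variable {e e' : OpenPartialHomeomorph M (Coord D)}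

theorem det_fderiv_trans (e e' : OpenPartialHomeomorph M (Coord D)) (y : Coord D) :
    (fderiv ℝ (trans e e') y).det = (jacMat e e' y).det := by
  rw [ContinuousLinearMap.det, ← LinearMap.det_toMatrix (EuclideanSpace.basisFun (Fin D) ℝ).toBasis,
    ← Matrix.det_transpose]
  congr 1

namespace Spacetime

/-- The density `√|det g|` of the metric volume in a chart. -/
def density (e : OpenPartialHomeomorph M (Coord D)) (y : Coord D) : ℝ := √|(S.gMat e y).det|

theorem density_pos (he : e ∈ atlas (Coord D) M) {y : Coord D} (hy : y ∈ e.target) :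
    0 < S.density e y :=
  Real.sqrt_pos.2 (abs_pos.2 (S.gMat_det_ne_zero he hy))

theorem contDiffOn_density (he : e ∈ atlas (Coord D) M) :
    ContDiffOn ℝ ∞ (S.density e) e.target := by
  intro y hy
  have h := contDiffOn_det (S.contDiffOn_gMat he) y hy
  have h0 := S.gMat_det_ne_zero he hy
  refine ContDiffWithinAt.sqrt ?_ (abs_ne_zero.2 h0)
  exact (contDiffAt_abs h0).comp_contDiffWithinAt y h

theorem density_trans (he : e ∈ atlas (Coord D) M) (he' : e' ∈ atlas (Coord D) M) {y : Coord D}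
    (hy : y ∈ overlap e e') :
    S.density e y = |(jacMat e e' y).det| * S.density e' (trans e e' y) := by
  unfold density
  rw [S.gMat_trans he he' hy, Matrix.det_mul, Matrix.det_mul, Matrix.det_transpose, abs_mul,
    abs_mul, mul_right_comm, ← sq, Real.sqrt_mul (sq_nonneg _), Real.sqrt_sq (abs_nonneg _)]

/-- The part of the metric volume that is seen by a single chart. -/
def chartVol (e : OpenPartialHomeomorph M (Coord D)) : Measure M :=
  Measure.map e.symm
    ((volume.restrict e.target).withDensity fun y => ENNReal.ofReal (S.density e y))

omit [IsManifold 𝓘(ℝ, Coord D) ∞ M] in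
theorem measurableSet_target_preimage {s : Set M} (hs : MeasurableSet s) :
    MeasurableSet (e.target ∩ e.symm ⁻¹' s) := by
  have h : Measurable (fun y : e.target => e.symm y) :=
    (e.continuousOn_symm.domRestrict).measurable
  have := e.open_target.measurableSet.subtype_image (h hs)
  convert this using 1
  ext y
  simp [and_comm]

omit [IsManifold 𝓘(ℝ, Coord D) ∞ M] in
theorem aemeasurable_symm (e : OpenPartialHomeomorph M (Coord D)) (ρ : Coord D → ENNReal) :
    AEMeasurable e.symm ((volume.restrict e.target).withDensity ρ) :=
  (e.continuousOn_symm.aemeasurable e.open_target.measurableSet).mono_ac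
    (withDensity_absolutelyContinuous _ _)

theorem chartVol_apply {s : Set M} (hs : MeasurableSet s) :
    S.chartVol e s = ∫⁻ y in e.target ∩ e.symm ⁻¹' s, ENNReal.ofReal (S.density e y) := by
  unfold chartVol
  rw [Measure.map_apply_of_aemeasurable (aemeasurable_symm e _) hs, withDensity_apply',
    Measure.restrict_restrict' e.open_target.measurableSet, Set.inter_comm]

/-- The densities of the metric volume in two charts agree on the overlap, by the change of
variables formula. -/
theorem chartVol_inter_source (he : e ∈ atlas (Coord D) M) (he' : e' ∈ atlas (Coord D) M)
    {s : Set M} (hs : MeasurableSet s) :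
    S.chartVol e' (s ∩ e.source) = S.chartVol e (s ∩ e'.source) := by
  rw [S.chartVol_apply (hs.inter e.open_source.measurableSet),
    S.chartVol_apply (hs.inter e'.open_source.measurableSet)]
  have himg : e'.target ∩ e'.symm ⁻¹' (s ∩ e.source) =
      trans e e' '' (e.target ∩ e.symm ⁻¹' (s ∩ e'.source)) := by
    ext y'
    constructor
    · rintro ⟨h1, h2, h3⟩
      have hy' : y' ∈ overlap e' e := ⟨h1, h3⟩
      have := trans_mem_overlap hy'
      refine ⟨trans e' e y', ⟨this.1, ?_, this.2⟩, ?_⟩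
      · rwa [symm_trans hy']
      · rw [trans_trans hy', trans_self h1]
    · rintro ⟨y, ⟨h1, h2, h3⟩, rfl⟩
      have hy : y ∈ overlap e e' := ⟨h1, h3⟩
      have := trans_mem_overlap hy
      refine ⟨this.1, ?_, this.2⟩
      rwa [symm_trans hy]
  have hsub : e.target ∩ e.symm ⁻¹' (s ∩ e'.source) ⊆ overlap e e' :=
    fun y hy => ⟨hy.1, hy.2.2⟩
  have hm := measurableSet_target_preimage (e := e) (hs.inter e'.open_source.measurableSet)
  rw [himg, lintegral_image_eq_lintegral_abs_det_fderiv_mul volume hm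
    (fun y hy => (differentiableAt_trans he he' (hsub hy)).hasFDerivAt.hasFDerivWithinAt)
    (fun y hy y' hy' h => ?_)]
  · refine setLIntegral_congr_fun hm fun y hy => ?_
    rw [det_fderiv_trans, S.density_trans he he' (hsub hy), ENNReal.ofReal_mul (abs_nonneg _)]
  · rw [← trans_self hy.1, ← trans_self hy'.1, ← trans_trans (hsub hy), ← trans_trans (hsub hy'), h]

theorem vol_eq : S.vol = ⨆ e ∈ atlas (Coord D) M, S.chartVol e := rfl

/-- The metric volume of a set in the domain of a chart is given by the density in that chart. -/
theorem vol_apply (he : e ∈ atlas (Coord D) M) {s : Set M} (hs : MeasurableSet s)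
    (hse : s ⊆ e.source) : S.vol s = S.chartVol e s := by
  have hle : ∀ e ∈ atlas (Coord D) M, S.chartVol e ≤ S.vol := fun e he => by
    rw [vol_eq]; exact le_iSup₂ (f := fun e (_ : e ∈ atlas (Coord D) M) => S.chartVol e) e he
  refine le_antisymm ?_ (hle e he s)
  have h : S.vol ≤ S.chartVol e + S.vol.restrict e.sourceᶜ := by
    conv_lhs => rw [vol_eq]
    refine iSup₂_le fun e' he' => Measure.le_iff.2 fun t ht => ?_
    rw [← measure_inter_add_sdiff t e.open_source.measurableSet, Measure.add_apply,
      Measure.restrict_apply ht]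
    refine add_le_add ?_ (hle e' he' _)
    rw [S.chartVol_inter_source he he' ht]
    exact measure_mono Set.inter_subset_left
  refine (h s).trans ?_
  rw [Measure.add_apply, Measure.restrict_apply hs, ← Set.sdiff_eq, Set.sdiff_eq_empty.2 hse]
  simp

theorem vol_restrict (he : e ∈ atlas (Coord D) M) : S.vol.restrict e.source = S.chartVol e := by
  ext s hs
  rw [Measure.restrict_apply hs, S.vol_apply he (hs.inter e.open_source.measurableSet)
    Set.inter_subset_right, S.chartVol_inter_source he he hs,
    S.chartVol_apply (hs.inter e.open_source.measurableSet), S.chartVol_apply hs]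
  congr 2
  ext y
  simp only [Set.mem_inter_iff, Set.mem_preimage]
  exact ⟨fun h => ⟨h.1, h.2.1⟩, fun h => ⟨h.1, h.2, e.map_target h.1⟩⟩

instance isLocallyFiniteMeasure_vol : IsLocallyFiniteMeasure S.vol := by
  refine ⟨fun x => ?_⟩
  set e := chartAt (Coord D) x
  have he : e ∈ atlas (Coord D) M := chart_mem_atlas _ x
  have hx : x ∈ e.source := mem_chart_source _ x
  have hcont : ContinuousAt (S.density e) (e x) :=
    (S.contDiffOn_density he).continuousOn.continuousAt (e.open_target.mem_nhds (e.map_source hx))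
  obtain ⟨r, hr, hball⟩ := Metric.mem_nhds_iff.1 (Filter.inter_mem
    (e.open_target.mem_nhds (e.map_source hx))
    (hcont.eventually (gt_mem_nhds (lt_add_one (S.density e (e x))))))
  have ho : IsOpen (e.source ∩ e ⁻¹' Metric.ball (e x) r) :=
    e.isOpen_inter_preimage Metric.isOpen_ball
  refine ⟨_, ho.mem_nhds ⟨hx, Metric.mem_ball_self hr⟩, ?_⟩
  rw [S.vol_apply he ho.measurableSet Set.inter_subset_left, S.chartVol_apply ho.measurableSet]
  have hsub : e.target ∩ e.symm ⁻¹' (e.source ∩ e ⁻¹' Metric.ball (e x) r) ⊆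
      Metric.ball (e x) r := by
    rintro y ⟨h1, h2, h3⟩
    simpa [e.right_inv h1] using h3
  calc _ ≤ ∫⁻ y in Metric.ball (e x) r, ENNReal.ofReal (S.density e y) :=
        lintegral_mono_set hsub
    _ ≤ ∫⁻ y in Metric.ball (e x) r, ENNReal.ofReal (S.density e (e x) + 1) :=
        setLIntegral_mono measurable_const fun y hy =>
          ENNReal.ofReal_le_ofReal (le_of_lt (hball hy).2)
    _ < ⊤ := by
        rw [setLIntegral_const]
        exact ENNReal.mul_lt_top ENNReal.ofReal_lt_top measure_ball_lt_top

/-- The integral of a function with support in the domain of a chart. -/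
theorem integral_vol (he : e ∈ atlas (Coord D) M) {g : M → ℂ} (hg : AEStronglyMeasurable g S.vol)
    (h0 : ∀ x, x ∉ e.source → g x = 0) :
    ∫ x, g x ∂S.vol = ∫ y in e.target, S.density e y • g (e.symm y) := by
  rw [← setIntegral_eq_integral_of_forall_compl_eq_zero h0, S.vol_restrict he, chartVol,
    integral_map (aemeasurable_symm e _), integral_withDensity_eq_integral_toReal_smul₀]
  · refine setIntegral_congr_fun e.open_target.measurableSet fun y hy => ?_
    rw [ENNReal.toReal_ofReal (S.density_pos he hy).le]
  · exact ((S.contDiffOn_density he).continuousOn.aemeasurable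
      e.open_target.measurableSet).ennreal_ofReal
  · exact Filter.Eventually.of_forall fun _ => ENNReal.ofReal_lt_top
  · have := hg.mono_measure (Measure.restrict_le_self (s := e.source))
    rwa [S.vol_restrict he] at this

end Spacetime

/-- **Jacobi's formula** for the derivative of a determinant. -/
theorem pd_det {m : Coord D → Matrix (Fin D) (Fin D) ℝ} {y : Coord D}
    (hm : ∀ a b, DifferentiableAt ℝ (fun y => m y a b) y) (hdet : (m y).det ≠ 0) (b : Fin D) :
    pd b (fun y => (m y).det) y =
      (m y).det * ∑ i, ∑ k, (m y)⁻¹ i k * pd b (fun y => m y k i) y := by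
  have hp : ∀ σ : Equiv.Perm (Fin D), DifferentiableAt ℝ (fun y => ∏ i, m y (σ i) i) y := fun σ =>
    (HasFDerivAt.finsetProd fun i _ => (hm (σ i) i).hasFDerivAt).differentiableAt
  have h1 : pd b (fun y => (m y).det) y =
      ∑ i, ((m y).updateCol i (fun k => pd b (fun y => m y k i) y)).det := by
    simp only [Matrix.det_apply']
    rw [pd_sum _ fun σ _ => (differentiableAt_const _).fun_mul (hp σ), Finset.sum_comm]
    refine Finset.sum_congr rfl fun σ _ => ?_
    rw [pd_mul (differentiableAt_const _) (hp σ), pd_const, zero_mul, zero_add,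
      pd_prod _ fun i _ => hm _ _, Finset.mul_sum]
    refine Finset.sum_congr rfl fun i _ => ?_
    congr 1
    rw [← Finset.mul_prod_erase _ _ (Finset.mem_univ i)]
    congr 1
    · simp
    · refine Finset.prod_congr rfl fun j hj => ?_
      rw [Matrix.updateCol_ne (Finset.ne_of_mem_erase hj)]
  rw [h1, Finset.mul_sum]
  refine Finset.sum_congr rfl fun i _ => ?_
  rw [← Matrix.cramer_apply, Matrix.cramer_eq_adjugate_mulVec, Matrix.mulVec, dotProduct,
    Finset.mul_sum]
  refine Finset.sum_congr rfl fun k _ => ?_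
  rw [Matrix.inv_def, Ring.inverse_eq_inv', Matrix.smul_apply, smul_eq_mul, ← mul_assoc,
    ← mul_assoc, mul_inv_cancel₀ hdet, one_mul]

namespace Spacetime

/-- The contracted Christoffel symbols are the logarithmic derivatives of the density. -/
theorem pd_density (he : e ∈ atlas (Coord D) M) {y : Coord D} (hy : y ∈ e.target) (b : Fin D) :
    pd b (S.density e) y = S.density e y * ∑ a, S.christoffel e y a a b := by
  have hm : ∀ p q, DifferentiableAt ℝ (fun y => S.gMat e y p q) y := fun p q =>
    ((S.contDiffOn_gMat he p q).contDiffAt (e.open_target.mem_nhds hy)).differentiableAt (by simp)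
  have h0 := S.gMat_det_ne_zero he hy
  have hsym : ∀ p q, (S.gMat e y)⁻¹ p q = (S.gMat e y)⁻¹ q p := by
    intro p q
    have : (S.gMat e y).transpose = S.gMat e y := by
      ext i j
      exact S.gMat_isSymm e y j i
    conv_lhs => rw [← this, ← Matrix.transpose_nonsing_inv]
    rfl
  have htr : ∑ a, S.christoffel e y a a b =
      (1 / 2) * ∑ i, ∑ k, (S.gMat e y)⁻¹ i k * pd b (fun y => S.gMat e y k i) y := by
    unfold christoffel
    rw [← Finset.mul_sum]
    congr 1
    have h1 : ∀ p q r, fderiv ℝ (fun y' => S.gMat e y' p q) y (stdVec D r) =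
      pd r (fun y' => S.gMat e y' p q) y := fun _ _ _ => rfl
    simp_rw [h1, mul_sub, mul_add, Finset.sum_sub_distrib, Finset.sum_add_distrib]
    have h2 : ∑ x, ∑ d, (S.gMat e y)⁻¹ x d * pd x (fun y' => S.gMat e y' d b) y =
        ∑ x, ∑ d, (S.gMat e y)⁻¹ x d * pd d (fun y' => S.gMat e y' x b) y := by
      rw [Finset.sum_comm]
      refine Finset.sum_congr rfl fun x _ => Finset.sum_congr rfl fun d _ => ?_
      rw [hsym]
    rw [h2]
    ring
  have hd : DifferentiableAt ℝ (fun y => (S.gMat e y).det) y :=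
    ((contDiffOn_det (S.contDiffOn_gMat he)).contDiffAt
      (e.open_target.mem_nhds hy)).differentiableAt (by simp)
  have hsq : pd b (fun y => S.density e y * S.density e y) y =
      |(S.gMat e y).det| * ∑ i, ∑ k, (S.gMat e y)⁻¹ i k * pd b (fun y => S.gMat e y k i) y := by
    have : (fun y => S.density e y * S.density e y) = fun y => |(S.gMat e y).det| :=
      funext fun y => Real.mul_self_sqrt (abs_nonneg _)
    rw [this]
    rcases lt_or_gt_of_ne h0 with hneg | hpos
    · have : (fun y => |(S.gMat e y).det|) =ᶠ[𝓝 y] fun y => (-1) * (S.gMat e y).det := by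
        filter_upwards [hd.continuousAt.eventually (gt_mem_nhds hneg)] with y hy
        rw [abs_of_neg hy, neg_one_mul]
      rw [pd_congr this, pd_mul (differentiableAt_const _) hd, pd_const, pd_det hm h0,
        abs_of_neg hneg]
      ring
    · have : (fun y => |(S.gMat e y).det|) =ᶠ[𝓝 y] fun y => (S.gMat e y).det := by
        filter_upwards [hd.continuousAt.eventually (lt_mem_nhds hpos)] with y hy
        rw [abs_of_pos hy]
      rw [pd_congr this, pd_det hm h0, abs_of_pos hpos]
  have hdens : DifferentiableAt ℝ (S.density e) y :=
    ((S.contDiffOn_density he).contDiffAt (e.open_target.mem_nhds hy)).differentiableAt (by simp)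
  rw [pd_mul hdens hdens] at hsq
  have hpos := S.density_pos he hy
  have habs : |(S.gMat e y).det| = S.density e y * S.density e y :=
    (Real.mul_self_sqrt (abs_nonneg _)).symm
  rw [habs] at hsq
  rw [htr]
  apply mul_left_cancel₀ hpos.ne'
  linear_combination (1 / 2) * hsq

end Spacetime

end Volume

/-! ### Test tensors supported in a chart, and integration by parts -/

section TestTensors

variable {D : ℕ} {M : Type*} [TopologicalSpace M] [ChartedSpace (Coord D) M]
  [IsManifold 𝓘(ℝ, Coord D) ∞ M]
variable {ι : Type*} [Fintype ι] [DecidableEq ι]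
variable {e : OpenPartialHomeomorph M (Coord D)}

/-- The contravariant tensor field that vanishes outside the domain of the chart `e` and has there
the components `φ` in this chart. -/
def ofChart (e : OpenPartialHomeomorph M (Coord D)) (φ : (ι → Fin D) → Coord D → ℂ) :
    TensorField D M ι ℂ := fun x c =>
  open Classical in
  if x ∈ e.source then
    pull (fun b b' => jacobi e (chartAt (Coord D) x) (e x) b' b) (fun c => φ c (e x)) c
  else 0

theorem ofChart_of_notMem {φ : (ι → Fin D) → Coord D → ℂ} {x : M} (hx : x ∉ e.source) :
    ofChart e φ x = 0 := by
  ext c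
  simp [ofChart, hx]

theorem contraComp_ofChart (he : e ∈ atlas (Coord D) M) (φ : (ι → Fin D) → Coord D → ℂ)
    {y : Coord D} (hy : y ∈ e.target) (c : ι → Fin D) :
    contraComp e (ofChart e φ) y c = φ c y := by
  have hc := mem_overlap_chartAt hy
  have h : ofChart e φ (e.symm y) = pull (fun b b' =>
      jacobi e (chartAt (Coord D) (e.symm y)) y b' b) (fun c => φ c y) := by
    ext c
    simp only [ofChart, e.map_target hy, if_true, e.right_inv hy]
  rw [contraComp_eq he _ hy, h, pull_pull]
  refine (pull_congr_matrix (fun a b => ?_) _ _).trans (pull_one _ _)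
  have := jacobi_inv he (chart_mem_atlas _ _) hc b a
  simp_rw [mul_comm (jacobi (chartAt (Coord D) (e.symm y)) e _ _ _)]
  rw [this]
  simp [eq_comm]

theorem isTestTensor_ofChart [T2Space M] (he : e ∈ atlas (Coord D) M)
    {φ : (ι → Fin D) → Coord D → ℂ} {K : Set (Coord D)} (hK : IsCompact K) (hKe : K ⊆ e.target)
    (hφ : ∀ c, ContDiffOn ℝ ∞ (φ c) e.target) (hφK : ∀ c, ∀ y ∉ K, φ c y = 0) :
    IsTestTensor (ofChart e φ) := by
  have hKM : IsCompact (e.symm '' K) := hK.image_of_continuousOn (e.continuousOn_symm.mono hKe)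
  have h0 : ∀ x ∉ e.symm '' K, ofChart e φ x = 0 := by
    intro x hx
    by_cases hxe : x ∈ e.source
    · ext c
      have : ∀ c, φ c (e x) = 0 := fun c => hφK c _ fun h => hx ⟨e x, h, e.left_inv hxe⟩
      simp [ofChart, pull, this]
    · exact ofChart_of_notMem hxe
  refine ⟨fun e' he' c => ?_, HasCompactSupport.intro hKM h0⟩
  intro y hy
  refine ContDiffAt.contDiffWithinAt ?_
  by_cases hye : e'.symm y ∈ e.source
  · have hyo : y ∈ overlap e' e := ⟨hy, hye⟩
    have hnhds := (isOpen_overlap e' e).mem_nhds hyo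
    have h1 : ContDiffOn ℝ ∞ (fun y => contraComp e' (ofChart e φ) y c) (overlap e' e) := by
      refine ContDiffOn.congr (f := fun y => pull (fun b b' => jacobi e e' (trans e' e y) b' b)
        (fun c => φ c (trans e' e y)) c) ?_ fun y hy => ?_
      · unfold pull
        have ht := contDiffOn_trans he' he
        refine ContDiffOn.sum fun c' _ => ?_
        have h1 : ContDiffOn ℝ ∞ (fun y => ∏ s, jacobi e e' (trans e' e y) (c' s) (c s))
            (overlap e' e) := contDiffOn_prod fun s _ =>
          (contDiffOn_jacobi he he' _ _).comp ht fun y hy => trans_mem_overlap hy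
        exact h1.smul ((hφ c').comp ht fun y hy => (trans_mem_overlap hy).1)
      · rw [contraComp_trans he' he _ hy]
        congr 1
        ext c
        exact contraComp_ofChart he φ (trans_mem_overlap hy).1 c
    exact h1.contDiffAt hnhds
  · have hy' : e'.symm y ∉ e.symm '' K := by
      rintro ⟨z, hz, h⟩
      exact hye (h ▸ e.map_target (hKe hz))
    have h2 : ∀ᶠ y' in 𝓝 y, e'.symm y' ∉ e.symm '' K :=
      (e'.continuousAt_symm hy).eventually (hKM.isClosed.isOpen_compl.mem_nhds hy')
    refine (contDiffAt_const (c := (0 : ℂ))).congr_of_eventuallyEq ?_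
    filter_upwards [h2] with y' hy'
    simp [contraComp, h0 _ hy']

/-- The pairing of a test tensor with a smooth covariant tensor field is a test function. -/
theorem isTestFn_pairing {f w : TensorField D M ι ℂ} (hf : IsTestTensor f) (hw : SmoothCov w) :
    IsTestFn D (fun x => ∑ c, f x c * w x c) := by
  constructor
  · refine contMDiff_of_contDiffOn fun e he => ?_
    refine ContDiffOn.congr (ContDiffOn.sum (s := Finset.univ) fun c _ =>
      (hf.smooth e he c).mul (hw e he c)) fun y hy => ?_
    exact (sum_contraComp_mul_covComp he f w hy).symm
  · refine hf.compact.mono fun x hx => ?_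
    contrapose! hx
    have : f x = 0 := by simpa using hx
    simp [this]

section Integrals

variable [T2Space M] [SecondCountableTopology M] [MeasurableSpace M] [BorelSpace M]
  (S : Spacetime D M)

theorem IsTestFn.integrable {u : M → ℂ} (hu : IsTestFn D u) : Integrable u S.vol :=
  hu.1.continuous.integrable_of_hasCompactSupport hu.2

theorem integrable_pairing {f w : TensorField D M ι ℂ} (hf : IsTestTensor f) (hw : SmoothCov w) :
    Integrable (fun x => ∑ c, f x c * w x c) S.vol :=
  (isTestFn_pairing hf hw).integrable S

theorem integral_ofChart (he : e ∈ atlas (Coord D) M)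
    {φ : (ι → Fin D) → Coord D → ℂ} {K : Set (Coord D)} (hK : IsCompact K) (hKe : K ⊆ e.target)
    (hφ : ∀ c, ContDiffOn ℝ ∞ (φ c) e.target) (hφK : ∀ c, ∀ y ∉ K, φ c y = 0)
    {w : TensorField D M ι ℂ} (hw : SmoothCov w) :
    ∫ x, ∑ c, ofChart e φ x c * w x c ∂S.vol =
      ∫ y in e.target, S.density e y • ∑ c, φ c y * covComp e w y c := by
  rw [S.integral_vol he
    (integrable_pairing S (isTestTensor_ofChart he hK hKe hφ hφK) hw).aestronglyMeasurable
    (fun x hx => by simp [ofChart_of_notMem hx])]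
  refine setIntegral_congr_fun e.open_target.measurableSet fun y hy => ?_
  simp only [← sum_contraComp_mul_covComp he _ w hy, contraComp_ofChart he φ hy]

/-- The fundamental lemma of the calculus of variations in a chart. -/
theorem eq_zero_of_integral_chart (he : e ∈ atlas (Coord D) M) {g : Coord D → ℂ}
    (hg : ContinuousOn g e.target)
    (h : ∀ φ : Coord D → ℝ, ContDiff ℝ ∞ φ → HasCompactSupport φ → tsupport φ ⊆ e.target →
      ∫ y in e.target, S.density e y • ((φ y : ℂ) * g y) = 0) {y : Coord D} (hy : y ∈ e.target) :
    g y = 0 := by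
  have hc : ContinuousOn (fun y => S.density e y • g y) e.target :=
    (S.contDiffOn_density he).continuousOn.smul hg
  have h1 := e.open_target.ae_eq_zero_of_integral_contDiff_smul_eq_zero
    (μ := volume) (hc.locallyIntegrableOn e.open_target.measurableSet) fun φ h1 h2 h3 => by
      rw [← h φ h1 h2 h3, ← setIntegral_eq_integral_of_forall_compl_eq_zero (s := e.target)]
      · refine setIntegral_congr_fun e.open_target.measurableSet fun y hy => ?_
        simp only [Complex.real_smul]
        ring
      · intro y hy
        rw [image_eq_zero_of_notMem_tsupport (fun h => hy (h3 h)), zero_smul]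
  have h2 : (fun y => S.density e y • g y) =ᵐ[volume.restrict e.target] fun _ => 0 :=
    (ae_restrict_iff' e.open_target.measurableSet).2 h1
  have h3 := Measure.eqOn_open_of_ae_eq h2 e.open_target hc continuousOn_const hy
  exact (smul_eq_zero.1 h3).resolve_left (S.density_pos he hy).ne'

/-- The fundamental lemma of the calculus of variations for smooth covariant tensor fields. -/
theorem eq_zero_of_integral {w : TensorField D M ι ℂ} (hw : SmoothCov w)
    (h : ∀ f, IsTestTensor f → ∫ x, ∑ c, f x c * w x c ∂S.vol = 0) : w = 0 := by
  ext x c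
  have he : chartAt (Coord D) x ∈ atlas (Coord D) M := chart_mem_atlas _ x
  rw [← covComp_chartAt w]
  refine eq_zero_of_integral_chart S he (g := fun y => covComp (chartAt (Coord D) x) w y c)
    (hw _ he c).continuousOn (fun φ h1 h2 h3 => ?_) (mem_chart_target _ x)
  have hφ : ∀ c', ContDiffOn ℝ ∞ (fun y => if c' = c then (φ y : ℂ) else 0)
      (chartAt (Coord D) x).target := by
    intro c'
    split_ifs
    · exact (Complex.ofRealCLM.contDiff.comp h1).contDiffOn
    · exact contDiffOn_const
  have hφK : ∀ c', ∀ y ∉ tsupport φ, (if c' = c then (φ y : ℂ) else 0) = 0 := by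
    intro c' y hy
    simp [image_eq_zero_of_notMem_tsupport hy]
  have h4 := h _ (isTestTensor_ofChart he h2 h3 hφ hφK)
  rw [integral_ofChart S he h2 h3 hφ hφK hw] at h4
  rw [← h4]
  refine setIntegral_congr_fun (chartAt (Coord D) x).open_target.measurableSet fun y hy => ?_
  simp

/-- The integral of a divergence of compact support vanishes. -/
theorem integral_div_eq_zero (he : e ∈ atlas (Coord D) M) {v : Fin D → Coord D → ℂ}
    {K : Set (Coord D)} (hK : IsCompact K) (hKe : K ⊆ e.target)
    (hv : ∀ a, ContDiffOn ℝ ∞ (v a) e.target) (hvK : ∀ a, ∀ y ∉ K, v a y = 0) :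
    ∫ y in e.target, S.density e y •
      ∑ a, (pd a (v a) y + ∑ b, S.christoffel e y a a b • v b y) = 0 := by
  set h : Fin D → Coord D → ℂ := fun a y => S.density e y • v a y with hh
  have hz : ∀ a, ∀ y ∉ K, h a =ᶠ[𝓝 y] fun _ => 0 := by
    intro a y hy
    filter_upwards [hK.isClosed.isOpen_compl.mem_nhds hy] with z hz
    simp [hh, hvK a z hz]
  have hsm : ∀ a, ContDiff ℝ ∞ (h a) := by
    intro a
    refine contDiff_iff_contDiffAt.2 fun y => ?_
    by_cases hy : y ∈ K
    · exact ((S.contDiffOn_density he).smul (hv a)).contDiffAt (e.open_target.mem_nhds (hKe hy))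
    · exact contDiffAt_const.congr_of_eventuallyEq (hz a y hy)
  have hcs : ∀ a, HasCompactSupport (h a) := fun a =>
    HasCompactSupport.intro hK fun y hy => (hz a y hy).eq_of_nhds
  have hint : ∀ a, ∫ y, pd a (h a) y = 0 := by
    intro a
    have hpd : HasCompactSupport (fun y => fderiv ℝ (h a) y (stdVec D a)) :=
      (hcs a).fderiv_apply (𝕜 := ℝ) _
    have hpc : Continuous (fun y => fderiv ℝ (h a) y (stdVec D a)) :=
      ((hsm a).continuous_fderiv (by simp)).clm_apply continuous_const
    have := integral_mul_fderiv_eq_neg_fderiv_mul_of_integrable (μ := (volume : Measure (Coord D)))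
      (f := fun _ => (1 : ℂ)) (g := h a) (v := stdVec D a) (by simp)
      (by simpa using hpc.integrable_of_hasCompactSupport hpd)
      (by simpa using (hsm a).continuous.integrable_of_hasCompactSupport (hcs a))
      (fun _ _ => differentiableAt_const _) (fun y _ => (hsm a).differentiable (by simp) y)
    simpa [pd] using this
  have hpz : ∀ a, ∀ y ∉ e.target, pd a (h a) y = 0 := by
    intro a y hy
    rw [pd_congr (hz a y fun h => hy (hKe h)), pd_const]
  calc _ = ∫ y in e.target, ∑ a, pd a (h a) y := by
        refine setIntegral_congr_fun e.open_target.measurableSet fun y hy => ?_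
        have hd : DifferentiableAt ℝ (S.density e) y := ((S.contDiffOn_density he).contDiffAt
          (e.open_target.mem_nhds hy)).differentiableAt (by simp)
        have hvd : ∀ a, DifferentiableAt ℝ (v a) y := fun a => ((hv a).contDiffAt
          (e.open_target.mem_nhds hy)).differentiableAt (by simp)
        simp only [hh]
        simp_rw [pd_smul hd (hvd _), S.pd_density he hy, Finset.sum_add_distrib, smul_add]
        rw [add_comm]
        congr 1
        · rw [Finset.sum_comm, Finset.smul_sum]
          refine Finset.sum_congr rfl fun b _ => ?_
          rw [← Finset.sum_smul, smul_smul]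
        · rw [Finset.smul_sum]
    _ = ∫ y, ∑ a, pd a (h a) y := by
        refine setIntegral_eq_integral_of_forall_compl_eq_zero fun y hy => ?_
        exact Finset.sum_eq_zero fun a _ => hpz a y hy
    _ = 0 := by
        rw [integral_finsetSum _ fun a _ => ?_]
        · exact Finset.sum_eq_zero fun a _ => hint a
        · exact (((hsm a).continuous_fderiv (by simp)).clm_apply
            continuous_const).integrable_of_hasCompactSupport ((hcs a).fderiv_apply (𝕜 := ℝ) _)

/-- The product rule for the contraction of a contravariant with a covariant tensor field. -/
theorem sum_chartDiv_mul (S : Spacetime D M) {C : Coord D → (Option ι → Fin D) → ℂ}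
    {w : Coord D → (ι → Fin D) → ℂ} {y : Coord D}
    (hC : ∀ c, DifferentiableAt ℝ (fun y => C y c) y)
    (hw : ∀ c, DifferentiableAt ℝ (fun y => w y c) y) :
    ∑ c, (∑ a, covDeriv (upperConn (S.christoffel e)) C a (fun o => o.elim a c) y) * w y c =
      ∑ a, (pd a (fun y => ∑ c, C y (fun o => o.elim a c) * w y c) y +
        ∑ b, S.christoffel e y a a b • ∑ c, C y (fun o => o.elim b c) * w y c) -
      ∑ c, ∑ a, C y (fun o => o.elim a c) *
        covDeriv (lowerConn (S.christoffel e)) w a c y := by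
  have hup : ∀ (a : Fin D) (c : ι → Fin D) (d : Fin D),
      Function.update (fun o : Option ι => o.elim a c) none d = fun o => o.elim d c := by
    intro a c d
    ext o
    cases o <;> simp
  have hup' : ∀ (a : Fin D) (c : ι → Fin D) (s : ι) (d : Fin D),
      Function.update (fun o : Option ι => o.elim a c) (some s) d =
        fun o => o.elim a (Function.update c s d) := by
    intro a c s d
    ext o
    cases o with
    | none => simp
    | some t => by_cases h : t = s <;> simp [h]
  have hkey : ∀ a, ∑ c, ∑ s, ∑ d, upperConn (S.christoffel e) y a (c s) d •
      C y (fun o => o.elim a (Function.update c s d)) * w y c =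
      -∑ c, ∑ s, ∑ d, C y (fun o => o.elim a c) *
        (lowerConn (S.christoffel e) y a (c s) d • w y (Function.update c s d)) := by
    intro a
    rw [Finset.sum_comm, Finset.sum_comm (f := fun c s => ∑ d, C y _ * _),
      ← Finset.sum_neg_distrib]
    refine Finset.sum_congr rfl fun s _ => ?_
    rw [sum_update_swap s, ← Finset.sum_neg_distrib]
    refine Finset.sum_congr rfl fun c _ => ?_
    rw [← Finset.sum_neg_distrib]
    refine Finset.sum_congr rfl fun d _ => ?_
    simp only [Function.update_self, Function.update_idem, Function.update_eq_self, upperConn,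
      lowerConn, neg_smul, neg_mul, smul_mul_assoc, mul_smul_comm]
  have h1 : ∀ a, pd a (fun y => ∑ c, C y (fun o => o.elim a c) * w y c) y =
      ∑ c, pd a (fun y => C y (fun o => o.elim a c)) y * w y c +
      ∑ c, C y (fun o => o.elim a c) * pd a (fun y => w y c) y := by
    intro a
    rw [pd_sum _ fun c _ => (hC _).fun_mul (hw _), ← Finset.sum_add_distrib]
    exact Finset.sum_congr rfl fun c _ => pd_mul (hC _) (hw _)
  simp_rw [h1]
  rw [Finset.sum_comm (f := fun c a => C y _ * covDeriv _ _ _ _ _), ← Finset.sum_sub_distrib]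
  simp_rw [Finset.sum_mul]
  rw [Finset.sum_comm]
  refine Finset.sum_congr rfl fun a _ => ?_
  unfold covDeriv
  simp_rw [Fintype.sum_option, hup, hup', Option.elim_none, Option.elim_some, sub_mul, add_mul,
    mul_sub, Finset.sum_sub_distrib,
    Finset.sum_add_distrib, Finset.sum_mul, Finset.mul_sum]
  rw [hkey a]
  have h3 : ∑ c, ∑ d, upperConn (S.christoffel e) y a a d •
      C y (fun o => o.elim d c) * w y c =
      -∑ b, S.christoffel e y a a b • ∑ c, C y (fun o => o.elim b c) * w y c := by
    rw [Finset.sum_comm, ← Finset.sum_neg_distrib]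
    refine Finset.sum_congr rfl fun b _ => ?_
    rw [Finset.smul_sum, ← Finset.sum_neg_distrib]
    refine Finset.sum_congr rfl fun c _ => ?_
    simp [upperConn, mul_assoc]
  rw [h3]
  ring

end Integrals

end TestTensors

/-! ### Convolution of functions of finite multisets -/

section Multisets

variable {α R : Type*} [CommRing R]

/-- Two labellings of the same multiset differ by a bijection of the labels. -/
theorem exists_equiv_of_map_eq {ι ι' : Type*} [Fintype ι] [Fintype ι'] {f : ι → α} {g : ι' → α}
    (h : Finset.univ.val.map f = Finset.univ.val.map g) : ∃ σ : ι ≃ ι', ∀ i, g (σ i) = f i := by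
  classical
  have hc : ∀ c, Nonempty ({a // f a = c} ≃ {b // g b = c}) := by
    intro c
    refine ⟨Fintype.equivOfCardEq ?_⟩
    have h1 := congrArg (Multiset.count c) h
    rw [Multiset.count_map, Multiset.count_map] at h1
    rw [Fintype.card_subtype, Fintype.card_subtype]
    simpa [Finset.card_def, eq_comm] using h1
  exact ⟨Equiv.ofFiberEquiv fun c => (hc c).some, fun i => Equiv.ofFiberEquiv_map _ i⟩

/-- The convolution `(a * b)(s) = ∑ a(t) b(s - t)`, the sum being over all ways to split `s`
(with multiplicities, as for subsets of a labelling set of `s`). -/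
def conv (a b : Multiset α → R) (s : Multiset α) : R :=
  (s.antidiagonal.map fun p => a p.1 * b p.2).sum

@[simp] theorem conv_zero (a b : Multiset α → R) : conv a b 0 = a 0 * b 0 := by
  simp [conv]

theorem conv_cons (a b : Multiset α → R) (x : α) (s : Multiset α) :
    conv a b (x ::ₘ s) = conv (fun t => a (x ::ₘ t)) b s + conv a (fun t => b (x ::ₘ t)) s := by
  simp [conv, Multiset.antidiagonal_cons, add_comm]

theorem conv_add_left (a a' b : Multiset α → R) (s : Multiset α) :
    conv (fun t => a t + a' t) b s = conv a b s + conv a' b s := by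
  simp [conv, add_mul]

theorem conv_add_right (a b b' : Multiset α → R) (s : Multiset α) :
    conv a (fun t => b t + b' t) s = conv a b s + conv a b' s := by
  simp [conv, mul_add]

theorem conv_mul_left (r : R) (a b : Multiset α → R) (s : Multiset α) :
    conv (fun t => r * a t) b s = r * conv a b s := by
  simp [conv, mul_assoc, Multiset.sum_map_mul_left]

theorem conv_mul_right (r : R) (a b : Multiset α → R) (s : Multiset α) :
    conv a (fun t => r * b t) s = r * conv a b s := by
  simp [conv, mul_left_comm, Multiset.sum_map_mul_left]

theorem conv_sum_left {κ : Type*} (u : Finset κ) (a : κ → Multiset α → R) (b : Multiset α → R)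
    (s : Multiset α) : conv (fun t => ∑ i ∈ u, a i t) b s = ∑ i ∈ u, conv (a i) b s := by
  classical
  induction u using Finset.induction_on with
  | empty => simp [conv]
  | insert i u hi ih => simp only [Finset.sum_insert hi, conv_add_left, ih]

theorem conv_sum_right {κ : Type*} (u : Finset κ) (a : Multiset α → R) (b : κ → Multiset α → R)
    (s : Multiset α) : conv a (fun t => ∑ i ∈ u, b i t) s = ∑ i ∈ u, conv a (b i) s := by
  classical
  induction u using Finset.induction_on with
  | empty => simp [conv]
  | insert i u hi ih => simp only [Finset.sum_insert hi, conv_add_right, ih]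

/-- The convolution is a sum over the subsets of a labelling set. -/
theorem conv_map {ι : Type*} [DecidableEq ι] (a b : Multiset α → R) (g : ι → α) (A : Finset ι) :
    conv a b (A.val.map g) =
      ∑ T ∈ A.powerset, a (T.val.map g) * b ((A \ T).val.map g) := by
  induction A using Finset.induction_on generalizing a b with
  | empty => simp
  | insert i A hi ih =>
    have h : (insert i A).val.map g = g i ::ₘ A.val.map g := by
      rw [Finset.insert_val_of_notMem hi, Multiset.map_cons]
    rw [h, conv_cons, ih, ih, Finset.sum_powerset_insert hi, add_comm]
    congr 1
    · refine Finset.sum_congr rfl fun T hT => ?_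
      have hiT : i ∉ T := fun h => hi (Finset.mem_powerset.1 hT h)
      rw [Finset.insert_sdiff_of_notMem _ hiT, Finset.insert_val_of_notMem (by simp [hi]),
        Multiset.map_cons]
    · refine Finset.sum_congr rfl fun T hT => ?_
      have hiT : i ∉ T := fun h => hi (Finset.mem_powerset.1 hT h)
      rw [Finset.insert_sdiff_insert, Finset.sdiff_insert_of_notMem hi,
        Finset.insert_val_of_notMem hiT, Multiset.map_cons]

/-- If `a 0 = 0`, then `(a * b)(s)` only involves the values of `b` at multisets smaller than `s`.
-/
theorem conv_congr_of_card {a b b' : Multiset α → R} (ha : a 0 = 0) {s : Multiset α}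
    (h : ∀ t, t.card < s.card → b t = b' t) : conv a b s = conv a b' s := by
  unfold conv
  refine congrArg _ (Multiset.map_congr rfl fun p hp => ?_)
  rcases eq_or_ne p.1 0 with h0 | h0
  · simp [h0, ha]
  · rw [h p.2]
    have h1 := congrArg Multiset.card (Multiset.mem_antidiagonal.1 hp)
    have h2 := Multiset.card_pos.2 h0
    rw [Multiset.card_add] at h1
    omega

theorem conv_unit_left [DecidableEq (Multiset α)] (r : R) (b : Multiset α → R) (s : Multiset α) :
    conv (fun t => if t = 0 then r else 0) b s = r * b s := by
  induction s using Multiset.induction_on generalizing b with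
  | empty => simp
  | cons x s ih =>
    rw [conv_cons, ih]
    simp [conv]

/-- The function `a` with its value at the empty multiset removed. -/
def tailFn (a : Multiset α → R) (s : Multiset α) : R :=
  open Classical in if s = 0 then 0 else a s

theorem conv_eq_tailFn (a b : Multiset α → R) (s : Multiset α) :
    conv a b s = a 0 * b s + conv (tailFn a) b s := by
  classical
  rw [← conv_unit_left (a 0), ← conv_add_left]
  congr 1
  ext t
  by_cases h : t = 0 <;> simp [tailFn, h]

/-- Functions `a` with `a 0 = 1` are invertible for the convolution, hence cancellable. -/
theorem conv_left_cancel {a b b' : Multiset α → R} (ha : a 0 = 1)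
    (h : ∀ s, conv a b s = conv a b' s) : b = b' := by
  have key : ∀ (n : ℕ) (s : Multiset α), s.card = n → b s = b' s := by
    intro n
    induction n using Nat.strong_induction_on with
    | _ n ih =>
      rintro s rfl
      have h1 := h s
      rw [conv_eq_tailFn, conv_eq_tailFn a b', ha, one_mul, one_mul,
        conv_congr_of_card (b' := b') (by simp [tailFn]) fun t ht => ih _ ht t rfl] at h1
      exact add_right_cancel h1
  exact funext fun s => key _ s rfl

/-- The solution `z` of `b = a * z` (for `a 0 = 1`) on multisets with fewer than `n` elements. -/
def deconvAux (a b : Multiset α → R) : ℕ → Multiset α → R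
  | 0, _ => 0
  | n + 1, s => b s - conv (tailFn a) (deconvAux a b n) s

/-- The solution `z` of `b = a * z`, for `a 0 = 1`. -/
def deconv (a b : Multiset α → R) (s : Multiset α) : R := deconvAux a b (s.card + 1) s

theorem deconvAux_eq (a b : Multiset α → R) : ∀ (n : ℕ) (s : Multiset α), s.card < n →
    deconvAux a b n s = deconvAux a b (s.card + 1) s
  | 0, _, h => absurd h (Nat.not_lt_zero _)
  | n + 1, s, h => by
    simp only [deconvAux]
    congr 1
    refine conv_congr_of_card (by simp [tailFn]) fun t ht => ?_
    rw [deconvAux_eq a b n t (by omega), deconvAux_eq a b s.card t ht]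
termination_by n => n

theorem deconv_eq (a b : Multiset α → R) (s : Multiset α) :
    deconv a b s = b s - conv (tailFn a) (deconv a b) s := by
  rw [deconv, deconvAux]
  congr 1
  exact conv_congr_of_card (by simp [tailFn]) fun t ht => deconvAux_eq a b _ t ht

theorem conv_deconv {a : Multiset α → R} (ha : a 0 = 1) (b : Multiset α → R) (s : Multiset α) :
    conv a (deconv a b) s = b s := by
  rw [conv_eq_tailFn, ha, one_mul, deconv_eq]
  ring

/-- The convolution with a function that is supported on the multisets with one element. -/
def insertFn [DecidableEq α] (d : α → R) (a : Multiset α → R) (s : Multiset α) : R :=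
  (s.map fun x => d x * a (s.erase x)).sum

theorem insertFn_cons [DecidableEq α] (d : α → R) (a : Multiset α → R) (x : α) (s : Multiset α) :
    insertFn d a (x ::ₘ s) = d x * a s + insertFn d (fun t => a (x ::ₘ t)) s := by
  unfold insertFn
  rw [Multiset.map_cons, Multiset.sum_cons, Multiset.erase_cons_head]
  congr 2
  refine Multiset.map_congr rfl fun y hy => ?_
  by_cases h : x = y
  · subst h
    simp only [Multiset.erase_cons_head, Multiset.cons_erase hy]
  · rw [Multiset.erase_cons_tail _ (by simpa using h)]

/-- Associativity of the convolution, for a factor supported on the multisets with one element. -/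
theorem conv_insertFn [DecidableEq α] (d : α → R) (a b : Multiset α → R) (s : Multiset α) :
    conv (insertFn d a) b s = insertFn d (conv a b) s := by
  induction s using Multiset.induction_on generalizing a b with
  | empty => simp [insertFn]
  | cons x s ih =>
    rw [conv_cons, insertFn_cons]
    have h1 : (fun t => insertFn d a (x ::ₘ t)) =
        fun t => d x * a t + insertFn d (fun t => a (x ::ₘ t)) t :=
      funext fun t => insertFn_cons d a x t
    have h2 : (fun t => conv a b (x ::ₘ t)) = fun t => conv (fun t => a (x ::ₘ t)) b t +
      conv a (fun t => b (x ::ₘ t)) t := funext fun t => conv_cons a b x t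
    have h3 : ∀ (f g : Multiset α → R), insertFn d (fun t => f t + g t) s =
        insertFn d f s + insertFn d g s := fun f g => by simp [insertFn, mul_add]
    rw [h1, h2, conv_add_left, conv_mul_left, h3, ih, ih, add_assoc]

/-- The derivation of the convolution algebra that is determined by its action `X x` on a single
element `x`: `(𝒟 a)(s) = ∑_{x ∈ s} a(X x + (s - x))`, where `a` is extended linearly. -/
def deriveFn [DecidableEq α] (X : α → (α → R) →ₗ[R] R) (a : Multiset α → R) (s : Multiset α) : R :=
  (s.map fun x => X x fun x' => a (x' ::ₘ s.erase x)).sum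

theorem deriveFn_cons [DecidableEq α] (X : α → (α → R) →ₗ[R] R) (a : Multiset α → R) (x : α)
    (s : Multiset α) : deriveFn X a (x ::ₘ s) =
      X x (fun x' => a (x' ::ₘ s)) + deriveFn X (fun t => a (x ::ₘ t)) s := by
  unfold deriveFn
  rw [Multiset.map_cons, Multiset.sum_cons, Multiset.erase_cons_head]
  congr 2
  refine Multiset.map_congr rfl fun y hy => ?_
  congr 1
  ext x'
  by_cases h : x = y
  · subst h
    simp only [Multiset.erase_cons_head]
    rw [Multiset.cons_swap, Multiset.cons_erase hy]
  · rw [Multiset.erase_cons_tail _ (by simpa using h), Multiset.cons_swap]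

theorem conv_map_linear_left (X : (α → R) →ₗ[R] R) (a : α → Multiset α → R) (b : Multiset α → R)
    (s : Multiset α) : conv (fun t => X fun x => a x t) b s = X fun x => conv (a x) b s := by
  induction s using Multiset.induction_on generalizing a b with
  | empty =>
    simp only [conv_zero]
    rw [mul_comm, ← smul_eq_mul, ← map_smul]
    congr 1
    ext x
    simp [mul_comm]
  | cons x s ih =>
    simp only [conv_cons]
    rw [ih, ih, ← map_add]
    rfl

theorem conv_comm (a b : Multiset α → R) (s : Multiset α) : conv a b s = conv b a s := by
  induction s using Multiset.induction_on generalizing a b with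
  | empty => simp [mul_comm]
  | cons x s ih => rw [conv_cons, conv_cons, ih a, ih _ b, add_comm]

/-- The product rule for the derivation `deriveFn X` of the convolution algebra. -/
theorem deriveFn_conv [DecidableEq α] (X : α → (α → R) →ₗ[R] R) (a b : Multiset α → R)
    (s : Multiset α) :
    deriveFn X (conv a b) s = conv (deriveFn X a) b s + conv a (deriveFn X b) s := by
  induction s using Multiset.induction_on generalizing a b with
  | empty => simp [deriveFn]
  | cons x s ih =>
    have h1 : ∀ a : Multiset α → R, (fun t => deriveFn X a (x ::ₘ t)) =
        fun t => X x (fun x' => a (x' ::ₘ t)) + deriveFn X (fun t => a (x ::ₘ t)) t :=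
      fun a => funext fun t => deriveFn_cons X a x t
    have h2 : (fun t => conv a b (x ::ₘ t)) = fun t => conv (fun t => a (x ::ₘ t)) b t +
      conv a (fun t => b (x ::ₘ t)) t := funext fun t => conv_cons a b x t
    have h3 : ∀ (f g : Multiset α → R), deriveFn X (fun t => f t + g t) s =
        deriveFn X f s + deriveFn X g s := fun f g => by
      unfold deriveFn
      rw [← Multiset.sum_map_add]
      refine congrArg _ (Multiset.map_congr rfl fun x _ => ?_)
      rw [← map_add]
      rfl
    have h4 : (X x fun x' => conv a b (x' ::ₘ s)) =
        conv (fun t => X x fun x' => a (x' ::ₘ t)) b s +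
        conv a (fun t => X x fun x' => b (x' ::ₘ t)) s := by
      rw [conv_comm a, conv_map_linear_left, conv_map_linear_left, ← map_add]
      congr 1
      ext x'
      simp only [Pi.add_apply, conv_cons, conv_comm a]
      rw [add_comm, conv_comm b]
    rw [deriveFn_cons, h2, h3, ih, ih, h4, conv_cons, conv_cons, h1, h1, conv_add_left,
      conv_add_right]
    ring

end Multisets

/-! ### Strings of multi-indices as multisets of lists -/

section Strings

variable {D : ℕ}

/-- The multiset of the multi-indices (lists of spacetime indices) of a string of multi-indices. -/
def idx {p : ℕ} (k : Fin p → ℕ) (c : Slots k → Fin D) : Multiset (List (Fin D)) :=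
  Finset.univ.val.map fun i => List.ofFn fun s => c ⟨i, s⟩

theorem card_idx {p : ℕ} (k : Fin p → ℕ) (c : Slots k → Fin D) : (idx k c).card = p := by
  simp [idx]

theorem idx_zero (k : Fin 0 → ℕ) (c : Slots k → Fin D) : idx k c = 0 := rfl

theorem idx_length {p : ℕ} (A : Fin p → List (Fin D)) :
    idx (fun i => (A i).length) (fun s => (A s.1).get s.2) = Finset.univ.val.map A := by
  unfold idx
  congr 1
  ext1 i
  exact List.ofFn_get _

theorem exists_idx (s : Multiset (List (Fin D))) :
    ∃ A : Fin s.card → List (Fin D), s = Finset.univ.val.map A := by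
  obtain ⟨l, rfl⟩ := Quot.exists_rep s
  refine ⟨l.get, ?_⟩
  have h := Fin.univ_val_map l.get
  rw [List.ofFn_get] at h
  exact h.symm

theorem idx_perm {p : ℕ} (k : Fin p → ℕ) (c : Slots k → Fin D) (π : Equiv.Perm (Fin p)) :
    idx (k ∘ π) (fun s => c ⟨π s.1, s.2⟩) = idx k c := by
  unfold idx
  have h := congrArg Finset.val (Finset.map_univ_equiv π)
  rw [Finset.map_val] at h
  conv_rhs => rw [← h, Multiset.map_map]
  rfl

/-- A symmetric function of strings only depends on the multiset of the multi-indices: two strings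
with the same multiset have the same number of factors and differ by a permutation. -/
theorem eq_of_idx_eq {V : Type*} {φ : (p : ℕ) → (k : Fin p → ℕ) → (Slots k → Fin D) → V}
    (hφ : ∀ (p : ℕ) (k : Fin p → ℕ) (π : Equiv.Perm (Fin p)) (c : Slots k → Fin D),
      φ p (k ∘ π) (fun s => c ⟨π s.1, s.2⟩) = φ p k c)
    {p p' : ℕ} {k : Fin p → ℕ} {k' : Fin p' → ℕ} {c : Slots k → Fin D} {c' : Slots k' → Fin D}
    (h : idx k c = idx k' c') : φ p k c = φ p' k' c' := by
  obtain rfl : p = p' := by rw [← card_idx k c, h, card_idx]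
  obtain ⟨π, hπ⟩ := exists_equiv_of_map_eq h
  obtain rfl : k = k' ∘ π := by
    ext i
    have := congrArg List.length (hπ i)
    simpa using this.symm
  obtain rfl : c = fun s => c' ⟨π s.1, s.2⟩ := by
    ext ⟨i, s⟩
    have := List.ofFn_injective (hπ i)
    rw [← congrFun this s]
  exact hφ _ _ _ _

/-- The function of multisets that corresponds to a symmetric function `φ` of strings: its value at
`s` is that of `φ` at an arbitrary ordering of `s`. -/
def ofIdx {V : Type*} (φ : (p : ℕ) → (k : Fin p → ℕ) → (Slots k → Fin D) → V)
    (s : Multiset (List (Fin D))) : V :=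
  φ s.toList.length (fun i => (s.toList.get i).length) (fun t => (s.toList.get t.1).get t.2)

theorem ofIdx_idx {V : Type*} {φ : (p : ℕ) → (k : Fin p → ℕ) → (Slots k → Fin D) → V}
    (hφ : ∀ (p : ℕ) (k : Fin p → ℕ) (π : Equiv.Perm (Fin p)) (c : Slots k → Fin D),
      φ p (k ∘ π) (fun s => c ⟨π s.1, s.2⟩) = φ p k c)
    {p : ℕ} (k : Fin p → ℕ) (c : Slots k → Fin D) : ofIdx φ (idx k c) = φ p k c := by
  refine eq_of_idx_eq hφ ?_
  rw [idx_length, Fin.univ_val_map, List.ofFn_get, Multiset.coe_toList]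

theorem idx_succAbove {p : ℕ} (k : Fin (p + 1) → ℕ) (c : Slots k → Fin D) (i : Fin (p + 1)) :
    idx k c = (List.ofFn fun s => c ⟨i, s⟩) ::ₘ
      idx (fun j => k (i.succAbove j)) (fun s => c ⟨i.succAbove s.1, s.2⟩) := by
  unfold idx
  rw [Fin.univ_succAbove p i, Finset.cons_val, Multiset.map_cons, Finset.map_val, Multiset.map_map]
  rfl

theorem insertFn_idx {R : Type*} [CommRing R] (d : List (Fin D) → R)
    (a : Multiset (List (Fin D)) → R) {p : ℕ} (k : Fin (p + 1) → ℕ) (c : Slots k → Fin D) :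
    insertFn d a (idx k c) = ∑ i : Fin (p + 1), d (List.ofFn fun s => c ⟨i, s⟩) *
      a (idx (fun j => k (i.succAbove j)) (fun s => c ⟨i.succAbove s.1, s.2⟩)) := by
  unfold insertFn
  conv_lhs => enter [1, 2]; unfold idx
  rw [Multiset.map_map]
  change ∑ i, _ = _
  refine Finset.sum_congr rfl fun i _ => ?_
  simp only [Function.comp]
  rw [idx_succAbove k c i, Multiset.erase_cons_head]

theorem idx_subIndex {p : ℕ} (k : Fin p → ℕ) (c : Slots k → Fin D) (T : Finset (Fin p)) :
    idx (subIndex k T) (c ∘ subSlot k T) = T.val.map fun i => List.ofFn fun s => c ⟨i, s⟩ := by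
  have h := congrArg Finset.val (Finset.map_orderEmbOfFin_univ T rfl)
  rw [Finset.map_val] at h
  conv_rhs => rw [← h, Multiset.map_map]
  rfl

theorem conv_idx {R : Type*} [CommRing R] (a b : Multiset (List (Fin D)) → R) {p : ℕ}
    (k : Fin p → ℕ) (c : Slots k → Fin D) :
    conv a b (idx k c) = ∑ T : Finset (Fin p), a (idx (subIndex k T) (c ∘ subSlot k T)) *
      b (idx (subIndex k Tᶜ) (c ∘ subSlot k Tᶜ)) := by
  simp_rw [idx_subIndex]
  unfold idx
  rw [conv_map, Finset.powerset_univ]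
  simp_rw [← Finset.compl_eq_univ_sdiff]

theorem bijective_subSlot {p : ℕ} (k : Fin p → ℕ) (T : Finset (Fin p)) :
    Function.Bijective (Sum.elim (subSlot k T) (subSlot k Tᶜ)) := by
  have hinj : ∀ (T : Finset (Fin p)), Function.Injective (subSlot k T) := by
    rintro T ⟨i, s⟩ ⟨j, t⟩ h
    have h1 : i = j := (T.orderEmbOfFin rfl).injective (congrArg Sigma.fst h)
    subst h1
    have h2 : s = t := eq_of_heq (Sigma.mk.inj_iff.1 h).2
    rw [h2]
  have hmem : ∀ (T : Finset (Fin p)) (s : Slots (subIndex k T)), (subSlot k T s).1 ∈ T :=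
    fun T s => T.orderEmbOfFin_mem rfl s.1
  have hsurj : ∀ (T : Finset (Fin p)) (s : Slots k), s.1 ∈ T → ∃ t, subSlot k T t = s := by
    rintro T ⟨i, s⟩ hi
    have : i ∈ Set.range (T.orderEmbOfFin rfl) := by
      rw [Finset.range_orderEmbOfFin]
      exact hi
    obtain ⟨j, rfl⟩ := this
    exact ⟨⟨j, s⟩, rfl⟩
  constructor
  · refine Function.Injective.sumElim (hinj _) (hinj _) fun a b h => ?_
    have h1 := hmem T a
    rw [h] at h1
    exact Finset.mem_compl.1 (hmem Tᶜ b) h1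
  · intro s
    by_cases hs : s.1 ∈ T
    · obtain ⟨t, ht⟩ := hsurj T s hs
      exact ⟨Sum.inl t, ht⟩
    · obtain ⟨t, ht⟩ := hsurj Tᶜ s (Finset.mem_compl.2 hs)
      exact ⟨Sum.inr t, ht⟩

/-- The slots of the multi-indices other than the `i`-th one, and those of the `i`-th one. -/
theorem bijective_succAbove {p : ℕ} (k : Fin (p + 1) → ℕ) (i : Fin (p + 1)) :
    Function.Bijective (Sum.elim
      (fun s : Slots (fun j => k (i.succAbove j)) => (⟨i.succAbove s.1, s.2⟩ : Slots k))
      (fun s : Fin (k i) => (⟨i, s⟩ : Slots k))) := by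
  constructor
  · refine Function.Injective.sumElim ?_ ?_ ?_
    · rintro ⟨j, s⟩ ⟨j', t⟩ h
      simp only [Sigma.mk.injEq] at h
      obtain ⟨h1, h2⟩ := h
      obtain rfl := Fin.succAbove_right_injective h1
      rw [eq_of_heq h2]
    · intro s t h
      simpa using h
    · intro a b h
      exact Fin.succAbove_ne i a.1 (congrArg Sigma.fst h)
  · rintro ⟨j, s⟩
    by_cases hj : j = i
    · subst hj
      exact ⟨Sum.inr s, rfl⟩
    · obtain ⟨j, rfl⟩ := Fin.exists_succAbove_eq hj
      exact ⟨Sum.inl ⟨j, s⟩, rfl⟩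

theorem bijective_addDerivSlot {p : ℕ} (k : Fin p → ℕ) (i : Fin p) :
    Function.Bijective (addDerivSlot k i) := by
  rw [Fintype.bijective_iff_injective_and_card]
  constructor
  · rintro (_ | ⟨j, s⟩) (_ | ⟨j', t⟩) h
    · rfl
    · simp only [addDerivSlot, Sigma.mk.injEq] at h
      obtain ⟨rfl, h⟩ := h
      have := congrArg Fin.val (eq_of_heq h)
      simp at this
    · simp only [addDerivSlot, Sigma.mk.injEq] at h
      obtain ⟨rfl, h⟩ := h
      have := congrArg Fin.val (eq_of_heq h)
      simp at this
    · simp only [addDerivSlot, Sigma.mk.injEq] at h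
      obtain ⟨rfl, h⟩ := h
      have := congrArg Fin.val (eq_of_heq h)
      have h2 : s = t := by
        ext
        simp only at this
        split_ifs at this <;> omega
      rw [h2]
  · simp only [Fintype.card_option, Fintype.card_sigma, Fintype.card_fin]
    unfold addDeriv
    rw [← Finset.add_sum_erase _ _ (Finset.mem_univ i),
      ← Finset.add_sum_erase _ (fun j => if j = i then k j + 1 else k j) (Finset.mem_univ i)]
    rw [if_pos rfl, Finset.sum_congr rfl fun j hj => if_neg (Finset.ne_of_mem_erase hj)]
    ring

/-- The slots after one more derivative, as the new slot and the old ones. -/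
def addDerivEquiv {p : ℕ} (k : Fin p → ℕ) (i : Fin p) : Option (Slots k) ≃ Slots (addDeriv k i) :=
  Equiv.ofBijective _ (bijective_addDerivSlot k i)

/-- An additional derivative of the `i`-th factor adds a first entry to the `i`-th list. -/
theorem idx_addDeriv {p : ℕ} (k : Fin (p + 1) → ℕ) (i : Fin (p + 1)) (a : Fin D)
    (c : Slots k → Fin D) :
    idx (addDeriv k i) ((fun o : Option (Slots k) => o.elim a c) ∘ (addDerivEquiv k i).symm) =
      (a :: List.ofFn fun s => c ⟨i, s⟩) ::ₘ
        idx (fun j => k (i.succAbove j)) (fun s => c ⟨i.succAbove s.1, s.2⟩) := by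
  rw [idx_succAbove _ _ i]
  have hsymm : ∀ o, (addDerivEquiv k i).symm (addDerivSlot k i o) = o :=
    (addDerivEquiv k i).symm_apply_apply
  congr 1
  · refine List.ext_get (by simp [addDeriv]) fun n h1 h2 => ?_
    simp only [List.get_eq_getElem, List.getElem_ofFn, Function.comp]
    cases n with
    | zero =>
      have : (⟨i, ⟨0, by simpa using h1⟩⟩ : Slots (addDeriv k i)) = addDerivSlot k i none := rfl
      rw [this, hsymm]
      rfl
    | succ n =>
      have hn : n < k i := by simpa using h2
      have : (⟨i, ⟨n + 1, by simpa using h1⟩⟩ : Slots (addDeriv k i)) =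
          addDerivSlot k i (some ⟨i, ⟨n, hn⟩⟩) := by
        simp [addDerivSlot]
      rw [this, hsymm]
      simp
  · unfold idx
    congr 1
    ext1 j
    have hj : i.succAbove j ≠ i := Fin.succAbove_ne i j
    refine List.ext_get (by simp [addDeriv, hj]) fun n h1 h2 => ?_
    simp only [List.get_eq_getElem, List.getElem_ofFn, Function.comp]
    have hn : n < k (i.succAbove j) := by simpa using h2
    have : (⟨i.succAbove j, ⟨n, by simpa using h1⟩⟩ : Slots (addDeriv k i)) =
        addDerivSlot k i (some ⟨i.succAbove j, ⟨n, hn⟩⟩) := by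
      simp [addDerivSlot, hj]
    rw [this, hsymm]
    rfl

end Strings

/-! ### Pairings, and families of tensor fields -/

section Families

variable {D : ℕ} {M : Type*} [TopologicalSpace M] [ChartedSpace (Coord D) M]
  [IsManifold 𝓘(ℝ, Coord D) ∞ M]
variable {V W : Type*} [NormedAddCommGroup V] [NormedSpace ℝ V] [NormedAddCommGroup W]
  [NormedSpace ℝ W]
variable {ι : Type*} [Fintype ι] [DecidableEq ι]
variable {e : OpenPartialHomeomorph M (Coord D)}

theorem covComp_clm (L : V →L[ℝ] W) (w : TensorField D M ι V) (y : Coord D) (c : ι → Fin D) :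
    covComp e (fun x c => L (w x c)) y c = L (covComp e w y c) := by
  simp [covComp, map_sum]

theorem SmoothCov.clm (L : V →L[ℝ] W) {w : TensorField D M ι V} (hw : SmoothCov w) :
    SmoothCov (fun x c => L (w x c)) := by
  intro e he c
  simp only [covComp_clm]
  exact L.contDiff.comp_contDiffOn (hw e he c)

theorem SmoothCov.zero : SmoothCov (fun (_ : M) (_ : ι → Fin D) => (0 : V)) := by
  intro e he c
  simp only [covComp, smul_zero, Finset.sum_const_zero]
  exact contDiffOn_const

theorem covComp_sub (w w' : TensorField D M ι V) (y : Coord D) (c : ι → Fin D) :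
    covComp e (fun x c => w x c - w' x c) y c = covComp e w y c - covComp e w' y c := by
  simp [covComp, smul_sub]

theorem SmoothCov.sub {w w' : TensorField D M ι V} (hw : SmoothCov w) (hw' : SmoothCov w') :
    SmoothCov (fun x c => w x c - w' x c) := by
  intro e he c
  simp only [covComp_sub]
  exact (hw e he c).sub (hw' e he c)

theorem SmoothCov.equiv {ι' : Type*} [Fintype ι'] [DecidableEq ι'] (σ : ι' ≃ ι)
    {w : TensorField D M ι' V} (hw : SmoothCov w) : SmoothCov (fun x c => w x (c ∘ σ)) :=
  fun e he c => (hw e he _).congr fun _ hy => covComp_equiv σ he w hy c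

theorem covComp_of_isEmpty [IsEmpty ι] (w : TensorField D M ι V) (y : Coord D) (c : ι → Fin D) :
    covComp e w y c = w (e.symm y) c := by
  simp only [covComp, Finset.univ_eq_empty, Finset.prod_empty, one_smul]
  rw [Fintype.sum_eq_single c fun c' h => absurd (Subsingleton.elim c' c) h]

theorem smoothCov_of_isEmpty [IsEmpty ι] {u : M → ℂ} (hu : IsSmoothFn D u) :
    SmoothCov (fun x (_ : ι → Fin D) => u x) := by
  intro e he c
  simp only [covComp_of_isEmpty]
  exact contDiffOn_comp_symm hu he

theorem IsSmoothFn.mul {u v : M → ℂ} (hu : IsSmoothFn D u) (hv : IsSmoothFn D v) :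
    IsSmoothFn D (fun x => u x * v x) :=
  contMDiff_of_contDiffOn fun _ he => (contDiffOn_comp_symm hu he).mul (contDiffOn_comp_symm hv he)

theorem IsTestTensor.relabel {ι' : Type*} [Fintype ι'] [DecidableEq ι'] (σ : ι ≃ ι')
    {f : TensorField D M ι' ℂ} (hf : IsTestTensor f) : IsTestTensor (relabel σ.symm f) where
  smooth e he c := by
    refine (hf.smooth e he (c ∘ σ.symm)).congr fun y hy => ?_
    rw [contraComp_eq he _ hy, contraComp_eq he _ hy]
    exact pull_equiv σ.symm _ _ _
  compact := by
    refine hf.compact.mono fun x hx => ?_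
    contrapose! hx
    have : f x = 0 := by simpa using hx
    simp only [Function.mem_support, not_not]
    ext c
    simp [WickField.relabel, this]

theorem IsTestTensor.star {f : TensorField D M ι ℂ} (hf : IsTestTensor f) :
    IsTestTensor (fun x c => star (f x c)) where
  smooth e he c := by
    refine (Complex.conjCLE.contDiff.comp_contDiffOn (hf.smooth e he c)).congr fun y hy => ?_
    simp [contraComp, map_sum]
  compact := by
    refine hf.compact.mono fun x hx => ?_
    contrapose! hx
    have : f x = 0 := by simpa using hx
    simp only [Function.mem_support, not_not]
    ext c
    simp [this]

/-- A family of functions of strings of multi-indices, seen as a family of tensor fields. -/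
def tens (w : M → Multiset (List (Fin D)) → V) {p : ℕ} (k : Fin p → ℕ) :
    TensorField D M (Slots k) V := fun x c => w x (idx k c)

/-- A symmetric family of smooth covariant tensor fields. -/
def SmoothFam (w : M → Multiset (List (Fin D)) → V) : Prop :=
  ∀ (p : ℕ) (k : Fin p → ℕ), SmoothCov (tens w k)

theorem tens_conv {𝔸 : Type*} [NormedCommRing 𝔸] [NormedAlgebra ℝ 𝔸]
    (w z : M → Multiset (List (Fin D)) → 𝔸) {p : ℕ} (k : Fin p → ℕ) :
    tens (fun x => conv (w x) (z x)) k = fun x c => ∑ T : Finset (Fin p),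
      tens w (subIndex k T) x (c ∘ subSlot k T) * tens z (subIndex k Tᶜ) x (c ∘ subSlot k Tᶜ) := by
  ext x c
  exact conv_idx _ _ _ _

/-- The recursion for the quotient only involves sums and products, so that it preserves smoothness.
-/
theorem SmoothFam.deconv {a b : M → Multiset (List (Fin D)) → ℝ} (ha : SmoothFam a)
    (hb : SmoothFam b) : SmoothFam (fun x => deconv (a x) (b x)) := by
  intro p
  induction p using Nat.strong_induction_on with
  | _ p ih =>
    intro k
    have h : tens (fun x => WickField.deconv (a x) (b x)) k = fun x c => tens b k x c -
        ∑ T : Finset (Fin p), tens (fun x => tailFn (a x)) (subIndex k T) x (c ∘ subSlot k T) *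
          tens (fun x => WickField.deconv (a x) (b x)) (subIndex k Tᶜ) x (c ∘ subSlot k Tᶜ) := by
      ext x c
      simp only [tens]
      rw [deconv_eq, conv_idx]
    rw [h]
    refine (hb p k).sub (SmoothCov.sum fun T _ => ?_)
    by_cases hT : T.card = 0
    · have h0 : ∀ x c, tens (fun x => tailFn (a x)) (subIndex k T) x (c ∘ subSlot k T) = 0 := by
        intro x c
        have : idx (subIndex k T) (c ∘ subSlot k T) = 0 := by
          rw [← Multiset.card_eq_zero, card_idx, hT]
        simp [tens, this, tailFn]
      simp only [h0, zero_mul]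
      exact SmoothCov.zero
    · have h1 : tens (fun x => tailFn (a x)) (subIndex k T) = tens a (subIndex k T) := by
        ext x c
        have : idx (subIndex k T) c ≠ 0 := by
          rwa [Ne, ← Multiset.card_eq_zero, card_idx]
        simp [tens, tailFn, this]
      rw [h1]
      refine SmoothCov.mul (bijective_subSlot k T) (ha _ _) (ih _ ?_ _)
      have := Finset.card_compl T
      have h2 := Finset.card_le_univ T
      rw [Fintype.card_fin] at this h2
      omega

theorem apply_ofFn {W : Type*} (φ : (n : ℕ) → (Fin n → Fin D) → W) {n : ℕ} (g : Fin n → Fin D) :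
    φ (List.ofFn g).length (List.ofFn g).get = φ n g :=
  congrArg (fun q : Σ n, Fin n → Fin D => φ q.1 q.2) (List.equivSigmaTuple.right_inv ⟨n, g⟩)

theorem SmoothFam.insertFn (S : Spacetime D M) {u : M → ℂ} (hu : IsSmoothFn D u)
    {w : M → Multiset (List (Fin D)) → ℂ} (hw : SmoothFam w) :
    SmoothFam (fun x => insertFn (fun L => S.nabla L.length u x L.get) (w x)) := by
  intro p k
  cases p with
  | zero =>
    have : tens (fun x => WickField.insertFn (fun L => S.nabla L.length u x L.get) (w x)) k =
        fun x c => 0 := by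
      ext x c
      simp [tens, idx_zero, WickField.insertFn]
    rw [this]
    exact SmoothCov.zero
  | succ p =>
    have : tens (fun x => WickField.insertFn (fun L => S.nabla L.length u x L.get) (w x)) k =
        fun x c => ∑ i, tens w (fun j => k (i.succAbove j)) x
          (c ∘ fun s => ⟨i.succAbove s.1, s.2⟩) * S.nabla (k i) u x (c ∘ fun s => ⟨i, s⟩) := by
      ext x c
      simp only [tens]
      rw [insertFn_idx]
      refine Finset.sum_congr rfl fun i _ => ?_
      rw [apply_ofFn (fun n g => S.nabla n u x g), mul_comm]
      rfl
    rw [this]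
    exact SmoothCov.sum fun i _ => SmoothCov.mul (bijective_succAbove k i) (hw _ _)
      (S.smoothCov_nabla (fun e he => contDiffOn_comp_symm hu he) _)

section Pairing

variable [T2Space M] [SecondCountableTopology M] [MeasurableSpace M] [BorelSpace M]
  (S : Spacetime D M)

/-- The integral of the full contraction of a test tensor and a covariant tensor field. -/
def pairing (f w : TensorField D M ι ℂ) : ℂ := ∫ x, ∑ c, f x c * w x c ∂S.vol

/-- Smooth covariant tensor fields are determined by their integrals against test tensors. -/
theorem eq_of_pairing_eq {w w' : TensorField D M ι ℂ} (hw : SmoothCov w) (hw' : SmoothCov w')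
    (h : ∀ f, IsTestTensor f → pairing S f w = pairing S f w') : w = w' := by
  have h1 := eq_zero_of_integral S (hw.sub hw') fun f hf => by
    simp only [mul_sub, Finset.sum_sub_distrib]
    rw [integral_sub (integrable_pairing S hf hw) (integrable_pairing S hf hw')]
    exact sub_eq_zero.2 (h f hf)
  ext x c
  exact sub_eq_zero.1 (congrFun (congrFun h1 x) c)

theorem pairing_sum {κ : Type*} (u : Finset κ) {f : TensorField D M ι ℂ}
    {w : κ → TensorField D M ι ℂ} (hf : IsTestTensor f) (hw : ∀ i ∈ u, SmoothCov (w i)) :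
    pairing S f (fun x c => ∑ i ∈ u, w i x c) = ∑ i ∈ u, pairing S f (w i) := by
  unfold pairing
  rw [← integral_finsetSum _ fun i hi => integrable_pairing S hf (hw i hi)]
  refine integral_congr_ae (Filter.Eventually.of_forall fun x => ?_)
  simp only [Finset.mul_sum]
  rw [Finset.sum_comm]

theorem pairing_relabel {ι' : Type*} [Fintype ι'] [DecidableEq ι'] (σ : ι ≃ ι')
    (f : TensorField D M ι ℂ) (w : TensorField D M ι' ℂ) :
    pairing S (relabel σ f) w = pairing S f (fun x c => w x (c ∘ σ.symm)) := by
  unfold pairing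
  refine integral_congr_ae (Filter.Eventually.of_forall fun x => ?_)
  refine Fintype.sum_equiv (Equiv.arrowCongr σ.symm (Equiv.refl _)) _ _ fun c => ?_
  simp only [relabel]
  congr 2
  ext s
  simp

theorem pairing_contract {ι' : Type*} [Fintype ι'] [DecidableEq ι'] (σ : ι' → ι)
    (f w : TensorField D M ι ℂ) (g : TensorField D M ι' ℂ) :
    pairing S (contract σ f w) g = pairing S f (fun x C => g x (C ∘ σ) * w x C) := by
  unfold pairing
  refine integral_congr_ae (Filter.Eventually.of_forall fun x => ?_)
  simp only [sum_contract]
  exact Finset.sum_congr rfl fun C _ => by ring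

theorem pairing_smul (r : ℂ) (f w : TensorField D M ι ℂ) :
    pairing S f (fun x c => r * w x c) = r * pairing S f w := by
  unfold pairing
  rw [← integral_const_mul]
  refine integral_congr_ae (Filter.Eventually.of_forall fun x => ?_)
  simp only [Finset.mul_sum, mul_left_comm]

theorem star_pairing (f w : TensorField D M ι ℂ) :
    star (pairing S f w) = pairing S (fun x c => star (f x c)) (fun x c => star (w x c)) := by
  unfold pairing
  refine (integral_conj (f := fun x => ∑ c, f x c * w x c)).symm.trans ?_
  refine integral_congr_ae (Filter.Eventually.of_forall fun x => ?_)
  simp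

theorem eq_of_integral_mul_eq {u v : M → ℂ} (hu : IsSmoothFn D u) (hv : IsSmoothFn D v)
    (h : ∀ f, IsTestFn D f → ∫ x, f x * u x ∂S.vol = ∫ x, f x * v x ∂S.vol) : u = v := by
  have key := eq_of_pairing_eq (ι := Fin 0) S (smoothCov_of_isEmpty hu) (smoothCov_of_isEmpty hv)
    fun f hf => by
      have h1 : IsTestFn D (fun x => f x Fin.elim0) := by
        have := isTestFn_pairing hf (smoothCov_of_isEmpty (u := fun _ => 1) contMDiff_const)
        simpa [Fintype.sum_unique, Subsingleton.elim (default : Fin 0 → Fin D) Fin.elim0] using this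
      have h2 := h _ h1
      simpa [pairing, Fintype.sum_unique,
        Subsingleton.elim (default : Fin 0 → Fin D) Fin.elim0] using h2
  ext x
  exact congrFun (congrFun key x) Fin.elim0

end Pairing

end Families

/-! ### The expansion of Wick monomials into expectation values -/

section Wick

variable {D : ℕ} {M : Type*} [TopologicalSpace M] [ChartedSpace (Coord D) M]
  [IsManifold 𝓘(ℝ, Coord D) ∞ M] [T2Space M] [SecondCountableTopology M] [MeasurableSpace M]
  [BorelSpace M]
variable {S : Spacetime D M} {m2 ξ : ℝ} {G : GreenOperators S m2 ξ} {Ψ : HadamardState S G}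

theorem isSmoothFn_causal (G : GreenOperators S m2 ξ) {h : M → ℂ} (hh : IsTestFn D h) :
    IsSmoothFn D (G.causal h) := by
  have h1 := G.adv_smooth h hh
  have h2 := G.ret_smooth h hh
  unfold IsSmoothFn at *
  exact h1.sub h2

theorem isSmoothPow_prod {n : ℕ} {u : Fin n → M → ℂ} (hu : ∀ i, IsSmoothFn D (u i)) :
    IsSmoothPow D (fun x => ∏ i, u i (x i)) := by
  intro e he
  have h : ContDiffOn ℝ ∞ (fun y : Fin n → Coord D => ∏ i, (u i ∘ (e i).symm) (y i))
      (powTarget e) := by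
    refine contDiffOn_prod fun i _ => ?_
    exact (contDiffOn_comp_symm (hu i) (he i)).comp
      (contDiff_apply ℝ (Coord D) i).contDiffOn fun y hy => hy i (Set.mem_univ i)
  exact h

/-- The two ways to smear one argument of the two-point function differ by the causal
propagator. -/
theorem kerR_sub_kerL (Ψ : HadamardState S G) {h : M → ℂ} (hh : IsTestFn D h) (x : M) :
    Ψ.kerR h x - Ψ.kerL h x = Complex.I * G.causal h x := by
  have hR := Ψ.kerR_smooth h hh
  have hL := Ψ.kerL_smooth h hh
  have hG := isSmoothFn_causal G hh
  have hint : ∀ {f u : M → ℂ}, IsTestFn D f → IsSmoothFn D u →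
      Integrable (fun x => f x * u x) S.vol := by
    intro f u hf hu
    exact IsTestFn.integrable (D := D) S ⟨hf.1.mul hu, hf.2.mul_right⟩
  refine congrFun (eq_of_integral_mul_eq S (u := fun x => Ψ.kerR h x - Ψ.kerL h x)
    (v := fun x => Complex.I * G.causal h x) ?_ ?_ fun f hf => ?_) x
  · unfold IsSmoothFn at *
    exact hR.sub hL
  · exact IsSmoothFn.mul (D := D) contMDiff_const hG
  · have := Ψ.ccr f h hf hh
    rw [Ψ.kerR_spec f h hf hh, Ψ.kerL_spec f h hf hh] at this
    simp_rw [mul_sub, mul_left_comm (f _) Complex.I]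
    rw [integral_sub (hint hf hR) (hint hf hL), this, integral_const_mul]

theorem SameElem.expectation_eq {a b : WickElem M} (h : SameElem G a b) :
    expectation a = expectation b := by
  have := h 0 Fin.elim0 fun i => i.elim0
  simpa [expectation] using this

theorem expectation_sum {κ : Type*} (u : Finset κ) (a : κ → WickElem M) :
    expectation (∑ i ∈ u, a i) = ∑ i ∈ u, expectation (a i) := by
  simp [expectation, Finset.sum_apply]

namespace WickPrescription

variable (Φ : WickPrescription Ψ)

/-- The expectation values of the Wick monomials. -/
def weight {p : ℕ} (k : Fin p → ℕ) : TensorField D M (Slots k) ℂ :=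
  Classical.choose (Φ.smooth k)

theorem smoothCov_weight {p : ℕ} (k : Fin p → ℕ) : SmoothCov (Φ.weight k) :=
  (Classical.choose_spec (Φ.smooth k)).1

theorem expectation_mono {p : ℕ} (k : Fin p → ℕ) {f : TensorField D M (Slots k) ℂ}
    (hf : IsTestTensor f) : expectation (Φ.mono k f) = pairing S f (Φ.weight k) :=
  (Classical.choose_spec (Φ.smooth k)).2 f hf

/-- The expectation values of Wick monomials are real, by Hermiticity. -/
theorem star_weight {p : ℕ} (k : Fin p → ℕ) (x : M) (c : Slots k → Fin D) :
    star (Φ.weight k x c) = Φ.weight k x c := by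
  have h1 : SmoothCov (fun x c => star (Φ.weight k x c)) :=
    (Φ.smoothCov_weight k).clm Complex.conjCLE.toContinuousLinearMap
  refine congrFun (congrFun (eq_of_pairing_eq S h1 (Φ.smoothCov_weight k) fun f hf => ?_) x) c
  have h2 := (Φ.hermitian k _ hf.star).expectation_eq
  simp only [star_star] at h2
  rw [Φ.expectation_mono k hf] at h2
  rw [← h2]
  have h3 : expectation (Φ.mono k fun x c => star (f x c)).adjoint =
      star (expectation (Φ.mono k fun x c => star (f x c))) := by
    simp [expectation, WickElem.adjoint]
  rw [h3, Φ.expectation_mono k hf.star, star_pairing]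
  simp only [star_star]

/-- The expectation values of Wick monomials are symmetric under permutations of the factors. -/
theorem weight_symm (p : ℕ) (k : Fin p → ℕ) (π : Equiv.Perm (Fin p)) (x : M)
    (c : Slots k → Fin D) : Φ.weight (k ∘ π) x (fun s => c ⟨π s.1, s.2⟩) = Φ.weight k x c := by
  let σ : Slots (k ∘ π) ≃ Slots k := Equiv.sigmaCongrLeft (β := fun i => Fin (k i)) π
  have h : Φ.weight (k ∘ π) = fun x c => Φ.weight k x (c ∘ σ.symm) := by
    refine eq_of_pairing_eq S (Φ.smoothCov_weight _) ((Φ.smoothCov_weight k).equiv σ.symm)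
      fun f hf => ?_
    have h1 := (Φ.symm k π f hf).expectation_eq
    have h2 : IsTestTensor (relabel σ f) := hf.relabel σ.symm
    rw [Φ.expectation_mono _ hf] at h1
    rw [h1, ← pairing_relabel]
    exact Φ.expectation_mono _ h2
  rw [h]
  refine congrArg (Φ.weight k x) (funext fun s => ?_)
  exact congrArg c (σ.apply_symm_apply s)

/-- The expectation values of the Wick monomials, as real functions of strings of
multi-indices. -/
def fam (x : M) (s : Multiset (List (Fin D))) : ℝ :=
  (ofIdx (fun _ k c => Φ.weight k x c) s).re

theorem ofReal_fam_idx {p : ℕ} (k : Fin p → ℕ) (x : M) (c : Slots k → Fin D) :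
    (Φ.fam x (idx k c) : ℂ) = Φ.weight k x c := by
  rw [fam, ofIdx_idx fun p k π c => Φ.weight_symm p k π x c]
  exact Complex.conj_eq_iff_re.1 (Φ.star_weight k x c)

theorem smoothFam_fam : SmoothFam Φ.fam := by
  intro p k
  have h : tens Φ.fam k = fun x c => Complex.reCLM (Φ.weight k x c) := by
    ext x c
    rw [← Φ.ofReal_fam_idx]
    rfl
  rw [h]
  exact (Φ.smoothCov_weight k).clm _

theorem fam_zero (x : M) : Φ.fam x 0 = 1 := by
  have h1 : Φ.weight (fun i : Fin 0 => i.elim0) = fun x c => 1 := by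
    refine eq_of_pairing_eq S (Φ.smoothCov_weight _) (smoothCov_of_isEmpty contMDiff_const)
      fun f hf => ?_
    rw [← Φ.expectation_mono _ hf, (Φ.unit _ f hf).expectation_eq]
    simp only [expectation, Pi.smul_apply, unitElem, pairing, smul_eq_mul, mul_one,
      Fintype.sum_unique]
    refine integral_congr_ae (Filter.Eventually.of_forall fun x => ?_)
    exact congrArg (f x) (Subsingleton.elim _ _)
  have h2 := Φ.ofReal_fam_idx (fun i : Fin 0 => i.elim0) x (fun s => s.1.elim0)
  rw [h1, idx_zero] at h2
  exact Complex.ofReal_eq_one.1 h2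

end WickPrescription

/-- The coefficient functions of the expansion of Wick monomials into products of solutions of the
Klein-Gordon equation: `n` factors `∇_α φ` are replaced with `∇_α Δ h_1, …, ∇_α Δ h_n`, and the
others with their expectation values. -/
def expansion (G : GreenOperators S m2 ξ) (w : M → Multiset (List (Fin D)) → ℂ) :
    (n : ℕ) → (Fin n → M → ℂ) → M → Multiset (List (Fin D)) → ℂ
  | 0, _, x => w x
  | n + 1, h, x => fun s => (1 / (n + 1 : ℂ)) * insertFn
      (fun L => S.nabla L.length (G.causal (h 0)) x L.get) (expansion G w n (Fin.tail h) x) s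

theorem smoothFam_expansion (G : GreenOperators S m2 ξ) {w : M → Multiset (List (Fin D)) → ℂ}
    (hw : SmoothFam w) : ∀ (n : ℕ) (h : Fin n → M → ℂ), (∀ i, IsTestFn D (h i)) →
      SmoothFam (expansion G w n h)
  | 0, _, _ => hw
  | n + 1, h, hh => fun _ k =>
    (SmoothFam.insertFn S (isSmoothFn_causal G (hh 0))
      (smoothFam_expansion G hw n (Fin.tail h) fun i => hh i.succ) _ k).clm
        ((1 / (n + 1 : ℂ)) • ContinuousLinearMap.id ℝ ℂ)

/-- The replacement of factors is a composition of convolutions, which commute with the convolution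
by the coefficients `z`. -/
theorem expansion_conv (G : GreenOperators S m2 ξ) (w z : M → Multiset (List (Fin D)) → ℂ) :
    ∀ (n : ℕ) (h : Fin n → M → ℂ) (x : M) (s : Multiset (List (Fin D))),
      expansion G (fun x => conv (w x) (z x)) n h x s = conv (expansion G w n h x) (z x) s
  | 0, _, _, _ => rfl
  | n + 1, h, x, s => by
    simp only [expansion]
    rw [conv_mul_left, conv_insertFn]
    congr 2
    ext s
    exact expansion_conv G w z n _ x s

/-- The recursion that follows from the commutator with the linear field. -/
theorem WickPrescription.mono_succ (Φ : WickPrescription Ψ) {p : ℕ} (k : Fin (p + 1) → ℕ)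
    {f : TensorField D M (Slots k) ℂ} (hf : IsTestTensor f) {n : ℕ} (h : Fin (n + 1) → M → ℂ)
    (hh : ∀ i, IsTestFn D (h i)) :
    (n + 1 : ℂ) * Φ.mono k f (n + 1) (fun x => ∏ i, G.causal (h i) (x i)) =
      ∑ i : Fin (p + 1), Φ.mono (fun j => k (i.succAbove j))
        (contract (fun s => ⟨i.succAbove s.1, s.2⟩) f
          (fun x C => S.nabla (k i) (G.causal (h 0)) x (fun s => C ⟨i, s⟩))) n
        (fun x => ∏ i, G.causal (h i.succ) (x i)) := by
  have h1 := Φ.commutator k f (h 0) hf (hh 0) n (fun i => h i.succ) fun i => hh i.succ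
  have hd := ((Φ.mem k f hf).2 (n + 1)).distr
  have hsm : ∀ r : M → ℂ, IsSmoothFn D r → IsSmoothPow D (fun x : Fin (n + 1) → M =>
      r (x 0) * ∏ i, G.causal (h i.succ) (Fin.tail x i)) := by
    intro r hr
    have := isSmoothPow_prod (D := D)
      (u := Fin.cons (α := fun _ => M → ℂ) r fun i => G.causal (h i.succ)) (by
      intro i
      refine Fin.cases ?_ (fun i => ?_) i
      · exact hr
      · exact isSmoothFn_causal G (hh i.succ))
    simpa [Fin.prod_univ_succ, Fin.tail] using this
  have h2 : (mulField Ψ (Φ.mono k f) (h 0) - fieldMul Ψ (h 0) (Φ.mono k f)) n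
      (fun x => ∏ i, G.causal (h i.succ) (x i)) = Complex.I * ((n + 1 : ℂ) *
        Φ.mono k f (n + 1) (fun x => ∏ i, G.causal (h i) (x i))) := by
    have hL := hsm _ (Ψ.kerL_smooth _ (hh 0))
    have hG := hsm _ (isSmoothFn_causal G (hh 0))
    have hR : (fun x : Fin (n + 1) → M =>
        Ψ.kerR (h 0) (x 0) * ∏ i, G.causal (h i.succ) (Fin.tail x i)) =
        (fun x => Ψ.kerL (h 0) (x 0) * ∏ i, G.causal (h i.succ) (Fin.tail x i)) +
        Complex.I • (fun x => G.causal (h 0) (x 0) * ∏ i, G.causal (h i.succ) (Fin.tail x i)) := by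
      ext x
      have := kerR_sub_kerL Ψ (hh 0) (x 0)
      simp only [Pi.add_apply, Pi.smul_apply, smul_eq_mul]
      rw [← mul_assoc, ← this]
      ring
    have hIG : IsSmoothPow D (Complex.I • (fun x : Fin (n + 1) → M => G.causal (h 0) (x 0) *
        ∏ i, G.causal (h i.succ) (Fin.tail x i))) := fun e he =>
      (hG e he).const_smul Complex.I
    simp only [mulField, fieldMul, Pi.sub_apply, Pi.add_apply, contractPart]
    rw [hR, hd.add _ _ hL hIG, hd.smul _ _ hG]
    have h3 : (fun x : Fin (n + 1) → M => ∏ i, G.causal (h i) (x i)) =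
        fun x => G.causal (h 0) (x 0) * ∏ i, G.causal (h i.succ) (Fin.tail x i) := by
      ext x
      rw [Fin.prod_univ_succ]
      rfl
    rw [h3]
    ring
  rw [h2] at h1
  have h4 := mul_left_cancel₀ Complex.I_ne_zero h1
  rw [h4]
  simp [Finset.sum_apply]

/-- The values of a Wick monomial on products of solutions. -/
theorem WickPrescription.mono_eq_pairing (Φ : WickPrescription Ψ) :
    ∀ (n : ℕ) (h : Fin n → M → ℂ), (∀ i, IsTestFn D (h i)) → ∀ {p : ℕ} (k : Fin p → ℕ)
      {f : TensorField D M (Slots k) ℂ}, IsTestTensor f →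
      Φ.mono k f n (fun x => ∏ i, G.causal (h i) (x i)) =
        pairing S f (tens (expansion G (fun x s => (Φ.fam x s : ℂ)) n h) k) := by
  have hw : SmoothFam (fun x s => (Φ.fam x s : ℂ)) := fun _ k =>
    (Φ.smoothFam_fam _ k).clm Complex.ofRealCLM
  intro n
  induction n with
  | zero =>
    intro h hh p k f hf
    have h1 := Φ.expectation_mono k hf
    have h2 : tens (expansion G (fun x s => (Φ.fam x s : ℂ)) 0 h) k = Φ.weight k := by
      ext x c
      exact Φ.ofReal_fam_idx k x c
    rw [h2, ← h1]
    simp [expectation]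
  | succ n ih =>
    intro h hh p k f hf
    cases p with
    | zero =>
      rw [Φ.unit k f hf _ h hh]
      have : tens (expansion G (fun x s => (Φ.fam x s : ℂ)) (n + 1) h) k = fun x c => 0 := by
        ext x c
        simp [tens, expansion, idx_zero, insertFn]
      rw [this]
      simp [unitElem, pairing]
    | succ p =>
      have h1 := Φ.mono_succ k hf h hh
      have hn : (n + 1 : ℂ) ≠ 0 := by exact_mod_cast n.succ_ne_zero
      have hnab : ∀ m, SmoothCov (S.nabla m (G.causal (h 0))) := S.smoothCov_nabla
        fun e he => contDiffOn_comp_symm (isSmoothFn_causal G (hh 0)) he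
      have hsm := smoothFam_expansion G hw n (Fin.tail h) fun i => hh i.succ
      have h2 : tens (expansion G (fun x s => (Φ.fam x s : ℂ)) (n + 1) h) k =
          fun x c => (1 / (n + 1 : ℂ)) * ∑ i : Fin (p + 1),
            tens (expansion G (fun x s => (Φ.fam x s : ℂ)) n (Fin.tail h))
              (fun j => k (i.succAbove j)) x (c ∘ fun s => ⟨i.succAbove s.1, s.2⟩) *
            S.nabla (k i) (G.causal (h 0)) x (c ∘ fun s => ⟨i, s⟩) := by
        ext x c
        simp only [tens, expansion]
        rw [insertFn_idx]
        congr 1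
        refine Finset.sum_congr rfl fun i _ => ?_
        rw [apply_ofFn (fun n g => S.nabla n _ x g), mul_comm]
        rfl
      rw [h2, pairing_smul, pairing_sum S _ hf fun i _ =>
        SmoothCov.mul (bijective_succAbove k i) (hsm _ _) (hnab _)]
      rw [← mul_right_inj' hn, h1, ← mul_assoc, mul_one_div_cancel hn, one_mul]
      refine Finset.sum_congr rfl fun i _ => ?_
      have h3 := IsTestTensor.contract (bijective_succAbove k i) hf (hnab (k i))
      refine (ih (fun i => h i.succ) (fun i => hh i.succ) _ h3).trans ?_
      rw [pairing_contract]
      rfl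

end Wick

/-! ### The mixing coefficients -/

section Mixing

variable {D : ℕ} {M : Type*} [TopologicalSpace M] [ChartedSpace (Coord D) M]
  [IsManifold 𝓘(ℝ, Coord D) ∞ M] [T2Space M] [SecondCountableTopology M] [MeasurableSpace M]
  [BorelSpace M]
variable {S : Spacetime D M} {m2 ξ : ℝ} {G : GreenOperators S m2 ξ} {Ψ : HadamardState S G}
variable (Φ Φ' : WickPrescription Ψ)

theorem map_conv {α R R' : Type*} [CommRing R] [CommRing R'] (φ : R →+* R')
    (a b : Multiset α → R) (s : Multiset α) :
    φ (conv a b s) = conv (fun t => φ (a t)) (fun t => φ (b t)) s := by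
  simp [conv, map_multiset_sum, Multiset.map_map]

/-- The coefficients `𝒵^I`, as functions of strings of multi-indices: the quotient of the
expectation values in the algebra of convolution. -/
def mixCoeff (x : M) : Multiset (List (Fin D)) → ℝ := deconv (Φ.fam x) (Φ'.fam x)

theorem conv_mixCoeff (x : M) : conv (Φ.fam x) (mixCoeff Φ Φ' x) = Φ'.fam x :=
  funext fun s => conv_deconv (Φ.fam_zero x) _ s

theorem smoothFam_mixCoeff : SmoothFam (mixCoeff Φ Φ') :=
  Φ.smoothFam_fam.deconv Φ'.smoothFam_fam

theorem mixCoeff_zero (x : M) : mixCoeff Φ Φ' x 0 = 1 := by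
  have := congrFun (conv_mixCoeff Φ Φ' x) 0
  rwa [conv_zero, Φ.fam_zero, Φ'.fam_zero, one_mul] at this

/-- The values of a monomial on products of solutions arise from the expectation values by
`expansion`, which commutes with the convolution by the mixing coefficients. -/
theorem isMixing_mixCoeff : IsMixing Φ Φ' (fun _ k => tens (mixCoeff Φ Φ') k) where
  smooth n k := smoothFam_mixCoeff Φ Φ' n k
  symm n k π x c := congrArg (mixCoeff Φ Φ' x) (idx_perm k c π)
  mixing := by
    intro p k f hf n h hh
    have hz : SmoothFam (fun x s => (mixCoeff Φ Φ' x s : ℂ)) := fun p k =>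
      (smoothFam_mixCoeff Φ Φ' p k).clm Complex.ofRealCLM
    have hw : SmoothFam (fun x s => (Φ.fam x s : ℂ)) := fun p k =>
      (Φ.smoothFam_fam p k).clm Complex.ofRealCLM
    have hW := smoothFam_expansion G hw n h hh
    have h1 : (fun x s => (Φ'.fam x s : ℂ)) = fun x =>
        conv (fun s => (Φ.fam x s : ℂ)) (fun s => (mixCoeff Φ Φ' x s : ℂ)) := by
      ext x s
      rw [← conv_mixCoeff Φ Φ' x]
      exact map_conv Complex.ofRealHom _ _ s
    have h2 : expansion G (fun x s => (Φ'.fam x s : ℂ)) n h = fun x =>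
        conv (expansion G (fun x s => (Φ.fam x s : ℂ)) n h x)
          (fun s => (mixCoeff Φ Φ' x s : ℂ)) := by
      ext x s
      rw [h1]
      exact expansion_conv G _ (fun x s => (mixCoeff Φ Φ' x s : ℂ)) n h x s
    rw [Φ'.mono_eq_pairing n h hh k hf, h2, tens_conv,
      pairing_sum S _ hf fun T _ => SmoothCov.mul (bijective_subSlot k T) (hW _ _) (hz _ _),
      Finset.sum_apply, Finset.sum_apply]
    refine Finset.sum_congr rfl fun T _ => ?_
    have h3 := IsTestTensor.contract (bijective_subSlot k T) hf (hz _ (subIndex k Tᶜ))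
    refine (pairing_contract S _ _ _ _).symm.trans ?_
    exact (Φ.mono_eq_pairing n h hh _ h3).symm

theorem smoothCov_weight_mul {Z : (p : ℕ) → (k : Fin p → ℕ) → TensorField D M (Slots k) ℂ}
    (hZ : ∀ p (k : Fin p → ℕ), SmoothCov (Z p k)) {p : ℕ} (k : Fin p → ℕ) (T : Finset (Fin p)) :
    SmoothCov (fun x (c : Slots k → Fin D) => Φ.weight (subIndex k T) x (c ∘ subSlot k T) *
      Z _ (subIndex k Tᶜ) x (c ∘ subSlot k Tᶜ)) :=
  SmoothCov.mul (bijective_subSlot k T) (Φ.smoothCov_weight _) (hZ _ (subIndex k Tᶜ))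

variable {Φ Φ'}

theorem weight_eq_of_sameElem {Z : (p : ℕ) → (k : Fin p → ℕ) → TensorField D M (Slots k) ℂ}
    (hZ : ∀ p (k : Fin p → ℕ), SmoothCov (Z p k)) {p : ℕ} (k : Fin p → ℕ)
    (h : ∀ f, IsTestTensor f → SameElem G (Φ'.mono k f)
      (∑ T : Finset (Fin p), Φ.mono (subIndex k T) (contract (subSlot k T) f
        (fun x C => Z _ (subIndex k Tᶜ) x (C ∘ subSlot k Tᶜ))))) :
    Φ'.weight k = fun x c => ∑ T : Finset (Fin p), Φ.weight (subIndex k T) x (c ∘ subSlot k T) *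
      Z _ (subIndex k Tᶜ) x (c ∘ subSlot k Tᶜ) := by
  refine eq_of_pairing_eq S (Φ'.smoothCov_weight k)
    (SmoothCov.sum fun T _ => smoothCov_weight_mul Φ hZ k T) fun f hf => ?_
  rw [pairing_sum S _ hf fun T _ => smoothCov_weight_mul Φ hZ k T, ← Φ'.expectation_mono k hf,
    (h f hf).expectation_eq, expectation_sum]
  refine Finset.sum_congr rfl fun T _ => ?_
  have h3 := IsTestTensor.contract (bijective_subSlot k T) hf (hZ _ (subIndex k Tᶜ))
  exact (Φ.expectation_mono _ h3).trans (pairing_contract S _ _ _ _)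

/-- The expectation values of the mixing formula. -/
theorem IsMixing.weight_eq {Z : MixingCoeffs D M} (hZ : IsMixing Φ Φ' Z) {p : ℕ} (k : Fin p → ℕ)
    (x : M) (c : Slots k → Fin D) :
    Φ'.weight k x c = ∑ T : Finset (Fin p), Φ.weight (subIndex k T) x (c ∘ subSlot k T) *
      (Z _ (subIndex k Tᶜ) x (c ∘ subSlot k Tᶜ) : ℂ) :=
  congrFun (congrFun (weight_eq_of_sameElem (Z := fun p k x c => (Z p k x c : ℂ))
    (fun p k => (hZ.smooth p k).clm Complex.ofRealCLM) k (hZ.mixing k)) x) c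

theorem weight_subIndex_empty (Φ : WickPrescription Ψ) {p : ℕ} (k : Fin p → ℕ) (x : M)
    (c : Slots k → Fin D) : Φ.weight (subIndex k ∅) x (c ∘ subSlot k ∅) = 1 := by
  rw [← Φ.ofReal_fam_idx, idx_subIndex]
  simp [Φ.fam_zero]

/-- Restriction to the set of all factors is trivial; the set is a variable, as `∅ᶜ` and `univ`
agree only propositionally. -/
theorem subIndex_univ (Z : MixingCoeffs D M) {p : ℕ} (k : Fin p → ℕ) (x : M)
    (c : Slots k → Fin D) {T : Finset (Fin p)} (hT : T = Finset.univ) :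
    Z _ (subIndex k T) x (c ∘ subSlot k T) = Z p k x c := by
  have key : ∀ (q : ℕ) (_ : q = p) (e : Fin q → Fin p) (_ : ∀ j, (e j : ℕ) = j),
      Z q (fun j => k (e j)) x (fun s => c ⟨e s.1, s.2⟩) = Z p k x c := by
    rintro q rfl e he
    obtain rfl : e = id := funext fun j => Fin.ext (he j)
    rfl
  have hcard : T.card = p := by simp [hT]
  refine key _ hcard (T.orderEmbOfFin rfl) fun j => ?_
  have h1 : (T.orderEmbOfFin rfl : Fin T.card → Fin p) = Fin.cast hcard := by
    refine (Finset.orderEmbOfFin_unique rfl (fun i => ?_) ?_).symm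
    · simp [hT]
    · exact fun a b h => h
  rw [h1]
  rfl

/-- The term with `T = ∅` of the mixing formula contains the coefficient with all multi-indices, and
the other terms contain coefficients with fewer multi-indices. -/
theorem IsMixing.unique {Z Z' : MixingCoeffs D M} (hZ : IsMixing Φ Φ' Z)
    (hZ' : IsMixing Φ Φ' Z') : Z' = Z := by
  have key : ∀ (p : ℕ) (k : Fin p → ℕ) (x : M) (c : Slots k → Fin D), Z' p k x c = Z p k x c := by
    intro p
    induction p using Nat.strong_induction_on with
    | _ p ih =>
      intro k x c
      have h := (hZ'.weight_eq k x c).symm.trans (hZ.weight_eq k x c)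
      rw [← Finset.add_sum_erase _ _ (Finset.mem_univ ∅),
        ← Finset.add_sum_erase (a := ∅) Finset.univ _ (Finset.mem_univ _),
        weight_subIndex_empty, one_mul, one_mul, subIndex_univ Z' k x c (by simp),
        subIndex_univ Z k x c (by simp)] at h
      have h2 : ∀ T ∈ Finset.univ.erase (∅ : Finset (Fin p)),
          Z' _ (subIndex k Tᶜ) x (c ∘ subSlot k Tᶜ) = Z _ (subIndex k Tᶜ) x (c ∘ subSlot k Tᶜ) := by
        intro T hT
        refine ih _ ?_ _ _ _
        have h3 := Finset.card_pos.2 (Finset.nonempty_of_ne_empty (Finset.ne_of_mem_erase hT))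
        have h4 := Finset.card_compl T
        have h5 := Finset.card_le_univ T
        rw [Fintype.card_fin] at h4 h5
        omega
      rw [Finset.sum_congr rfl fun T hT => by rw [h2 T hT]] at h
      exact_mod_cast add_right_cancel h
  ext p k x c
  exact key p k x c

end Mixing

/-! ### Families of tensor fields in a chart, and relations between expectation values -/

section ChartFamilies

variable {D : ℕ} {M : Type*} [TopologicalSpace M] [ChartedSpace (Coord D) M]
  [IsManifold 𝓘(ℝ, Coord D) ∞ M]
variable {e : OpenPartialHomeomorph M (Coord D)}

theorem covComp_idx_symm (w : M → Multiset (List (Fin D)) → ℝ) (y : Coord D) (p : ℕ)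
    (k : Fin p → ℕ) (π : Equiv.Perm (Fin p)) (c : Slots k → Fin D) :
    covComp e (tens w (k ∘ π)) y (fun s => c ⟨π s.1, s.2⟩) = covComp e (tens w k) y c := by
  let σ : Slots (k ∘ π) ≃ Slots k := Equiv.sigmaCongrLeft (β := fun i => Fin (k i)) π
  have h : tens w k = fun x c => tens w (k ∘ π) x (c ∘ σ) := by
    ext x c
    exact congrArg (w x) (idx_perm k c π).symm
  rw [h]
  exact (pull_equiv σ _ _ _).symm

/-- The components in the chart `e` of a symmetric family of covariant tensor fields. -/
def chartFam (e : OpenPartialHomeomorph M (Coord D)) (w : M → Multiset (List (Fin D)) → ℝ)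
    (y : Coord D) (s : Multiset (List (Fin D))) : ℝ :=
  ofIdx (fun _ k c => covComp e (tens w k) y c) s

theorem chartFam_idx (w : M → Multiset (List (Fin D)) → ℝ) (y : Coord D) {p : ℕ} (k : Fin p → ℕ)
    (c : Slots k → Fin D) : chartFam e w y (idx k c) = covComp e (tens w k) y c :=
  ofIdx_idx (fun p k π c => covComp_idx_symm w y p k π c) k c

theorem exists_eq_idx (s : Multiset (List (Fin D))) :
    ∃ (k : Fin s.card → ℕ) (c : Slots k → Fin D), s = idx k c := by
  obtain ⟨A, hA⟩ := exists_idx s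
  exact ⟨fun i => (A i).length, fun s => (A s.1).get s.2, by rw [idx_length, ← hA]⟩

theorem chartFam_zero (w : M → Multiset (List (Fin D)) → ℝ) (y : Coord D) :
    chartFam e w y 0 = w (e.symm y) 0 := by
  have := chartFam_idx (e := e) w y (fun i : Fin 0 => i.elim0) (fun s => s.1.elim0)
  rwa [idx_zero, covComp_of_isEmpty] at this

theorem contDiffOn_chartFam (he : e ∈ atlas (Coord D) M) {w : M → Multiset (List (Fin D)) → ℝ}
    (hw : SmoothFam w) (s : Multiset (List (Fin D))) :
    ContDiffOn ℝ ∞ (fun y => chartFam e w y s) e.target := by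
  obtain ⟨k, c, h⟩ := exists_eq_idx s
  rw [h]
  simp only [chartFam_idx]
  exact hw _ k e he c

theorem chartFam_conv (he : e ∈ atlas (Coord D) M) (w z : M → Multiset (List (Fin D)) → ℝ)
    {y : Coord D} (hy : y ∈ e.target) :
    chartFam e (fun x => conv (w x) (z x)) y = conv (chartFam e w y) (chartFam e z y) := by
  ext s
  obtain ⟨k, c, h⟩ := exists_eq_idx s
  rw [h, chartFam_idx, conv_idx, tens_conv, covComp_sum _ _ he hy]
  refine Finset.sum_congr rfl fun T _ => ?_
  rw [covComp_mul (bijective_subSlot k T) he _ _ hy, chartFam_idx, chartFam_idx]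

theorem chartFam_chartAt (w : M → Multiset (List (Fin D)) → ℝ) (x : M)
    (s : Multiset (List (Fin D))) :
    chartFam (chartAt (Coord D) x) w (chartAt (Coord D) x x) s = w x s := by
  obtain ⟨k, c, h⟩ := exists_eq_idx s
  rw [h, chartFam_idx, covComp_chartAt]
  rfl

/-- The iterated covariant derivative of a function along a list of indices. -/
def covL {V : Type*} [NormedAddCommGroup V] [NormedSpace ℝ V]
    (Γ : Coord D → Fin D → Fin D → Fin D → ℝ) (L : List (Fin D)) (u : Coord D → V) (y : Coord D) :
    V := covD Γ L.length u L.get y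

/-- The action of the covariant derivative `∇_a`, minus its Christoffel terms, on a symbol of a
derivative `∇_L`: `∂_a (∇_L u) = ∇_a ∇_L u + ∑_j Γ^d_{a L_j} ∇_{L[j := d]} u`. -/
def slotDeriv (Γ : Coord D → Fin D → Fin D → Fin D → ℝ) (y : Coord D) (a : Fin D)
    (L : List (Fin D)) : (List (Fin D) → ℝ) →ₗ[ℝ] ℝ :=
  LinearMap.proj (a :: L) + ∑ j : Fin L.length, ∑ d,
    Γ y d a (L.get j) • LinearMap.proj (List.ofFn (Function.update L.get j d))

theorem slotDeriv_apply (Γ : Coord D → Fin D → Fin D → Fin D → ℝ) (y : Coord D) (a : Fin D)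
    (L : List (Fin D)) (φ : List (Fin D) → ℝ) : slotDeriv Γ y a L φ = φ (a :: L) +
      ∑ j : Fin L.length, ∑ d, Γ y d a (L.get j) * φ (List.ofFn (Function.update L.get j d)) := by
  simp [slotDeriv]

theorem slotDeriv_ofFn (Γ : Coord D → Fin D → Fin D → Fin D → ℝ) (y : Coord D) (a : Fin D)
    {n : ℕ} (g : Fin n → Fin D) (φ : List (Fin D) → ℝ) :
    slotDeriv Γ y a (List.ofFn g) φ = φ (a :: List.ofFn g) +
      ∑ j, ∑ d, Γ y d a (g j) * φ (List.ofFn (Function.update g j d)) := by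
  rw [slotDeriv_apply]
  congr 1
  exact apply_ofFn (fun n g => ∑ j, ∑ d, Γ y d a (g j) * φ (List.ofFn (Function.update g j d))) g

/-- The derivation that represents covariant differentiation on strings of multi-indices. -/
theorem deriveFn_slotDeriv_idx (Γ : Coord D → Fin D → Fin D → Fin D → ℝ) (y : Coord D) (a : Fin D)
    (φ : Multiset (List (Fin D)) → ℝ) {p : ℕ} (k : Fin p → ℕ) (c : Slots k → Fin D) :
    deriveFn (slotDeriv Γ y a) φ (idx k c) =
      ∑ i, φ (idx (addDeriv k i) ((fun o : Option (Slots k) => o.elim a c) ∘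
        (addDerivEquiv k i).symm)) +
      ∑ s : Slots k, ∑ d, Γ y d a (c s) * φ (idx k (Function.update c s d)) := by
  cases p with
  | zero => simp [idx_zero, deriveFn]
  | succ p =>
    have h1 : deriveFn (slotDeriv Γ y a) φ (idx k c) = ∑ i,
        slotDeriv Γ y a (List.ofFn fun s => c ⟨i, s⟩) (fun L => φ (L ::ₘ
          idx (fun j => k (i.succAbove j)) (fun s => c ⟨i.succAbove s.1, s.2⟩))) := by
      unfold deriveFn
      conv_lhs => enter [1, 2]; unfold idx
      rw [Multiset.map_map]
      change ∑ i, _ = _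
      refine Finset.sum_congr rfl fun i _ => ?_
      simp only [Function.comp]
      rw [idx_succAbove k c i, Multiset.erase_cons_head]
    rw [h1, Fintype.sum_sigma, ← Finset.sum_add_distrib]
    refine Finset.sum_congr rfl fun i _ => ?_
    rw [slotDeriv_ofFn, idx_addDeriv]
    congr 1
    refine Finset.sum_congr rfl fun t _ => Finset.sum_congr rfl fun d _ => ?_
    rw [idx_succAbove k (Function.update c ⟨i, t⟩ d) i]
    congr 3
    · congr 1
      ext s
      by_cases h : s = t
      · subst h; simp
      · have : (⟨i, s⟩ : Slots k) ≠ ⟨i, t⟩ := by simpa using h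
        simp [Function.update_of_ne h, Function.update_of_ne this]
    · congr 1
      ext s
      have : (⟨i.succAbove s.1, s.2⟩ : Slots k) ≠ ⟨i, t⟩ := fun h =>
        Fin.succAbove_ne i s.1 (congrArg Sigma.fst h)
      rw [Function.update_of_ne this]

variable [T2Space M] [SecondCountableTopology M] [MeasurableSpace M] [BorelSpace M]
variable {S : Spacetime D M}

/-- A test tensor with only one non-zero component in the chart `e`. -/
theorem isTestTensor_single {ι : Type*} [Fintype ι] [DecidableEq ι] (he : e ∈ atlas (Coord D) M)
    (C₀ : ι → Fin D) {φ : Coord D → ℂ} {K : Set (Coord D)} (hK : IsCompact K) (hKe : K ⊆ e.target)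
    (hφ : ContDiffOn ℝ ∞ φ e.target) (hφK : ∀ y ∉ K, φ y = 0) :
    IsTestTensor (M := M) (ofChart e fun C y => if C = C₀ then φ y else 0) := by
  refine isTestTensor_ofChart he hK hKe (fun C => ?_) fun C y hy => ?_
  · split_ifs
    exacts [hφ, contDiffOn_const]
  · split_ifs
    exacts [hφK y hy, rfl]

/-- The pairing with a test tensor with a single component in the chart `e`. -/
theorem pairing_single {ι : Type*} [Fintype ι] [DecidableEq ι] (he : e ∈ atlas (Coord D) M)
    (C₀ : ι → Fin D) {φ : Coord D → ℂ} {K : Set (Coord D)} (hK : IsCompact K) (hKe : K ⊆ e.target)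
    (hφ : ContDiffOn ℝ ∞ φ e.target) (hφK : ∀ y ∉ K, φ y = 0) {w : TensorField D M ι ℂ}
    (hw : SmoothCov w) : pairing S (ofChart e fun C y => if C = C₀ then φ y else 0) w =
      ∫ y in e.target, S.density e y • (φ y * covComp e w y C₀) := by
  have h := integral_ofChart S he hK hKe (φ := fun C y => if C = C₀ then φ y else 0)
    (fun C => by split_ifs; exacts [hφ, contDiffOn_const])
    (fun C y hy => by split_ifs; exacts [hφK y hy, rfl]) hw
  rw [pairing, h]
  simp

theorem integrableOn_of_continuousOn {g : Coord D → ℂ} {K U : Set (Coord D)} (hK : IsCompact K)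
    (hU : IsOpen U) (hKU : K ⊆ U) (hg : ContinuousOn g U) (h0 : ∀ y ∉ K, g y = 0) :
    IntegrableOn g U volume :=
  ((hg.mono hKU).integrableOn_compact hK).of_forall_sdiff_eq_zero hU.measurableSet
    fun y hy => h0 y hy.2

variable {m2 ξ : ℝ} {G : GreenOperators S m2 ξ} {Ψ : HadamardState S G}

namespace WickPrescription

variable (Φ : WickPrescription Ψ)

theorem covComp_weight (y : Coord D) {p : ℕ} (k : Fin p → ℕ) (c : Slots k → Fin D) :
    covComp e (Φ.weight k) y c = (chartFam e Φ.fam y (idx k c) : ℂ) := by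
  have h : Φ.weight k = fun x c => Complex.ofRealCLM (tens Φ.fam k x c) := by
    ext x c
    exact (Φ.ofReal_fam_idx k x c).symm
  rw [h, covComp_clm, chartFam_idx]
  rfl

/-- A linear relation with smooth coefficients between the covariant derivatives of functions
holds between the expectation values of Wick monomials, for any of the factors. -/
theorem sum_mul_chartFam_cons (he : e ∈ atlas (Coord D) M) {J : Type*} [Fintype J]
    {b : J → Coord D → ℝ} (hb : ∀ j, ContDiffOn ℝ ∞ (b j) e.target) (A : J → List (Fin D))
    (h : ∀ u : Coord D → ℂ, ContDiffOn ℝ ∞ u e.target → ∀ y ∈ e.target,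
      ∑ j, b j y • covL (S.christoffel e) (A j) u y = 0)
    {y : Coord D} (hy : y ∈ e.target) (s : Multiset (List (Fin D))) :
    ∑ j, b j y * chartFam e Φ.fam y (A j ::ₘ s) = 0 := by
  obtain ⟨B, hB⟩ := exists_idx s
  let L : J → Fin (s.card + 1) → List (Fin D) := fun j => Fin.cons (A j) B
  let k : J → Fin (s.card + 1) → ℕ := fun j i => (L j i).length
  let c : (j : J) → Slots (k j) → Fin D := fun j t => (L j t.1).get t.2
  have hidx : ∀ j, idx (k j) (c j) = A j ::ₘ s := by
    intro j
    rw [idx_length, Fin.univ_succ, Finset.cons_val, Multiset.map_cons, Finset.map_val,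
      Multiset.map_map]
    exact (congrArg (fun t => A j ::ₘ t) hB).symm
  have key : ∀ y ∈ e.target, ∑ j, (b j y : ℂ) * covComp e (Φ.weight (k j)) y (c j) = 0 := by
    intro y hy
    refine eq_zero_of_integral_chart S he
      (g := fun y => ∑ j, (b j y : ℂ) * covComp e (Φ.weight (k j)) y (c j))
      (continuousOn_finsetSum _ fun j _ => ?_) (fun φ h1 h2 h3 => ?_) hy
    · exact (Complex.continuous_ofReal.comp_continuousOn (hb j).continuousOn).mul
        ((Φ.smoothCov_weight (k j)) e he (c j)).continuousOn
    -- smear the relation with `φ`: the test tensors have the single components `φ b_j`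
    let ψ : J → Coord D → ℂ := fun j y => ((φ y * b j y : ℝ) : ℂ)
    have hψ : ∀ j, ContDiffOn ℝ ∞ (ψ j) e.target := fun j =>
      Complex.ofRealCLM.contDiff.comp_contDiffOn (h1.contDiffOn.mul (hb j))
    have hψK : ∀ j, ∀ y ∉ tsupport φ, ψ j y = 0 := fun j y hy => by
      simp [ψ, image_eq_zero_of_notMem_tsupport hy]
    let f : (j : J) → TensorField D M (Slots (k j)) ℂ := fun j =>
      ofChart e fun C y => if C = c j then ψ j y else 0
    have hf : ∀ j, IsTestTensor (f j) := fun j =>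
      isTestTensor_single he (c j) h2 h3 (hψ j) (hψK j)
    have hcl : ∀ u : Fin (s.card + 1) → M → ℂ, (∀ i, IsSmoothFn D (u i)) → ∀ x,
        ∑ j, ∑ C, f j x C * ∏ i, S.nabla (k j i) (u i) x (fun s => C ⟨i, s⟩) = 0 := by
      intro u hu x
      by_cases hx : x ∈ e.source
      · have hy := e.map_source hx
        have hux := fun i => contDiffOn_comp_symm (hu i) he
        have h4 : ∀ j, ∑ C, f j x C * ∏ i, S.nabla (k j i) (u i) x (fun s => C ⟨i, s⟩) =
            (φ (e x) : ℂ) * (∏ i : Fin s.card, covL (S.christoffel e) (B i) (u i.succ ∘ e.symm)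
              (e x)) * (b j (e x) • covL (S.christoffel e) (A j) (u 0 ∘ e.symm) (e x)) := by
          intro j
          have h5 := sum_contraComp_mul_covComp he (f j)
            (fun x C => ∏ i, S.nabla (k j i) (u i) x (fun s => C ⟨i, s⟩)) hy
          rw [e.left_inv hx] at h5
          rw [← h5]
          simp_rw [f, contraComp_ofChart he _ hy, covComp_prod he _ hy,
            S.covComp_nabla he (fun e he => contDiffOn_comp_symm (hu _) he) _ _ hy]
          simp only [ite_mul, zero_mul, Finset.sum_ite_eq', Finset.mem_univ, if_true]
          rw [Fin.prod_univ_succ]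
          have h6 : ψ j (e x) = (φ (e x) : ℂ) * (b j (e x) : ℂ) := by simp [ψ]
          rw [h6, Complex.real_smul]
          change _ * _ * (covL (S.christoffel e) (A j) (u 0 ∘ e.symm) (e x) *
            ∏ i : Fin s.card, covL (S.christoffel e) (B i) (u i.succ ∘ e.symm) (e x)) = _
          ring
        simp_rw [h4, ← Finset.mul_sum]
        rw [h _ (hux 0) _ hy, mul_zero]
      · have : ∀ j, f j x = 0 := fun j => ofChart_of_notMem hx
        simp [this]
    let σ := Fintype.equivFin J
    have h7 := (Φ.classical (fun _ => 1) (fun j => k (σ.symm j)) (fun j => f (σ.symm j))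
      (fun j => hf _) fun u hu x => by
        simp only [one_mul]
        rw [← hcl u hu x]
        exact Equiv.sum_comp σ.symm fun j => ∑ C, f j x C *
          ∏ i, S.nabla (k j i) (u i) x (fun s => C ⟨i, s⟩)).expectation_eq
    simp only [one_smul, expectation_sum, Φ.expectation_mono _ (hf _)] at h7
    have h8 : ∑ j, pairing S (f j) (Φ.weight (k j)) = 0 := by
      rw [← Equiv.sum_comp σ.symm fun j => pairing S (f j) (Φ.weight (k j)), h7]
      rfl
    rw [← h8]
    simp_rw [f, pairing_single he _ h2 h3 (hψ _) (hψK _) (Φ.smoothCov_weight _)]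
    rw [← integral_finsetSum]
    · refine setIntegral_congr_fun e.open_target.measurableSet fun y _ => ?_
      simp only [Finset.mul_sum, Finset.smul_sum, ψ, Complex.ofReal_mul, mul_assoc]
    · intro j _
      refine integrableOn_of_continuousOn h2 e.open_target h3 ?_ fun y hy => by
        rw [hψK j y hy, zero_mul, smul_zero]
      exact (S.contDiffOn_density he).continuousOn.smul ((hψ j).continuousOn.mul
        (Φ.smoothCov_weight (k j) e he (c j)).continuousOn)
  have h9 := key y hy
  simp_rw [covComp_weight, hidx] at h9
  exact_mod_cast h9

end WickPrescription

end ChartFamilies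

/-! ### The Leibniz rule for the mixing coefficients -/

section ChartRelations

variable {D : ℕ} {M : Type*} [TopologicalSpace M] [ChartedSpace (Coord D) M]
  [IsManifold 𝓘(ℝ, Coord D) ∞ M] [T2Space M] [SecondCountableTopology M] [MeasurableSpace M]
  [BorelSpace M]
variable {e : OpenPartialHomeomorph M (Coord D)}
variable {S : Spacetime D M} {m2 ξ : ℝ} {G : GreenOperators S m2 ξ} {Ψ : HadamardState S G}

/-- Integration by parts against a test tensor with a single component in a chart. -/
theorem pairing_divergence_single {ι : Type*} [Fintype ι] [DecidableEq ι]
    (he : e ∈ atlas (Coord D) M) (a₀ : Fin D) (c₀ : ι → Fin D) {φ : Coord D → ℂ}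
    {K : Set (Coord D)} (hK : IsCompact K) (hKe : K ⊆ e.target) (hφ : ContDiffOn ℝ ∞ φ e.target)
    (hφK : ∀ y ∉ K, φ y = 0) {w : TensorField D M ι ℂ} (hw : SmoothCov w) :
    pairing S (-S.divergence (ofChart e fun C y =>
      if C = (fun o : Option ι => o.elim a₀ c₀) then φ y else 0)) w =
      ∫ y in e.target, S.density e y •
        (φ y * covDeriv (lowerConn (S.christoffel e)) (covComp e w) a₀ c₀ y) := by
  set ψ : (Option ι → Fin D) → Coord D → ℂ := fun C y =>
    if C = (fun o : Option ι => o.elim a₀ c₀) then φ y else 0 with hψdef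
  have hψ : ∀ C, ContDiffOn ℝ ∞ (ψ C) e.target := fun C => by
    simp only [hψdef]
    split_ifs
    exacts [hφ, contDiffOn_const]
  have hψK : ∀ C, ∀ y ∉ K, ψ C y = 0 := fun C y hy => by
    simp only [hψdef]
    split_ifs
    exacts [hφK y hy, rfl]
  have hf : IsTestTensor (M := M) (ofChart e ψ) := isTestTensor_ofChart he hK hKe hψ hψK
  have hd := S.isTestTensor_divergence hf
  have hwc := hw e he
  have hρ := S.contDiffOn_density he
  have hΓ := S.contDiffOn_christoffel he
  let v : Fin D → Coord D → ℂ := fun a y => ∑ c, ψ (fun o => o.elim a c) y * covComp e w y c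
  have hv : ∀ a, ContDiffOn ℝ ∞ (v a) e.target := fun a =>
    ContDiffOn.sum fun c _ => (hψ _).mul (hwc c)
  have hvK : ∀ a, ∀ y ∉ K, v a y = 0 := fun a y hy => by simp [v, hψK _ y hy]
  have hcov : ContDiffOn ℝ ∞ (covDeriv (lowerConn (S.christoffel e)) (covComp e w) a₀ c₀)
      e.target := contDiffOn_covDeriv e.open_target (fun a b d => hΓ d a b) hwc _ _
  have h1 : pairing S (-S.divergence (ofChart e ψ)) w =
      -pairing S (S.divergence (ofChart e ψ)) w := by
    unfold pairing
    rw [← integral_neg]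
    refine integral_congr_ae (Filter.Eventually.of_forall fun x => ?_)
    simp
  have h2 : pairing S (S.divergence (ofChart e ψ)) w = ∫ y in e.target, S.density e y •
      ∑ c, S.chartDiv e (ofChart e ψ) y c * covComp e w y c := by
    have h0 : ∀ x, x ∉ e.source → S.divergence (ofChart e ψ) x = 0 := by
      intro x hx
      have hKM : IsCompact (e.symm '' K) :=
        hK.image_of_continuousOn (e.continuousOn_symm.mono hKe)
      have hxK : x ∉ e.symm '' K := by
        rintro ⟨z, hz, rfl⟩
        exact hx (e.map_target (hKe hz))
      set e' := chartAt (Coord D) x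
      have hx' : x ∈ e'.source := mem_chart_source _ _
      have hcont : Filter.Tendsto e'.symm (𝓝 (e' x)) (𝓝 x) := by
        have := e'.continuousAt_symm (e'.map_source hx')
        rwa [ContinuousAt, e'.left_inv hx'] at this
      have hz : ∀ C, (fun y => contraComp e' (ofChart e ψ) y C) =ᶠ[𝓝 (e' x)] fun _ => 0 := by
        intro C
        filter_upwards [hcont (hKM.isClosed.isOpen_compl.mem_nhds hxK)] with y hy
        have : ofChart e ψ (e'.symm y) = 0 := by
          by_cases hs : e'.symm y ∈ e.source
          · ext c
            have : ∀ c, ψ c (e (e'.symm y)) = 0 := fun c => hψK c _ fun h =>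
              hy ⟨_, h, e.left_inv hs⟩
            simp [ofChart, pull, this]
          · exact ofChart_of_notMem hs
        simp [contraComp, this]
      have hz0 : ∀ C, contraComp (chartAt (Coord D) x) (ofChart e ψ) (chartAt (Coord D) x x) C =
        0 := fun C => (hz C).eq_of_nhds
      ext c
      rw [Spacetime.divergence_eq_chartDiv]
      simp only [Spacetime.chartDiv, covDeriv, Pi.zero_apply]
      refine Finset.sum_eq_zero fun a _ => ?_
      rw [pd_congr (hz _), pd_const]
      simp [hz0]
    unfold pairing
    rw [S.integral_vol he (integrable_pairing S hd hw).aestronglyMeasurable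
      (fun x hx => by simp [h0 x hx])]
    refine setIntegral_congr_fun e.open_target.measurableSet fun y hy => ?_
    simp only [← sum_contraComp_mul_covComp he _ w hy, S.contraComp_divergence he hf hy]
  have h3 : ∀ y ∈ e.target, S.density e y •
      ∑ c, S.chartDiv e (ofChart e ψ) y c * covComp e w y c =
      S.density e y • ∑ a, (pd a (v a) y + ∑ b, S.christoffel e y a a b • v b y) -
      S.density e y • (φ y * covDeriv (lowerConn (S.christoffel e)) (covComp e w) a₀ c₀ y) := by
    intro y hy
    have hn := e.open_target.mem_nhds hy
    have h4 : ∀ c, S.chartDiv e (ofChart e ψ) y c =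
        ∑ a, covDeriv (upperConn (S.christoffel e)) (fun y C => ψ C y) a (fun o => o.elim a c) y := by
      intro c
      refine Finset.sum_congr rfl fun a _ => ?_
      unfold covDeriv
      have : ∀ C, (fun y => contraComp e (ofChart e ψ) y C) =ᶠ[𝓝 y] ψ C := fun C => by
        filter_upwards [hn] with y hy
        exact contraComp_ofChart he ψ hy C
      rw [pd_congr (this _)]
      simp only [contraComp_ofChart he ψ hy]
    simp_rw [h4]
    rw [sum_chartDiv_mul S (fun c => ((hψ c).contDiffAt hn).differentiableAt (by simp))
      (fun c => ((hwc c).contDiffAt hn).differentiableAt (by simp)), smul_sub]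
    congr 2
    rw [Finset.sum_eq_single c₀, Finset.sum_eq_single a₀]
    · simp
    · intro a _ ha
      have : (fun o : Option ι => o.elim a c₀) ≠ fun o => o.elim a₀ c₀ := fun h =>
        ha (congrFun h none)
      simp [this]
    · simp
    · intro c _ hc
      refine Finset.sum_eq_zero fun a _ => ?_
      have : (fun o : Option ι => o.elim a c) ≠ fun o => o.elim a₀ c₀ := fun h =>
        hc (funext fun s => congrFun h (some s))
      simp [this]
    · simp
  rw [h1, h2, setIntegral_congr_fun e.open_target.measurableSet h3, integral_sub,
    integral_div_eq_zero S he hK hKe hv hvK, zero_sub, neg_neg]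
  · refine integrableOn_of_continuousOn hK e.open_target hKe ?_ fun y hy => ?_
    · exact hρ.continuousOn.smul (continuousOn_finsetSum _ fun a _ =>
        (contDiffOn_pd e.open_target (hv a)).continuousOn.add (continuousOn_finsetSum _ fun b _ =>
          (hΓ a a b).continuousOn.smul (hv b).continuousOn))
    · have : ∀ a, v a =ᶠ[𝓝 y] fun _ => 0 := fun a => by
        filter_upwards [hK.isClosed.isOpen_compl.mem_nhds hy] with z hz using hvK a z hz
      simp [pd_congr (this _), pd_const, hvK _ y hy]
  · refine integrableOn_of_continuousOn hK e.open_target hKe ?_ fun y hy => ?_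
    · exact hρ.continuousOn.smul (hφ.continuousOn.mul hcov.continuousOn)
    · rw [hφK y hy, zero_mul, smul_zero]

namespace WickPrescription

variable (Φ : WickPrescription Ψ)

/-- The Leibniz rule for the expectation values, in a chart. -/
theorem covDeriv_weight (he : e ∈ atlas (Coord D) M) {p : ℕ} (k : Fin p → ℕ) (a : Fin D)
    (c : Slots k → Fin D) {y : Coord D} (hy : y ∈ e.target) :
    covDeriv (lowerConn (S.christoffel e)) (covComp e (Φ.weight k)) a c y =
      ∑ i, covComp e (Φ.weight (addDeriv k i)) y
        ((fun o : Option (Slots k) => o.elim a c) ∘ (addDerivEquiv k i).symm) := by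
  set C₀ : Option (Slots k) → Fin D := fun o => o.elim a c with hC₀
  have hw : ∀ {p : ℕ} (k : Fin p → ℕ), SmoothCov (Φ.weight k) := Φ.smoothCov_weight
  have hcov : ContDiffOn ℝ ∞ (covDeriv (lowerConn (S.christoffel e)) (covComp e (Φ.weight k)) a c)
      e.target := contDiffOn_covDeriv e.open_target
    (fun a b d => S.contDiffOn_christoffel he d a b) (hw k e he) _ _
  refine sub_eq_zero.1 (eq_zero_of_integral_chart S he
    (g := fun y => covDeriv (lowerConn (S.christoffel e)) (covComp e (Φ.weight k)) a c y -
      ∑ i, covComp e (Φ.weight (addDeriv k i)) y (C₀ ∘ (addDerivEquiv k i).symm))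
    ?_ (fun φ h1 h2 h3 => ?_) hy)
  · exact hcov.continuousOn.sub
      (continuousOn_finsetSum _ fun i _ => (hw (addDeriv k i) e he _).continuousOn)
  let ψ : Coord D → ℂ := fun y => (φ y : ℂ)
  have hψ : ContDiffOn ℝ ∞ ψ e.target := Complex.ofRealCLM.contDiff.comp_contDiffOn h1.contDiffOn
  have hψK : ∀ y ∉ tsupport φ, ψ y = 0 := fun y hy => by
    simp [ψ, image_eq_zero_of_notMem_tsupport hy]
  have hf := isTestTensor_single (M := M) he C₀ h2 h3 hψ hψK
  have hρ := S.contDiffOn_density he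
  have h4 := (Φ.leibniz k _ hf).expectation_eq
  have hdiv : IsTestTensor (-S.divergence (ofChart e fun C y => if C = C₀ then ψ y else 0)) := by
    have hd := S.isTestTensor_divergence hf
    refine ⟨fun e' he' c => ?_, ?_⟩
    · refine (hd.smooth e' he' c).neg.congr fun y _ => ?_
      simp [contraComp]
    · refine hd.compact.mono fun x hx => ?_
      contrapose! hx
      have : S.divergence (ofChart e fun C y => if C = C₀ then ψ y else 0) x = 0 := by
        simpa using hx
      simp [this]
  rw [Φ.expectation_mono k hdiv, expectation_sum, hC₀,
    pairing_divergence_single he a c h2 h3 hψ hψK (hw k)] at h4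
  have h5 : ∀ i, expectation (Φ.mono (addDeriv k i) (relabel (addDerivSlot k i)
      (ofChart e fun C y => if C = C₀ then ψ y else 0))) =
      ∫ y in e.target, S.density e y • (ψ y *
        covComp e (Φ.weight (addDeriv k i)) y (C₀ ∘ (addDerivEquiv k i).symm)) := by
    intro i
    have h6 : IsTestTensor (relabel (addDerivEquiv k i)
        (ofChart (M := M) e fun C y => if C = C₀ then ψ y else 0)) :=
      hf.relabel (addDerivEquiv k i).symm
    refine (Φ.expectation_mono _ h6).trans ?_
    rw [pairing_relabel,
      pairing_single he C₀ h2 h3 hψ hψK ((hw (addDeriv k i)).equiv (addDerivEquiv k i).symm)]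
    refine setIntegral_congr_fun e.open_target.measurableSet fun y hy => ?_
    simp only [covComp_equiv (addDerivEquiv k i).symm he _ hy]
  rw [Finset.sum_congr rfl fun i _ => h5 i, ← integral_finsetSum] at h4
  · have hint : ∀ g : Coord D → ℂ, ContinuousOn g e.target →
        IntegrableOn (fun y => S.density e y • (ψ y * g y)) e.target volume := fun g hg =>
      integrableOn_of_continuousOn h2 e.open_target h3
        (hρ.continuousOn.smul (hψ.continuousOn.mul hg)) fun y hy => by
          rw [hψK y hy, zero_mul, smul_zero]
    have h7 := sub_eq_zero.2 h4
    rw [← integral_sub (hint _ hcov.continuousOn)] at h7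
    · rw [← h7]
      refine setIntegral_congr_fun e.open_target.measurableSet fun y hy => ?_
      simp only [mul_sub, smul_sub, Finset.mul_sum, Finset.smul_sum, ψ]
    · exact integrable_finsetSum _ fun i _ => hint _ (hw (addDeriv k i) e he _).continuousOn
  · intro i _
    exact integrableOn_of_continuousOn h2 e.open_target h3 (hρ.continuousOn.smul
      (hψ.continuousOn.mul (hw (addDeriv k i) e he _).continuousOn)) fun y hy => by
        rw [hψK y hy, zero_mul, smul_zero]

/-- The Leibniz rule for the expectation values, with the Christoffel terms written as a derivation
of the convolution algebra. -/
theorem pd_chartFam (he : e ∈ atlas (Coord D) M) (a : Fin D) {y : Coord D} (hy : y ∈ e.target)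
    (s : Multiset (List (Fin D))) : pd a (fun y => chartFam e Φ.fam y s) y =
      deriveFn (slotDeriv (S.christoffel e) y a) (chartFam e Φ.fam y) s := by
  obtain ⟨k, c, h⟩ := exists_eq_idx s
  rw [h, deriveFn_slotDeriv_idx]
  have h1 := Φ.covDeriv_weight he k a c hy
  unfold covDeriv at h1
  simp_rw [covComp_weight] at h1
  have hd : DifferentiableAt ℝ (fun y => chartFam e Φ.fam y (idx k c)) y :=
    ((contDiffOn_chartFam he Φ.smoothFam_fam _).contDiffAt
      (e.open_target.mem_nhds hy)).differentiableAt (by simp)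
  have h2 : pd a (fun y => (chartFam e Φ.fam y (idx k c) : ℂ)) y =
      ((pd a (fun y => chartFam e Φ.fam y (idx k c)) y : ℝ) : ℂ) := by
    have := (Complex.ofRealCLM.hasFDerivAt.comp y hd.hasFDerivAt).fderiv
    unfold pd
    exact congrArg (fun L => L (stdVec D a)) this
  rw [h2, sub_eq_iff_eq_add] at h1
  simp only [lowerConn, Complex.real_smul] at h1
  exact_mod_cast h1

end WickPrescription

variable (Φ Φ' : WickPrescription Ψ)

theorem chartFam_fam_eq_conv (he : e ∈ atlas (Coord D) M) {y : Coord D} (hy : y ∈ e.target) :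
    conv (chartFam e Φ.fam y) (chartFam e (mixCoeff Φ Φ') y) = chartFam e Φ'.fam y := by
  rw [← chartFam_conv he _ _ hy]
  congr 1
  ext x
  rw [conv_mixCoeff]

theorem chartFam_fam_zero (y : Coord D) : chartFam e Φ.fam y 0 = 1 := by
  rw [chartFam_zero, Φ.fam_zero]

/-- A linear relation with smooth coefficients between the covariant derivatives of functions
holds between the mixing coefficients, in any of the multi-indices. -/
theorem sum_mul_chartFam_mixCoeff_cons (he : e ∈ atlas (Coord D) M) {J : Type*} [Fintype J]
    {b : J → Coord D → ℝ} (hb : ∀ j, ContDiffOn ℝ ∞ (b j) e.target) (A : J → List (Fin D))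
    (h : ∀ u : Coord D → ℂ, ContDiffOn ℝ ∞ u e.target → ∀ y ∈ e.target,
      ∑ j, b j y • covL (S.christoffel e) (A j) u y = 0)
    {y : Coord D} (hy : y ∈ e.target) (s : Multiset (List (Fin D))) :
    ∑ j, b j y * chartFam e (mixCoeff Φ Φ') y (A j ::ₘ s) = 0 := by
  have h1 := fun s => Φ.sum_mul_chartFam_cons he hb A h hy s
  have h2 := fun s => Φ'.sum_mul_chartFam_cons he hb A h hy s
  have h3 := conv_left_cancel (chartFam_fam_zero (e := e) Φ y)
    (b := fun s => ∑ j, b j y * chartFam e (mixCoeff Φ Φ') y (A j ::ₘ s)) (b' := fun _ => 0)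
    fun s => by
      have h4 : conv (fun s => ∑ j, b j y * chartFam e Φ.fam y (A j ::ₘ s))
          (chartFam e (mixCoeff Φ Φ') y) s + conv (chartFam e Φ.fam y)
          (fun s => ∑ j, b j y * chartFam e (mixCoeff Φ Φ') y (A j ::ₘ s)) s = 0 := by
        rw [conv_sum_left, conv_sum_right, ← Finset.sum_add_distrib, ← h2 s]
        refine Finset.sum_congr rfl fun j _ => ?_
        rw [conv_mul_left, conv_mul_right, ← mul_add, ← conv_cons,
          chartFam_fam_eq_conv Φ Φ' he hy]
      rw [funext h1] at h4
      simpa [conv] using h4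
  exact congrFun h3 s

/-- The Leibniz rule for the mixing coefficients, in a chart. -/
theorem pd_chartFam_mixCoeff (he : e ∈ atlas (Coord D) M) (a : Fin D) {y : Coord D}
    (hy : y ∈ e.target) (s : Multiset (List (Fin D))) :
    pd a (fun y => chartFam e (mixCoeff Φ Φ') y s) y =
      deriveFn (slotDeriv (S.christoffel e) y a) (chartFam e (mixCoeff Φ Φ') y) s := by
  have hd : ∀ (w : M → Multiset (List (Fin D)) → ℝ), SmoothFam w → ∀ s,
      DifferentiableAt ℝ (fun y => chartFam e w y s) y := fun w hw s =>
    ((contDiffOn_chartFam he hw s).contDiffAt (e.open_target.mem_nhds hy)).differentiableAt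
      (by simp)
  have hw := hd _ Φ.smoothFam_fam
  have hz := hd _ (smoothFam_mixCoeff Φ Φ')
  have h1 : ∀ s, pd a (fun y => chartFam e Φ'.fam y s) y =
      conv (fun s => pd a (fun y => chartFam e Φ.fam y s) y) (chartFam e (mixCoeff Φ Φ') y) s +
      conv (chartFam e Φ.fam y)
        (fun s => pd a (fun y => chartFam e (mixCoeff Φ Φ') y s) y) s := by
    intro s
    have h2 : (fun y => chartFam e Φ'.fam y s) =ᶠ[𝓝 y]
        fun y => conv (chartFam e Φ.fam y) (chartFam e (mixCoeff Φ Φ') y) s := by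
      filter_upwards [e.open_target.mem_nhds hy] with y hy
      rw [chartFam_fam_eq_conv Φ Φ' he hy]
    obtain ⟨k, c, h⟩ := exists_eq_idx s
    rw [pd_congr h2, h]
    simp_rw [conv_idx]
    rw [pd_sum _ fun T _ => (hw _).fun_mul (hz _), ← Finset.sum_add_distrib]
    exact Finset.sum_congr rfl fun T _ => pd_mul (hw _) (hz _)
  have h3 := conv_left_cancel (chartFam_fam_zero (e := e) Φ y)
    (b := fun s => pd a (fun y => chartFam e (mixCoeff Φ Φ') y s) y)
    (b' := deriveFn (slotDeriv (S.christoffel e) y a) (chartFam e (mixCoeff Φ Φ') y)) fun s => by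
      have h4 := h1 s
      rw [Φ'.pd_chartFam he a hy, ← chartFam_fam_eq_conv Φ Φ' he hy, deriveFn_conv] at h4
      simp_rw [Φ.pd_chartFam he a hy] at h4
      exact (add_left_cancel h4).symm
  exact congrFun h3 s

end ChartRelations

/-! ### The mixing coefficients with one multi-index -/

section OneFactor

variable {D : ℕ} {M : Type*} [TopologicalSpace M] [ChartedSpace (Coord D) M]
  [IsManifold 𝓘(ℝ, Coord D) ∞ M] [T2Space M] [SecondCountableTopology M] [MeasurableSpace M]
  [BorelSpace M]
variable {S : Spacetime D M} {m2 ξ : ℝ} {G : GreenOperators S m2 ξ} {Ψ : HadamardState S G}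

theorem WickPrescription.fam_singleton_nil (Φ : WickPrescription Ψ) (x : M) :
    Φ.fam x {[]} = 0 := by
  have hE : IsEmpty (Slots fun _ : Fin 1 => 0) := ⟨fun s => s.2.elim0⟩
  have h1 : Φ.weight (fun _ : Fin 1 => 0) = fun x c => 0 := by
    refine eq_of_pairing_eq S (Φ.smoothCov_weight _) SmoothCov.zero fun f hf => ?_
    have h2 : IsTestFn D (fun x => f x default) := by
      have := isTestFn_pairing hf (smoothCov_of_isEmpty (u := fun _ => 1) contMDiff_const)
      simpa [Fintype.sum_unique] using this
    have h3 : f = fun x _ => f x default := by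
      ext x c
      exact congrArg (f x) (Subsingleton.elim _ _)
    rw [← Φ.expectation_mono _ hf, h3, (Φ.field _ h2).expectation_eq]
    simp [expectation, linearField, pairing]
  have h4 := Φ.ofReal_fam_idx (fun _ : Fin 1 => 0) x (fun s => s.2.elim0)
  rw [h1] at h4
  have h5 : idx (fun _ : Fin 1 => 0) (fun s => (s.2.elim0 : Fin D)) = {[]} := rfl
  rw [h5] at h4
  exact Complex.ofReal_eq_zero.1 h4

variable (Φ Φ' : WickPrescription Ψ)

theorem mixCoeff_singleton_nil (x : M) : mixCoeff Φ Φ' x {[]} = 0 := by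
  have h := congrFun (conv_mixCoeff Φ Φ' x) {[]}
  rw [← Multiset.cons_zero, conv_cons, conv_zero, conv_zero, Multiset.cons_zero,
    Φ.fam_singleton_nil, Φ'.fam_singleton_nil, Φ.fam_zero] at h
  simpa using h

/-- The mixing coefficients with a single multi-index vanish: for the empty multi-index this is
the normalization of the linear field, and the Leibniz rule adds derivatives. -/
theorem chartFam_mixCoeff_singleton {e : OpenPartialHomeomorph M (Coord D)}
    (he : e ∈ atlas (Coord D) M) : ∀ (n : ℕ) (L : List (Fin D)), L.length = n →
      ∀ y ∈ e.target, chartFam e (mixCoeff Φ Φ') y {L} = 0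
  | 0, L, hL, y, hy => by
    obtain rfl := List.length_eq_zero_iff.1 hL
    have h := chartFam_idx (e := e) (mixCoeff Φ Φ') y (fun _ : Fin 1 => 0)
      (fun s => (s.2.elim0 : Fin D))
    have hE : IsEmpty (Slots fun _ : Fin 1 => 0) := ⟨fun s => s.2.elim0⟩
    rw [covComp_of_isEmpty] at h
    exact h.trans (mixCoeff_singleton_nil Φ Φ' _)
  | n + 1, [], hL, _, _ => by simp at hL
  | n + 1, a :: L, hL, y, hy => by
    have hL' : L.length = n := by simpa using hL
    have ih := chartFam_mixCoeff_singleton he n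
    have h := pd_chartFam_mixCoeff Φ Φ' he a hy {L}
    have h0 : (fun y => chartFam e (mixCoeff Φ Φ') y {L}) =ᶠ[𝓝 y] fun _ => 0 := by
      filter_upwards [e.open_target.mem_nhds hy] with y hy using ih L hL' y hy
    rw [pd_congr h0, pd_const] at h
    simp only [deriveFn, Multiset.map_singleton, Multiset.sum_singleton, slotDeriv_apply,
      Multiset.erase_singleton, Multiset.cons_zero] at h
    rw [Finset.sum_eq_zero fun j _ => Finset.sum_eq_zero fun d _ => by
      rw [ih _ (by simpa using hL') y hy, mul_zero], add_zero] at h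
    exact h.symm

theorem mixCoeff_one (k : Fin 1 → ℕ) (x : M) (c : Slots k → Fin D) :
    tens (mixCoeff Φ Φ') k x c = 0 := by
  obtain ⟨L, hL⟩ := Multiset.card_eq_one.1 (card_idx k c)
  rw [tens, hL, ← chartFam_chartAt (mixCoeff Φ Φ') x]
  exact chartFam_mixCoeff_singleton Φ Φ' (chart_mem_atlas _ _) _ L rfl _ (mem_chart_target _ x)

end OneFactor

/-! ### Covariant derivatives with respect to several variables -/

section SeveralVariables

variable {D : ℕ} {ι : Type*} [Fintype ι] [DecidableEq ι]
variable {Γ : Coord D → Fin D → Fin D → Fin D → ℝ} {U : Set (Coord D)}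

theorem covL_cons {V : Type*} [NormedAddCommGroup V] [NormedSpace ℝ V]
    (Γ : Coord D → Fin D → Fin D → Fin D → ℝ) (a : Fin D) (A : List (Fin D)) (u : Coord D → V)
    (y : Coord D) : covL Γ (a :: A) u y = pd a (covL Γ A u) y - ∑ j : Fin A.length, ∑ d,
      Γ y d a (A.get j) • covL Γ (List.ofFn (Function.update A.get j d)) u y := by
  have h : ∀ (j : Fin A.length) (d : Fin D), covL Γ (List.ofFn (Function.update A.get j d)) u y =
      covD Γ A.length u (Function.update A.get j d) y := fun j d =>
    apply_ofFn (fun n g => covD Γ n u g y) _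
  simp_rw [h]
  rfl

theorem pd_covL (Γ : Coord D → Fin D → Fin D → Fin D → ℝ) (a : Fin D) (A : List (Fin D))
    (u : Coord D → ℝ) (y : Coord D) :
    pd a (covL Γ A u) y = slotDeriv Γ y a A fun L => covL Γ L u y := by
  rw [slotDeriv_apply, covL_cons]
  simp

theorem contDiffOn_covL {V : Type*} [NormedAddCommGroup V] [NormedSpace ℝ V] (hU : IsOpen U)
    (hΓ : ∀ c a b, ContDiffOn ℝ ∞ (fun y => Γ y c a b) U) {u : Coord D → V}
    (hu : ContDiffOn ℝ ∞ u U) (A : List (Fin D)) : ContDiffOn ℝ ∞ (covL Γ A u) U :=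
  contDiffOn_covD hU hΓ hu _ _

/-- The partial derivative with respect to the component `a` of the `i`-th variable. -/
def pdv (i : ι) (a : Fin D) (H : (ι → Coord D) → ℝ) (y : ι → Coord D) : ℝ :=
  pd a (fun v => H (Function.update y i v)) (y i)

/-- The iterated covariant derivative along `A` with respect to the `i`-th variable. -/
def op (Γ : Coord D → Fin D → Fin D → Fin D → ℝ) (i : ι) (A : List (Fin D))
    (H : (ι → Coord D) → ℝ) (y : ι → Coord D) : ℝ :=
  covL Γ A (fun v => H (Function.update y i v)) (y i)

/-- Iterated covariant derivatives along `A i` with respect to the variables `i` in a list. -/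
def mop (Γ : Coord D → Fin D → Fin D → Fin D → ℝ) (l : List ι) (A : ι → List (Fin D))
    (H : (ι → Coord D) → ℝ) : (ι → Coord D) → ℝ :=
  l.foldr (fun i H => op Γ i (A i) H) H

theorem op_nil (i : ι) (H : (ι → Coord D) → ℝ) : op Γ i [] H = H := by
  ext y
  simp [op, covL, covD]

/-- The partial derivative of a covariant derivative, in terms of covariant derivatives. -/
theorem pdv_op (i : ι) (a : Fin D) (A : List (Fin D)) (H : (ι → Coord D) → ℝ) (y : ι → Coord D) :
    pdv i a (op Γ i A H) y = slotDeriv Γ (y i) a A fun L => op Γ i L H y := by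
  simp only [pdv, op, Function.update_idem, Function.update_self]
  exact pd_covL Γ a A _ _

theorem op_cons (i : ι) (a : Fin D) (A : List (Fin D)) (H : (ι → Coord D) → ℝ) :
    op Γ i (a :: A) H = fun y => pdv i a (op Γ i A H) y - ∑ j : Fin A.length, ∑ d,
      Γ (y i) d a (A.get j) * op Γ i (List.ofFn (Function.update A.get j d)) H y := by
  ext y
  rw [pdv_op, slotDeriv_apply]
  ring

/-- The domain in which all variables lie in `U`. -/
def powDom (ι : Type*) (U : Set (Coord D)) : Set (ι → Coord D) := Set.univ.pi fun _ => U

theorem isOpen_powDom (hU : IsOpen U) : IsOpen (powDom ι U) :=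
  isOpen_set_pi Set.finite_univ fun _ _ => hU

theorem mem_powDom {y : ι → Coord D} : y ∈ powDom ι U ↔ ∀ i, y i ∈ U := by
  simp [powDom]

theorem pdv_eq_fderiv {i : ι} {a : Fin D} {H : (ι → Coord D) → ℝ} {y : ι → Coord D}
    (hH : DifferentiableAt ℝ H y) :
    pdv i a H y = fderiv ℝ H y (Pi.single i (stdVec D a)) := by
  have h1 := hasFDerivAt_update (𝕜 := ℝ) y (i := i) (y i)
  have h2 : HasFDerivAt H (fderiv ℝ H y) (Function.update y i (y i)) := by
    rw [Function.update_eq_self]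
    exact hH.hasFDerivAt
  have h3 := (h2.comp (y i) h1).fderiv
  unfold pdv pd
  change fderiv ℝ (H ∘ Function.update y i) (y i) _ = _
  rw [h3, ContinuousLinearMap.comp_apply]
  congr 1
  ext j : 1
  by_cases hj : j = i
  · subst hj; simp
  · simp [Pi.single_eq_of_ne hj]

theorem differentiableAt_of_contDiffOn {E F : Type*} [NormedAddCommGroup E]
    [NormedSpace ℝ E] [NormedAddCommGroup F] [NormedSpace ℝ F] {H : E → F} {W : Set E}
    (hH : ContDiffOn ℝ ∞ H W) (hW : IsOpen W) {y : E} (hy : y ∈ W) : DifferentiableAt ℝ H y :=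
  (hH.contDiffAt (hW.mem_nhds hy)).differentiableAt (by simp)

theorem contDiffOn_pdv (hU : IsOpen U) {H : (ι → Coord D) → ℝ}
    (hH : ContDiffOn ℝ ∞ H (powDom ι U)) (i : ι) (a : Fin D) :
    ContDiffOn ℝ ∞ (pdv i a H) (powDom ι U) := by
  refine ((hH.fderiv_of_isOpen (isOpen_powDom hU) (m := ∞) (by simp)).clm_apply
    (contDiffOn_const (c := Pi.single i (stdVec D a)))).congr fun y hy => ?_
  exact pdv_eq_fderiv (differentiableAt_of_contDiffOn hH (isOpen_powDom hU) hy)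

theorem contDiffOn_coef (hΓ : ∀ c a b, ContDiffOn ℝ ∞ (fun y => Γ y c a b) U) (i : ι)
    (c a b : Fin D) : ContDiffOn ℝ ∞ (fun y : ι → Coord D => Γ (y i) c a b) (powDom ι U) :=
  (hΓ c a b).comp (contDiff_apply ℝ (Coord D) i).contDiffOn fun _ hy => mem_powDom.1 hy i

/-- Induction over multi-indices, with all multi-indices of the same length as hypotheses. -/
theorem list_induction {P : List (Fin D) → Prop} (h0 : P [])
    (h1 : ∀ a A, P A → (∀ A' : List (Fin D), A'.length = A.length → P A') → P (a :: A))
    (A : List (Fin D)) : P A := by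
  have key : ∀ (n : ℕ) (A : List (Fin D)), A.length = n → P A := by
    intro n
    induction n with
    | zero =>
      intro A hA
      rwa [List.length_eq_zero_iff.1 hA]
    | succ n ih =>
      rintro (_ | ⟨a, A⟩) hA
      · simp at hA
      · have hA' : A.length = n := by simpa using hA
        exact h1 a A (ih A hA') fun A' h => ih A' (h.trans hA')
  exact key _ A rfl

theorem contDiffOn_op (hU : IsOpen U) (hΓ : ∀ c a b, ContDiffOn ℝ ∞ (fun y => Γ y c a b) U)
    {H : (ι → Coord D) → ℝ} (hH : ContDiffOn ℝ ∞ H (powDom ι U)) (i : ι) (A : List (Fin D)) :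
    ContDiffOn ℝ ∞ (op Γ i A H) (powDom ι U) := by
  induction A using list_induction with
  | h0 => rwa [op_nil]
  | h1 a A ih ih' =>
    rw [op_cons]
    exact (contDiffOn_pdv hU ih i a).sub (ContDiffOn.sum fun j _ => ContDiffOn.sum fun d _ =>
      (contDiffOn_coef hΓ i _ _ _).mul (ih' _ (by simp)))

theorem contDiffOn_mop (hU : IsOpen U) (hΓ : ∀ c a b, ContDiffOn ℝ ∞ (fun y => Γ y c a b) U)
    {H : (ι → Coord D) → ℝ} (hH : ContDiffOn ℝ ∞ H (powDom ι U)) (l : List ι)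
    (A : ι → List (Fin D)) : ContDiffOn ℝ ∞ (mop Γ l A H) (powDom ι U) := by
  induction l with
  | nil => exact hH
  | cons i l ih => exact contDiffOn_op hU hΓ ih i (A i)

theorem pdv_congr {i : ι} {a : Fin D} {H H' : (ι → Coord D) → ℝ} {y : ι → Coord D}
    (h : H =ᶠ[𝓝 y] H') : pdv i a H =ᶠ[𝓝 y] pdv i a H' := by
  filter_upwards [eventually_eventually_nhds.2 h] with z hz
  refine pd_congr ?_
  have hc : Filter.Tendsto (fun v => Function.update z i v) (𝓝 (z i)) (𝓝 z) := by
    have : Continuous (fun v => Function.update z i v) := continuous_const.update i continuous_id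
    have h := this.tendsto (z i)
    rwa [Function.update_eq_self] at h
  exact hc hz

theorem op_congr {i : ι} {A : List (Fin D)} {H H' : (ι → Coord D) → ℝ} {y : ι → Coord D}
    (h : H =ᶠ[𝓝 y] H') : op Γ i A H =ᶠ[𝓝 y] op Γ i A H' := by
  induction A using list_induction with
  | h0 => rwa [op_nil, op_nil]
  | h1 a A ih ih' =>
    rw [op_cons, op_cons]
    have h2 : ∀ᶠ z in 𝓝 y, ∀ (j : Fin A.length) (d : Fin D),
        op Γ i (List.ofFn (Function.update A.get j d)) H z =
        op Γ i (List.ofFn (Function.update A.get j d)) H' z :=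
      Filter.eventually_all.2 fun j => Filter.eventually_all.2 fun d => ih' _ (by simp)
    filter_upwards [pdv_congr (i := i) (a := a) ih, h2] with z hz1 hz2
    simp only [hz1, hz2]

theorem mop_congr {l : List ι} {A : ι → List (Fin D)} {H H' : (ι → Coord D) → ℝ} {y : ι → Coord D}
    (h : H =ᶠ[𝓝 y] H') : mop Γ l A H =ᶠ[𝓝 y] mop Γ l A H' := by
  induction l with
  | nil => exact h
  | cons i l ih => exact op_congr ih

theorem eventuallyEq_of_eqOn (hU : IsOpen U) {H H' : (ι → Coord D) → ℝ}
    (h : Set.EqOn H H' (powDom ι U)) {y : ι → Coord D} (hy : y ∈ powDom ι U) : H =ᶠ[𝓝 y] H' :=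
  Filter.eventuallyEq_of_mem ((isOpen_powDom hU).mem_nhds hy) h

theorem op_eqOn (hU : IsOpen U) {i : ι} {A : List (Fin D)} {H H' : (ι → Coord D) → ℝ}
    (h : Set.EqOn H H' (powDom ι U)) : Set.EqOn (op Γ i A H) (op Γ i A H') (powDom ι U) :=
  fun _ hy => (op_congr (eventuallyEq_of_eqOn hU h hy)).eq_of_nhds

theorem mop_eqOn (hU : IsOpen U) {l : List ι} {A : ι → List (Fin D)} {H H' : (ι → Coord D) → ℝ}
    (h : Set.EqOn H H' (powDom ι U)) : Set.EqOn (mop Γ l A H) (mop Γ l A H') (powDom ι U) :=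
  fun _ hy => (mop_congr (eventuallyEq_of_eqOn hU h hy)).eq_of_nhds

theorem mop_congr_list {l : List ι} {A A' : ι → List (Fin D)} (h : ∀ i ∈ l, A i = A' i)
    (H : (ι → Coord D) → ℝ) : mop Γ l A H = mop Γ l A' H := by
  induction l with
  | nil => rfl
  | cons i l ih =>
    change op Γ i (A i) (mop Γ l A H) = op Γ i (A' i) (mop Γ l A' H)
    rw [h i (by simp), ih fun j hj => h j (by simp [hj])]

theorem pdv_add (hU : IsOpen U) {H H' : (ι → Coord D) → ℝ} (hH : ContDiffOn ℝ ∞ H (powDom ι U))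
    (hH' : ContDiffOn ℝ ∞ H' (powDom ι U)) (i : ι) (a : Fin D) {y : ι → Coord D}
    (hy : y ∈ powDom ι U) : pdv i a (fun y => H y + H' y) y = pdv i a H y + pdv i a H' y := by
  have h1 := differentiableAt_of_contDiffOn hH (isOpen_powDom hU) hy
  have h2 := differentiableAt_of_contDiffOn hH' (isOpen_powDom hU) hy
  rw [pdv_eq_fderiv h1, pdv_eq_fderiv h2, pdv_eq_fderiv (h1.fun_add h2), fderiv_fun_add h1 h2]
  rfl

theorem op_add (hU : IsOpen U) (hΓ : ∀ c a b, ContDiffOn ℝ ∞ (fun y => Γ y c a b) U)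
    {H H' : (ι → Coord D) → ℝ} (hH : ContDiffOn ℝ ∞ H (powDom ι U))
    (hH' : ContDiffOn ℝ ∞ H' (powDom ι U)) (i : ι) (A : List (Fin D)) :
    Set.EqOn (op Γ i A fun y => H y + H' y) (fun y => op Γ i A H y + op Γ i A H' y)
      (powDom ι U) := by
  induction A using list_induction with
  | h0 => simp only [op_nil]; exact fun _ _ => rfl
  | h1 a A ih ih' =>
    intro y hy
    simp only [op_cons]
    rw [(pdv_congr (eventuallyEq_of_eqOn hU ih hy)).eq_of_nhds, pdv_add hU
      (contDiffOn_op hU hΓ hH i A) (contDiffOn_op hU hΓ hH' i A) i a hy]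
    simp only [ih' _ (show (List.ofFn (Function.update A.get _ _)).length = A.length by simp) hy,
      mul_add, Finset.sum_add_distrib]
    ring

theorem covL_mul_const (c : ℝ) (u : Coord D → ℝ) (A : List (Fin D)) (y : Coord D) :
    covL Γ A (fun v => c * u v) y = c * covL Γ A u y := by
  induction A using list_induction generalizing y with
  | h0 => rfl
  | h1 a A ih ih' =>
    rw [covL_cons, covL_cons, mul_sub, Finset.mul_sum]
    congr 1
    · rw [funext ih]
      unfold pd
      exact congrArg (fun L => L y (stdVec D a))
        (fderiv_const_smul_field (𝕜 := ℝ) (f := covL Γ A u) c)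
    · refine Finset.sum_congr rfl fun j _ => ?_
      rw [Finset.mul_sum]
      refine Finset.sum_congr rfl fun d _ => ?_
      rw [ih' _ (by simp), smul_eq_mul, smul_eq_mul]
      ring

theorem op_mul {i : ι} {A : List (Fin D)} {c H : (ι → Coord D) → ℝ}
    (hc : ∀ y v, c (Function.update y i v) = c y) (y : ι → Coord D) :
    op Γ i A (fun y => c y * H y) y = c y * op Γ i A H y := by
  unfold op
  simp only [hc]
  exact covL_mul_const _ _ _ _

theorem op_sum (hU : IsOpen U) (hΓ : ∀ c a b, ContDiffOn ℝ ∞ (fun y => Γ y c a b) U)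
    {κ : Type*} (s : Finset κ) {H : κ → (ι → Coord D) → ℝ}
    (hH : ∀ q, ContDiffOn ℝ ∞ (H q) (powDom ι U)) (i : ι) (A : List (Fin D)) :
    Set.EqOn (op Γ i A fun y => ∑ q ∈ s, H q y) (fun y => ∑ q ∈ s, op Γ i A (H q) y)
      (powDom ι U) := by
  classical
  induction s using Finset.induction_on with
  | empty =>
    intro y _
    have := op_mul (Γ := Γ) (i := i) (A := A) (c := fun _ => 0) (H := fun _ => 0)
      (fun _ _ => rfl) y
    simpa using this
  | insert q s hq ih =>
    intro y hy
    simp only [Finset.sum_insert hq]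
    exact (op_add hU hΓ (hH q) (ContDiffOn.sum fun q _ => hH q) i A hy).trans
      (congrArg _ (ih hy))

theorem mop_add (hU : IsOpen U) (hΓ : ∀ c a b, ContDiffOn ℝ ∞ (fun y => Γ y c a b) U)
    {H H' : (ι → Coord D) → ℝ} (hH : ContDiffOn ℝ ∞ H (powDom ι U))
    (hH' : ContDiffOn ℝ ∞ H' (powDom ι U)) (l : List ι) (A : ι → List (Fin D)) :
    Set.EqOn (mop Γ l A fun y => H y + H' y) (fun y => mop Γ l A H y + mop Γ l A H' y)
      (powDom ι U) := by
  induction l with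
  | nil => exact fun _ _ => rfl
  | cons i l ih =>
    intro y hy
    exact (op_eqOn hU ih hy).trans
      (op_add hU hΓ (contDiffOn_mop hU hΓ hH l A) (contDiffOn_mop hU hΓ hH' l A) i _ hy)

theorem mop_mul {l : List ι} {A : ι → List (Fin D)} {c H : (ι → Coord D) → ℝ}
    (hc : ∀ i ∈ l, ∀ y v, c (Function.update y i v) = c y) (y : ι → Coord D) :
    mop Γ l A (fun y => c y * H y) y = c y * mop Γ l A H y := by
  induction l generalizing y with
  | nil => rfl
  | cons i l ih =>
    have h1 : mop Γ l A (fun y => c y * H y) = fun y => c y * mop Γ l A H y :=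
      funext fun y => ih (fun j hj => hc j (by simp [hj])) y
    change op Γ i (A i) (mop Γ l A _) y = _
    rw [h1]
    exact op_mul (hc i (by simp)) y

theorem mop_sum (hU : IsOpen U) (hΓ : ∀ c a b, ContDiffOn ℝ ∞ (fun y => Γ y c a b) U)
    {κ : Type*} (s : Finset κ) {H : κ → (ι → Coord D) → ℝ}
    (hH : ∀ q, ContDiffOn ℝ ∞ (H q) (powDom ι U)) (l : List ι) (A : ι → List (Fin D)) :
    Set.EqOn (mop Γ l A fun y => ∑ q ∈ s, H q y) (fun y => ∑ q ∈ s, mop Γ l A (H q) y)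
      (powDom ι U) := by
  induction l with
  | nil => exact fun _ _ => rfl
  | cons i l ih =>
    intro y hy
    exact (op_eqOn hU ih hy).trans
      (op_sum hU hΓ s (fun q => contDiffOn_mop hU hΓ (hH q) l A) i _ hy)

/-- Products of functions of one variable each. -/
theorem mop_prod {l : List ι} (hl : l.Nodup) (A : ι → List (Fin D)) (h : ι → Coord D → ℝ)
    (y : ι → Coord D) : mop Γ l A (fun y => ∏ i, h i (y i)) y =
      ∏ i, (if i ∈ l then covL Γ (A i) (h i) (y i) else h i (y i)) := by
  induction l generalizing y with
  | nil => simp [mop]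
  | cons i l ih =>
    have hil := (List.nodup_cons.1 hl).1
    change op Γ i (A i) (mop Γ l A _) y = _
    rw [funext (ih (List.nodup_cons.1 hl).2), ← Finset.mul_prod_erase _ _ (Finset.mem_univ i)]
    have h1 : (fun y : ι → Coord D => ∏ j, if j ∈ l then covL Γ (A j) (h j) (y j) else h j (y j)) =
        fun y => (∏ j ∈ Finset.univ.erase i,
          if j ∈ l then covL Γ (A j) (h j) (y j) else h j (y j)) * h i (y i) := by
      ext y
      rw [← Finset.mul_prod_erase _ _ (Finset.mem_univ i), if_neg hil, mul_comm]
    rw [h1, op_mul, mul_comm]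
    · congr 1
      · simp [op]
      · refine Finset.prod_congr rfl fun j hj => ?_
        have : j ≠ i := Finset.ne_of_mem_erase hj
        simp [this]
    · intro y v
      refine Finset.prod_congr rfl fun j hj => ?_
      rw [Function.update_of_ne (Finset.ne_of_mem_erase hj)]

end SeveralVariables

/-! ### Differentiation along the diagonal -/

section Diagonal

variable {D : ℕ} {ι : Type*} [Fintype ι] [DecidableEq ι]
variable {Γ : Coord D → Fin D → Fin D → Fin D → ℝ} {U : Set (Coord D)}

theorem pdv_mul {i : ι} {a : Fin D} {c H : (ι → Coord D) → ℝ}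
    (hc : ∀ y v, c (Function.update y i v) = c y) (y : ι → Coord D) :
    pdv i a (fun y => c y * H y) y = c y * pdv i a H y := by
  unfold pdv
  simp only [hc]
  exact congrArg (fun L => L (y i) (stdVec D a))
    (fderiv_const_smul_field (𝕜 := ℝ) (f := fun v => H (Function.update y i v)) (c y))

theorem pdv_sub (hU : IsOpen U) {H H' : (ι → Coord D) → ℝ} (hH : ContDiffOn ℝ ∞ H (powDom ι U))
    (hH' : ContDiffOn ℝ ∞ H' (powDom ι U)) (i : ι) (a : Fin D) {y : ι → Coord D}
    (hy : y ∈ powDom ι U) : pdv i a (fun y => H y - H' y) y = pdv i a H y - pdv i a H' y := by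
  have h1 := differentiableAt_of_contDiffOn hH (isOpen_powDom hU) hy
  have h2 := differentiableAt_of_contDiffOn hH' (isOpen_powDom hU) hy
  rw [pdv_eq_fderiv h1, pdv_eq_fderiv h2, pdv_eq_fderiv (h1.fun_sub h2), fderiv_fun_sub h1 h2]
  rfl

theorem pdv_sum (hU : IsOpen U) {κ : Type*} (s : Finset κ) {H : κ → (ι → Coord D) → ℝ}
    (hH : ∀ q, ContDiffOn ℝ ∞ (H q) (powDom ι U)) (i : ι) (a : Fin D) {y : ι → Coord D}
    (hy : y ∈ powDom ι U) : pdv i a (fun y => ∑ q ∈ s, H q y) y = ∑ q ∈ s, pdv i a (H q) y := by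
  have h1 := fun q => differentiableAt_of_contDiffOn (hH q) (isOpen_powDom hU) hy
  rw [pdv_eq_fderiv (DifferentiableAt.fun_sum fun q _ => h1 q), fderiv_fun_sum fun q _ => h1 q]
  simp [pdv_eq_fderiv (h1 _)]

theorem pdv_comm (hU : IsOpen U) {H : (ι → Coord D) → ℝ} (hH : ContDiffOn ℝ ∞ H (powDom ι U))
    (i j : ι) (a b : Fin D) {y : ι → Coord D} (hy : y ∈ powDom ι U) :
    pdv i a (pdv j b H) y = pdv j b (pdv i a H) y := by
  have hHy : ContDiffAt ℝ ∞ H y := hH.contDiffAt ((isOpen_powDom hU).mem_nhds hy)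
  have hs := hHy.isSymmSndFDerivAt (by simp; norm_cast)
  have hd : DifferentiableAt ℝ (fderiv ℝ H) y :=
    (hHy.fderiv_right (m := 1) (by norm_cast)).differentiableAt (by simp)
  have key : ∀ (i j : ι) (a b : Fin D), pdv i a (pdv j b H) y =
      fderiv ℝ (fderiv ℝ H) y (Pi.single i (stdVec D a)) (Pi.single j (stdVec D b)) := by
    intro i j a b
    have h1 : pdv j b H =ᶠ[𝓝 y] fun y => fderiv ℝ H y (Pi.single j (stdVec D b)) :=
      eventuallyEq_of_eqOn hU (fun z hz => pdv_eq_fderiv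
        (differentiableAt_of_contDiffOn hH (isOpen_powDom hU) hz)) hy
    rw [(pdv_congr h1).eq_of_nhds, pdv_eq_fderiv (hd.clm_apply (by fun_prop)),
      fderiv_clm_apply hd (by fun_prop)]
    simp
  rw [key, key, hs.eq]

theorem pdv_op_comm (hU : IsOpen U) (hΓ : ∀ c a b, ContDiffOn ℝ ∞ (fun y => Γ y c a b) U)
    {H : (ι → Coord D) → ℝ} (hH : ContDiffOn ℝ ∞ H (powDom ι U)) {i j : ι} (hij : j ≠ i)
    (a : Fin D) (A : List (Fin D)) :
    Set.EqOn (pdv i a (op Γ j A H)) (op Γ j A (pdv i a H)) (powDom ι U) := by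
  induction A using list_induction with
  | h0 => simp only [op_nil]; exact fun _ _ => rfl
  | h1 b A ih ih' =>
    intro y hy
    have hsm : ∀ A, ContDiffOn ℝ ∞ (op Γ j A H) (powDom ι U) := contDiffOn_op hU hΓ hH j
    have hterm : ∀ (t : Fin A.length) (d : Fin D), ContDiffOn ℝ ∞ (fun y : ι → Coord D =>
        Γ (y j) d b (A.get t) * op Γ j (List.ofFn (Function.update A.get t d)) H y)
        (powDom ι U) := fun t d => (contDiffOn_coef hΓ j _ _ _).mul (hsm _)
    rw [op_cons, op_cons, pdv_sub hU (contDiffOn_pdv hU (hsm A) j b)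
      (ContDiffOn.sum fun t _ => ContDiffOn.sum fun d _ => hterm t d) i a hy,
      pdv_comm hU (hsm A) i j a b hy, (pdv_congr (eventuallyEq_of_eqOn hU ih hy)).eq_of_nhds,
      pdv_sum hU _ (fun t => ContDiffOn.sum fun d _ => hterm t d) i a hy]
    congr 1
    refine Finset.sum_congr rfl fun t _ => ?_
    rw [pdv_sum hU _ (hterm t) i a hy]
    refine Finset.sum_congr rfl fun d _ => ?_
    rw [pdv_mul fun y v => by rw [Function.update_of_ne hij], ih' _ (by simp) hy]

theorem pdv_mop_of_notMem (hU : IsOpen U) (hΓ : ∀ c a b, ContDiffOn ℝ ∞ (fun y => Γ y c a b) U)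
    {H : (ι → Coord D) → ℝ} (hH : ContDiffOn ℝ ∞ H (powDom ι U)) {i : ι} (a : Fin D) {l : List ι}
    (hl : i ∉ l) (A : ι → List (Fin D)) :
    Set.EqOn (pdv i a (mop Γ l A H)) (mop Γ l A (pdv i a H)) (powDom ι U) := by
  induction l with
  | nil => exact fun _ _ => rfl
  | cons j l ih =>
    simp only [List.mem_cons, not_or] at hl
    intro y hy
    exact (pdv_op_comm hU hΓ (contDiffOn_mop hU hΓ hH l A) (Ne.symm hl.1) a (A j) hy).trans
      (op_eqOn hU (ih hl.2) hy)

/-- The partial derivative with respect to a variable in the list acts on the multi-index of that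
variable. -/
theorem pdv_mop_of_mem (hU : IsOpen U) (hΓ : ∀ c a b, ContDiffOn ℝ ∞ (fun y => Γ y c a b) U)
    {H : (ι → Coord D) → ℝ} (hH : ContDiffOn ℝ ∞ H (powDom ι U)) {i : ι} (a : Fin D) {l : List ι}
    (hl : l.Nodup) (hi : i ∈ l) (A : ι → List (Fin D)) :
    Set.EqOn (pdv i a (mop Γ l A H)) (fun y => slotDeriv Γ (y i) a (A i)
      fun L => mop Γ l (Function.update A i L) H y) (powDom ι U) := by
  induction l with
  | nil => simp at hi
  | cons j l ih =>
    have hjl := (List.nodup_cons.1 hl).1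
    intro y hy
    by_cases hji : j = i
    · subst hji
      have h1 : ∀ L, mop Γ l (Function.update A j L) H = mop Γ l A H := fun L =>
        mop_congr_list (fun k hk => by
          rw [Function.update_of_ne (ne_of_mem_of_not_mem hk hjl)]) H
      change pdv j a (op Γ j (A j) _) y = _
      rw [pdv_op]
      congr 1
      ext L
      change _ = op Γ j (Function.update A j L j) (mop Γ l _ H) y
      rw [h1, Function.update_self]
      rfl
    · have hil : i ∈ l := (List.mem_cons.1 hi).resolve_left (Ne.symm hji)
      have hsm : ∀ A, ContDiffOn ℝ ∞ (mop Γ l A H) (powDom ι U) := contDiffOn_mop hU hΓ hH l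
      have hj : ∀ L, mop Γ (j :: l) (Function.update A i L) H =
          op Γ j (A j) (mop Γ l (Function.update A i L) H) := fun L => by
        change op Γ j (Function.update A i L j) (mop Γ l (Function.update A i L) H) = _
        rw [Function.update_of_ne hji]
      have hterm : ∀ (t : Fin (A i).length) (d : Fin D), ContDiffOn ℝ ∞ (fun y : ι → Coord D =>
          Γ (y i) d a ((A i).get t) * mop Γ l (Function.update A i
            (List.ofFn (Function.update (A i).get t d))) H y) (powDom ι U) := fun t d =>
        (contDiffOn_coef hΓ i _ _ _).mul (hsm _)
      change pdv i a (op Γ j (A j) (mop Γ l A H)) y = _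
      rw [pdv_op_comm hU hΓ (hsm A) hji a (A j) hy, op_eqOn hU (ih (List.nodup_cons.1 hl).2 hil) hy]
      simp only [slotDeriv_apply, hj]
      rw [op_add hU hΓ (hsm _)
        (ContDiffOn.sum fun t _ => ContDiffOn.sum fun d _ => hterm t d) j _ hy]
      dsimp only
      rw [op_sum hU hΓ _ (fun t => ContDiffOn.sum fun d _ => hterm t d) j _ hy]
      congr 1
      refine Finset.sum_congr rfl fun t _ => ?_
      rw [op_sum hU hΓ _ (hterm t) j _ hy]
      refine Finset.sum_congr rfl fun d _ => ?_
      rw [op_mul fun y v => by rw [Function.update_of_ne (Ne.symm hji)]]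

/-- The derivative of the restriction to the diagonal is the sum of the derivatives with respect to
the variables. -/
theorem pd_diagonal {G : (ι → Coord D) → ℝ} (a : Fin D) (w : Coord D)
    (hG : DifferentiableAt ℝ G fun _ => w) :
    pd a (fun w => G fun _ => w) w = ∑ i, pdv i a G fun _ => w := by
  have h1 : HasFDerivAt (fun w : Coord D => fun _ : ι => w)
      (ContinuousLinearMap.pi fun _ => ContinuousLinearMap.id ℝ (Coord D)) w :=
    hasFDerivAt_pi.2 fun _ => hasFDerivAt_id w
  have h2 := (hG.hasFDerivAt.comp w h1).fderiv
  unfold pd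
  change fderiv ℝ (G ∘ fun w : Coord D => fun _ : ι => w) w _ = _
  rw [h2, ContinuousLinearMap.comp_apply]
  simp only [pdv_eq_fderiv hG, ← map_sum]
  congr 1
  ext i : 1
  simp [Finset.sum_apply, Pi.single_apply]

/-- The Leibniz rule on the diagonal of `M^n × M`, solved for the derivative with respect to the
last variable, which is labelled by `none`. -/
theorem mop_pdv_none {n : ℕ} (hU : IsOpen U) (hΓ : ∀ c a b, ContDiffOn ℝ ∞ (fun y => Γ y c a b) U)
    {K : (Option (Fin n) → Coord D) → ℝ} (hK : ContDiffOn ℝ ∞ K (powDom (Option (Fin n)) U))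
    (a : Fin D) (A : Option (Fin n) → List (Fin D)) {w : Coord D} (hw : w ∈ U) :
    mop Γ ((List.finRange n).map some) A (pdv none a K) (fun _ => w) =
      pd a (fun w => mop Γ ((List.finRange n).map some) A K fun _ => w) w -
        ∑ i : Fin n, slotDeriv Γ w a (A (some i)) fun L =>
          mop Γ ((List.finRange n).map some) (Function.update A (some i) L) K fun _ => w := by
  have hw' : (fun _ => w) ∈ powDom (Option (Fin n)) U := mem_powDom.2 fun _ => hw
  have hl : ((List.finRange n).map some).Nodup :=
    (List.nodup_finRange n).map (Option.some_injective _)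
  rw [pd_diagonal a w (differentiableAt_of_contDiffOn (contDiffOn_mop hU hΓ hK _ A)
    (isOpen_powDom hU) hw'), Fintype.sum_option, pdv_mop_of_notMem hU hΓ hK a (by simp) A hw']
  have h : ∀ i : Fin n, pdv (some i) a (mop Γ ((List.finRange n).map some) A K) (fun _ => w) =
      slotDeriv Γ w a (A (some i)) fun L =>
        mop Γ ((List.finRange n).map some) (Function.update A (some i) L) K fun _ => w :=
    fun i => pdv_mop_of_mem hU hΓ hK a hl (by simp) A hw'
  simp only [h]
  ring

/-- The derivatives with respect to the variables `some i` do not affect the variable `none`. -/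
theorem mop_map_some {n : ℕ} (l : List (Fin n)) (A : Option (Fin n) → List (Fin D))
    (H : (Option (Fin n) → Coord D) → ℝ) (y : Option (Fin n) → Coord D) :
    mop Γ (l.map some) A H y = mop Γ l (fun i => A (some i))
      (fun x => H fun o => o.elim (y none) x) (fun i => y (some i)) := by
  induction l generalizing y with
  | nil =>
    change H y = H _
    congr 1
    ext o : 1
    cases o <;> rfl
  | cons i l ih =>
    change covL Γ (A (some i)) (fun v => mop Γ (l.map some) A H (Function.update y (some i) v)) _ =
      covL Γ (A (some i)) (fun v => mop Γ l _ _ (Function.update _ i v)) _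
    congr 1
    ext v
    rw [ih]
    congr 1
    ext j : 1
    by_cases h : j = i
    · subst h; simp
    · have : (some j : Option (Fin n)) ≠ some i := by simpa using h
      rw [Function.update_of_ne h, Function.update_of_ne this]

theorem map_update {n : ℕ} (A : Fin n → List (Fin D)) (i : Fin n) (L : List (Fin D)) :
    Finset.univ.val.map (Function.update A i L) = L ::ₘ (Finset.univ.val.map A).erase (A i) := by
  have h : ∀ A : Fin n → List (Fin D), Finset.univ.val.map A =
      A i ::ₘ (Finset.univ.erase i).val.map A := fun A => by
    rw [← Multiset.map_cons, ← Finset.insert_val_of_notMem (Finset.notMem_erase i _),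
      Finset.insert_erase (Finset.mem_univ i)]
  rw [h, h A, Multiset.erase_cons_head, Function.update_self]
  congr 1
  refine Multiset.map_congr rfl fun j hj => Function.update_of_ne ?_ _ _
  exact Finset.ne_of_mem_erase (Finset.mem_def.2 hj)

/-- If the covariant derivatives on the diagonal of a function of `(x_1, …, x_n; z)` with respect to
the `x_i` are the components of a family `f` of tensor fields that obeys the Leibniz rule, then
all derivatives that involve `z` vanish on the diagonal. -/
theorem mop_op_none_eq_zero {n : ℕ} (hU : IsOpen U)
    (hΓ : ∀ c a b, ContDiffOn ℝ ∞ (fun y => Γ y c a b) U)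
    {K : (Option (Fin n) → Coord D) → ℝ} (hK : ContDiffOn ℝ ∞ K (powDom (Option (Fin n)) U))
    {f : Coord D → Multiset (List (Fin D)) → ℝ}
    (hf : ∀ w ∈ U, ∀ A : Option (Fin n) → List (Fin D),
      mop Γ ((List.finRange n).map some) A K (fun _ => w) =
        f w (Finset.univ.val.map fun i => A (some i)))
    (hL : ∀ w ∈ U, ∀ a s, pd a (fun y => f y s) w = deriveFn (slotDeriv Γ w a) (f w) s)
    {b : List (Fin D)} (hb : b ≠ []) {w : Coord D} (hw : w ∈ U)
    (A : Option (Fin n) → List (Fin D)) :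
    mop Γ ((List.finRange n).map some) A (op Γ none b K) (fun _ => w) = 0 := by
  have hw' : (fun _ => w) ∈ powDom (Option (Fin n)) U := mem_powDom.2 fun _ => hw
  induction b using list_induction generalizing w A with
  | h0 => exact absurd rfl hb
  | h1 a b ih ih' =>
    have hsm : ∀ b, ContDiffOn ℝ ∞ (op Γ none b K) (powDom (Option (Fin n)) U) :=
      contDiffOn_op hU hΓ hK none
    by_cases hb' : b = []
    · subst hb'
      rw [op_cons, op_nil]
      simp only [List.length_nil, Finset.univ_eq_empty, Finset.sum_empty, sub_zero]
      change mop Γ _ A (pdv none a K) _ = 0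
      rw [mop_pdv_none hU hΓ hK a A hw]
      have h1 : (fun w => mop Γ ((List.finRange n).map some) A K fun _ => w) =ᶠ[𝓝 w]
          fun w => f w (Finset.univ.val.map fun i => A (some i)) :=
        Filter.eventuallyEq_of_mem (hU.mem_nhds hw) fun z hz => hf z hz A
      rw [pd_congr h1, hL w hw, sub_eq_zero, deriveFn, Multiset.map_map]
      change ∑ i, _ = _
      refine Finset.sum_congr rfl fun i _ => ?_
      simp only [Function.comp]
      congr 1
      ext L
      rw [hf w hw, ← map_update (fun i => A (some i)) i L]
      congr 2
      ext j : 1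
      by_cases h : j = i
      · subst h; simp
      · have : (some j : Option (Fin n)) ≠ some i := by simpa using h
        rw [Function.update_of_ne h, Function.update_of_ne this]
    · have h1 : ∀ z ∈ U, ∀ A, mop Γ ((List.finRange n).map some) A (op Γ none b K)
          (fun _ => z) = 0 := fun z hz A => ih hb' hz A (mem_powDom.2 fun _ => hz)
      have h2 : ∀ (j : Fin b.length) (d : Fin D), mop Γ ((List.finRange n).map some) A
          (op Γ none (List.ofFn (Function.update b.get j d)) K) (fun _ => w) = 0 := fun j d =>
        ih' _ (by simp) (by simpa [← List.length_pos_iff_ne_nil] using j.pos) hw A hw'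
      have hterm : ∀ (j : Fin b.length) (d : Fin D), ContDiffOn ℝ ∞
          (fun y : Option (Fin n) → Coord D => -(Γ (y none) d a (b.get j)) *
            op Γ none (List.ofFn (Function.update b.get j d)) K y)
          (powDom (Option (Fin n)) U) := fun j d =>
        (contDiffOn_coef hΓ none _ _ _).neg.mul (hsm _)
      have h3 : op Γ none (a :: b) K = fun y => pdv none a (op Γ none b K) y +
          ∑ j : Fin b.length, ∑ d, -(Γ (y none) d a (b.get j)) *
            op Γ none (List.ofFn (Function.update b.get j d)) K y := by
        rw [op_cons]
        ext y
        simp [sub_eq_add_neg]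
      rw [h3, mop_add hU hΓ (contDiffOn_pdv hU (hsm b) none a)
        (ContDiffOn.sum fun j _ => ContDiffOn.sum fun d _ => hterm j d) _ A hw']
      dsimp only
      rw [mop_pdv_none hU hΓ (hsm b) a A hw,
        mop_sum hU hΓ _ (fun j => ContDiffOn.sum fun d _ => hterm j d) _ A hw']
      have h4 : (fun w => mop Γ ((List.finRange n).map some) A (op Γ none b K) fun _ => w) =ᶠ[𝓝 w]
          fun _ => 0 := Filter.eventuallyEq_of_mem (hU.mem_nhds hw) fun z hz => h1 z hz A
      have h5 : ∀ i : Fin n, (fun L => mop Γ ((List.finRange n).map some)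
          (Function.update A (some i) L) (op Γ none b K) fun _ => w) = 0 :=
        fun i => funext fun L => h1 w hw _
      simp only [pd_congr h4, pd_const, h5, map_zero, Finset.sum_const_zero, sub_zero, zero_add]
      refine Finset.sum_eq_zero fun j _ => ?_
      rw [mop_sum hU hΓ _ (hterm j) _ A hw']
      refine Finset.sum_eq_zero fun d _ => ?_
      rw [mop_mul, h2, mul_zero]
      intro i hi y v
      obtain ⟨i', -, rfl⟩ := List.mem_map.1 hi
      rw [Function.update_of_ne (by simp)]

end Diagonal

/-! ### Partial and covariant derivatives -/

section Combinations

variable {D : ℕ} {U : Set (Coord D)} {Γ : Coord D → Fin D → Fin D → Fin D → ℝ}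

/-- Iterated partial derivatives along a list of indices, the outermost one being the first. -/
def dL {V : Type*} [NormedAddCommGroup V] [NormedSpace ℝ V] (B : List (Fin D)) (u : Coord D → V) :
    Coord D → V :=
  B.foldr (fun a g => pd a g) u

theorem contDiffOn_dL {V : Type*} [NormedAddCommGroup V] [NormedSpace ℝ V] (hU : IsOpen U)
    {u : Coord D → V} (hu : ContDiffOn ℝ ∞ u U) (B : List (Fin D)) :
    ContDiffOn ℝ ∞ (dL B u) U := by
  induction B with
  | nil => exact hu
  | cons a B ih => exact contDiffOn_pd hU ih

theorem pd_eqOn {V : Type*} [NormedAddCommGroup V] [NormedSpace ℝ V] (hU : IsOpen U)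
    {u v : Coord D → V} (h : Set.EqOn u v U) (a : Fin D) : Set.EqOn (pd a u) (pd a v) U :=
  fun _ hy => pd_congr (Filter.eventuallyEq_of_mem (hU.mem_nhds hy) h)

theorem dL_perm {V : Type*} [NormedAddCommGroup V] [NormedSpace ℝ V] (hU : IsOpen U)
    {u : Coord D → V} (hu : ContDiffOn ℝ ∞ u U) {B B' : List (Fin D)} (h : B.Perm B') :
    Set.EqOn (dL B u) (dL B' u) U := by
  induction h with
  | nil => exact fun _ _ => rfl
  | cons a _ ih => exact pd_eqOn hU ih a
  | swap a b B => exact fun y hy => pd_comm hU (contDiffOn_dL hU hu B) hy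
  | trans _ _ ih ih' => exact ih.trans ih'

/-- The multi-indices of length at most `N`. -/
def lists (D N : ℕ) : Finset (List (Fin D)) := (List.finite_length_le (Fin D) N).toFinset

theorem mem_lists {N : ℕ} {B : List (Fin D)} : B ∈ lists D N ↔ B.length ≤ N := by
  simp [lists]

/-- Operators on functions on `ℝ^D` with values in arbitrary normed spaces. The coefficients of a
combination of operators are to be the same for real and for complex functions. -/
abbrev Operator (D : ℕ) := (V : Type) → [NormedAddCommGroup V] → [NormedSpace ℝ V] →
  (Coord D → V) → Coord D → V

/-- On `U`, the operator `Q` is a linear combination with smooth real coefficients of the operators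
`P B` with `B` of length at most `N`. -/
def IsCombination (U : Set (Coord D)) (P : List (Fin D) → Operator D) (N : ℕ) (Q : Operator D) :
    Prop :=
  ∃ b : List (Fin D) → Coord D → ℝ, (∀ B, ContDiffOn ℝ ∞ (b B) U) ∧
    (∀ B, N < B.length → b B = 0) ∧
    ∀ (V : Type) [NormedAddCommGroup V] [NormedSpace ℝ V] (u : Coord D → V), ContDiffOn ℝ ∞ u U →
      ∀ y ∈ U, Q V u y = ∑ B ∈ lists D N, b B y • P B V u y

namespace IsCombination

variable {P : List (Fin D) → Operator D} {N : ℕ} {Q Q' : Operator D}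

theorem base {B : List (Fin D)} (hB : B.length ≤ N) : IsCombination U P N (P B) := by
  classical
  refine ⟨fun B' _ => if B' = B then 1 else 0, fun _ => contDiffOn_const, fun B' h => ?_,
    fun V _ _ u _ y _ => ?_⟩
  · have : B' ≠ B := fun h' => absurd hB (by rw [← h']; omega)
    ext y
    simp [this]
  · simp [ite_smul, mem_lists, hB]

theorem congr (h : IsCombination U P N Q) (hQ : ∀ (V : Type) [NormedAddCommGroup V]
    [NormedSpace ℝ V] (u : Coord D → V), ContDiffOn ℝ ∞ u U → ∀ y ∈ U, Q' V u y = Q V u y) :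
    IsCombination U P N Q' := by
  obtain ⟨b, h1, h2, h3⟩ := h
  exact ⟨b, h1, h2, fun V _ _ u hu y hy => (hQ V u hu y hy).trans (h3 V u hu y hy)⟩

theorem mono {N' : ℕ} (hN : N ≤ N') (h : IsCombination U P N Q) : IsCombination U P N' Q := by
  obtain ⟨b, h1, h2, h3⟩ := h
  refine ⟨b, h1, fun B hB => h2 B (hN.trans_lt hB), fun V _ _ u hu y hy => ?_⟩
  rw [h3 V u hu y hy]
  refine Finset.sum_subset (fun B hB => mem_lists.2 ((mem_lists.1 hB).trans hN)) fun B _ hB => ?_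
  rw [h2 B (by simpa [mem_lists] using hB)]
  simp

theorem add (h : IsCombination U P N Q) (h' : IsCombination U P N Q') :
    IsCombination U P N fun V _ _ u y => Q V u y + Q' V u y := by
  obtain ⟨b, h1, h2, h3⟩ := h
  obtain ⟨b', h1', h2', h3'⟩ := h'
  refine ⟨fun B y => b B y + b' B y, fun B => (h1 B).add (h1' B), fun B hB => ?_,
    fun V _ _ u hu y hy => ?_⟩
  · ext y
    simp [h2 B hB, h2' B hB]
  · simp only [h3 V u hu y hy, h3' V u hu y hy, add_smul, Finset.sum_add_distrib]

theorem smul {r : Coord D → ℝ} (hr : ContDiffOn ℝ ∞ r U) (h : IsCombination U P N Q) :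
    IsCombination U P N fun V _ _ u y => r y • Q V u y := by
  obtain ⟨b, h1, h2, h3⟩ := h
  refine ⟨fun B y => r y * b B y, fun B => hr.mul (h1 B), fun B hB => ?_,
    fun V _ _ u hu y hy => ?_⟩
  · ext y
    simp [h2 B hB]
  · simp only [h3 V u hu y hy, Finset.smul_sum, smul_smul]

theorem sum {κ : Type*} {s : Finset κ} {Q : κ → Operator D}
    (h : ∀ q ∈ s, IsCombination U P N (Q q)) :
    IsCombination U P N fun V _ _ u y => ∑ q ∈ s, Q q V u y := by
  classical
  induction s using Finset.induction_on with
  | empty =>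
    exact ⟨fun _ _ => 0, fun _ => contDiffOn_const, fun _ _ => rfl, fun V _ _ u _ y _ => by simp⟩
  | insert q s hq ih =>
    refine ((h q (by simp)).add (ih fun q hq => h q (by simp [hq]))).congr fun V _ _ u _ y _ => ?_
    rw [Finset.sum_insert hq]

theorem pd (hU : IsOpen U)
    (hP : ∀ B (V : Type) [NormedAddCommGroup V] [NormedSpace ℝ V] (u : Coord D → V),
      ContDiffOn ℝ ∞ u U → ContDiffOn ℝ ∞ (P B V u) U) {a : Fin D}
    (hpd : ∀ B, B.length ≤ N →
      IsCombination U P (N + 1) fun V _ _ u => WickField.pd a (P B V u))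
    (h : IsCombination U P N Q) :
    IsCombination U P (N + 1) fun V _ _ u => WickField.pd a (Q V u) := by
  obtain ⟨b, h1, -, h3⟩ := h
  have h4 : IsCombination U P (N + 1) fun V _ _ u y =>
      ∑ B ∈ lists D N, (WickField.pd a (b B) y • P B V u y + b B y • WickField.pd a (P B V u) y) :=
    IsCombination.sum fun B hB =>
      (IsCombination.smul (contDiffOn_pd hU (h1 B)) (base ((mem_lists.1 hB).trans N.le_succ))).add
        (IsCombination.smul (h1 B) (hpd B (mem_lists.1 hB)))
  refine h4.congr fun V _ _ u hu y hy => ?_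
  have hd : ∀ {W : Type} [NormedAddCommGroup W] [NormedSpace ℝ W] {f : Coord D → W},
      ContDiffOn ℝ ∞ f U → DifferentiableAt ℝ f y := fun hf =>
    differentiableAt_of_contDiffOn hf hU hy
  rw [pd_eqOn hU (fun y hy => h3 V u hu y hy) a hy,
    pd_sum _ fun B _ => (hd (h1 B)).fun_smul (hd (hP B V u hu))]
  exact Finset.sum_congr rfl fun B _ => pd_smul (hd (h1 B)) (hd (hP B V u hu))

end IsCombination

/-- A covariant derivative is a combination of partial derivatives of at most the same order. -/
theorem isCombination_covL (hU : IsOpen U) (hΓ : ∀ c a b, ContDiffOn ℝ ∞ (fun y => Γ y c a b) U)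
    (A : List (Fin D)) :
    IsCombination U (fun B _ _ _ u => dL B u) A.length fun _ _ _ u => covL Γ A u := by
  induction A using list_induction with
  | h0 => exact IsCombination.base (P := fun B _ _ _ u => dL B u) (B := []) le_rfl
  | h1 a A ih ih' =>
    have h1 := ih.pd hU (fun B V _ _ u hu => contDiffOn_dL hU hu B) (a := a) fun B hB =>
      IsCombination.base (P := fun B _ _ _ u => dL B u) (B := a :: B) (by simpa using hB)
    have h2 : IsCombination U (fun B _ _ _ u => dL B u) (A.length + 1) fun V _ _ u y =>
        ∑ j : Fin A.length, ∑ d, -(Γ y d a (A.get j)) •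
          covL Γ (List.ofFn (Function.update A.get j d)) u y :=
      IsCombination.sum fun j _ => IsCombination.sum fun d _ =>
        IsCombination.smul (hΓ d a (A.get j)).neg
          ((ih' _ (by simp)).mono (by simp))
    refine (h1.add h2).congr fun V _ _ u _ y _ => ?_
    rw [covL_cons]
    simp [sub_eq_add_neg]

/-- A partial derivative is a combination of covariant derivatives of at most the same order. -/
theorem isCombination_dL (hU : IsOpen U) (hΓ : ∀ c a b, ContDiffOn ℝ ∞ (fun y => Γ y c a b) U)
    (B : List (Fin D)) :
    IsCombination U (fun A _ _ _ u => covL Γ A u) B.length fun _ _ _ u => dL B u := by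
  induction B with
  | nil => exact IsCombination.base (P := fun A _ _ _ u => covL Γ A u) (B := []) le_rfl
  | cons a B ih =>
    refine ih.pd hU (fun A V _ _ u hu => contDiffOn_covL hU hΓ hu A) fun A hA => ?_
    have h1 : IsCombination U (fun A _ _ _ u => covL Γ A u) (B.length + 1)
        fun V _ _ u => covL Γ (a :: A) u :=
      IsCombination.base (P := fun A _ _ _ u => covL Γ A u) (B := a :: A) (by simpa using hA)
    have h2 : IsCombination U (fun A _ _ _ u => covL Γ A u) (B.length + 1) fun V _ _ u y =>
        ∑ j : Fin A.length, ∑ d, Γ y d a (A.get j) •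
          covL Γ (List.ofFn (Function.update A.get j d)) u y :=
      IsCombination.sum fun j _ => IsCombination.sum fun d _ =>
        IsCombination.smul (hΓ d a (A.get j)) (IsCombination.base
          (P := fun A _ _ _ u => covL Γ A u) (by simp; omega))
    refine (h1.add h2).congr fun V _ _ u _ y _ => ?_
    rw [covL_cons]
    abel

end Combinations

/-! ### Taylor coefficients with prescribed covariant derivatives -/

section Jets

variable {D : ℕ} {U : Set (Coord D)} {Γ : Coord D → Fin D → Fin D → Fin D → ℝ}

/-- The normalized monomial `∏_a v_a^{s_a} / s_a!`, where `s_a` is the multiplicity of `a` in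
`s`. -/
def monom (s : Multiset (Fin D)) (v : Coord D) : ℝ := ∏ a, v a ^ s.count a / (s.count a).factorial

theorem contDiff_monom (s : Multiset (Fin D)) : ContDiff ℝ ∞ (monom s) := by
  unfold monom
  fun_prop

theorem monom_smul (s : Multiset (Fin D)) (t : ℝ) (v : Coord D) :
    monom s (t • v) = t ^ s.card * monom s v := by
  unfold monom
  rw [← Multiset.sum_count_eq_card (s := Finset.univ) fun a _ => Finset.mem_univ a,
    ← Finset.prod_pow_eq_pow_sum, ← Finset.prod_mul_distrib]
  refine Finset.prod_congr rfl fun a _ => ?_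
  rw [PiLp.smul_apply, smul_eq_mul, mul_pow, mul_div_assoc]

theorem monom_apply_zero (s : Multiset (Fin D)) : monom s 0 = if s = 0 then 1 else 0 := by
  by_cases h : s = 0
  · subst h
    simp [monom]
  · obtain ⟨a, ha⟩ := Multiset.exists_mem_of_ne_zero h
    rw [if_neg h]
    refine Finset.prod_eq_zero (Finset.mem_univ a) ?_
    have : s.count a ≠ 0 := (Multiset.count_pos.2 ha).ne'
    simp [this]

theorem pd_coord_pow (a b : Fin D) (n : ℕ) (v : Coord D) :
    pd a (fun v : Coord D => v b ^ n / n.factorial) v =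
      if b = a then n * v b ^ (n - 1) / n.factorial else 0 := by
  have h1 : HasFDerivAt (fun v : Coord D => v b) (EuclideanSpace.proj b : Coord D →L[ℝ] ℝ) v :=
    (EuclideanSpace.proj b : Coord D →L[ℝ] ℝ).hasFDerivAt
  have h2 : HasFDerivAt (fun v : Coord D => v b ^ n / n.factorial) _ v :=
    (h1.pow n).mul_const ((n.factorial : ℝ)⁻¹)
  unfold pd
  rw [h2.fderiv]
  by_cases hab : b = a
  · subst hab
    simp [stdVec]
    ring
  · simp [stdVec, hab]

theorem pd_monom (a : Fin D) (s : Multiset (Fin D)) :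
    pd a (monom s) = fun v => if a ∈ s then monom (s.erase a) v else 0 := by
  ext v
  unfold monom
  rw [pd_prod _ fun b _ => by fun_prop]
  simp only [pd_coord_pow, ite_mul, zero_mul, Finset.sum_ite_eq', Finset.mem_univ, if_true]
  split_ifs with h
  · rw [← Finset.mul_prod_erase _ _ (Finset.mem_univ a)]
    congr 1
    · obtain ⟨m, hm⟩ := Nat.exists_eq_succ_of_ne_zero (Multiset.count_pos.2 h).ne'
      rw [Multiset.count_erase_self, hm]
      simp only [Nat.succ_eq_add_one, Nat.add_sub_cancel, Nat.factorial_succ, Nat.cast_mul]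
      have h1 : ((m + 1 : ℕ) : ℝ) ≠ 0 := by positivity
      rw [mul_div_mul_left _ _ h1]
    · refine Finset.prod_congr rfl fun b hb => ?_
      rw [Multiset.count_erase_of_ne (Finset.ne_of_mem_erase hb)]
  · simp [Multiset.count_eq_zero_of_notMem h]

theorem dL_append (B : List (Fin D)) (a : Fin D) (u : Coord D → ℝ) :
    dL (B ++ [a]) u = dL B (pd a u) := by
  simp [dL]

theorem dL_zero (B : List (Fin D)) : dL B (fun _ : Coord D => (0 : ℝ)) = fun _ => 0 := by
  induction B with
  | nil => rfl
  | cons a B ih =>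
    change pd a (dL B _) = _
    rw [ih]
    exact funext fun y => pd_const a 0 y

/-- The partial derivatives at the origin of the normalized monomials are dual to the monomials. -/
theorem dL_monom_zero (B : List (Fin D)) (s : Multiset (Fin D)) :
    dL B (monom s) 0 = if (B : Multiset (Fin D)) = s then 1 else 0 := by
  induction B using List.reverseRecOn generalizing s with
  | nil =>
    change monom s 0 = _
    rw [monom_apply_zero]
    simp only [Multiset.coe_nil, eq_comm]
  | append_singleton B a ih =>
    have hB : ((B ++ [a] : List (Fin D)) : Multiset (Fin D)) = a ::ₘ (B : Multiset (Fin D)) := by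
      rw [← Multiset.coe_add, Multiset.coe_singleton, add_comm, Multiset.singleton_add]
    rw [dL_append, pd_monom, hB]
    by_cases h : a ∈ s
    · simp only [if_pos h]
      rw [show (fun v => monom (s.erase a) v) = monom (s.erase a) from rfl, ih]
      refine if_congr ?_ rfl rfl
      constructor
      · intro h'
        rw [h', Multiset.cons_erase h]
      · intro h'
        rw [← h', Multiset.erase_cons_head]
    · simp only [if_neg h]
      rw [dL_zero, if_neg]
      rintro rfl
      simp at h

theorem dL_comp_sub (B : List (Fin D)) (u : Coord D → ℝ) (w : Coord D) :
    dL B (fun y => u (y - w)) = fun y => dL B u (y - w) := by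
  induction B with
  | nil => rfl
  | cons a B ih =>
    change pd a (dL B _) = fun y => pd a (dL B u) (y - w)
    rw [ih]
    ext y
    unfold pd
    rw [fderiv_comp_sub]

/-- A relation between the values of `f` that holds in each factor separately holds in all factors
at once. -/
theorem sum_factors {α : Type*} {Λ : Finset α} {E : α → α → ℝ} {g : Multiset α → ℝ}
    (hg : ∀ a ∈ Λ, ∀ s, g (a ::ₘ s) = ∑ a' ∈ Λ, E a a' * g (a' ::ₘ s)) {n : ℕ} (A : Fin n → α)
    (hA : ∀ j, A j ∈ Λ) (s : Multiset α) : g (Finset.univ.val.map A + s) =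
      ∑ A' ∈ Fintype.piFinset fun _ : Fin n => Λ,
        (∏ j, E (A j) (A' j)) * g (Finset.univ.val.map A' + s) := by
  classical
  induction n generalizing s with
  | zero => simp
  | succ n ih =>
    have hmap : ∀ A : Fin (n + 1) → α, Finset.univ.val.map A =
        A 0 ::ₘ Finset.univ.val.map (Fin.tail A) := fun A => by
      rw [Fin.univ_succ, Finset.cons_val, Multiset.map_cons, Finset.map_val, Multiset.map_map]
      rfl
    rw [hmap, Multiset.cons_add, ← Multiset.add_cons, ih (Fin.tail A) (fun j => hA _)]
    simp_rw [Multiset.add_cons, hg _ (hA 0), Finset.mul_sum]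
    rw [← Finset.sum_product']
    refine Finset.sum_nbij' (fun p => Fin.cons p.2 p.1) (fun A => (Fin.tail A, A 0))
      (fun p hp => ?_) (fun A' hA' => ?_) (fun p _ => ?_) (fun A' _ => ?_) fun p _ => ?_
    · rw [Finset.mem_product, Fintype.mem_piFinset] at hp
      rw [Fintype.mem_piFinset]
      exact Fin.cases hp.2 hp.1
    · rw [Fintype.mem_piFinset] at hA'
      rw [Finset.mem_product, Fintype.mem_piFinset]
      exact ⟨fun j => hA' _, hA' 0⟩
    · simp
    · simp
    · rw [hmap, Fin.prod_univ_succ]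
      simp only [Fin.cons_zero, Fin.cons_succ, Fin.tail_cons, Multiset.cons_add, Fin.tail]
      ring

/-- A family of tensor components is compatible with the relations between covariant derivatives
of functions on `U`. -/
def Compatible (Γ : Coord D → Fin D → Fin D → Fin D → ℝ) (U : Set (Coord D))
    (f : Coord D → Multiset (List (Fin D)) → ℝ) : Prop :=
  ∀ (J : Type) [Fintype J] (b : J → Coord D → ℝ) (A : J → List (Fin D)),
    (∀ j, ContDiffOn ℝ ∞ (b j) U) →
    (∀ u : Coord D → ℂ, ContDiffOn ℝ ∞ u U → ∀ y ∈ U, ∑ j, b j y • covL Γ (A j) u y = 0) →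
    ∀ y ∈ U, ∀ s, ∑ j, b j y * f y (A j ::ₘ s) = 0

/-- The coefficients of the covariant derivatives `∇_A` of functions in terms of their iterated
partial derivatives `∂_B`, and conversely. -/
structure JetTransform (Γ : Coord D → Fin D → Fin D → Fin D → ℝ) (U : Set (Coord D)) where
  /-- `∇_A = ∑_B (toPartial A B) ∂_B` -/
  toPartial : List (Fin D) → List (Fin D) → Coord D → ℝ
  /-- `∂_B = ∑_A (toCov B A) ∇_A` -/
  toCov : List (Fin D) → List (Fin D) → Coord D → ℝ
  toPartial_smooth : ∀ A B, ContDiffOn ℝ ∞ (toPartial A B) U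
  toCov_smooth : ∀ A B, ContDiffOn ℝ ∞ (toCov A B) U
  toPartial_eq_zero : ∀ A B, A.length < B.length → toPartial A B = 0
  toCov_eq_zero : ∀ A B, A.length < B.length → toCov A B = 0
  covL_eq : ∀ (A : List (Fin D)) (N : ℕ), A.length ≤ N → ∀ (V : Type) [NormedAddCommGroup V]
    [NormedSpace ℝ V] (u : Coord D → V), ContDiffOn ℝ ∞ u U → ∀ y ∈ U,
      covL Γ A u y = ∑ B ∈ lists D N, toPartial A B y • dL B u y
  dL_eq : ∀ (B : List (Fin D)) (N : ℕ), B.length ≤ N → ∀ (V : Type) [NormedAddCommGroup V]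
    [NormedSpace ℝ V] (u : Coord D → V), ContDiffOn ℝ ∞ u U → ∀ y ∈ U,
      dL B u y = ∑ A ∈ lists D N, toCov B A y • covL Γ A u y

theorem nonempty_jetTransform (hU : IsOpen U)
    (hΓ : ∀ c a b, ContDiffOn ℝ ∞ (fun y => Γ y c a b) U) : Nonempty (JetTransform Γ U) := by
  choose C hC1 hC2 hC3 using fun A => isCombination_covL (Γ := Γ) hU hΓ A
  choose T hT1 hT2 hT3 using fun B => isCombination_dL (Γ := Γ) hU hΓ B
  have hsub : ∀ {k N : ℕ}, k ≤ N → lists D k ⊆ lists D N := fun h B hB =>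
    mem_lists.2 ((mem_lists.1 hB).trans h)
  refine ⟨⟨C, T, hC1, hT1, hC2, hT2, fun A N hA V _ _ u hu y hy => ?_,
    fun B N hB V _ _ u hu y hy => ?_⟩⟩
  · refine (hC3 A V u hu y hy).trans (Finset.sum_subset (hsub hA) fun B _ hB => ?_)
    rw [hC2 A B (by simpa [mem_lists] using hB)]
    simp
  · refine (hT3 B V u hu y hy).trans (Finset.sum_subset (hsub hB) fun A _ hA => ?_)
    rw [hT2 B A (by simpa [mem_lists] using hA)]
    simp

theorem covL_monom (X : JetTransform Γ U) {A : List (Fin D)} {N : ℕ} (hA : A.length ≤ N)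
    (s : Multiset (Fin D)) {w : Coord D} (hw : w ∈ U) :
    covL Γ A (fun y => monom s (y - w)) w =
      ∑ B ∈ lists D N, X.toPartial A B w * if (B : Multiset (Fin D)) = s then 1 else 0 := by
  have hs : ContDiffOn ℝ ∞ (fun y => monom s (y - w)) U :=
    ((contDiff_monom s).comp (contDiff_id.sub contDiff_const)).contDiffOn
  rw [X.covL_eq A N hA ℝ _ hs w hw]
  refine Finset.sum_congr rfl fun B _ => ?_
  rw [dL_comp_sub]
  dsimp only
  rw [sub_self, dL_monom_zero, smul_eq_mul]

/-- The Taylor coefficients at `w`, labelled by the exponents of monomials in `n` points, of a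
function whose covariant derivatives at `w` are given by the family `f`. The order in which the
entries of an exponent are taken as a multi-index of partial derivatives is arbitrary. -/
def JetTransform.taylor (X : JetTransform Γ U) (f : Coord D → Multiset (List (Fin D)) → ℝ) {n : ℕ}
    (μ : Fin n → Multiset (Fin D)) (w : Coord D) : ℝ :=
  ∑ A ∈ Fintype.piFinset fun j => lists D (μ j).card,
    (∏ j, X.toCov (μ j).toList (A j) w) * f w (Finset.univ.val.map A)

namespace JetTransform

variable (X : JetTransform Γ U) {f : Coord D → Multiset (List (Fin D)) → ℝ} {n : ℕ}

theorem contDiffOn_taylor (hf : ∀ s, ContDiffOn ℝ ∞ (fun y => f y s) U)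
    (μ : Fin n → Multiset (Fin D)) : ContDiffOn ℝ ∞ (X.taylor f μ) U :=
  ContDiffOn.sum fun _ _ => (contDiffOn_prod fun _ _ => X.toCov_smooth _ _).mul (hf _)

theorem taylor_eq (μ : Fin n → Multiset (Fin D)) {N : ℕ} (hN : ∀ j, (μ j).card ≤ N) (w : Coord D) :
    X.taylor f μ w = ∑ A ∈ Fintype.piFinset fun _ => lists D N,
      (∏ j, X.toCov (μ j).toList (A j) w) * f w (Finset.univ.val.map A) := by
  refine Finset.sum_subset (Fintype.piFinset_subset _ _ fun j B hB =>
    mem_lists.2 ((mem_lists.1 hB).trans (hN j))) fun A _ hA => ?_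
  simp only [Fintype.mem_piFinset, mem_lists, not_forall, not_le] at hA
  obtain ⟨j, hj⟩ := hA
  rw [Finset.prod_eq_zero (Finset.mem_univ j), zero_mul]
  rw [X.toCov_eq_zero _ _ (by rwa [Multiset.length_toList])]
  rfl

theorem taylor_perm (μ : Fin n → Multiset (Fin D)) (π : Equiv.Perm (Fin n)) (w : Coord D) :
    X.taylor f (μ ∘ π) w = X.taylor f μ w := by
  have hN : ∀ j, (μ j).card ≤ ∑ i, (μ i).card := fun j =>
    Finset.single_le_sum (f := fun i => (μ i).card) (fun _ _ => Nat.zero_le _) (Finset.mem_univ j)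
  rw [X.taylor_eq (μ ∘ π) (fun j => hN (π j)), X.taylor_eq μ hN]
  refine Finset.sum_nbij' (fun A => A ∘ π.symm) (fun A => A ∘ π) (fun A hA => ?_) (fun A hA => ?_)
    (fun A _ => ?_) (fun A _ => ?_) fun A _ => ?_
  · rw [Fintype.mem_piFinset] at hA ⊢
    exact fun j => hA _
  · rw [Fintype.mem_piFinset] at hA ⊢
    exact fun j => hA _
  · ext1 j; simp
  · ext1 j; simp
  · congr 1
    · rw [← Equiv.prod_comp π fun j => X.toCov (μ j).toList ((A ∘ π.symm) j) w]
      simp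
    · congr 1
      rw [← Multiset.map_map, Multiset.map_univ_val_equiv]

/-- The identity `∇_A = ∑_B ∑_{A'} (toPartial A B) (toCov B A') ∇_{A'}` for functions is passed on
to a compatible family. The multi-index `B` is replaced with an ordering that only depends on its
multiset, which is allowed since partial derivatives commute. -/
theorem cons_eq_sum (hU : IsOpen U) (hf : Compatible Γ U f) {N : ℕ} {A : List (Fin D)}
    (hA : A ∈ lists D N) {w : Coord D} (hw : w ∈ U) (s : Multiset (List (Fin D))) :
    f w (A ::ₘ s) = ∑ A' ∈ lists D N, (∑ B ∈ lists D N, X.toPartial A B w *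
      X.toCov (B : Multiset (Fin D)).toList A' w) * f w (A' ::ₘ s) := by
  let E : List (Fin D) → Coord D → ℝ := fun A' w => ∑ B ∈ lists D N, X.toPartial A B w *
      X.toCov (B : Multiset (Fin D)).toList A' w
  have h := hf (Option (lists D N)) (fun o => o.elim (fun _ => 1) fun A' y => -E A' y)
    (fun o => o.elim A fun A' => A') ?_ ?_ w hw s
  · simp only [Fintype.sum_option, Option.elim_none, Option.elim_some, one_mul, neg_mul,
      Finset.sum_neg_distrib, Finset.univ_eq_attach] at h
    rw [Finset.sum_attach (lists D N) fun A' => E A' w * f w (A' ::ₘ s)] at h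
    linarith
  · rintro (_ | A')
    · exact contDiffOn_const
    · exact (ContDiffOn.sum fun B _ => (X.toPartial_smooth _ _).mul (X.toCov_smooth _ _)).neg
  · intro u hu y hy
    simp only [Fintype.sum_option, Option.elim_none, Option.elim_some, one_smul, neg_smul,
      Finset.sum_neg_distrib, Finset.univ_eq_attach]
    rw [Finset.sum_attach (lists D N) fun A' => E A' y • covL Γ A' u y, ← sub_eq_add_neg,
      sub_eq_zero, X.covL_eq A N (mem_lists.1 hA) ℂ u hu y hy]
    simp only [E, Finset.sum_smul]
    rw [Finset.sum_comm]
    refine Finset.sum_congr rfl fun B hB => ?_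
    have hp : B.Perm (B : Multiset (Fin D)).toList :=
      Multiset.coe_eq_coe.1 (Multiset.coe_toList _).symm
    rw [dL_perm hU hu hp hy, X.dL_eq _ N (by rw [← hp.length_eq]; exact mem_lists.1 hB) ℂ u hu y hy,
      Finset.smul_sum]
    simp only [smul_smul]

end JetTransform

/-- The exponents of the monomials of degree `d` in `n` points. -/
def exponents (D n d : ℕ) : Finset (Fin n → Multiset (Fin D)) :=
  {μ ∈ Fintype.piFinset fun _ => Finset.Icc 0 (d • (Finset.univ : Finset (Fin D)).val) |
    ∑ j, (μ j).card = d}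

theorem mem_exponents {n d : ℕ} {μ : Fin n → Multiset (Fin D)} :
    μ ∈ exponents D n d ↔ ∑ j, (μ j).card = d := by
  refine ⟨fun h => (Finset.mem_filter.1 h).2, fun h => Finset.mem_filter.2 ⟨?_, h⟩⟩
  rw [Fintype.mem_piFinset]
  intro j
  rw [Finset.mem_Icc]
  refine ⟨Multiset.zero_le _, Multiset.le_iff_count.2 fun a => ?_⟩
  have h1 : (μ j).card ≤ ∑ i, (μ i).card :=
    Finset.single_le_sum (f := fun i => (μ i).card) (fun _ _ => Nat.zero_le _) (Finset.mem_univ j)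
  have h2 : Multiset.count a (Finset.univ : Finset (Fin D)).val = 1 :=
    Multiset.count_eq_one_of_mem Finset.univ.nodup (Finset.mem_univ a)
  rw [Multiset.count_nsmul, h2, mul_one, ← h]
  exact (Multiset.count_le_card a _).trans h1

/-- The covariant derivatives of the Taylor polynomial of degree `N` are as prescribed, up to the
order `N`. -/
theorem JetTransform.sum_taylor_monom (X : JetTransform Γ U) (hU : IsOpen U)
    {f : Coord D → Multiset (List (Fin D)) → ℝ} (hf : Compatible Γ U f) {n N : ℕ}
    (A : Fin n → List (Fin D)) (hA : ∑ j, (A j).length ≤ N) {w : Coord D} (hw : w ∈ U) :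
    ∑ d ∈ Finset.range (N + 1), ∑ μ ∈ exponents D n d,
      X.taylor f μ w * ∏ j, covL Γ (A j) (fun y => monom (μ j) (y - w)) w =
    f w (Finset.univ.val.map A) := by
  have hAj : ∀ j, (A j).length ≤ N := fun j => (Finset.single_le_sum
    (f := fun i => (A i).length) (fun _ _ => Nat.zero_le _) (Finset.mem_univ j)).trans hA
  have h1 : ∀ μ : Fin n → Multiset (Fin D),
      ∏ j, covL Γ (A j) (fun y => monom (μ j) (y - w)) w =
        ∑ B ∈ Fintype.piFinset fun _ => lists D N, (∏ j, X.toPartial (A j) (B j) w) *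
          if (fun j => (B j : Multiset (Fin D))) = μ then 1 else 0 := by
    intro μ
    simp_rw [covL_monom X (hAj _) _ hw]
    rw [Finset.prod_univ_sum]
    refine Finset.sum_congr rfl fun B _ => ?_
    rw [Finset.prod_mul_distrib, Finset.prod_ite_zero]
    simp only [Finset.mem_univ, forall_const, funext_iff, Finset.prod_const_one]
  have h2 : ∑ d ∈ Finset.range (N + 1), ∑ μ ∈ exponents D n d,
      X.taylor f μ w * ∏ j, covL Γ (A j) (fun y => monom (μ j) (y - w)) w =
      ∑ B ∈ Fintype.piFinset fun _ => lists D N, (∏ j, X.toPartial (A j) (B j) w) *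
        X.taylor f (fun j => (B j : Multiset (Fin D))) w := by
    simp_rw [h1, Finset.mul_sum]
    simp_rw [Finset.sum_comm (s := exponents D n _)]
    rw [Finset.sum_comm]
    refine Finset.sum_congr rfl fun B _ => ?_
    by_cases hB : ∀ j, (B j).length ≤ (A j).length
    · have hd : ∑ j, (B j : Multiset (Fin D)).card ∈ Finset.range (N + 1) := by
        rw [Finset.mem_range, Nat.lt_succ_iff]
        exact (Finset.sum_le_sum fun j _ => hB j).trans hA
      rw [Finset.sum_eq_single_of_mem _ hd, Finset.sum_eq_single_of_mem _ (mem_exponents.2 rfl)]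
      · simp; ring
      · intro μ _ hμ
        rw [if_neg (Ne.symm hμ)]
        simp
      · intro d _ hd'
        refine Finset.sum_eq_zero fun μ hμ => ?_
        rw [if_neg]
        · simp
        · rintro rfl
          exact hd' (mem_exponents.1 hμ).symm
    · push Not at hB
      obtain ⟨j, hj⟩ := hB
      have h0 : ∏ j, X.toPartial (A j) (B j) w = 0 :=
        Finset.prod_eq_zero (Finset.mem_univ j) (by rw [X.toPartial_eq_zero _ _ hj]; rfl)
      simp [h0]
  rw [h2]
  -- a conversion to partial derivatives and back, in every factor, does not change the family
  have h3 := sum_factors (fun a ha s => X.cons_eq_sum hU hf ha hw s) A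
    (fun j => mem_lists.2 (hAj j)) 0
  simp only [add_zero] at h3
  rw [h3]
  have h4 : ∀ B ∈ Fintype.piFinset fun _ : Fin n => lists D N,
      X.taylor f (fun j => (B j : Multiset (Fin D))) w =
      ∑ A' ∈ Fintype.piFinset fun _ => lists D N,
        (∏ j, X.toCov (B j : Multiset (Fin D)).toList (A' j) w) * f w (Finset.univ.val.map A') :=
    fun B hB => X.taylor_eq _ (fun j => mem_lists.1 (Fintype.mem_piFinset.1 hB j)) w
  rw [Finset.sum_congr rfl fun B hB => congrArg _ (h4 B hB)]
  simp_rw [Finset.mul_sum]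
  rw [Finset.sum_comm]
  refine Finset.sum_congr rfl fun A' _ => ?_
  rw [Finset.prod_univ_sum, Finset.sum_mul]
  refine Finset.sum_congr rfl fun B _ => ?_
  rw [Finset.prod_mul_distrib, mul_assoc]

end Jets

/-! ### Borel's theorem with parameters -/

section Borel

variable {E G : Type*} [NormedAddCommGroup E] [NormedSpace ℝ E] [NormedAddCommGroup G]
  [NormedSpace ℝ G]

/-- The linear map `(v, w) ↦ (t v, w)`. -/
def scaleFst (E G : Type*) [NormedAddCommGroup E] [NormedSpace ℝ E] [NormedAddCommGroup G]
    [NormedSpace ℝ G] (t : ℝ) : E × G →L[ℝ] E × G :=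
  (t • ContinuousLinearMap.fst ℝ E G).prod (ContinuousLinearMap.snd ℝ E G)

theorem scaleFst_apply (t : ℝ) (p : E × G) : scaleFst E G t p = (t • p.1, p.2) := rfl

theorem norm_scaleFst_le {t : ℝ} (ht : 1 ≤ t) : ‖scaleFst E G t‖ ≤ t := by
  refine ContinuousLinearMap.opNorm_le_bound _ (by linarith) fun p => ?_
  rw [scaleFst_apply, Prod.norm_def, max_le_iff]
  constructor
  · rw [norm_smul, Real.norm_of_nonneg (by linarith)]
    exact mul_le_mul_of_nonneg_left (norm_fst_le p) (by linarith)
  · calc ‖p.2‖ ≤ ‖p‖ := norm_snd_le p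
      _ = 1 * ‖p‖ := (one_mul _).symm
      _ ≤ t * ‖p‖ := mul_le_mul_of_nonneg_right ht (norm_nonneg _)

/-- Each derivative of `g (t v, w)` costs at most a factor of `t`. -/
theorem norm_iteratedFDeriv_scaleFst_le {g : E × G → ℝ} (hg : ContDiff ℝ ∞ g) {t : ℝ} (ht : 1 ≤ t)
    (m : ℕ) (p : E × G) : ‖iteratedFDeriv ℝ m (g ∘ scaleFst E G t) p‖ ≤
      t ^ m * ‖iteratedFDeriv ℝ m g (scaleFst E G t p)‖ := by
  rw [ContinuousLinearMap.iteratedFDeriv_comp_right _ hg _ (i := m) (by exact_mod_cast le_top)]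
  refine (ContinuousMultilinearMap.norm_compContinuousLinearMap_le _ _).trans ?_
  rw [Finset.prod_const, Finset.card_univ, Fintype.card_fin, mul_comm]
  exact mul_le_mul_of_nonneg_right (pow_le_pow_left₀ (norm_nonneg _) (norm_scaleFst_le ht) m)
    (norm_nonneg _)

/-- Homogeneous functions of degree `d` vanish to the order `d` at the origin. -/
theorem iteratedFDeriv_homogeneous_eq_zero {h : E × G → ℝ} (hs : ContDiff ℝ ∞ h) {d : ℕ}
    (hom : ∀ (t : ℝ) v w, h (t • v, w) = t ^ d * h (v, w)) {m : ℕ} (hm : m < d) (w : G) :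
    iteratedFDeriv ℝ m h (0, w) = 0 := by
  have h1 : h ∘ scaleFst E G 2 = (2 : ℝ) ^ d • h := by
    ext p
    exact hom 2 p.1 p.2
  -- compare the scaling of `h` by `2 ^ d` with that of its `m`-th derivative by `2 ^ m`
  have h2 := norm_iteratedFDeriv_scaleFst_le hs one_le_two m ((0 : E), w)
  rw [h1, iteratedFDeriv_const_smul_apply (hs.contDiffAt.of_le (by exact_mod_cast le_top)),
    norm_smul, scaleFst_apply, smul_zero, Real.norm_of_nonneg (by positivity)] at h2
  by_contra hne
  have h3 : 0 < ‖iteratedFDeriv ℝ m h (0, w)‖ := norm_pos_iff.2 hne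
  have h4 : (2 : ℝ) ^ m < 2 ^ d := pow_lt_pow_right₀ one_lt_two hm
  nlinarith

/-- Borel's theorem: a formal series of homogeneous functions of `v` with parameter `w` is the
Taylor series at `v = 0` of a smooth function, obtained by cutting off the term of degree `d` at the
scale `1 / t d`. -/
theorem exists_borel {χ : E → ℝ} (hχ : ContDiff ℝ ∞ χ) (hχc : HasCompactSupport χ)
    (hχ1 : ∀ᶠ v in 𝓝 0, χ v = 1) {K : Set G} (hK : IsCompact K) {h : ℕ → E × G → ℝ}
    (hs : ∀ d, ContDiff ℝ ∞ (h d))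
    (hom : ∀ d (t : ℝ) v w, h d (t • v, w) = t ^ d * h d (v, w))
    (hhK : ∀ d v w, w ∉ K → h d (v, w) = 0) (r : ℝ) :
    ∃ t : ℕ → ℝ, (∀ d, r ≤ t d) ∧ ContDiff ℝ ∞ (fun p : E × G => ∑' d, χ (t d • p.1) * h d p) ∧
      ∀ N w, ∀ k ≤ N, iteratedFDeriv ℝ k (fun p : E × G => ∑' d, χ (t d • p.1) * h d p -
        ∑ d ∈ Finset.range (N + 1), h d p) (0, w) = 0 := by
  let g : ℕ → E × G → ℝ := fun d p => χ p.1 * h d p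
  have hg : ∀ d, ContDiff ℝ ∞ (g d) := fun d => (hχ.comp contDiff_fst).mul (hs d)
  have hgc : ∀ d, HasCompactSupport (g d) := fun d =>
    HasCompactSupport.intro (hχc.prod hK) fun p hp => by
      rw [Set.mem_prod, not_and_or] at hp
      rcases hp with hp | hp
      · simp [g, image_eq_zero_of_notMem_tsupport hp]
      · simp [g, hhK d p.1 p.2 hp]
  have hC : ∀ d, ∃ C : ℝ, 0 ≤ C ∧ ∀ m < d, ∀ p, ‖iteratedFDeriv ℝ m (g d) p‖ ≤ C := by
    intro d
    have h1 : ∀ m, ∃ C : ℝ, ∀ p, ‖iteratedFDeriv ℝ m (g d) p‖ ≤ C := fun m =>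
      ((hgc d).iteratedFDeriv m).exists_bound_of_continuous
        ((hg d).continuous_iteratedFDeriv (by exact_mod_cast le_top))
    choose C hC using h1
    refine ⟨∑ m ∈ Finset.range d, |C m|, Finset.sum_nonneg fun _ _ => abs_nonneg _,
      fun m hm p => (hC m p).trans ((le_abs_self _).trans ?_)⟩
    exact Finset.single_le_sum (f := fun m => |C m|) (fun _ _ => abs_nonneg _)
      (Finset.mem_range.2 hm)
  choose C hC0 hC using hC
  -- for `m < d`, the `m`-th derivative of the term of degree `d` is at most `C d / t d`
  let t : ℕ → ℝ := fun d => max (max 1 r) (2 ^ d * C d)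
  have ht1 : ∀ d, 1 ≤ t d := fun d => (le_max_left _ _).trans (le_max_left _ _)
  have ht0 : ∀ d, 0 < t d := fun d => zero_lt_one.trans_le (ht1 d)
  let T : ℕ → E × G → ℝ := fun d p => χ (t d • p.1) * h d p
  have hT : ∀ d, T d = ((t d) ^ d)⁻¹ • (g d ∘ scaleFst E G (t d)) := by
    intro d
    ext p
    have h1 : h d (t d • p.1, p.2) = t d ^ d * h d p := hom d (t d) p.1 p.2
    have h2 : t d ^ d ≠ 0 := (pow_pos (ht0 d) d).ne'
    change χ (t d • p.1) * h d p = (t d ^ d)⁻¹ * (χ (t d • p.1) * h d (t d • p.1, p.2))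
    rw [h1]
    field_simp
  have hTs : ∀ d, ContDiff ℝ ∞ (T d) := fun d =>
    (hχ.comp (contDiff_fst.const_smul (t d))).mul (hs d)
  have hTb : ∀ d, ∀ m < d, ∀ p, ‖iteratedFDeriv ℝ m (T d) p‖ ≤ (1 / 2) ^ d := by
    intro d m hm p
    have hgs : ContDiff ℝ ∞ (g d ∘ scaleFst E G (t d)) :=
      (hg d).comp (scaleFst E G (t d)).contDiff
    rw [hT, iteratedFDeriv_const_smul_apply (hgs.contDiffAt.of_le (by exact_mod_cast le_top)),
      norm_smul, Real.norm_of_nonneg (by have := ht0 d; positivity)]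
    have h1 := (norm_iteratedFDeriv_scaleFst_le (hg d) (ht1 d) m p).trans
      (mul_le_mul_of_nonneg_left (hC d m hm _) (by have := ht0 d; positivity))
    have h2 : t d ^ m * t d ≤ t d ^ d := by
      rw [← pow_succ]
      exact pow_le_pow_right₀ (ht1 d) hm
    have h3 : 2 ^ d * C d ≤ t d := le_max_right _ _
    have h4 : t d ^ m * C d ≤ t d ^ d * (1 / 2) ^ d := by
      have h5 : C d ≤ t d * (1 / 2) ^ d := by
        rw [one_div, inv_pow, ← div_eq_mul_inv, le_div_iff₀ (by positivity)]
        linarith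
      calc t d ^ m * C d ≤ t d ^ m * (t d * (1 / 2) ^ d) :=
            mul_le_mul_of_nonneg_left h5 (by have := ht0 d; positivity)
        _ = t d ^ m * t d * (1 / 2) ^ d := by ring
        _ ≤ _ := mul_le_mul_of_nonneg_right h2 (by positivity)
    rw [inv_mul_le_iff₀ (pow_pos (ht0 d) d)]
    exact h1.trans h4
  have hsum : Summable fun d : ℕ => (1 / 2 : ℝ) ^ d := summable_geometric_two
  have hTsum : ∀ p, Summable fun d => T d p := by
    intro p
    refine (summable_nat_add_iff 1).1 (Summable.of_norm_bounded ((summable_nat_add_iff 1).2 hsum)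
      fun d => ?_)
    have := hTb (d + 1) 0 d.succ_pos p
    rwa [norm_iteratedFDeriv_zero] at this
  refine ⟨t, fun d => (le_max_right _ _).trans (le_max_left _ _), ?_, fun N w k hk => ?_⟩
  · refine contDiff_tsum_of_eventually (f := T) (v := fun _ d => (1 / 2 : ℝ) ^ d) hTs
      (fun _ _ => hsum) fun k _ => ?_
    rw [Nat.cofinite_eq_atTop]
    filter_upwards [Filter.eventually_gt_atTop k] with d hd p using hTb d k hd p
  · have hnear : ∀ d, ∀ᶠ p : E × G in 𝓝 (0, w), T d p = h d p := by
      intro d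
      have h1 : Filter.Tendsto (fun p : E × G => t d • p.1) (𝓝 (0, w)) (𝓝 0) := by
        have : Continuous fun p : E × G => t d • p.1 := by fun_prop
        simpa using this.tendsto (0, w)
      filter_upwards [h1.eventually hχ1] with p hp
      change χ (t d • p.1) * h d p = _
      rw [hp, one_mul]
    -- near `v = 0` the cut-offs of finitely many terms are one; what remains are the higher terms
    have h1 : (fun p : E × G => ∑' d, χ (t d • p.1) * h d p - ∑ d ∈ Finset.range (N + 1), h d p)
        =ᶠ[𝓝 (0, w)] fun p => ∑' d, T (d + (N + 1)) p := by
      have h2 : ∀ᶠ p : E × G in 𝓝 (0, w), ∀ d ∈ Finset.range (N + 1), T d p = h d p :=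
        (Filter.eventually_all_finset _).2 fun d _ => hnear d
      filter_upwards [h2] with p hp
      rw [← Finset.sum_congr rfl hp, sub_eq_iff_eq_add', (hTsum p).sum_add_tsum_nat_add]
    rw [(h1.iteratedFDeriv ℝ k).eq_of_nhds, iteratedFDeriv_tsum_apply (N := (N : ℕ∞))
      (v := fun _ d => (1 / 2 : ℝ) ^ (d + (N + 1)))]
    · convert tsum_zero with d
      have h3 : T (d + (N + 1)) =ᶠ[𝓝 (0, w)] h (d + (N + 1)) := hnear _
      rw [(h3.iteratedFDeriv ℝ k).eq_of_nhds]
      exact iteratedFDeriv_homogeneous_eq_zero (hs _) (hom _) (by omega) w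
    · exact fun d => (hTs _).of_le (by exact_mod_cast le_top)
    · exact fun _ _ => (summable_nat_add_iff (N + 1)).2 hsum
    · intro m d p hm
      have : m ≤ N := by exact_mod_cast hm
      exact hTb _ m (by omega) p
    · exact_mod_cast hk

end Borel

/-! ### Functions that vanish to a given order -/

section Vanishing

/-- The composition with a function that vanishes to the order `N` vanishes to the order `N`. -/
theorem iteratedFDeriv_comp_eq_zero {E F : Type*} [NormedAddCommGroup E] [NormedSpace ℝ E]
    [NormedAddCommGroup F] [NormedSpace ℝ F] {g : F → ℝ} (hg : ContDiff ℝ ∞ g) {f : E → F}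
    {s : Set E} (hs : IsOpen s) (hf : ContDiffOn ℝ ∞ f s) {x : E} (hx : x ∈ s) {N : ℕ}
    (h0 : ∀ k ≤ N, iteratedFDeriv ℝ k g (f x) = 0) {k : ℕ} (hk : k ≤ N) :
    iteratedFDeriv ℝ k (g ∘ f) x = 0 := by
  let B : ℝ := 1 + ∑ i ∈ Finset.range (k + 1), ‖iteratedFDerivWithin ℝ i f s x‖
  have hsum : 0 ≤ ∑ i ∈ Finset.range (k + 1), ‖iteratedFDerivWithin ℝ i f s x‖ :=
    Finset.sum_nonneg fun _ _ => norm_nonneg _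
  have h1 := norm_iteratedFDerivWithin_comp_le (n := k) (x := x) (C := 0) (D := B)
    hg.contDiffOn hf (by exact_mod_cast le_top) uniqueDiffOn_univ hs.uniqueDiffOn
    (Set.mapsTo_univ f s) hx
    (fun i hi => by rw [iteratedFDerivWithin_univ, h0 i (hi.trans hk), norm_zero])
    (fun i hi hik => by
      have h2 : ‖iteratedFDerivWithin ℝ i f s x‖ ≤ B := by
        have := Finset.single_le_sum (f := fun i => ‖iteratedFDerivWithin ℝ i f s x‖)
          (fun _ _ => norm_nonneg _) (Finset.mem_range.2 (Nat.lt_succ_of_le hik))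
        exact this.trans (by linarith)
      exact h2.trans (le_self_pow₀ (by linarith) (by omega)))
  rw [iteratedFDerivWithin_of_isOpen k hs hx] at h1
  simpa using h1

variable {D : ℕ} {ι : Type*} [Fintype ι] [DecidableEq ι]
variable {Γ : Coord D → Fin D → Fin D → Fin D → ℝ} {U : Set (Coord D)}

/-- The iterated partial derivatives of `G` up to the order `N` vanish at `y`. -/
def VanishesTo : ℕ → ((ι → Coord D) → ℝ) → (ι → Coord D) → Prop
  | 0, G, y => G y = 0
  | N + 1, G, y => G y = 0 ∧ ∀ i a, VanishesTo N (pdv i a G) y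

namespace VanishesTo

variable {N : ℕ} {G G' : (ι → Coord D) → ℝ} {y : ι → Coord D}

theorem apply (h : VanishesTo N G y) : G y = 0 := by
  cases N with
  | zero => exact h
  | succ N => exact h.1

theorem congr (h : VanishesTo N G y) (hG : G =ᶠ[𝓝 y] G') : VanishesTo N G' y := by
  induction N generalizing G G' with
  | zero => exact hG.eq_of_nhds.symm.trans h
  | succ N ih => exact ⟨hG.eq_of_nhds.symm.trans h.1, fun i a => ih (h.2 i a) (pdv_congr hG)⟩

theorem of_succ (h : VanishesTo (N + 1) G y) : VanishesTo N G y := by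
  induction N generalizing G with
  | zero => exact h.1
  | succ N ih => exact ⟨h.1, fun i a => ih (h.2 i a)⟩

theorem add (hU : IsOpen U) (hG : ContDiffOn ℝ ∞ G (powDom ι U))
    (hG' : ContDiffOn ℝ ∞ G' (powDom ι U)) (hy : y ∈ powDom ι U) (h : VanishesTo N G y)
    (h' : VanishesTo N G' y) : VanishesTo N (fun y => G y + G' y) y := by
  induction N generalizing G G' with
  | zero =>
    change G y + G' y = 0
    rw [h.apply, h'.apply, add_zero]
  | succ N ih =>
    refine ⟨by simp [h.1, h'.1], fun i a => ?_⟩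
    refine (ih (contDiffOn_pdv hU hG i a) (contDiffOn_pdv hU hG' i a) (h.2 i a) (h'.2 i a)).congr ?_
    exact eventuallyEq_of_eqOn hU (fun z hz => (pdv_add hU hG hG' i a hz).symm) hy

theorem mul (hU : IsOpen U) {c : (ι → Coord D) → ℝ} (hc : ContDiffOn ℝ ∞ c (powDom ι U))
    (hG : ContDiffOn ℝ ∞ G (powDom ι U)) (hy : y ∈ powDom ι U) (h : VanishesTo N G y) :
    VanishesTo N (fun y => c y * G y) y := by
  induction N generalizing c G with
  | zero =>
    change c y * G y = 0
    rw [h.apply, mul_zero]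
  | succ N ih =>
    refine ⟨by simp [h.1], fun i a => ?_⟩
    refine (add hU ((contDiffOn_pdv hU hc i a).mul hG) (hc.mul (contDiffOn_pdv hU hG i a)) hy
      (ih (contDiffOn_pdv hU hc i a) hG h.of_succ) (ih hc (contDiffOn_pdv hU hG i a) (h.2 i a))).congr
      ?_
    refine eventuallyEq_of_eqOn hU (fun z hz => ?_) hy
    have h1 := differentiableAt_of_contDiffOn hc (isOpen_powDom hU) hz
    have h2 := differentiableAt_of_contDiffOn hG (isOpen_powDom hU) hz
    rw [pdv_eq_fderiv h1, pdv_eq_fderiv h2, pdv_eq_fderiv (h1.fun_mul h2), fderiv_fun_mul h1 h2]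
    simp [mul_comm, add_comm]

theorem sum (hU : IsOpen U) {κ : Type*} (s : Finset κ) {G : κ → (ι → Coord D) → ℝ}
    (hG : ∀ q, ContDiffOn ℝ ∞ (G q) (powDom ι U)) (hy : y ∈ powDom ι U)
    (h : ∀ q, VanishesTo N (G q) y) : VanishesTo N (fun y => ∑ q ∈ s, G q y) y := by
  classical
  induction s using Finset.induction_on with
  | empty =>
    have h1 : ∀ N, VanishesTo N (fun _ : ι → Coord D => (0 : ℝ)) y := by
      intro N
      induction N with
      | zero => rfl
      | succ N ih =>
        refine ⟨rfl, fun i a => ?_⟩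
        have : pdv i a (fun _ : ι → Coord D => (0 : ℝ)) = fun _ => 0 :=
          funext fun y => pd_const a 0 (y i)
        rwa [this]
    simpa using h1 N
  | insert q s hq ih =>
    simp only [Finset.sum_insert hq]
    exact add hU (hG q) (ContDiffOn.sum fun q _ => hG q) hy (h q) ih

theorem op (hU : IsOpen U) (hΓ : ∀ c a b, ContDiffOn ℝ ∞ (fun y => Γ y c a b) U)
    (hG : ContDiffOn ℝ ∞ G (powDom ι U)) (hy : y ∈ powDom ι U) (i : ι) (A : List (Fin D))
    (h : VanishesTo (N + A.length) G y) : VanishesTo N (op Γ i A G) y := by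
  induction A using list_induction generalizing N with
  | h0 => rwa [op_nil]
  | h1 a A ih ih' =>
    have hsm : ∀ A, ContDiffOn ℝ ∞ (WickField.op Γ i A G) (powDom ι U) := contDiffOn_op hU hΓ hG i
    have h' : VanishesTo (N + 1 + A.length) G y := by
      rwa [List.length_cons, add_comm A.length, ← add_assoc] at h
    have hterm : ∀ (j : Fin A.length) (d : Fin D), ContDiffOn ℝ ∞
        (fun y : ι → Coord D => -(Γ (y i) d a (A.get j)) *
          WickField.op Γ i (List.ofFn (Function.update A.get j d)) G y) (powDom ι U) :=
      fun j d => (contDiffOn_coef hΓ i _ _ _).neg.mul (hsm _)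
    have h1 : WickField.op Γ i (a :: A) G = fun y => pdv i a (WickField.op Γ i A G) y +
        ∑ j : Fin A.length, ∑ d, -(Γ (y i) d a (A.get j)) *
          WickField.op Γ i (List.ofFn (Function.update A.get j d)) G y := by
      rw [op_cons]
      ext y
      simp [sub_eq_add_neg]
    rw [h1]
    refine add hU (contDiffOn_pdv hU (hsm A) i a)
      (ContDiffOn.sum fun j _ => ContDiffOn.sum fun d _ => hterm j d) hy ((ih h').2 i a) ?_
    refine sum hU _ (fun j => ContDiffOn.sum fun d _ => hterm j d) hy fun j => ?_
    refine sum hU _ (hterm j) hy fun d => ?_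
    exact mul hU (contDiffOn_coef hΓ i _ _ _).neg (hsm _) hy
      (ih' _ (by simp) (N := N + 1) (by simpa using h')).of_succ

theorem mop (hU : IsOpen U) (hΓ : ∀ c a b, ContDiffOn ℝ ∞ (fun y => Γ y c a b) U)
    (hG : ContDiffOn ℝ ∞ G (powDom ι U)) (hy : y ∈ powDom ι U) (l : List ι)
    (A : ι → List (Fin D)) (h : VanishesTo (N + (l.map fun i => (A i).length).sum) G y) :
    VanishesTo N (mop Γ l A G) y := by
  induction l generalizing N with
  | nil => exact h
  | cons i l ih =>
    rw [List.map_cons, List.sum_cons, ← add_assoc] at h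
    exact op hU hΓ (contDiffOn_mop hU hΓ hG l A) hy i (A i) (ih h)

theorem of_iteratedFDeriv (hU : IsOpen U) (hG : ContDiffOn ℝ ∞ G (powDom ι U))
    (hy : y ∈ powDom ι U) (h : ∀ k ≤ N, iteratedFDeriv ℝ k G y = 0) : VanishesTo N G y := by
  have h0 : ∀ {N : ℕ} {G : (ι → Coord D) → ℝ}, (∀ k ≤ N, iteratedFDeriv ℝ k G y = 0) →
      G y = 0 := fun {N G} h => by
    have := congrArg norm (h 0 (Nat.zero_le _))
    rwa [norm_iteratedFDeriv_zero, norm_zero, norm_eq_zero] at this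
  induction N generalizing G with
  | zero => exact h0 h
  | succ N ih =>
    refine ⟨h0 h, fun i a => ih (contDiffOn_pdv hU hG i a) fun k hk => ?_⟩
    have h1 : pdv i a G =ᶠ[𝓝 y] fun y => fderiv ℝ G y (Pi.single i (stdVec D a)) :=
      eventuallyEq_of_eqOn hU (fun z hz => pdv_eq_fderiv
        (differentiableAt_of_contDiffOn hG (isOpen_powDom hU) hz)) hy
    rw [(h1.iteratedFDeriv ℝ k).eq_of_nhds]
    have h2 : ContDiffAt ℝ ∞ (fderiv ℝ G) y :=
      (hG.fderiv_of_isOpen (isOpen_powDom hU) (m := ∞) (by simp)).contDiffAt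
        ((isOpen_powDom hU).mem_nhds hy)
    have h3 := norm_iteratedFDeriv_clm_apply_const (n := k) (c := Pi.single i (stdVec D a)) h2
      (by exact_mod_cast le_top)
    rw [norm_iteratedFDeriv_fderiv, h (k + 1) (by omega), norm_zero, mul_zero] at h3
    exact norm_le_zero_iff.1 h3

end VanishesTo

end Vanishing

/-! ### The sum of the Taylor series along the diagonal -/

section TaylorSeries

theorem contDiff_of_eq_zero {E : Type*} [NormedAddCommGroup E] [NormedSpace ℝ E] {U K : Set E}
    (hU : IsOpen U) (hK : IsClosed K) (hKU : K ⊆ U) {g : E → ℝ} (hg : ContDiffOn ℝ ∞ g U)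
    (h0 : ∀ y ∉ K, g y = 0) : ContDiff ℝ ∞ g := by
  rw [contDiff_iff_contDiffAt]
  intro y
  by_cases hy : y ∈ U
  · exact hg.contDiffAt (hU.mem_nhds hy)
  · have hyK : y ∈ Kᶜ := fun h => hy (hKU h)
    exact contDiffAt_const.congr_of_eventuallyEq
      (Filter.eventuallyEq_of_mem (hK.isOpen_compl.mem_nhds hyK) fun z hz => h0 z hz)

variable {D : ℕ} {U : Set (Coord D)} {Γ : Coord D → Fin D → Fin D → Fin D → ℝ}

/-- The term of degree `d` of the Taylor series in `v = (x_1 - w, …, x_n - w)` of the function with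
covariant derivatives `ρ f` on the diagonal. -/
def JetTransform.term (X : JetTransform Γ U) (f : Coord D → Multiset (List (Fin D)) → ℝ)
    (ρ : Coord D → ℝ) (n d : ℕ) (p : (Fin n → Coord D) × Coord D) : ℝ :=
  ∑ μ ∈ exponents D n d, ρ p.2 * X.taylor f μ p.2 * ∏ j, monom (μ j) (p.1 j)

namespace JetTransform

variable (X : JetTransform Γ U) {f : Coord D → Multiset (List (Fin D)) → ℝ} {ρ : Coord D → ℝ}

theorem contDiff_term (hU : IsOpen U) (hf : ∀ s, ContDiffOn ℝ ∞ (fun y => f y s) U)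
    (hρ : ContDiffOn ℝ ∞ ρ U) {K : Set (Coord D)} (hK : IsClosed K) (hKU : K ⊆ U)
    (hρK : ∀ y ∉ K, ρ y = 0) (n d : ℕ) : ContDiff ℝ ∞ (X.term f ρ n d) := by
  refine ContDiff.sum fun μ _ => ContDiff.mul ?_ ?_
  · have h1 : ContDiff ℝ ∞ fun w => ρ w * X.taylor f μ w :=
      contDiff_of_eq_zero hU hK hKU (hρ.mul (X.contDiffOn_taylor hf μ)) fun y hy => by
        rw [hρK y hy, zero_mul]
    exact h1.comp contDiff_snd
  · exact contDiff_prod fun j _ => (contDiff_monom _).comp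
      ((contDiff_apply ℝ (Coord D) j).comp contDiff_fst)

theorem term_smul (n d : ℕ) (t : ℝ) (v : Fin n → Coord D) (w : Coord D) :
    X.term f ρ n d (t • v, w) = t ^ d * X.term f ρ n d (v, w) := by
  unfold term
  rw [Finset.mul_sum]
  refine Finset.sum_congr rfl fun μ hμ => ?_
  simp only [Pi.smul_apply, monom_smul, Finset.prod_mul_distrib, Finset.prod_pow_eq_pow_sum]
  rw [mem_exponents.1 hμ]
  ring

theorem term_perm {n : ℕ} (d : ℕ) (π : Equiv.Perm (Fin n)) (v : Fin n → Coord D) (w : Coord D) :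
    X.term f ρ n d (v ∘ π, w) = X.term f ρ n d (v, w) := by
  have hmem : ∀ (σ : Equiv.Perm (Fin n)) (μ : Fin n → Multiset (Fin D)), μ ∈ exponents D n d →
      μ ∘ σ ∈ exponents D n d := fun σ μ hμ => by
    rw [mem_exponents] at hμ ⊢
    rw [← hμ]
    exact Equiv.sum_comp σ fun j => (μ j).card
  refine Finset.sum_nbij' (fun μ => μ ∘ π.symm) (fun μ => μ ∘ π) (hmem _) (hmem _)
    (fun μ _ => by ext1 j; simp) (fun μ _ => by ext1 j; simp) fun μ _ => ?_
  dsimp only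
  rw [X.taylor_perm, ← Equiv.prod_comp π fun j => monom ((μ ∘ π.symm) j) (v j)]
  simp

/-- A symmetric function with the given Taylor series, with support within the distance `δ` from
the diagonal `v = 0`. -/
theorem exists_sum (hU : IsOpen U) (hf : ∀ s, ContDiffOn ℝ ∞ (fun y => f y s) U)
    (hρ : ContDiffOn ℝ ∞ ρ U) {K : Set (Coord D)} (hK : IsCompact K) (hKU : K ⊆ U)
    (hρK : ∀ y ∉ K, ρ y = 0) (n : ℕ) {δ : ℝ} (hδ : 0 < δ) :
    ∃ B : (Fin n → Coord D) × Coord D → ℝ, ContDiff ℝ ∞ B ∧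
      (∀ v w, w ∉ K → B (v, w) = 0) ∧
      (∀ v w, (∃ j, δ < ‖v j‖) → B (v, w) = 0) ∧
      (∀ (π : Equiv.Perm (Fin n)) v w, B (v ∘ π, w) = B (v, w)) ∧
      ∀ N w, ∀ k ≤ N, iteratedFDeriv ℝ k
        (fun p => B p - ∑ d ∈ Finset.range (N + 1), X.term f ρ n d p) (0, w) = 0 := by
  let χ₀ : ContDiffBump (0 : Coord D) := ⟨1 / 2, 1, by norm_num, by norm_num⟩
  let χ : (Fin n → Coord D) → ℝ := fun v => ∏ j, χ₀ (v j)
  have hχ : ContDiff ℝ ∞ χ := contDiff_prod fun j _ => χ₀.contDiff.comp (contDiff_apply ℝ (Coord D) j)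
  have hχc : HasCompactSupport χ := by
    refine HasCompactSupport.intro (isCompact_univ_pi fun _ : Fin n => χ₀.hasCompactSupport)
      fun v hv => ?_
    simp only [Set.mem_pi, Set.mem_univ, true_implies, not_forall] at hv
    obtain ⟨j, hj⟩ := hv
    exact Finset.prod_eq_zero (Finset.mem_univ j) (image_eq_zero_of_notMem_tsupport hj)
  have hχ1 : ∀ᶠ v in 𝓝 0, χ v = 1 := by
    have h1 : ∀ᶠ v : Fin n → Coord D in 𝓝 0, ∀ j, χ₀ (v j) = 1 :=
      Filter.eventually_all.2 fun j =>
        ((continuous_apply j).tendsto (0 : Fin n → Coord D)).eventually χ₀.eventuallyEq_one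
    filter_upwards [h1] with v hv
    simp [χ, hv]
  have hK0 : ∀ d v w, w ∉ K → X.term f ρ n d (v, w) = 0 := fun d v w hw => by
    simp [term, hρK w hw]
  obtain ⟨t, ht, hB, hjet⟩ := exists_borel hχ hχc hχ1 hK
    (fun d => X.contDiff_term hU hf hρ hK.isClosed hKU hρK n d)
    (fun d t v w => X.term_smul n d t v w) hK0 (1 / δ)
  -- as `t d ≥ 1 / δ`, all terms are cut off at the distance `δ`
  refine ⟨_, hB, fun v w hw => ?_, fun v w hv => ?_, fun π v w => ?_, hjet⟩
  · simp [hK0 _ v w hw]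
  · obtain ⟨j, hj⟩ := hv
    have h1 : ∀ d, χ (t d • v) = 0 := fun d => by
      refine Finset.prod_eq_zero (Finset.mem_univ j) (χ₀.zero_of_le_dist ?_)
      have h2 : 1 / δ ≤ t d := ht d
      have h3 : 0 < t d := (one_div_pos.2 hδ).trans_le h2
      rw [dist_zero_right, Pi.smul_apply, norm_smul, Real.norm_of_nonneg h3.le]
      calc (1 : ℝ) = 1 / δ * δ := by field_simp
        _ ≤ t d * ‖v j‖ := mul_le_mul h2 hj.le hδ.le h3.le
    simp [h1]
  · have h1 : ∀ d, χ (t d • (v ∘ π)) = χ (t d • v) := fun d =>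
      Equiv.prod_comp π fun j => χ₀ (t d • v j)
    simp only [h1, X.term_perm]

end JetTransform

theorem covL_congr {V : Type*} [NormedAddCommGroup V] [NormedSpace ℝ V] {u u' : Coord D → V}
    {y : Coord D} (h : u =ᶠ[𝓝 y] u') (A : List (Fin D)) : covL Γ A u =ᶠ[𝓝 y] covL Γ A u' := by
  induction A using list_induction with
  | h0 => exact h
  | h1 a A ih ih' =>
    have h2 : ∀ᶠ z in 𝓝 y, ∀ (j : Fin A.length) (d : Fin D),
        covL Γ (List.ofFn (Function.update A.get j d)) u z =
        covL Γ (List.ofFn (Function.update A.get j d)) u' z :=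
      Filter.eventually_all.2 fun j => Filter.eventually_all.2 fun d => ih' _ (by simp)
    filter_upwards [eventually_eventually_nhds.2 ih, h2] with z hz1 hz2
    rw [covL_cons, covL_cons, pd_congr hz1]
    simp only [hz2]

end TaylorSeries

/-! ### Functions with support in the domain of a chart -/

section LocalFunction

variable {D : ℕ} {M : Type*} [TopologicalSpace M] [ChartedSpace (Coord D) M]
  [IsManifold 𝓘(ℝ, Coord D) ∞ M] [T2Space M] {S : Spacetime D M}
variable {ε : OpenPartialHomeomorph M (Coord D)}

theorem mop_zero {ι : Type*} [Fintype ι] [DecidableEq ι]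
    (Γ : Coord D → Fin D → Fin D → Fin D → ℝ) (l : List ι) (A : ι → List (Fin D))
    (y : ι → Coord D) : mop Γ l A (fun _ => 0) y = 0 := by
  have := mop_mul (Γ := Γ) (l := l) (A := A) (c := fun _ => 0) (H := fun _ => 0)
    (fun _ _ _ _ => rfl) y
  simpa using this

/-- A function on `M^n × M` that vanishes off a closed set within the domain of a chart is smooth
if it is smooth in that chart. -/
theorem smoothOnPow_of_chart {n : ℕ} (hε : ε ∈ atlas (Coord D) M)
    {B : (Fin n → Coord D) × Coord D → ℝ} (hB : ContDiff ℝ ∞ B) {F : (Fin n → M) → M → ℝ}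
    (hF : ∀ x z, (∀ j, x j ∈ ε.source) → z ∈ ε.source →
      F x z = B (fun j => ε (x j) - ε z, ε z))
    {C C' : Set M} (hC : IsClosed C) (hC' : IsClosed C') (hCε : C ⊆ ε.source) (hCε' : C' ⊆ ε.source)
    (h0 : ∀ x z, F x z ≠ 0 → (∀ j, x j ∈ C) ∧ z ∈ C') : SmoothOnPow D F Set.univ := by
  intro e e₀ he he₀ q hq
  refine ContDiffAt.contDiffWithinAt ?_
  by_cases hs : (∀ j, powSymm e q.1 j ∈ ε.source) ∧ e₀.symm q.2 ∈ ε.source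
  · let W : Set ((Fin n → Coord D) × Coord D) :=
      (Set.univ.pi fun j => overlap (e j) ε) ×ˢ overlap e₀ ε
    have hW : IsOpen W :=
      (isOpen_set_pi Set.finite_univ fun j _ => isOpen_overlap _ _).prod (isOpen_overlap _ _)
    have hqW : q ∈ W := ⟨fun j _ => ⟨hq.1 j trivial, hs.1 j⟩, hq.2.1, hs.2⟩
    have hz : ContDiffOn ℝ ∞ (fun q : (Fin n → Coord D) × Coord D => trans e₀ ε q.2) W :=
      (contDiffOn_trans he₀ hε).comp contDiff_snd.contDiffOn fun q hq => hq.2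
    have hx : ∀ j, ContDiffOn ℝ ∞ (fun q : (Fin n → Coord D) × Coord D => trans (e j) ε (q.1 j)) W :=
      fun j => (contDiffOn_trans (he j) hε).comp
        ((contDiff_apply ℝ (Coord D) j).comp contDiff_fst).contDiffOn fun q hq => hq.1 j trivial
    have h1 : ContDiffOn ℝ ∞ (fun q : (Fin n → Coord D) × Coord D =>
        B (fun j => trans (e j) ε (q.1 j) - trans e₀ ε q.2, trans e₀ ε q.2)) W :=
      hB.comp_contDiffOn ((contDiffOn_pi.2 fun j => (hx j).sub hz).prodMk hz)
    refine (h1.contDiffAt (hW.mem_nhds hqW)).congr_of_eventuallyEq ?_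
    filter_upwards [hW.mem_nhds hqW] with q hq
    exact hF _ _ (fun j => (hq.1 j trivial).2) hq.2.2
  · let V : Set ((Fin n → Coord D) × Coord D) := powTarget e ×ˢ e₀.target
    have hV : IsOpen V :=
      (isOpen_set_pi Set.finite_univ fun j _ => (e j).open_target).prod e₀.open_target
    let g : (Fin n → Coord D) × Coord D → (Fin n → M) × M := fun q => (powSymm e q.1, e₀.symm q.2)
    have hg : ContinuousOn g V := by
      refine ContinuousOn.prodMk (continuousOn_pi.2 fun j => ?_) ?_
      · exact (e j).continuousOn_symm.comp (by fun_prop) fun q hq => hq.1 j trivial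
      · exact e₀.continuousOn_symm.comp (by fun_prop) fun q hq => hq.2
    let Q : Set ((Fin n → M) × M) := (Set.univ.pi fun _ => C) ×ˢ C'
    have hQ : IsClosed Q := (isClosed_set_pi fun _ _ => hC).prod hC'
    have hopen : IsOpen (V ∩ g ⁻¹' Qᶜ) := hg.isOpen_inter_preimage hV hQ.isOpen_compl
    have hq' : q ∈ V ∩ g ⁻¹' Qᶜ :=
      ⟨⟨hq.1, hq.2.1⟩, fun hQ => hs ⟨fun j => hCε (hQ.1 j trivial), hCε' hQ.2⟩⟩
    refine (contDiffAt_const (c := (0 : ℝ))).congr_of_eventuallyEq ?_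
    filter_upwards [hopen.mem_nhds hq'] with q hq
    by_contra hne
    exact hq.2 ⟨fun j _ => (h0 _ _ hne).1 j, (h0 _ _ hne).2⟩

open Classical in
/-- A function of `(x_1, …, x_n; z)` with covariant derivatives `ρ w` on the diagonal, where `w` is
a family of tensor fields compatible with the relations between covariant derivatives, and `ρ` has
compact support within the domain of the chart `ε`. -/
theorem exists_local_function (hε : ε ∈ atlas (Coord D) M) {w : M → Multiset (List (Fin D)) → ℝ}
    (hw : SmoothFam w) (hcomp : Compatible (S.christoffel ε) ε.target (chartFam ε w)) {ρ : M → ℝ}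
    (hρ : ContDiffOn ℝ ∞ (ρ ∘ ε.symm) ε.target) (hρc : HasCompactSupport ρ)
    (hρε : tsupport ρ ⊆ ε.source) (n : ℕ) :
    ∃ F : (Fin n → M) → M → ℝ, SmoothOnPow D F Set.univ ∧ (∀ x z, z ∉ tsupport ρ → F x z = 0) ∧
      (∀ (π : Equiv.Perm (Fin n)) x z, F (x ∘ π) z = F x z) ∧
      ∀ e ∈ atlas (Coord D) M, ∀ y ∈ e.target, ∀ A : Fin n → List (Fin D),
        mop (S.christoffel e) (List.finRange n) A
          (fun v => F (powSymm (fun _ => e) v) (e.symm y)) (fun _ => y) =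
        ρ (e.symm y) * chartFam e w y (Finset.univ.val.map A) := by
  set K : Set (Coord D) := ε '' tsupport ρ with hKdef
  have hK : IsCompact K := hρc.image_of_continuousOn (ε.continuousOn.mono hρε)
  have hKt : K ⊆ ε.target := by
    rintro _ ⟨x, hx, rfl⟩
    exact ε.map_source (hρε hx)
  -- the support in the variables `x_j` is kept within a compact part of the domain of the chart
  obtain ⟨δ, hδ, hKδ⟩ := hK.exists_cthickening_subset_open ε.open_target hKt
  have hKiff : ∀ {z}, z ∈ ε.source → ε z ∈ K → z ∈ tsupport ρ := by
    rintro z hz ⟨z', hz', h⟩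
    rwa [← ε.injOn (hρε hz') hz h]
  -- `ρ ∘ ε.symm` takes arbitrary values off the target of the chart
  let ρ' : Coord D → ℝ := K.indicator (ρ ∘ ε.symm)
  have hρ'0 : ∀ y ∉ K, ρ' y = 0 := fun y hy => Set.indicator_of_notMem hy _
  have hρ' : ∀ y ∈ ε.target, ρ' y = ρ (ε.symm y) := by
    intro y hy
    by_cases hyK : y ∈ K
    · exact Set.indicator_of_mem hyK _
    · rw [hρ'0 y hyK]
      exact (image_eq_zero_of_notMem_tsupport fun h => hyK ⟨_, h, ε.right_inv hy⟩).symm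
  obtain ⟨X⟩ := nonempty_jetTransform (Γ := S.christoffel ε) ε.open_target
    (S.contDiffOn_christoffel hε)
  have hf := fun s => contDiffOn_chartFam hε hw s
  have hρs : ContDiffOn ℝ ∞ ρ' ε.target := hρ.congr hρ'
  obtain ⟨B, hB, hB1, hB2, hB3, hB4⟩ :=
    X.exists_sum ε.open_target hf hρs hK hKt hρ'0 n hδ
  let F : (Fin n → M) → M → ℝ := fun x z =>
    if (∀ j, x j ∈ ε.source) ∧ z ∈ ε.source then B (fun j => ε (x j) - ε z, ε z) else 0
  have hF : ∀ x z, (∀ j, x j ∈ ε.source) → z ∈ ε.source →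
      F x z = B (fun j => ε (x j) - ε z, ε z) := fun x z hx hz => if_pos ⟨hx, hz⟩
  have h0 : ∀ x z, F x z ≠ 0 → (∀ j, x j ∈ ε.symm '' Metric.cthickening δ K) ∧ z ∈ tsupport ρ := by
    intro x z hne
    have hs : (∀ j, x j ∈ ε.source) ∧ z ∈ ε.source := by
      by_contra hs
      exact hne (if_neg hs)
    rw [hF x z hs.1 hs.2] at hne
    have hzK : ε z ∈ K := by
      by_contra h
      exact hne (hB1 _ _ h)
    refine ⟨fun j => ⟨ε (x j), ?_, ε.left_inv (hs.1 j)⟩, hKiff hs.2 hzK⟩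
    refine Metric.mem_cthickening_of_dist_le _ (ε z) _ _ hzK ?_
    rw [dist_eq_norm]
    by_contra h
    exact hne (hB2 _ _ ⟨j, not_le.1 h⟩)
  have hC : IsClosed (ε.symm '' Metric.cthickening δ K) :=
    (hK.cthickening.image_of_continuousOn (ε.continuousOn_symm.mono hKδ)).isClosed
  have hCε : ε.symm '' Metric.cthickening δ K ⊆ ε.source := by
    rintro _ ⟨y, hy, rfl⟩
    exact ε.map_target (hKδ hy)
  refine ⟨F, smoothOnPow_of_chart hε hB hF hC (isClosed_tsupport ρ) hCε hρε h0,
    fun x z hz => ?_, fun π x z => ?_, fun e he y hy A => ?_⟩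
  · by_contra hne
    exact hz (h0 x z hne).2
  · have h1 : (∀ j, (x ∘ π) j ∈ ε.source) ↔ ∀ j, x j ∈ ε.source :=
      ⟨fun h j => by simpa using h (π.symm j), fun h j => h (π j)⟩
    change (if _ then _ else _) = if _ then _ else _
    rw [if_congr (and_congr h1 Iff.rfl) rfl rfl]
    exact if_congr Iff.rfl (hB3 π (fun j => ε (x j) - ε z) (ε z)) rfl
  by_cases hyε : e.symm y ∈ ε.source
  swap
  · have h1 : (fun v => F (powSymm (fun _ => e) v) (e.symm y)) = fun _ => 0 := by
      ext v
      exact if_neg fun h => hyε h.2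
    rw [h1, mop_zero, image_eq_zero_of_notMem_tsupport fun h => hyε (hρε h), zero_mul]
  have hyO : y ∈ overlap e ε := ⟨hy, hyε⟩
  have hO := isOpen_overlap e ε
  have hyP : (fun _ => y) ∈ powDom (Fin n) (overlap e ε) := mem_powDom.2 fun _ => hyO
  have hΓ : ∀ c a b, ContDiffOn ℝ ∞ (fun y => S.christoffel e y c a b) (overlap e ε) :=
    fun c a b => (S.contDiffOn_christoffel he c a b).mono Set.inter_subset_left
  set τ := trans e ε with hτdef
  set w' := τ y with hw'
  have hw't : w' ∈ ε.target := (trans_mem_overlap hyO).1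
  have hτ : ContDiffOn ℝ ∞ τ (overlap e ε) := contDiffOn_trans he hε
  set N := ∑ j, (A j).length with hN
  let φ : (Fin n → Coord D) → (Fin n → Coord D) × Coord D := fun v => (fun j => τ (v j) - w', w')
  have hφ : ContDiffOn ℝ ∞ φ (powDom (Fin n) (overlap e ε)) := by
    refine ContDiffOn.prodMk (contDiffOn_pi.2 fun j => ContDiffOn.sub ?_ contDiffOn_const)
      contDiffOn_const
    exact hτ.comp (contDiff_apply ℝ (Coord D) j).contDiffOn fun v hv => mem_powDom.1 hv j
  have hterm : ∀ d, ContDiff ℝ ∞ (X.term (chartFam ε w) ρ' n d) := fun d =>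
    X.contDiff_term ε.open_target hf hρs hK.isClosed hKt hρ'0 n d
  let P : (Fin n → Coord D) × Coord D → ℝ := fun p =>
    ∑ d ∈ Finset.range (N + 1), X.term (chartFam ε w) ρ' n d p
  have hP : ContDiff ℝ ∞ P := ContDiff.sum fun d _ => hterm d
  have hsplit : Set.EqOn (fun v => F (powSymm (fun _ => e) v) (e.symm y))
      (fun v => P (φ v) + (B (φ v) - P (φ v))) (powDom (Fin n) (overlap e ε)) := by
    intro v hv
    have h := hF (powSymm (fun _ => e) v) (e.symm y) (fun j => (mem_powDom.1 hv j).2) hyε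
    dsimp only
    rw [add_sub_cancel]
    exact h
  have hPφ : ContDiffOn ℝ ∞ (fun v => P (φ v)) (powDom (Fin n) (overlap e ε)) :=
    hP.comp_contDiffOn hφ
  have hRφ : ContDiffOn ℝ ∞ (fun v => B (φ v) - P (φ v)) (powDom (Fin n) (overlap e ε)) :=
    (hB.sub hP).comp_contDiffOn hφ
  -- the remainder does not contribute, as it vanishes to the order of the derivatives
  have hR : mop (S.christoffel e) (List.finRange n) A (fun v => B (φ v) - P (φ v))
      (fun _ => y) = 0 := by
    refine VanishesTo.apply (N := 0) (VanishesTo.mop hO hΓ hRφ hyP _ A ?_)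
    rw [zero_add, ← Fin.sum_univ_def]
    refine VanishesTo.of_iteratedFDeriv hO hRφ hyP fun k hk => ?_
    refine iteratedFDeriv_comp_eq_zero (hB.sub hP) (isOpen_powDom hO) hφ hyP
      (fun k hk => ?_) hk
    have : φ (fun _ => y) = (0, w') := by
      simp only [φ, ← hw', sub_self]
      rfl
    rw [this]
    exact hB4 N w' k hk
  rw [mop_eqOn hO hsplit hyP, mop_add hO hΓ hPφ hRφ _ A hyP]
  dsimp only
  rw [hR, add_zero]
  -- the covariant derivatives of the Taylor polynomial, transformed to the chart `ε`
  let k : Fin n → ℕ := fun j => (A j).length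
  let c : Slots k → Fin D := fun s => (A s.1).get s.2
  have hcov : ∀ (j : Fin n) (s : Multiset (Fin D)),
      covL (S.christoffel e) (A j) (fun v => monom s (τ v - w')) y =
        pull (jacobi e ε y) (fun c' => covL (S.christoffel ε) (List.ofFn c')
          (fun v => monom s (v - w')) w') (A j).get := by
    intro j s
    let u : M → ℝ := fun x => monom s (ε x - w')
    have hs : ContDiff ℝ ∞ fun v => monom s (v - w') :=
      (contDiff_monom s).comp (contDiff_id.sub contDiff_const)
    have hu : Set.EqOn (u ∘ ε.symm) (fun v => monom s (v - w')) ε.target := by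
      intro v hv
      simp only [u, Function.comp_apply, ε.right_inv hv]
    refine (S.covD_trans he hε (hs.contDiffOn.congr hu) (A j).length (A j).get hyO).trans ?_
    congr 1
    ext c'
    rw [← (covL_congr (Filter.eventuallyEq_of_mem (ε.open_target.mem_nhds hw't) hu) _).eq_of_nhds]
    exact (apply_ofFn (fun m g => covD (S.christoffel ε) m (u ∘ ε.symm) g w') c').symm
  have hmono : ∀ μ : Fin n → Multiset (Fin D), ContDiffOn ℝ ∞
      (fun v : Fin n → Coord D => ∏ j, monom (μ j) (τ (v j) - w')) (powDom (Fin n) (overlap e ε)) :=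
    fun μ => contDiffOn_prod fun j _ => (contDiff_monom (μ j)).comp_contDiffOn
      ((hτ.comp (contDiff_apply ℝ (Coord D) j).contDiffOn fun v hv => mem_powDom.1 hv j).sub
        contDiffOn_const)
  have hmop : mop (S.christoffel e) (List.finRange n) A (fun v => P (φ v)) (fun _ => y) =
      ∑ d ∈ Finset.range (N + 1), ∑ μ ∈ exponents D n d, ρ' w' * X.taylor (chartFam ε w) μ w' *
        pull (jacobi e ε y) (fun c' => ∏ j, covL (S.christoffel ε) (List.ofFn fun s => c' ⟨j, s⟩)
          (fun v => monom (μ j) (v - w')) w') c := by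
    have hd : ∀ d, ContDiffOn ℝ ∞ (fun v => X.term (chartFam ε w) ρ' n d (φ v))
        (powDom (Fin n) (overlap e ε)) := fun d => (hterm d).comp_contDiffOn hφ
    change mop _ _ A (fun v => ∑ d ∈ Finset.range (N + 1), X.term (chartFam ε w) ρ' n d (φ v)) _ = _
    rw [mop_sum hO hΓ _ hd _ A hyP]
    refine Finset.sum_congr rfl fun d _ => ?_
    change mop _ _ A (fun v => ∑ μ ∈ exponents D n d, ρ' w' * X.taylor (chartFam ε w) μ w' *
      ∏ j, monom (μ j) (τ (v j) - w')) _ = _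
    rw [mop_sum hO hΓ _ (fun μ => contDiffOn_const.mul (hmono μ)) _ A hyP]
    refine Finset.sum_congr rfl fun μ _ => ?_
    rw [mop_mul fun _ _ _ _ => rfl, mop_prod (List.nodup_finRange n) A
      (fun j v => monom (μ j) (τ v - w'))]
    simp only [List.mem_finRange, if_true, hcov]
    congr 1
    exact (pull_prod (jacobi e ε y) (fun j c' => covL (S.christoffel ε) (List.ofFn c')
      (fun v => monom (μ j) (v - w')) w') c).symm
  rw [hmop, hρ' w' hw't, symm_trans hyO, ← idx_length, chartFam_idx, covComp_trans he hε _ hyO]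
  simp only [pull, smul_eq_mul, Finset.mul_sum]
  simp_rw [Finset.sum_comm (s := exponents D n _)]
  rw [Finset.sum_comm]
  refine Finset.sum_congr rfl fun c' _ => ?_
  have h1 := X.sum_taylor_monom ε.open_target hcomp (N := N)
    (fun j => List.ofFn fun s => c' ⟨j, s⟩) (by simp [N, k]) hw't
  have h2 : chartFam ε w w' (Finset.univ.val.map fun j => List.ofFn fun s => c' ⟨j, s⟩) =
      covComp ε (tens w k) w' c' := chartFam_idx w w' k c'
  rw [← h2, ← h1]
  simp only [Finset.mul_sum]
  refine Finset.sum_congr rfl fun d _ => Finset.sum_congr rfl fun μ _ => ?_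
  ring

end LocalFunction

/-! ### The functions on a neighbourhood of the total diagonal -/

section GlobalFunction

variable {D : ℕ} {M : Type*} [TopologicalSpace M] [ChartedSpace (Coord D) M]
  [IsManifold 𝓘(ℝ, Coord D) ∞ M] {S : Spacetime D M}

/-- For a fixed last variable, a smooth function is smooth in the other variables. -/
theorem SmoothOnPow.contDiffOn_left {n : ℕ} {F : (Fin n → M) → M → ℝ}
    (hF : SmoothOnPow D F Set.univ) {e : OpenPartialHomeomorph M (Coord D)}
    (he : e ∈ atlas (Coord D) M) {y : Coord D} (hy : y ∈ e.target) :
    ContDiffOn ℝ ∞ (fun v => F (powSymm (fun _ => e) v) (e.symm y)) (powDom (Fin n) e.target) :=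
  (hF (fun _ => e) e (fun _ => he) he).comp (contDiff_id.prodMk contDiff_const).contDiffOn
    fun _ hv => ⟨hv, hy, trivial⟩

variable [T2Space M] [SecondCountableTopology M]

/-- The function with prescribed covariant derivatives on the diagonal, glued from functions with
support near a point by a partition of unity in the last variable. -/
theorem exists_global_function {w : M → Multiset (List (Fin D)) → ℝ} (hw : SmoothFam w)
    (hcomp : ∀ e ∈ atlas (Coord D) M, Compatible (S.christoffel e) e.target (chartFam e w))
    (n : ℕ) : ∃ F : (Fin n → M) → M → ℝ, SmoothOnPow D F Set.univ ∧
      (∀ (π : Equiv.Perm (Fin n)) x z, F (x ∘ π) z = F x z) ∧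
      ∀ e ∈ atlas (Coord D) M, ∀ y ∈ e.target, ∀ A : Fin n → List (Fin D),
        mop (S.christoffel e) (List.finRange n) A
          (fun v => F (powSymm (fun _ => e) v) (e.symm y)) (fun _ => y) =
        chartFam e w y (Finset.univ.val.map A) := by
  have : LocallyCompactSpace M := ChartedSpace.locallyCompactSpace (Coord D) M
  obtain ⟨ι, fs, -⟩ := SmoothBumpCovering.exists_isSubordinate 𝓘(ℝ, Coord D) (M := M)
    isClosed_univ (U := fun _ => Set.univ) fun _ _ => Filter.univ_mem
  let P := fs.toSmoothPartitionOfUnity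
  have hsub : ∀ i, tsupport (P i) ⊆ tsupport (fs i) := fun i =>
    closure_mono (fs.support_toSmoothPartitionOfUnity_subset i)
  have hloc := fun i => exists_local_function (S := S) (chart_mem_atlas (Coord D) (fs.c i)) hw
    (hcomp _ (chart_mem_atlas _ _)) (contDiffOn_comp_symm (P i).contMDiff (chart_mem_atlas _ _))
    ((fs i).hasCompactSupport.of_isClosed_subset (isClosed_tsupport _) (hsub i))
    ((hsub i).trans (fs i).tsupport_subset_chartAt_source) n
  choose F hF hF0 hFs hFj using hloc
  have hfin : ∀ z : M, ∃ W ∈ 𝓝 z, ∃ T : Finset ι, ∀ z' ∈ W, ∀ i, z' ∈ tsupport (P i) → i ∈ T := by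
    intro z
    obtain ⟨W, hW, hT⟩ := P.locallyFinite.closure z
    exact ⟨W, hW, hT.toFinset, fun z' hz' i hi => hT.mem_toFinset.2 ⟨z', hi, hz'⟩⟩
  have hsum : ∀ {T : Finset ι} {z' : M}, (∀ i, z' ∈ tsupport (P i) → i ∈ T) → ∀ x,
      ∑ᶠ i, F i x z' = ∑ i ∈ T, F i x z' := fun h x =>
    finsum_eq_sum_of_support_subset _ fun i hi => h i (by_contra fun h => hi (hF0 i x _ h))
  refine ⟨fun x z => ∑ᶠ i, F i x z, fun e e₀ he he₀ q hq => ?_, fun π x z => ?_,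
    fun e he y hy A => ?_⟩
  · obtain ⟨W, hW, T, hT⟩ := hfin (e₀.symm q.2)
    have h1 : ∀ᶠ q' : (Fin n → Coord D) × Coord D in 𝓝 q, e₀.symm q'.2 ∈ W :=
      ((e₀.continuousAt_symm hq.2.1).comp (f := Prod.snd) continuous_snd.continuousAt) hW
    have h2 : ContDiffWithinAt ℝ ∞ (fun q : (Fin n → Coord D) × Coord D =>
        ∑ i ∈ T, F i (powSymm e q.1) (e₀.symm q.2)) _ q :=
      ContDiffWithinAt.sum fun i _ => hF i e e₀ he he₀ q hq
    refine h2.congr_of_eventuallyEq ?_ (hsum (hT _ (mem_of_mem_nhds hW)) _)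
    exact (h1.filter_mono nhdsWithin_le_nhds).mono fun q' hq' => hsum (hT _ hq') _
  · exact finsum_congr fun i => hFs i π x z
  · obtain ⟨W, hW, T, hT⟩ := hfin (e.symm y)
    have hT' := hT _ (mem_of_mem_nhds hW)
    rw [funext fun v => hsum hT' (powSymm (fun _ => e) v), mop_sum e.open_target
      (S.contDiffOn_christoffel he) T (fun i => (hF i).contDiffOn_left he hy) _ A
      (mem_powDom.2 fun _ => hy)]
    dsimp only
    simp only [hFj _ e he y hy]
    rw [← Finset.sum_mul, ← finsum_eq_sum_of_support_subset _ fun i hi =>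
      hT' i (subset_tsupport _ hi), P.sum_eq_one (Set.mem_univ _), one_mul]

/-- The mixed covariant derivatives on the diagonal, as derivatives with respect to `n + 1`
variables in a chart; the variable `none` is the last one. -/
theorem diagDeriv_eq_mop {n : ℕ} (F : (Fin n → M) → M → ℝ) (k : Fin n → ℕ) (l : ℕ) (z : M)
    (c : Slots k → Fin D) (b : Fin l → Fin D) :
    diagDeriv S F k l z c b =
      mop (S.christoffel (chartAt (Coord D) z)) ((List.finRange n).map some)
        (fun o => o.elim [] fun i => List.ofFn fun s => c ⟨i, s⟩)
        (op (S.christoffel (chartAt (Coord D) z)) none (List.ofFn b) fun y =>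
          F (powSymm (fun _ => chartAt (Coord D) z) fun i => y (some i))
            ((chartAt (Coord D) z).symm (y none)))
        (fun _ => chartAt (Coord D) z z) := by
  have hcov : ∀ {m : ℕ} (g : Fin m → Fin D) (u : Coord D → ℝ) (y : Coord D),
      covD (S.christoffel (chartAt (Coord D) z)) m u g y =
        covL (S.christoffel (chartAt (Coord D) z)) (List.ofFn g) u y := fun g u y =>
    (apply_ofFn (fun m g => covD (S.christoffel (chartAt (Coord D) z)) m u g y) g).symm
  rw [mop_map_some]
  simp only [diagDeriv, multiCovD, mop, op, hcov]
  rfl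

theorem contDiffOn_diag {n : ℕ} {F : (Fin n → M) → M → ℝ} (hF : SmoothOnPow D F Set.univ)
    {e : OpenPartialHomeomorph M (Coord D)} (he : e ∈ atlas (Coord D) M) :
    ContDiffOn ℝ ∞ (fun y : Option (Fin n) → Coord D =>
      F (powSymm (fun _ => e) fun i => y (some i)) (e.symm (y none)))
      (powDom (Option (Fin n)) e.target) := by
  have h : ContDiff ℝ ∞ fun y : Option (Fin n) → Coord D => (fun i => y (some i), y none) :=
    (contDiff_pi.2 fun i => contDiff_apply ℝ (Coord D) (some i)).prodMk
      (contDiff_apply ℝ (Coord D) none)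
  exact (hF (fun _ => e) e (fun _ => he) he).comp h.contDiffOn fun y hy =>
    ⟨fun i _ => mem_powDom.1 hy _, mem_powDom.1 hy _, trivial⟩

end GlobalFunction

section MixingFunction

variable {D : ℕ} {M : Type*} [TopologicalSpace M] [ChartedSpace (Coord D) M]
  [IsManifold 𝓘(ℝ, Coord D) ∞ M] [T2Space M] [SecondCountableTopology M] [MeasurableSpace M]
  [BorelSpace M]
variable {S : Spacetime D M} {m2 ξ : ℝ} {G : GreenOperators S m2 ξ} {Ψ : HadamardState S G}

/-- The mixing coefficients with `n` multi-indices are the derivatives on the diagonal of a smooth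
function of `(x_1, …, x_n; z)`; those which involve `z` vanish by the Leibniz rule for the mixing
coefficients. -/
theorem exists_mixing_function (Φ Φ' : WickPrescription Ψ) (n : ℕ) :
    ∃ F : (Fin n → M) → M → ℝ, SmoothOnPow D F Set.univ ∧
      (∀ (π : Equiv.Perm (Fin n)) x z, F (x ∘ π) z = F x z) ∧
      (∀ (k : Fin n → ℕ) (z : M) (c : Slots k → Fin D),
        tens (mixCoeff Φ Φ') k z c = diagDeriv S F k 0 z c Fin.elim0) ∧
      ∀ (k : Fin n → ℕ) (l : ℕ), 1 ≤ l → ∀ (z : M) (c : Slots k → Fin D) (b : Fin l → Fin D),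
        diagDeriv S F k l z c b = 0 := by
  obtain ⟨F, hF, hFs, hFj⟩ := exists_global_function (smoothFam_mixCoeff Φ Φ')
    (fun e he J _ b A hb h y hy s => sum_mul_chartFam_mixCoeff_cons Φ Φ' he hb A h hy s) n
  have hjet : ∀ e ∈ atlas (Coord D) M, ∀ y ∈ e.target, ∀ A : Option (Fin n) → List (Fin D),
      mop (S.christoffel e) ((List.finRange n).map some) A
        (fun y => F (powSymm (fun _ => e) fun i => y (some i)) (e.symm (y none))) (fun _ => y) =
      chartFam e (mixCoeff Φ Φ') y (Finset.univ.val.map fun i => A (some i)) := by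
    intro e he y hy A
    rw [mop_map_some]
    exact hFj e he y hy _
  refine ⟨F, hF, hFs, fun k z c => ?_, fun k l hl z c b => ?_⟩
  · rw [diagDeriv_eq_mop, List.ofFn_zero, op_nil,
      hjet _ (chart_mem_atlas _ z) _ (mem_chart_target _ z), chartFam_chartAt]
    rfl
  · rw [diagDeriv_eq_mop]
    have he := chart_mem_atlas (Coord D) z
    refine mop_op_none_eq_zero (chartAt (Coord D) z).open_target (S.contDiffOn_christoffel he)
      (contDiffOn_diag hF he) (hjet _ he) (fun y hy a s => pd_chartFam_mixCoeff Φ Φ' he a hy s) ?_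
      (mem_chart_target _ z) _
    rw [ne_eq, List.ofFn_eq_nil_iff]
    omega

end MixingFunction

end WickField

end

theorem mainTheorem5 {D : ℕ} (hD : 2 ≤ D) {M : Type*} [TopologicalSpace M] [T2Space M]
    [SecondCountableTopology M] [ChartedSpace (WickField.Coord D) M]
    [IsManifold 𝓘(ℝ, WickField.Coord D) ∞ M] [MeasurableSpace M] [BorelSpace M]
    (S : WickField.Spacetime D M) (hS : S.GloballyHyperbolic) (m2 ξ : ℝ)
    (G : WickField.GreenOperators S m2 ξ) (Ψ : WickField.HadamardState S G)
    (Φ Φ' : WickField.WickPrescription Ψ) :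
    ∃ Z : WickField.MixingCoeffs D M,
      WickField.IsMixing Φ Φ' Z ∧
      (∀ Z' : WickField.MixingCoeffs D M, WickField.IsMixing Φ Φ' Z' → Z' = Z) ∧
      (∀ (k : Fin 0 → ℕ) (x : M) (c : WickField.Slots k → Fin D), Z 0 k x c = 1) ∧
      (∀ (k : Fin 1 → ℕ) (x : M) (c : WickField.Slots k → Fin D), Z 1 k x c = 0) ∧
      ∀ n : ℕ, 2 ≤ n → ∃ (F : (Fin n → M) → M → ℝ) (U : Set ((Fin n → M) × M)),
        IsOpen U ∧ (∀ z : M, ((fun _ => z), z) ∈ U) ∧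
        (∀ (π : Equiv.Perm (Fin n)) (x : Fin n → M) (z : M), (x, z) ∈ U → (x ∘ π, z) ∈ U) ∧
        WickField.SmoothOnPow D F U ∧
        (∀ (π : Equiv.Perm (Fin n)) (x : Fin n → M) (z : M), (x, z) ∈ U → F (x ∘ π) z = F x z) ∧
        (∀ (k : Fin n → ℕ) (z : M) (c : WickField.Slots k → Fin D),
          Z n k z c = WickField.diagDeriv S F k 0 z c Fin.elim0) ∧
        (∀ (k : Fin n → ℕ) (l : ℕ), 1 ≤ l → ∀ (z : M) (c : WickField.Slots k → Fin D)
          (b : Fin l → Fin D), WickField.diagDeriv S F k l z c b = 0) := by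
  refine ⟨fun _ k => WickField.tens (WickField.mixCoeff Φ Φ') k,
    WickField.isMixing_mixCoeff Φ Φ',
    fun Z' hZ' => WickField.IsMixing.unique (WickField.isMixing_mixCoeff Φ Φ') hZ',
    fun k x c => WickField.mixCoeff_zero Φ Φ' x, WickField.mixCoeff_one Φ Φ', fun n _ => ?_⟩
  obtain ⟨F, hF, hFs, hF0, hFz⟩ := WickField.exists_mixing_function Φ Φ' n
  exact ⟨F, Set.univ, isOpen_univ, fun _ => trivial, fun _ _ _ _ => trivial, hF,
    fun π x z _ => hFs π x z, hF0, hFz⟩
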